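/- Let $n\ge 2$, let $M\subset\mathbb{R}^n$ be the closed unit ball, and let $g$ be a Riemannian metric on $M$ of class $C^{1,1}$, i.e. the components $g_{ij}$ are continuously differentiable up to the boundary with Lipschitz first derivatives. Let $SM=\{(x,v): x\in M,\ |v|_{g(x)}=1\}$ be the unit sphere bundle with the measure $d\Sigma_g=dS_x\,dV_g$ ($dS_x$ being the Riemannian volume of $(S_xM,g(x))$), and let $N$ be the bundle over $SM$ with fibre $N_{(x,v)}=\{v\}^\perp\subset T_xM$. With $r(x,v)=(x,v/|v|_{g(x)})$, put $\partial_k u=\partial_{v^k}(u\circ r)|_{SM}$ and $\delta_j u=(\partial_{x^j}-\Gamma^l_{jk}v^k\partial_{v^l})(u\circ r)|_{SM}$ for functions $u$ on $SM$, and $Xu=v^j\delta_ju$. For sections $W$ of $N$ put $(XW)^l=X(W^l)+\Gamma^l_{jk}v^jW^k$, $\operatorname{div}_vW=\partial_jW^j$, $\operatorname{div}_hW=(\delta_j+\Gamma^i_{ji})W^j$, and $RW=R(W,v)v$, where $R$ is the Riemann curvature tensor of $g$ (defined almost everywhere). Let $H^1_0(N)$ be the completion of the space of $C^1$ sections of $N$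 vanishing on $\{(x,v)\in SM: x\in\partial M\}$ in the norm given by $\|W\|^2_{L^2(N)}+\|XW\|^2_{L^2(N)}+\|\operatorname{div}_vW\|^2_{L^2(SM)}+\|\operatorname{div}_hW\|^2_{L^2(SM)}$, and let $$Q(W)=\|XW\|^2_{L^2(N)}-(RW,W)_{L^2(N)},\qquad W\in H^1_0(N).$$ For $z\in SM$ let $\tau(z)$ be the largest time up to which the geodesic in $M$ with initial data $z$ exists. Assume that $(M,g)$ is simple in the following sense: - (B1) there is $\varepsilon>0$ with $Q(W)\ge\varepsilon\|W\|^2_{L^2(N)}$ for all $W\in H^1_0(N)$; - (B2) any two points of $M$ are joined by a unique unit speed geodesic which lies in the interior of $M$ except possibly for its end points, and its length depends continuously on the two points (for equal points, the constant geodesic, of length $0$); - (B3) $\tau$ is finite on $SM$, and $\tau^2$ is Lipschitz on $SM$. Then: 1. If $f$ is a Lipschitz function on $M$ whose integrals over all maximal unit speed geodesics of $M$ vanish, then $f=0$. 2. Let $h$ be a Lipschitz $1$-form on $M$ that vanishes on $\partial M$ (that is, $h_x=0$ for all $x\in\partial M$). Then $h$ integrates to zero over all maximal geodesics of $M$ if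 and only if there is a function $p\in C^{1,1}(M)$ with $p|_{\partial M}=0$ and $h=\mathrm{d}p$. -/

import Mathlib

open Set MeasureTheory Filter Topology

noncomputable section

namespace RoughXRay

/-- Coordinate space `ℝⁿ` with its Euclidean norm. -/
abbrev E (n : ℕ) := EuclideanSpace ℝ (Fin n)

/-- The manifold `M`: the closed unit ball of `ℝⁿ`. -/
def ball (n : ℕ) : Set (E n) := Metric.closedBall 0 1

/-- The boundary of `M`. -/
def bdry (n : ℕ) : Set (E n) := Metric.sphere 0 1

/-- The interior of `M`. -/
def inner (n : ℕ) : Set (E n) := Metric.ball 0 1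

variable {n : ℕ}

/-- `f ∈ C^{1,1}(M)`: continuously differentiable up to the boundary, with Lipschitz derivative. -/
def IsC11 (f : E n → ℝ) : Prop :=
  ContDiffOn ℝ 1 f (ball n) ∧ ∃ K, LipschitzOnWith K (fderivWithin ℝ f (ball n)) (ball n)

/-- A `C^{1,1}` Riemannian metric on `M`, given by its matrix `g_{ij}` in the global coordinates. -/
def IsC11Metric (g : E n → Matrix (Fin n) (Fin n) ℝ) : Prop :=
  (∀ x ∈ ball n, (g x).PosDef) ∧ ∀ i j, IsC11 fun x => g x i j

/-- The inner product `⟨u, w⟩_{g(x)} = g_{ij}(x) uⁱ wʲ`. -/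
def ip (g : E n → Matrix (Fin n) (Fin n) ℝ) (x u w : E n) : ℝ :=
  ∑ i, ∑ j, g x i j * u i * w j

/-- The partial derivative `∂_j f` of a function on `M`. -/
def pd (f : E n → ℝ) (j : Fin n) (x : E n) : ℝ :=
  fderivWithin ℝ f (ball n) x (EuclideanSpace.single j 1)

/-- The Christoffel symbol `Γ^l_{jk}`. -/
def christoffel (g : E n → Matrix (Fin n) (Fin n) ℝ) (l j k : Fin n) (x : E n) : ℝ :=
  (1 / 2) * ∑ m, (g x)⁻¹ l m *
    (pd (fun y => g y m k) j x + pd (fun y => g y m j) k x - pd (fun y => g y j k) m x)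

/-- The curvature component `R^l_{ijk}`, where `R(∂_i, ∂_j) ∂_k = R^l_{ijk} ∂_l`. The Christoffel
symbols of a `C^{1,1}` metric are Lipschitz, so this is defined almost everywhere. -/
def curvature (g : E n → Matrix (Fin n) (Fin n) ℝ) (l i j k : Fin n) (x : E n) : ℝ :=
  pd (christoffel g l j k) i x - pd (christoffel g l i k) j x
    + ∑ m, (christoffel g l i m x * christoffel g m j k x
          - christoffel g l j m x * christoffel g m i k x)

/-! ### Geodesics -/

/-- `γ` is a unit speed geodesic in `M` on the interval `[a, b]`, with velocity `V`
(one-sided derivatives at the end points). -/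
def IsGeodesicOn (g : E n → Matrix (Fin n) (Fin n) ℝ) (γ V : ℝ → E n) (a b : ℝ) : Prop :=
  ∀ t ∈ Icc a b, γ t ∈ ball n ∧ ip g (γ t) (V t) (V t) = 1 ∧
    HasDerivWithinAt γ (V t) (Icc a b) t ∧
    HasDerivWithinAt V
      (WithLp.toLp 2 fun l => -∑ j, ∑ k, christoffel g l j k (γ t) * V t j * V t k) (Icc a b) t

/-- A maximal geodesic of `M`: it is not the restriction of a geodesic in `M` on a larger
interval. -/
def IsMaximalGeodesic (g : E n → Matrix (Fin n) (Fin n) ℝ) (γ V : ℝ → E n) (a b : ℝ) : Prop :=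
  a ≤ b ∧ IsGeodesicOn g γ V a b ∧
    ∀ (γ' V' : ℝ → E n) (a' b' : ℝ), a' ≤ a → b ≤ b' → IsGeodesicOn g γ' V' a' b' →
      EqOn γ' γ (Icc a b) → EqOn V' V (Icc a b) → a' = a ∧ b' = b

/-- `γ` on `[0, ℓ]` is a unit speed geodesic from `x` to `y` (of length `ℓ`), lying in the interior
of `M` except possibly for its end points. For `x = y` the constant geodesic is the case `ℓ = 0`. -/
def Joins (g : E n → Matrix (Fin n) (Fin n) ℝ) (x y : E n) (ℓ : ℝ) (γ V : ℝ → E n) : Prop :=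
  0 ≤ ℓ ∧ IsGeodesicOn g γ V 0 ℓ ∧ γ 0 = x ∧ γ ℓ = y ∧ ∀ t ∈ Ioo 0 ℓ, γ t ∈ inner n

/-- The unit sphere bundle `SM ⊆ TM = M × ℝⁿ`. -/
def SM (g : E n → Matrix (Fin n) (Fin n) ℝ) : Set (E n × E n) :=
  {p | p.1 ∈ ball n ∧ ip g p.1 p.2 p.2 = 1}

/-- The times `t ≥ 0` up to which the geodesic with initial data `p` exists in `M`. -/
def existenceTimes (g : E n → Matrix (Fin n) (Fin n) ℝ) (p : E n × E n) : Set ℝ :=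
  {t | 0 ≤ t ∧ ∃ γ V : ℝ → E n, IsGeodesicOn g γ V 0 t ∧ γ 0 = p.1 ∧ V 0 = p.2}

/-- The travel time function `τ` on `SM`. -/
def travelTime (g : E n → Matrix (Fin n) (Fin n) ℝ) (p : E n × E n) : ℝ :=
  sSup (existenceTimes g p)

/-! ### Calculus on the sphere bundle -/

/-- The radial projection `r(x, v) = (x, v / |v|_{g(x)})` of `TM ∖ 0` onto `SM`. -/
def radial (g : E n → Matrix (Fin n) (Fin n) ℝ) (p : E n × E n) : E n × E n :=
  (p.1, (Real.sqrt (ip g p.1 p.2 p.2))⁻¹ • p.2)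

/-- `TM ∖ 0`. -/
def slit (n : ℕ) : Set (E n × E n) := ball n ×ˢ {0}ᶜ

/-- The derivative of `u ∘ r` at `p`, in the direction `w`. -/
def dRad (g : E n → Matrix (Fin n) (Fin n) ℝ) (u : E n × E n → ℝ) (p w : E n × E n) : ℝ :=
  fderivWithin ℝ (u ∘ radial g) (slit n) p w

/-- `∂_k u = ∂_{v^k} (u ∘ r)`. -/
def vDer (g : E n → Matrix (Fin n) (Fin n) ℝ) (k : Fin n) (u : E n × E n → ℝ)
    (p : E n × E n) : ℝ :=
  dRad g u p (0, EuclideanSpace.single k 1)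

/-- `δ_j u = (∂_{x^j} - Γ^l_{jk} v^k ∂_{v^l}) (u ∘ r)`. -/
def hDer (g : E n → Matrix (Fin n) (Fin n) ℝ) (j : Fin n) (u : E n × E n → ℝ)
    (p : E n × E n) : ℝ :=
  dRad g u p (EuclideanSpace.single j 1,
    WithLp.toLp 2 fun l => -∑ k, christoffel g l j k p.1 * p.2 k)

/-- The geodesic vector field on functions, `Xu = v^j δ_j u`. -/
def geoX (g : E n → Matrix (Fin n) (Fin n) ℝ) (u : E n × E n → ℝ) (p : E n × E n) : ℝ :=
  ∑ j, p.2 j * hDer g j u p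

/-- The geodesic vector field on sections, `(XV)^l = X(V^l) + Γ^l_{jk} v^j V^k`. -/
def geoXSec (g : E n → Matrix (Fin n) (Fin n) ℝ) (V : E n × E n → E n) (p : E n × E n) : E n :=
  WithLp.toLp 2 fun l =>
    geoX g (fun q => V q l) p + ∑ j, ∑ k, christoffel g l j k p.1 * p.2 j * V p k

/-- The vertical divergence `∂_j V^j`. -/
def vDiv (g : E n → Matrix (Fin n) (Fin n) ℝ) (V : E n × E n → E n) (p : E n × E n) : ℝ :=
  ∑ j, vDer g j (fun q => V q j) p

/-- The horizontal divergence `(δ_j + Γ^i_{ji}) V^j`. -/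
def hDiv (g : E n → Matrix (Fin n) (Fin n) ℝ) (V : E n × E n → E n) (p : E n × E n) : ℝ :=
  ∑ j, (hDer g j (fun q => V q j) p + (∑ i, christoffel g i j i p.1) * V p j)

/-- The curvature operator `(RV)^l = R^l_{ijk} V^i v^j v^k`, that is, `R(V, v)v`. -/
def curvOp (g : E n → Matrix (Fin n) (Fin n) ℝ) (V : E n × E n → E n) (p : E n × E n) : E n :=
  WithLp.toLp 2 fun l => ∑ i, ∑ j, ∑ k, curvature g l i j k p.1 * V p i * p.2 j * p.2 k

/-- `V ∈ C¹₀(N)`: a `C¹` section of the bundle `N`, whose fibre at `(x, v)` is the orthogonal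
complement of `v`, vanishing over the boundary of `M`. A map on `SM` is `C¹` when its radial
extension to `TM ∖ 0` is. -/
def IsC10Section (g : E n → Matrix (Fin n) (Fin n) ℝ) (V : E n × E n → E n) : Prop :=
  (∀ p ∈ SM g, ip g p.1 (V p) p.2 = 0) ∧ ContDiffOn ℝ 1 (V ∘ radial g) (slit n) ∧
    ∀ p ∈ SM g, p.1 ∈ bdry n → V p = 0

/-- The measure `dΣ_g = dS_x dV_g` on `SM`. Here `dV_g = (det g)^{1/2} dx`, and the surface measure
`dS_x` of the unit sphere of the Euclidean space `(T_xM, g(x))` is written, as in Mathlib's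
`Measure.toSphere`, as `n` times the volume `(det g(x))^{1/2} dv` of the cone over a set. -/
def sigma (g : E n → Matrix (Fin n) (Fin n) ℝ) : Measure (E n × E n) :=
  (((volume : Measure (E n × E n)).restrict
      {p | p.1 ∈ ball n ∧ p.2 ≠ 0 ∧ ip g p.1 p.2 p.2 < 1}).withDensity
    fun p => ENNReal.ofReal (n * (g p.1).det)).map (radial g)

/-- `‖u‖²` in `L²(SM)`. -/
def sqNorm (g : E n → Matrix (Fin n) (Fin n) ℝ) (u : E n × E n → ℝ) : ENNReal :=
  ∫⁻ p, ENNReal.ofReal (u p ^ 2) ∂sigma g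

/-- `‖W‖²` in `L²(N)`. -/
def sqNormSec (g : E n → Matrix (Fin n) (Fin n) ℝ) (W : E n × E n → E n) : ENNReal :=
  ∫⁻ p, ENNReal.ofReal (ip g p.1 (W p) (W p)) ∂sigma g

/-- `W ∈ L²(N)`. -/
def MemL2Sec (g : E n → Matrix (Fin n) (Fin n) ℝ) (W : E n × E n → E n) : Prop :=
  AEStronglyMeasurable W (sigma g) ∧ (∀ᵐ p ∂sigma g, ip g p.1 (W p) p.2 = 0) ∧ sqNormSec g W < ⊤

/-- `u ∈ L²(SM)`. -/
def MemL2 (g : E n → Matrix (Fin n) (Fin n) ℝ) (u : E n × E n → ℝ) : Prop :=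
  AEStronglyMeasurable u (sigma g) ∧ sqNorm g u < ⊤

/-- An element `W` of `H¹₀(N)`, the completion of `C¹₀(N)` in the norm
`‖W‖² + ‖XW‖² + ‖div_v W‖² + ‖div_h W‖²`: it is given by the `L²` limits of `W_k`, `X W_k`,
`div_v W_k`, `div_h W_k` for a sequence `W_k` in `C¹₀(N)` that is Cauchy in this norm. -/
structure H10 (g : E n → Matrix (Fin n) (Fin n) ℝ) where
  sec : E n × E n → E n
  Xsec : E n × E n → E n
  divV : E n × E n → ℝ
  divH : E n × E n → ℝ
  memL2_sec : MemL2Sec g sec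
  memL2_Xsec : MemL2Sec g Xsec
  memL2_divV : MemL2 g divV
  memL2_divH : MemL2 g divH
  exists_approx : ∃ W : ℕ → E n × E n → E n, (∀ k, IsC10Section g (W k)) ∧
    Tendsto (fun k => sqNormSec g fun p => W k p - sec p) atTop (𝓝 0) ∧
    Tendsto (fun k => sqNormSec g fun p => geoXSec g (W k) p - Xsec p) atTop (𝓝 0) ∧
    Tendsto (fun k => sqNorm g fun p => vDiv g (W k) p - divV p) atTop (𝓝 0) ∧
    Tendsto (fun k => sqNorm g fun p => hDiv g (W k) p - divH p) atTop (𝓝 0)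

/-- The `L²(N)` inner product. -/
def ipL2 (g : E n → Matrix (Fin n) (Fin n) ℝ) (V W : E n × E n → E n) : ℝ :=
  ∫ p, ip g p.1 (V p) (W p) ∂sigma g

/-- The quadratic form `Q(W) = ‖XW‖² - (RW, W)`. -/
def quadForm (g : E n → Matrix (Fin n) (Fin n) ℝ) (W : H10 g) : ℝ :=
  ipL2 g W.Xsec W.Xsec - ipL2 g (curvOp g W.sec) W.sec

/-- Simple `C^{1,1}` metrics on the closed unit ball. -/
structure IsSimpleC11 (g : E n → Matrix (Fin n) (Fin n) ℝ) : Prop where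
  metric : IsC11Metric g
  coercive : ∃ ε > 0, ∀ W : H10 g, ε * ipL2 g W.sec W.sec ≤ quadForm g W
  /-- Any two points are joined by a geodesic in the interior, it is unique, and its length is a
  continuous function of the end points. -/
  unique_geodesic : ∃ len : E n → E n → ℝ,
    ContinuousOn (fun p : E n × E n => len p.1 p.2) (ball n ×ˢ ball n) ∧
    ∀ x ∈ ball n, ∀ y ∈ ball n,
      (∃ γ V : ℝ → E n, Joins g x y (len x y) γ V) ∧
      ∀ (ℓ₁ ℓ₂ : ℝ) (γ₁ V₁ γ₂ V₂ : ℝ → E n), Joins g x y ℓ₁ γ₁ V₁ → Joins g x y ℓ₂ γ₂ V₂ →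
        ℓ₁ = ℓ₂ ∧ EqOn γ₁ γ₂ (Icc 0 ℓ₁)
  /-- The travel time is finite on `SM`. -/
  nontrapping : ∀ p ∈ SM g, BddAbove (existenceTimes g p)
  lipschitz_sq : ∃ K, LipschitzOnWith K (fun p => travelTime g p ^ 2) (SM g)

end RoughXRay

end

/-! ### Coordinates on the ball and the regularity of the metric data -/

open Set MeasureTheory Filter Topology
set_option maxSynthPendingDepth 3
set_option linter.unusedSectionVars false

noncomputable section
namespace RoughXRay
variable {n : ℕ}

/-! The proof is the energy method based on the Pestov identity, arranged so that only first
derivatives of the unknown and of its derivative along geodesics survive. Let `X` be the geodesic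
vector field and let `u(z)` be the integral of the integrand (`f` or `h`) along the geodesic issued
from `z` up to the boundary (`GeoFlow.rayInt`). Then `Xu` is minus the integrand, and the vanishing
of all integrals over maximal geodesics makes `u` vanish over the boundary. It has to be shown that
this forces `f = 0`, respectively that `u` does not depend on the direction.

All analysis is done on `TM` minus the zero section with the measure `det g dx dv`; a profile
`κ(|v|²)` localizes the speed, and polar coordinates (`lintegral_slit`) lead back to `SM`. For a
`C²` function `U` with compact support in the interior and off the zero section, the Pestov identity
(`integral_pestov`) says that the integral of `|∂ᵗXU|² - (n-1)(XU)²/|v|²` equals that of `|XW|² -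
⟨RW, W⟩`, where `∂ᵗ` is the part of the vertical gradient orthogonal to `v` and `W = ∂ᵗU`. Condition
(B1), applied to `W` on each sphere bundle of radius `s`, bounds the right side below by `ε` times
the integral of `|v|²|W|²` (`integral_coercive`). The sum is the energy inequality
`integral_energy_nonneg`: the integral of `|∂ᵗXU|² - (n-1)(XU)²/|v|² - ε|v|²|∂ᵗU|²` is nonnegative.

This inequality makes sense when `U` and `XU` are merely Lipschitz. It passes to such functions by
mollification, where the commutator of the mollifier with the Lipschitz field `X` tends to zero
after one differentiation (`ae_tendsto_fderiv_mollify_along`,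
`integral_energy_nonneg_of_lipschitz`). Compact support in the base is removed by cutoffs with
gradients of order one over the distance to the boundary; this works if `U` and its vertical
derivative are of the order of that distance (`IsRoughPair.integral_energy_nonneg`).

The two boundary bounds come from (B3). The integrand vanishes on the boundary, so `u = O(τ²)`, and
its vertical derivative is `O(τ²)` too. Since the full integrals vanish, `u(x,v)` is minus the
integral along the reversed geodesic, so `τ` may be replaced by the smaller of the two travel times.
On the boundary one of them is zero, and `τ²` is Lipschitz, so the square of the smaller one is
`O(1-|x|)` (`exists_bound_min_travelTime`, `exists_vertical_bound`). For a function `f` the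
vanishing on the boundary is itself derived from short, nearly tangential geodesics
(`GeoFlow.eq_zero_of_mem_bdry`).

For a function, `XU = -|v| f(x)` has no tangential vertical derivative, all terms of the energy are
nonpositive, and `f = 0` follows from `n ≥ 2`. For a one-form, `XU = -h(v)`, and the first two terms
of the energy add up to `|h|² - n h(v)²/|v|²`, which integrates to zero in each fibre
(`integral_fiber_trace`). Hence `∂ᵗU = 0`; being homogeneous of degree zero, `U` depends on `x`
only, and `p = -U` is the primitive (`IsRayPotential.exists_primitive`). Conversely, maximal
geodesics end on the boundary, where a primitive vanishes. -/

instance : (volume : Measure (E n × E n)).IsAddHaarMeasure :=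
  inferInstanceAs (((volume : Measure (E n)).prod (volume : Measure (E n))).IsAddHaarMeasure)

/-- The standard basis vector. -/
abbrev bv (i : Fin n) : E n := EuclideanSpace.single i 1

lemma sum_coord_smul_bv (u : E n) : ∑ i, u i • (bv i : E n) = u := by
  ext j
  simp [Finset.sum_apply, Pi.single_apply]

lemma clm_eq_sum_coord {F : Type*} [NormedAddCommGroup F] [NormedSpace ℝ F] (L : E n →L[ℝ] F)
    (u : E n) : L u = ∑ i, u i • L (bv i) := by
  conv_lhs => rw [← sum_coord_smul_bv u]
  simp only [map_sum, map_smul]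

lemma eq_of_isLinearMap_of_basis {F : Type*} [AddCommGroup F] [Module ℝ F] {f h : E n → F}
    (hf : IsLinearMap ℝ f) (hh : IsLinearMap ℝ h)
    (H : ∀ i, f (bv i) = h (bv i)) (u : E n) : f u = h u := by
  have : hf.mk' f = hh.mk' h := by
    apply (EuclideanSpace.basisFun (Fin n) ℝ).toBasis.ext
    intro i
    simpa using H i
  exact congrArg (fun L : E n →ₗ[ℝ] F => L u) this

lemma isCompact_ball : IsCompact (ball n) := isCompact_closedBall _ _
lemma convex_ball : Convex ℝ (ball n) := convex_closedBall _ _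
lemma isClosed_ball : IsClosed (ball n) := Metric.isClosed_closedBall
lemma isOpen_inner : IsOpen (inner n) := Metric.isOpen_ball
lemma inner_subset_ball : inner n ⊆ ball n := Metric.ball_subset_closedBall
lemma interior_ball : interior (ball n) = inner n := interior_closedBall _ one_ne_zero
lemma ball_mem_nhds {x : E n} (hx : x ∈ inner n) : ball n ∈ 𝓝 x :=
  mem_of_superset (isOpen_inner.mem_nhds hx) inner_subset_ball
lemma uniqueDiffOn_ball : UniqueDiffOn ℝ (ball n) := by
  apply uniqueDiffOn_convex convex_ball
  rw [interior_ball]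
  exact ⟨0, by simp [inner]⟩
lemma mem_ball_iff {x : E n} : x ∈ ball n ↔ ‖x‖ ≤ 1 := by simp [ball]
lemma mem_inner_iff {x : E n} : x ∈ inner n ↔ ‖x‖ < 1 := by simp [inner]
lemma mem_bdry_iff {x : E n} : x ∈ bdry n ↔ ‖x‖ = 1 := by simp [bdry]
lemma bdry_subset_ball : bdry n ⊆ ball n := Metric.sphere_subset_closedBall

/-! ### Real functions Lipschitz on a compact set -/

/-- `f` is bounded and Lipschitz on `s`. -/
def LipOn {X : Type*} [PseudoMetricSpace X] (f : X → ℝ) (s : Set X) : Prop :=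
  (∃ K, LipschitzOnWith K f s) ∧ ∃ M : ℝ, ∀ x ∈ s, |f x| ≤ M

lemma lipOn_of_lipschitzOnWith {X : Type*} [PseudoMetricSpace X] {s : Set X} {f : X → ℝ}
    (hs : IsCompact s) (h : ∃ K, LipschitzOnWith K f s) : LipOn f s := by
  obtain ⟨K, hK⟩ := h
  obtain ⟨M, hM⟩ := hs.exists_bound_of_continuousOn hK.continuousOn
  exact ⟨⟨K, hK⟩, M, hM⟩

namespace LipOn
variable {X : Type*} [PseudoMetricSpace X] {s : Set X} {f h : X → ℝ}

lemma congr (hf : LipOn f s) (H : EqOn h f s) : LipOn h s := by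
  obtain ⟨⟨K, hK⟩, M, hM⟩ := hf
  refine ⟨⟨K, fun x hx y hy => ?_⟩, M, fun x hx => ?_⟩
  · rw [H hx, H hy]; exact hK hx hy
  · rw [H hx]; exact hM x hx

lemma const (c : ℝ) : LipOn (fun _ : X => c) s :=
  ⟨⟨0, LipschitzWith.const c |>.lipschitzOnWith⟩, |c|, fun _ _ => le_rfl⟩

lemma add (hf : LipOn f s) (hh : LipOn h s) : LipOn (fun x => f x + h x) s := by
  obtain ⟨⟨K, hK⟩, M, hM⟩ := hf
  obtain ⟨⟨K', hK'⟩, M', hM'⟩ := hh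
  exact ⟨⟨K + K', hK.add hK'⟩, M + M', fun x hx =>
    (abs_add_le _ _).trans (add_le_add (hM x hx) (hM' x hx))⟩

lemma neg (hf : LipOn f s) : LipOn (fun x => - f x) s := by
  obtain ⟨⟨K, hK⟩, M, hM⟩ := hf
  exact ⟨⟨K, hK.neg⟩, M, fun x hx => by simpa using hM x hx⟩

lemma sub (hf : LipOn f s) (hh : LipOn h s) : LipOn (fun x => f x - h x) s := by
  simpa [sub_eq_add_neg] using hf.add hh.neg

lemma mul (hf : LipOn f s) (hh : LipOn h s) : LipOn (fun x => f x * h x) s := by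
  obtain ⟨⟨K, hK⟩, M, hM⟩ := hf
  obtain ⟨⟨K', hK'⟩, M', hM'⟩ := hh
  refine ⟨⟨(|M| * K' + |M'| * K).toNNReal, ?_⟩, |M| * |M'|, fun x hx => ?_⟩
  · apply LipschitzOnWith.of_dist_le_mul
    intro x hx y hy
    rw [Real.coe_toNNReal _ (by positivity), Real.dist_eq]
    have h1 : f x * h x - f y * h y = f x * (h x - h y) + h y * (f x - f y) := by ring
    have h2 := hK.dist_le_mul x hx y hy
    have h3 := hK'.dist_le_mul x hx y hy
    rw [Real.dist_eq] at h2 h3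
    calc |f x * h x - f y * h y| ≤ |f x| * |h x - h y| + |h y| * |f x - f y| := by
          rw [h1]; refine (abs_add_le _ _).trans ?_; rw [abs_mul, abs_mul]
      _ ≤ |M| * (K' * dist x y) + |M'| * (K * dist x y) := by
          exact add_le_add
            (mul_le_mul ((hM x hx).trans (le_abs_self _)) h3 (abs_nonneg _) (abs_nonneg _))
            (mul_le_mul ((hM' y hy).trans (le_abs_self _)) h2 (abs_nonneg _) (abs_nonneg _))
      _ = _ := by ring
  · rw [abs_mul]
    have := (hM x hx).trans (le_abs_self _)
    have := (hM' x hx).trans (le_abs_self _)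
    gcongr

lemma sum {ι : Type*} {t : Finset ι} {F : ι → X → ℝ} (H : ∀ i ∈ t, LipOn (F i) s) :
    LipOn (fun x => ∑ i ∈ t, F i x) s := by
  classical
  induction t using Finset.induction_on with
  | empty => simpa using LipOn.const 0
  | insert a t ha ih =>
    have := (H a (by simp)).add (ih fun i hi => H i (by simp [hi]))
    refine this.congr fun x _ => ?_
    rw [Finset.sum_insert ha]

/-- A bounded Lipschitz function extends to a bounded Lipschitz function. -/
lemma exists_extension (hf : LipOn f s) :
    ∃ F : X → ℝ, (∃ K, LipschitzWith K F) ∧ (∃ M : ℝ, ∀ x, |F x| ≤ M) ∧ EqOn F f s := by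
  obtain ⟨⟨K, hK⟩, M, hM⟩ := hf
  obtain ⟨F, hF, hFs⟩ := hK.extend_real
  -- Truncating the Lipschitz extension at height `|M|` makes it bounded and leaves it unchanged on
  -- `s`.
  refine ⟨fun x => max (-|M|) (min (F x) |M|), ⟨K, (hF.min_const _).const_max _⟩, ⟨|M|, ?_⟩, ?_⟩
  · intro x
    rw [abs_le]
    exact ⟨le_max_left _ _, max_le (by linarith [abs_nonneg M]) (min_le_right _ _)⟩
  · intro x hx
    have h1 := abs_le.1 ((hM x hx).trans (le_abs_self M))
    change max (-|M|) (min (F x) |M|) = f x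
    rw [← hFs hx, min_eq_left h1.2, max_eq_right h1.1]

end LipOn

/-! ### The metric as a bilinear form -/

variable {g : E n → Matrix (Fin n) (Fin n) ℝ}

/-- The metric as a continuous bilinear form. -/
def gF (g : E n → Matrix (Fin n) (Fin n) ℝ) (x : E n) : E n →L[ℝ] E n →L[ℝ] ℝ :=
  ∑ i, ∑ j, g x i j • (EuclideanSpace.proj i : E n →L[ℝ] ℝ).smulRight
    (EuclideanSpace.proj j : E n →L[ℝ] ℝ)

lemma gF_apply (x u w : E n) : gF g x u w = ip g x u w := by
  simp [gF, ip, _root_.sum_apply, mul_assoc]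

lemma gF_bv (x : E n) (i j : Fin n) : gF g x (bv i) (bv j) = g x i j := by
  simp [gF, _root_.sum_apply]

lemma gF_bv_right (x u : E n) (j : Fin n) : gF g x u (bv j) = ∑ i, g x i j * u i := by
  simp [gF_apply, ip]

section metric
variable (hg : IsC11Metric g)
include hg

omit hg in
lemma contDiffOn_lipOn {f : E n → ℝ} (hf : ContDiffOn ℝ 1 f (ball n)) : LipOn f (ball n) :=
  lipOn_of_lipschitzOnWith isCompact_ball
    (hf.exists_lipschitzOnWith one_ne_zero convex_ball isCompact_ball)

lemma g_symm {x : E n} (hx : x ∈ ball n) (i j : Fin n) : g x i j = g x j i := by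
  have := (hg.1 x hx).1.apply i j
  simpa using this.symm

lemma gF_symm {x : E n} (hx : x ∈ ball n) (u w : E n) : gF g x u w = gF g x w u := by
  simp only [gF_apply, ip]
  rw [Finset.sum_comm]
  refine Finset.sum_congr rfl fun j _ => Finset.sum_congr rfl fun i _ => ?_
  rw [g_symm hg hx i j]; ring

lemma gF_pos {x : E n} (hx : x ∈ ball n) {u : E n} (hu : u ≠ 0) : 0 < gF g x u u := by
  have h := (hg.1 x hx).dotProduct_mulVec_pos (x := u.ofLp) (by
    intro h; apply hu; ext i; simpa using congrFun h i)
  rw [gF_apply]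
  have e : ip g x u u = star u.ofLp ⬝ᵥ (g x).mulVec u.ofLp := by
    simp only [ip, dotProduct, Matrix.mulVec, Finset.mul_sum]
    refine Finset.sum_congr rfl fun i _ => Finset.sum_congr rfl fun j _ => ?_
    simp; ring
  rw [e]; exact h

lemma gF_nonneg {x : E n} (hx : x ∈ ball n) (u : E n) : 0 ≤ gF g x u u := by
  by_cases hu : u = 0
  · simp [hu]
  · exact (gF_pos hg hx hu).le

lemma contDiffOn_gF : ContDiffOn ℝ 1 (gF g) (ball n) := by
  unfold gF
  refine ContDiffOn.sum fun i _ => ContDiffOn.sum fun j _ => ?_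
  exact (hg.2 i j).1.smul contDiffOn_const

lemma continuousOn_gF : ContinuousOn (gF g) (ball n) := (contDiffOn_gF hg).continuousOn

lemma hasFDerivWithinAt_gF {x : E n} (hx : x ∈ ball n) :
    HasFDerivWithinAt (gF g) (fderivWithin ℝ (gF g) (ball n) x) (ball n) x :=
  ((contDiffOn_gF hg).differentiableOn one_ne_zero x hx).hasFDerivWithinAt

lemma hasFDerivAt_gF {x : E n} (hx : x ∈ inner n) :
    HasFDerivAt (gF g) (fderivWithin ℝ (gF g) (ball n) x) x :=
  (hasFDerivWithinAt_gF hg (inner_subset_ball hx)).hasFDerivAt (ball_mem_nhds hx)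

lemma fderivWithin_gF_bv {x : E n} (hx : x ∈ ball n) (k i j : Fin n) :
    fderivWithin ℝ (gF g) (ball n) x (bv k) (bv i) (bv j) = pd (fun y => g y i j) k x := by
  have h1 := (hasFDerivWithinAt_gF hg hx).clm_apply (hasFDerivWithinAt_const (bv i) x (ball n))
  have h2 := h1.clm_apply (hasFDerivWithinAt_const (bv j) x (ball n))
  have h3 := h2.fderivWithin (uniqueDiffOn_ball x hx)
  simp only [gF_bv] at h3
  rw [pd, h3]
  simp

lemma pd_g_symm {x : E n} (hx : x ∈ ball n) (k i j : Fin n) :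
    pd (fun y => g y i j) k x = pd (fun y => g y j i) k x := by
  unfold pd
  rw [fderivWithin_congr (fun y hy => g_symm hg hy i j) (g_symm hg hx i j)]

lemma christoffel_symm {x : E n} (hx : x ∈ ball n) (l j k : Fin n) :
    christoffel g l j k x = christoffel g l k j x := by
  unfold christoffel
  congr 1
  refine Finset.sum_congr rfl fun m _ => ?_
  rw [pd_g_symm hg hx m j k]; ring

lemma isUnit_det {x : E n} (hx : x ∈ ball n) : IsUnit (g x).det :=
  (hg.1 x hx).det_pos.ne'.isUnit

lemma sum_g_christoffel {x : E n} (hx : x ∈ ball n) (i j k : Fin n) :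
    ∑ l, g x i l * christoffel g l j k x =
      (1 / 2) * (pd (fun y => g y i k) j x + pd (fun y => g y i j) k x
        - pd (fun y => g y j k) i x) := by
  have hinv : ∀ m, ∑ l, g x i l * (g x)⁻¹ l m = if i = m then 1 else 0 := by
    intro m
    have := congrFun (congrFun (Matrix.mul_nonsing_inv (g x) (isUnit_det hg hx)) i) m
    rw [Matrix.mul_apply, Matrix.one_apply] at this
    exact this
  unfold christoffel
  simp only [Finset.mul_sum]
  rw [Finset.sum_comm]
  have : ∀ m, ∑ l, g x i l * (1 / 2 * ((g x)⁻¹ l m * (pd (fun y => g y m k) j x +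
      pd (fun y => g y m j) k x - pd (fun y => g y j k) m x))) =
      (∑ l, g x i l * (g x)⁻¹ l m) * (1 / 2 * (pd (fun y => g y m k) j x +
      pd (fun y => g y m j) k x - pd (fun y => g y j k) m x)) := by
    intro m
    rw [Finset.sum_mul]
    exact Finset.sum_congr rfl fun l _ => by ring
  simp only [this, hinv]
  simp

end metric

/-! ### The inverse metric and the determinant -/

lemma contDiffOn_det {M : E n → Matrix (Fin n) (Fin n) ℝ} {s : Set (E n)}
    (h : ∀ i j, ContDiffOn ℝ 1 (fun x => M x i j) s) : ContDiffOn ℝ 1 (fun x => (M x).det) s := by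
  simp only [Matrix.det_apply]
  refine ContDiffOn.sum fun σ _ => ?_
  exact (contDiffOn_prod fun i _ => h _ _).const_smul _

section metric
variable (hg : IsC11Metric g)
include hg

lemma contDiffOn_det_g : ContDiffOn ℝ 1 (fun x => (g x).det) (ball n) :=
  contDiffOn_det fun i j => (hg.2 i j).1

lemma det_g_pos {x : E n} (hx : x ∈ ball n) : 0 < (g x).det := (hg.1 x hx).det_pos

/-- Cramer's rule: the entries of the inverse are quotients of determinants of `C¹` matrices by the
positive function `det g`. -/
lemma contDiffOn_inv_g (i j : Fin n) : ContDiffOn ℝ 1 (fun x => (g x)⁻¹ i j) (ball n) := by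
  have h1 : ∀ x, (g x)⁻¹ i j = (g x).det⁻¹ * ((g x).updateRow j (Pi.single i 1)).det := by
    intro x
    rw [Matrix.inv_def, Matrix.smul_apply, Ring.inverse_eq_inv', Matrix.adjugate_apply, smul_eq_mul]
  simp only [h1]
  refine ((contDiffOn_det_g hg).inv fun x hx => (det_g_pos hg hx).ne').mul ?_
  refine contDiffOn_det fun k l => ?_
  by_cases hk : k = j
  · subst hk; simp only [Matrix.updateRow_self]; exact contDiffOn_const
  · simp only [Matrix.updateRow_ne hk]; exact (hg.2 k l).1

lemma lipOn_pd (i j k : Fin n) : LipOn (pd (fun y => g y i j) k) (ball n) := by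
  obtain ⟨K, hK⟩ := (hg.2 i j).2
  refine lipOn_of_lipschitzOnWith isCompact_ball ⟨_,
    ((ContinuousLinearMap.apply ℝ ℝ (bv k : E n)).lipschitz.lipschitzOnWith
      (s := univ)).comp hK (mapsTo_univ _ _)⟩

/-- The `C^{1,1}` hypothesis enters here: the first derivatives of `g` are Lipschitz, and products
of bounded Lipschitz functions are Lipschitz. -/
lemma lipOn_christoffel (l j k : Fin n) : LipOn (christoffel g l j k) (ball n) := by
  unfold christoffel
  refine (LipOn.const _).mul (LipOn.sum fun m _ => ?_)
  exact (contDiffOn_lipOn (contDiffOn_inv_g hg l m)).mul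
    (((lipOn_pd hg _ _ _).add (lipOn_pd hg _ _ _)).sub (lipOn_pd hg _ _ _))

end metric

/-- A bounded Lipschitz extension to `ℝⁿ` of the Christoffel symbols, as a bilinear map. -/
structure Conn (g : E n → Matrix (Fin n) (Fin n) ℝ) where
  Γ : E n → E n →L[ℝ] E n →L[ℝ] E n
  lip : ∃ K, LipschitzWith K Γ
  bdd : ∃ M : ℝ, ∀ x, ‖Γ x‖ ≤ M
  coeff : ∀ x ∈ ball n, ∀ j k l, Γ x (bv j) (bv k) l = christoffel g l j k x

/-- Each symbol is extended on its own and multiplied by a constant bilinear map. A globally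
Lipschitz field makes Rademacher's theorem and a complete flow available. Outside the ball the
extension need be neither symmetric nor compatible with a metric, so the geometric identities below
are restricted to the ball. -/
lemma exists_conn (hg : IsC11Metric g) : Nonempty (Conn g) := by
  choose F hF hM hE using fun l j k => (lipOn_christoffel hg l j k).exists_extension
  choose K hK using hF
  choose M hM using hM
  let B : Fin n → Fin n → Fin n → E n →L[ℝ] E n →L[ℝ] E n := fun l j k =>
    (EuclideanSpace.proj j : E n →L[ℝ] ℝ).smulRight
      ((EuclideanSpace.proj k : E n →L[ℝ] ℝ).smulRight (bv l))
  refine ⟨⟨fun x => ∑ l, ∑ j, ∑ k, F l j k x • B l j k, ?_, ?_, ?_⟩⟩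
  · refine ⟨∑ l, ∑ j, ∑ k, K l j k * ‖B l j k‖₊, LipschitzWith.of_dist_le_mul fun x y => ?_⟩
    rw [dist_eq_norm]
    simp only [← Finset.sum_sub_distrib, ← sub_smul]
    push_cast
    simp only [Finset.sum_mul]
    refine norm_sum_le_of_le _ fun l _ => norm_sum_le_of_le _ fun j _ =>
      norm_sum_le_of_le _ fun k _ => ?_
    rw [norm_smul]
    have := (hK l j k).dist_le_mul x y
    rw [Real.dist_eq] at this
    calc _ ≤ (K l j k * dist x y) * ‖B l j k‖ := by gcongr; exact this
      _ = _ := by ring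
  · refine ⟨∑ l, ∑ j, ∑ k, M l j k * ‖B l j k‖, fun x => ?_⟩
    refine norm_sum_le_of_le _ fun l _ => norm_sum_le_of_le _ fun j _ =>
      norm_sum_le_of_le _ fun k _ => ?_
    rw [norm_smul]
    gcongr
    exact hM l j k x
  · intro x hx j k l
    simp [B, _root_.sum_apply, Pi.single_apply, hE l j k hx]

namespace Conn
variable (c : Conn g)

lemma apply_eq {x : E n} (hx : x ∈ ball n) (u w : E n) (l : Fin n) :
    c.Γ x u w l = ∑ j, ∑ k, christoffel g l j k x * u j * w k := by
  rw [clm_eq_sum_coord (c.Γ x) u]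
  simp only [_root_.sum_apply, _root_.smul_apply, WithLp.ofLp_sum,
    Finset.sum_apply, WithLp.ofLp_smul, Pi.smul_apply, smul_eq_mul]
  refine Finset.sum_congr rfl fun j _ => ?_
  rw [clm_eq_sum_coord (c.Γ x (bv j)) w]
  simp only [WithLp.ofLp_sum, Finset.sum_apply, WithLp.ofLp_smul, Pi.smul_apply, smul_eq_mul,
    Finset.mul_sum, c.coeff x hx]
  exact Finset.sum_congr rfl fun k _ => by ring

lemma symm (hg : IsC11Metric g) {x : E n} (hx : x ∈ ball n) (u w : E n) :
    c.Γ x u w = c.Γ x w u := by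
  ext l
  rw [c.apply_eq hx, c.apply_eq hx, Finset.sum_comm]
  refine Finset.sum_congr rfl fun k _ => Finset.sum_congr rfl fun j _ => ?_
  rw [christoffel_symm hg hx l j k]; ring

/-- Compatibility of the connection with the metric. -/
lemma compat (hg : IsC11Metric g) {x : E n} (hx : x ∈ ball n) (ξ u w : E n) :
    fderivWithin ℝ (gF g) (ball n) x ξ u w = gF g x (c.Γ x ξ u) w + gF g x u (c.Γ x ξ w) := by
  -- Christoffel symbols of the first kind. In the sum of two of them only the derivative of `g` in
  -- the direction `ξ` survives.
  have lower : ∀ a b d, gF g x (c.Γ x (bv a) (bv b)) (bv d) =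
      (1 / 2) * (pd (fun y => g y d b) a x + pd (fun y => g y d a) b x
        - pd (fun y => g y a b) d x) := by
    intro a b d
    rw [gF_bv_right, ← sum_g_christoffel hg hx]
    refine Finset.sum_congr rfl fun i _ => ?_
    rw [c.coeff x hx, g_symm hg hx]
  refine eq_of_isLinearMap_of_basis
    (f := fun ξ => fderivWithin ℝ (gF g) (ball n) x ξ u w)
    (h := fun ξ => gF g x (c.Γ x ξ u) w + gF g x u (c.Γ x ξ w))
    ⟨fun _ _ => by simp, fun _ _ => by simp⟩
    ⟨fun _ _ => by simp; ring, fun _ _ => by simp; ring⟩ (fun a => ?_) ξ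
  refine eq_of_isLinearMap_of_basis
    (f := fun u => fderivWithin ℝ (gF g) (ball n) x (bv a) u w)
    (h := fun u => gF g x (c.Γ x (bv a) u) w + gF g x u (c.Γ x (bv a) w))
    ⟨fun _ _ => by simp, fun _ _ => by simp⟩
    ⟨fun _ _ => by simp; ring, fun _ _ => by simp; ring⟩ (fun b => ?_) u
  refine eq_of_isLinearMap_of_basis
    (f := fun w => fderivWithin ℝ (gF g) (ball n) x (bv a) (bv b) w)
    (h := fun w => gF g x (c.Γ x (bv a) (bv b)) w + gF g x (bv b) (c.Γ x (bv a) w))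
    ⟨fun _ _ => by simp, fun _ _ => by simp⟩
    ⟨fun _ _ => by simp; ring, fun _ _ => by simp; ring⟩ (fun d => ?_) w
  rw [fderivWithin_gF_bv hg hx, gF_symm hg hx (bv b), lower, lower, pd_g_symm hg hx a b d,
    pd_g_symm hg hx d a b, pd_g_symm hg hx b a d, pd_g_symm hg hx d b a]
  ring

end Conn
end RoughXRay
end

/-! ### Ellipticity, the volume density and raising of indices -/

noncomputable section
namespace RoughXRay
variable {n : ℕ} {g : E n → Matrix (Fin n) (Fin n) ℝ}

/-- The minimum of the quadratic form over the compact product of the ball and the Euclidean unit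
sphere is positive; homogeneity does the rest. -/
lemma exists_ellipticity (hg : IsC11Metric g) :
    ∃ a > 0, ∀ x ∈ ball n, ∀ u : E n, a * ‖u‖ ^ 2 ≤ gF g x u u := by
  have hc : ContinuousOn (fun p : E n × E n => gF g p.1 p.2 p.2)
      (ball n ×ˢ Metric.sphere 0 1) := by
    have h1 : ContinuousOn (fun p : E n × E n => gF g p.1) (ball n ×ˢ Metric.sphere 0 1) :=
      (continuousOn_gF hg).comp continuousOn_fst fun p hp => hp.1
    exact (h1.clm_apply continuousOn_snd).clm_apply continuousOn_snd
  obtain ⟨a, ha, hle⟩ := (isCompact_ball.prod (isCompact_sphere (0 : E n) 1)).exists_forall_le'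
    (a := 0) hc (by
      rintro ⟨x, u⟩ ⟨hx, hu⟩
      refine gF_pos hg hx ?_
      rintro rfl
      simp at hu)
  refine ⟨a, ha, fun x hx u => ?_⟩
  by_cases hu : u = 0
  · simp [hu]
  have hu' : 0 < ‖u‖ := norm_pos_iff.2 hu
  have := hle (x, ‖u‖⁻¹ • u) ⟨hx, by simp [norm_smul, hu'.ne']⟩
  simp only [map_smul, _root_.smul_apply, smul_eq_mul] at this
  rw [← mul_assoc, ← mul_inv, ← div_eq_inv_mul, le_div_iff₀ (by positivity)] at this
  rw [pow_two]; exact this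

lemma exists_bound_gF (hg : IsC11Metric g) : ∃ C : ℝ, 0 ≤ C ∧ ∀ x ∈ ball n, ‖gF g x‖ ≤ C := by
  obtain ⟨C, hC⟩ := isCompact_ball.exists_bound_of_continuousOn (continuousOn_gF hg)
  exact ⟨C, (norm_nonneg _).trans (hC 0 (by simp [ball])), hC⟩

/-- Derivative of the determinant (Jacobi's formula). -/
lemma hasFDerivWithinAt_det {X : Type*} [NormedAddCommGroup X] [NormedSpace ℝ X]
    {M : X → Matrix (Fin n) (Fin n) ℝ}
    {M' : Fin n → Fin n → X →L[ℝ] ℝ} {s : Set X} {x : X}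
    (h : ∀ i j, HasFDerivWithinAt (fun x => M x i j) (M' i j) s x) :
    HasFDerivWithinAt (fun x => (M x).det) (∑ i, ∑ j, (M x).adjugate i j • M' j i) s x := by
  have h1 : HasFDerivWithinAt (fun x => (M x).det)
      (∑ σ : Equiv.Perm (Fin n), (Equiv.Perm.sign σ : ℝ) •
        ∑ i, (∏ j ∈ Finset.univ.erase i, M x (σ j) j) • M' (σ i) i) s x := by
    simp only [Matrix.det_apply']
    refine HasFDerivWithinAt.fun_sum fun σ _ => ?_
    exact (HasFDerivWithinAt.finsetProd fun i _ => h (σ i) i).const_mul _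
  refine h1.congr_fderiv ?_
  ext ξ
  have h2 : ∀ i, ∑ j, (M x).adjugate i j * M' j i ξ =
      ((M x).updateCol i fun j => M' j i ξ).det := by
    intro i
    rw [← Matrix.cramer_apply, Matrix.cramer_eq_adjugate_mulVec]
    rfl
  simp only [_root_.sum_apply, _root_.smul_apply, smul_eq_mul, h2]
  simp only [Matrix.det_apply', Finset.mul_sum]
  rw [Finset.sum_comm]
  refine Finset.sum_congr rfl fun i _ => Finset.sum_congr rfl fun σ _ => ?_
  congr 1
  rw [← Finset.mul_prod_erase _ _ (Finset.mem_univ i), Matrix.updateCol_self, mul_comm]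
  congr 1
  refine Finset.prod_congr rfl fun j hj => ?_
  rw [Matrix.updateCol_ne (Finset.ne_of_mem_erase hj)]

lemma hasFDerivWithinAt_g (hg : IsC11Metric g) {x : E n} (hx : x ∈ ball n) (i j : Fin n) :
    HasFDerivWithinAt (fun y => g y i j) (fderivWithin ℝ (fun y => g y i j) (ball n) x)
      (ball n) x :=
  ((hg.2 i j).1.differentiableOn one_ne_zero x hx).hasFDerivWithinAt

lemma fderivWithin_gF_apply_bv (hg : IsC11Metric g) {x : E n} (hx : x ∈ ball n) (ξ : E n)
    (i j : Fin n) : fderivWithin ℝ (gF g) (ball n) x ξ (bv i) (bv j) =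
      fderivWithin ℝ (fun y => g y i j) (ball n) x ξ := by
  refine eq_of_isLinearMap_of_basis
    (f := fun ξ => fderivWithin ℝ (gF g) (ball n) x ξ (bv i) (bv j))
    ⟨fun _ _ => by simp, fun _ _ => by simp⟩
    ⟨fun _ _ => by simp, fun _ _ => by simp⟩ (fun k => ?_) ξ
  exact fderivWithin_gF_bv hg hx k i j

/-- The derivative of the volume density. -/
lemma Conn.fderivWithin_det (c : Conn g) (hg : IsC11Metric g) {x : E n} (hx : x ∈ ball n)
    (ξ : E n) : fderivWithin ℝ (fun y => (g y).det) (ball n) x ξ =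
      2 * (g x).det * ∑ l, c.Γ x ξ (bv l) l := by
  rw [(hasFDerivWithinAt_det fun i j => hasFDerivWithinAt_g hg hx i j).fderivWithin
    (uniqueDiffOn_ball x hx)]
  simp only [_root_.sum_apply, _root_.smul_apply, smul_eq_mul]
  simp only [← fderivWithin_gF_apply_bv hg hx, c.compat hg hx, gF_bv_right]
  have h1 : ∀ l j, ∑ i, g x l i * (g x).adjugate i j = if l = j then (g x).det else 0 := by
    intro l j
    have := congrFun (congrFun (Matrix.mul_adjugate (g x)) l) j
    rw [Matrix.mul_apply] at this
    simpa [Matrix.one_apply] using this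
  have h2 : ∀ i l, ∑ j, (g x).adjugate i j * g x j l = if i = l then (g x).det else 0 := by
    intro l j
    have := congrFun (congrFun (Matrix.adjugate_mul (g x)) l) j
    rw [Matrix.mul_apply] at this
    simpa [Matrix.one_apply] using this
  simp only [mul_add, Finset.sum_add_distrib, gF_symm hg hx (bv _) (c.Γ x ξ (bv _)), gF_bv_right]
  -- The two terms of the compatibility identity contribute the same trace, hence the factor 2.
  have e1 : ∑ i, ∑ j, (g x).adjugate i j * ∑ l, g x l i * c.Γ x ξ (bv j) l =
      (g x).det * ∑ l, c.Γ x ξ (bv l) l := by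
    simp only [Finset.mul_sum]
    calc _ = ∑ j, ∑ l, (∑ i, g x l i * (g x).adjugate i j) * c.Γ x ξ (bv j) l := by
          rw [Finset.sum_comm]
          refine Finset.sum_congr rfl fun j _ => ?_
          rw [Finset.sum_comm]
          refine Finset.sum_congr rfl fun l _ => ?_
          rw [Finset.sum_mul]
          exact Finset.sum_congr rfl fun i _ => by ring
      _ = _ := by simp [h1]
  have e2 : ∑ i, ∑ j, (g x).adjugate i j * ∑ l, g x l j * c.Γ x ξ (bv i) l =
      (g x).det * ∑ l, c.Γ x ξ (bv l) l := by
    simp only [Finset.mul_sum]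
    calc _ = ∑ i, ∑ l, (∑ j, (g x).adjugate i j * g x j l) * c.Γ x ξ (bv i) l := by
          refine Finset.sum_congr rfl fun i _ => ?_
          rw [Finset.sum_comm]
          refine Finset.sum_congr rfl fun l _ => ?_
          rw [Finset.sum_mul]
          exact Finset.sum_congr rfl fun j _ => by rw [g_symm hg hx l j]; ring
      _ = _ := by simp [h2]
  rw [e1, e2]; ring

/-! ### Raising indices -/

/-- The isomorphism from covectors to vectors given by the metric. -/
def sharp (g : E n → Matrix (Fin n) (Fin n) ℝ) (x : E n) : (E n →L[ℝ] ℝ) →L[ℝ] E n :=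
  ∑ i, ∑ j, (g x)⁻¹ i j • (ContinuousLinearMap.apply ℝ ℝ (bv j : E n)).smulRight (bv i : E n)

lemma sharp_apply (x : E n) (α : E n →L[ℝ] ℝ) (i : Fin n) :
    sharp g x α i = ∑ j, (g x)⁻¹ i j * α (bv j) := by
  simp [sharp, Pi.single_apply]

lemma contDiffOn_sharp (hg : IsC11Metric g) : ContDiffOn ℝ 1 (sharp g) (ball n) := by
  unfold sharp
  refine ContDiffOn.sum fun i _ => ContDiffOn.sum fun j _ => ?_
  exact (contDiffOn_inv_g hg i j).smul contDiffOn_const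

lemma gF_sharp (hg : IsC11Metric g) {x : E n} (hx : x ∈ ball n) (α : E n →L[ℝ] ℝ) (w : E n) :
    gF g x (sharp g x α) w = α w := by
  refine eq_of_isLinearMap_of_basis (f := fun w => gF g x (sharp g x α) w)
    ⟨fun _ _ => by simp, fun _ _ => by simp⟩
    ⟨fun _ _ => by simp, fun _ _ => by simp⟩ (fun k => ?_) w
  have h1 : ∀ j, ∑ i, g x i k * (g x)⁻¹ i j = if k = j then 1 else 0 := by
    intro j
    have := congrFun (congrFun (Matrix.mul_nonsing_inv (g x) (isUnit_det hg hx)) k) j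
    rw [Matrix.mul_apply, Matrix.one_apply] at this
    simpa only [g_symm hg hx k] using this
  simp only [gF_bv_right, sharp_apply, Finset.mul_sum]
  rw [Finset.sum_comm]
  simp only [← mul_assoc, ← Finset.sum_mul, h1]
  simp

lemma gF_sharp_right (hg : IsC11Metric g) {x : E n} (hx : x ∈ ball n) (α : E n →L[ℝ] ℝ) (w : E n) :
    gF g x w (sharp g x α) = α w := by
  rw [gF_symm hg hx, gF_sharp hg hx]

lemma gF_injective (hg : IsC11Metric g) {x : E n} (hx : x ∈ ball n) {u w : E n}
    (h : ∀ ζ, gF g x u ζ = gF g x w ζ) : u = w := by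
  by_contra hne
  have h0 : gF g x (u - w) (u - w) = 0 := by
    rw [map_sub (gF g x), _root_.sub_apply, h, sub_self]
  exact (gF_pos hg hx (sub_ne_zero.2 hne)).ne' h0

lemma sharp_gF (hg : IsC11Metric g) {x : E n} (hx : x ∈ ball n) (u : E n) :
    sharp g x (gF g x u) = u :=
  gF_injective hg hx fun _ => gF_sharp hg hx _ _

/-- The square of the norm of the part of the covector `α` tangential to the sphere bundle. -/
def coN (g : E n → Matrix (Fin n) (Fin n) ℝ) (z : E n × E n) (α : E n →L[ℝ] ℝ) : ℝ :=
  α (sharp g z.1 α) - α z.2 ^ 2 / gF g z.1 z.2 z.2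

/-- The tangential part of the gradient corresponding to the covector `α`. -/
def tanPart (g : E n → Matrix (Fin n) (Fin n) ℝ) (z : E n × E n) (α : E n →L[ℝ] ℝ) : E n :=
  sharp g z.1 α - (α z.2 / gF g z.1 z.2 z.2) • z.2

lemma gF_tanPart (hg : IsC11Metric g) {z : E n × E n} (hx : z.1 ∈ ball n) (hv : z.2 ≠ 0)
    (α : E n →L[ℝ] ℝ) : gF g z.1 (tanPart g z α) (tanPart g z α) = coN g z α := by
  have hq := (gF_pos hg hx hv).ne'
  simp only [tanPart, coN, map_sub, map_smul, _root_.sub_apply, _root_.smul_apply, smul_eq_mul,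
    gF_sharp hg hx, gF_sharp_right hg hx]
  field_simp
  ring

lemma gF_tanPart_self (hg : IsC11Metric g) {z : E n × E n} (hx : z.1 ∈ ball n) (hv : z.2 ≠ 0)
    (α : E n →L[ℝ] ℝ) : gF g z.1 (tanPart g z α) z.2 = 0 := by
  have hq := (gF_pos hg hx hv).ne'
  simp only [tanPart, map_sub, map_smul, _root_.sub_apply, _root_.smul_apply, smul_eq_mul,
    gF_sharp hg hx]
  field_simp
  ring

lemma coN_nonneg (hg : IsC11Metric g) {z : E n × E n} (hx : z.1 ∈ ball n) (hv : z.2 ≠ 0)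
    (α : E n →L[ℝ] ℝ) : 0 ≤ coN g z α := by
  rw [← gF_tanPart hg hx hv]; exact gF_nonneg hg hx _

/-- A multiple of `v♭` changes only the radial part of a covector. Functions of `|v|²` have vertical
derivatives of this form, so localizing the speed is invisible to `coN` apart from a scalar factor.
-/
lemma coN_add_flat (hg : IsC11Metric g) {z : E n × E n} (hx : z.1 ∈ ball n) (hv : z.2 ≠ 0)
    (α : E n →L[ℝ] ℝ) (t : ℝ) : coN g z (α + t • gF g z.1 z.2) = coN g z α := by
  have hq := (gF_pos hg hx hv).ne'
  have h : gF g z.1 z.2 (sharp g z.1 α) = α z.2 := gF_sharp_right hg hx α z.2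
  simp only [coN, map_add, map_smul, _root_.add_apply, _root_.smul_apply, smul_eq_mul,
    sharp_gF hg hx, h]
  field_simp
  ring

lemma coN_smul (z : E n × E n) (α : E n →L[ℝ] ℝ) (t : ℝ) : coN g z (t • α) = t ^ 2 * coN g z α := by
  simp only [coN, map_smul, _root_.smul_apply, smul_eq_mul]
  ring

lemma exists_bound_coN (hg : IsC11Metric g) : ∃ C : ℝ, 0 ≤ C ∧
    ∀ z : E n × E n, z.1 ∈ ball n → z.2 ≠ 0 → ∀ α : E n →L[ℝ] ℝ, coN g z α ≤ C * ‖α‖ ^ 2 := by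
  obtain ⟨C, hC⟩ := isCompact_ball.exists_bound_of_continuousOn (contDiffOn_sharp hg).continuousOn
  refine ⟨C, (norm_nonneg _).trans (hC 0 (by simp [ball])), fun z hx hv α => ?_⟩
  have hq := gF_pos hg hx hv
  have h1 : α (sharp g z.1 α) ≤ ‖α‖ * (C * ‖α‖) :=
    (le_abs_self _).trans ((α.le_opNorm _).trans (by
      gcongr
      exact ((sharp g z.1).le_opNorm _).trans (by gcongr; exact hC _ hx)))
  have h2 : 0 ≤ α z.2 ^ 2 / gF g z.1 z.2 z.2 := by positivity
  unfold coN
  nlinarith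

end RoughXRay
end

noncomputable section
namespace RoughXRay
variable {n : ℕ} {g : E n → Matrix (Fin n) (Fin n) ℝ}

/-! ### Local Lipschitz continuity -/

section LocLip
variable {X F F' : Type*} [NormedAddCommGroup X] [NormedSpace ℝ X]
  [NormedAddCommGroup F] [NormedSpace ℝ F] [NormedAddCommGroup F'] [NormedSpace ℝ F']

/-- `f` is Lipschitz in a neighbourhood of `x`. -/
def LipAt (f : X → F) (x : X) : Prop := ∃ K, ∃ t ∈ 𝓝 x, LipschitzOnWith K f t

lemma lipAt_of_lipschitzWith {f : X → F} {K : NNReal} (h : LipschitzWith K f) (x : X) : LipAt f x :=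
  ⟨K, univ, univ_mem, h.lipschitzOnWith⟩

lemma lipAt_of_contDiffAt {f : X → F} {x : X} (h : ContDiffAt ℝ 1 f x) : LipAt f x :=
  h.exists_lipschitzOnWith

namespace LipAt

lemma continuousAt {f : X → F} {x : X} (h : LipAt f x) : ContinuousAt f x := by
  obtain ⟨K, t, ht, hK⟩ := h
  exact hK.continuousOn.continuousAt ht

lemma congr {f f' : X → F} {x : X} (h : LipAt f x) (he : f' =ᶠ[𝓝 x] f) : LipAt f' x := by
  obtain ⟨K, t, ht, hK⟩ := h
  refine ⟨K, t ∩ {y | f' y = f y}, inter_mem ht he, fun y hy z hz => ?_⟩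
  rw [hy.2, hz.2]
  exact hK hy.1 hz.1

lemma comp {Z : Type*} [NormedAddCommGroup Z] [NormedSpace ℝ Z] {f : X → F} {h : Z → X} {z : Z}
    (hf : LipAt f (h z)) (hh : LipAt h z) : LipAt (fun y => f (h y)) z := by
  have hc := hh.continuousAt
  obtain ⟨K, t, ht, hK⟩ := hf
  obtain ⟨K', t', ht', hK'⟩ := hh
  exact ⟨K * K', t' ∩ h ⁻¹' t, inter_mem ht' (hc ht),
    hK.comp (hK'.mono inter_subset_left) fun y hy => hy.2⟩

lemma prodMk {f : X → F} {f' : X → F'} {x : X} (h : LipAt f x) (h' : LipAt f' x) :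
    LipAt (fun y => (f y, f' y)) x := by
  obtain ⟨K, t, ht, hK⟩ := h
  obtain ⟨K', t', ht', hK'⟩ := h'
  exact ⟨max K K', t ∩ t', inter_mem ht ht',
    (hK.mono inter_subset_left).prodMk (hK'.mono inter_subset_right)⟩

lemma contDiffAt_comp {f : X → F} {Φ : F → F'} {x : X} (h : LipAt f x)
    (hΦ : ContDiffAt ℝ 1 Φ (f x)) : LipAt (fun y => Φ (f y)) x :=
  (lipAt_of_contDiffAt hΦ).comp h

lemma mul {f h : X → ℝ} {x : X} (hf : LipAt f x) (hh : LipAt h x) :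
    LipAt (fun y => f y * h y) x :=
  (hf.prodMk hh).contDiffAt_comp (Φ := fun p : ℝ × ℝ => p.1 * p.2)
    (contDiffAt_fst.mul contDiffAt_snd)

lemma add {f h : X → F} {x : X} (hf : LipAt f x) (hh : LipAt h x) :
    LipAt (fun y => f y + h y) x :=
  (hf.prodMk hh).contDiffAt_comp (Φ := fun p : F × F => p.1 + p.2)
    (contDiffAt_fst.add contDiffAt_snd)

lemma neg {f : X → F} {x : X} (hf : LipAt f x) : LipAt (fun y => - f y) x :=
  hf.contDiffAt_comp (Φ := fun p : F => -p) contDiffAt_id.neg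

lemma clm_apply {f : X → F →L[ℝ] F'} {h : X → F} {x : X} (hf : LipAt f x) (hh : LipAt h x) :
    LipAt (fun y => f y (h y)) x :=
  (hf.prodMk hh).contDiffAt_comp (Φ := fun p : (F →L[ℝ] F') × F => p.1 p.2)
    (contDiffAt_fst.clm_apply contDiffAt_snd)

end LipAt

/-- A locally Lipschitz function with compact support is Lipschitz. -/
lemma exists_lipschitzWith_of_lipAt [FiniteDimensional ℝ X] {f : X → F}
    (hc : HasCompactSupport f) (h : ∀ x ∈ tsupport f, LipAt f x) : ∃ K, LipschitzWith K f := by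
  have hl : LocallyLipschitz f := by
    intro x
    by_cases hx : x ∈ tsupport f
    · exact h x hx
    · have h0 : f =ᶠ[𝓝 x] fun _ => 0 := notMem_tsupport_iff_eventuallyEq.1 hx
      exact (lipAt_of_lipschitzWith (LipschitzWith.const (0 : F)) x).congr h0
  have : ProperSpace X := FiniteDimensional.proper_real X
  obtain ⟨R, hR⟩ := hc.isCompact.isBounded.subset_closedBall (0 : X)
  obtain ⟨K, hK⟩ := (hl.locallyLipschitzOn (s := Metric.closedBall 0 (R + 1))).exists_lipschitzOnWith_of_compact
    (isCompact_closedBall _ _)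
  obtain ⟨M, hM⟩ := hc.exists_bound_of_continuous hl.continuous
  have hM0 : 0 ≤ M := (norm_nonneg _).trans (hM 0)
  have hout : ∀ y, y ∉ Metric.closedBall (0 : X) R → f y = 0 := fun y hy =>
    image_eq_zero_of_notMem_tsupport fun h => hy (hR h)
  -- A point outside the ball of radius `R + 1` has distance at least 1 from `x`, so the bound `M`
  -- on the values serves as a Lipschitz constant there; inside, compactness gives `K`.
  have key : ∀ x y, x ∈ Metric.closedBall (0 : X) R →
      dist (f x) (f y) ≤ max K ⟨M, hM0⟩ * dist x y := by
    intro x y hx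
    by_cases hy : y ∈ Metric.closedBall (0 : X) (R + 1)
    · refine (hK.dist_le_mul x (Metric.closedBall_subset_closedBall (by linarith) hx) y hy).trans ?_
      gcongr
      exact le_max_left _ _
    · have hy' : y ∉ Metric.closedBall (0 : X) R := fun h =>
        hy (Metric.closedBall_subset_closedBall (by linarith) h)
      have h1 : 1 ≤ dist x y := by
        rw [Metric.mem_closedBall] at hx hy
        have := dist_triangle y x 0
        rw [dist_comm y x] at this
        linarith
      rw [hout y hy', dist_zero_right]
      calc ‖f x‖ ≤ M * 1 := by simpa using hM x
        _ ≤ max K ⟨M, hM0⟩ * dist x y := by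
          gcongr
          exact le_max_right K ⟨M, hM0⟩
  refine ⟨max K ⟨M, hM0⟩, LipschitzWith.of_dist_le_mul fun x y => ?_⟩
  by_cases hx : x ∈ Metric.closedBall (0 : X) R
  · exact key x y hx
  by_cases hy : y ∈ Metric.closedBall (0 : X) R
  · rw [dist_comm, dist_comm x]; exact key y x hy
  · rw [hout x hx, hout y hy, dist_self]; positivity

/-! ### Integration by parts for Lipschitz functions -/

variable [FiniteDimensional ℝ X] [MeasurableSpace X] [BorelSpace X] (μ : Measure X)
  [μ.IsAddHaarMeasure]

lemma integrable_fderiv_apply {φ : X → ℝ} {K : NNReal} (h : LipschitzWith K φ)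
    (hc : HasCompactSupport φ) (w : X) : Integrable (fun z => fderiv ℝ φ z w) μ := by
  have hsupp : ∀ z, z ∉ tsupport φ → fderiv ℝ φ z w = 0 := by
    intro z hz
    rw [image_eq_zero_of_notMem_tsupport (fun h' => hz (tsupport_fderiv_subset ℝ h'))]
    rfl
  have : IntegrableOn (fun z => fderiv ℝ φ z w) (tsupport φ) μ := by
    refine Measure.integrableOn_of_bounded (M := K * ‖w‖) hc.isCompact.measure_lt_top.ne
      (measurable_fderiv_apply_const ℝ φ w).aestronglyMeasurable
      (Eventually.of_forall fun z => ?_)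
    exact ((fderiv ℝ φ z).le_opNorm w).trans (by
      gcongr; exact norm_fderiv_le_of_lipschitz ℝ h)
  exact (integrableOn_iff_integrable_of_support_subset fun z hz => by
    by_contra h'; exact hz (hsupp z h')).1 this

/-- Integration by parts for Lipschitz functions against the constant function 1; by Rademacher's
theorem the line derivative is the derivative almost everywhere. -/
lemma integral_fderiv_apply_eq_zero {φ : X → ℝ} {K : NNReal} (h : LipschitzWith K φ)
    (hc : HasCompactSupport φ) (w : X) : ∫ z, fderiv ℝ φ z w ∂μ = 0 := by
  have h1 := LipschitzWith.integral_lineDeriv_mul_eq (μ := μ)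
    (LipschitzWith.const (α := X) (1 : ℝ)) h hc (-w)
  have h2 : ∀ z, lineDeriv ℝ (fun _ : X => (1 : ℝ)) z (-w) = 0 := fun z => by
    simp [lineDeriv]
  simp only [h2, zero_mul, integral_zero, neg_neg, mul_one] at h1
  rw [h1]
  refine integral_congr_ae ?_
  filter_upwards [h.ae_differentiableAt (μ := μ)] with z hz
  exact hz.lineDeriv_eq_fderiv.symm

/-- The divergence of a compactly supported Lipschitz vector field has integral zero. -/
lemma integral_eq_zero_of_ae_eq_sum_fderiv {ι : Type*} (t : Finset ι) (φ : ι → X → ℝ) (w : ι → X)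
    (h : ∀ i ∈ t, ∃ K, LipschitzWith K (φ i)) (hc : ∀ i ∈ t, HasCompactSupport (φ i)) {f : X → ℝ}
    (hf : ∀ᵐ z ∂μ, f z = ∑ i ∈ t, fderiv ℝ (φ i) z (w i)) : Integrable f μ ∧ ∫ z, f z ∂μ = 0 := by
  have hi : ∀ i ∈ t, Integrable (fun z => fderiv ℝ (φ i) z (w i)) μ := by
    intro i hi
    obtain ⟨K, hK⟩ := h i hi
    exact integrable_fderiv_apply μ hK (hc i hi) _
  refine ⟨(integrable_finsetSum t hi).congr ?_, ?_⟩
  · filter_upwards [hf] with z hz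
    rw [hz]
  rw [integral_congr_ae hf, integral_finsetSum _ hi]
  refine Finset.sum_eq_zero fun i hi => ?_
  obtain ⟨K, hK⟩ := h i hi
  exact integral_fderiv_apply_eq_zero μ hK (hc i hi) _

end LocLip
end RoughXRay
end

noncomputable section
namespace RoughXRay
variable {n : ℕ} {g : E n → Matrix (Fin n) (Fin n) ℝ}

/-! ### The geodesic spray and horizontal lifts -/

/-- The geodesic vector field on `TM`. -/
def spray (c : Conn g) (z : E n × E n) : E n × E n := (z.2, -c.Γ z.1 z.2 z.2)

/-- The horizontal lift, as a linear map. -/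
def horL (c : Conn g) (z : E n × E n) : E n →L[ℝ] E n × E n :=
  (ContinuousLinearMap.id ℝ (E n)).prod (-(c.Γ z.1).flip z.2)

lemma horL_apply (c : Conn g) (z : E n × E n) (ζ : E n) :
    horL c z ζ = (ζ, -c.Γ z.1 ζ z.2) := rfl

lemma horL_self (c : Conn g) (z : E n × E n) : horL c z z.2 = spray c z := rfl

/-- The inclusion of the vertical directions. -/
abbrev vinc (n : ℕ) : E n →L[ℝ] E n × E n := ContinuousLinearMap.inr ℝ (E n) (E n)

lemma vinc_apply (ζ : E n) : vinc n ζ = (0, ζ) := rfl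

lemma hasFDerivAt_gamma (c : Conn g) {z : E n × E n} (h : DifferentiableAt ℝ c.Γ z.1) :
    HasFDerivAt (fun p : E n × E n => c.Γ p.1)
      ((fderiv ℝ c.Γ z.1).comp (ContinuousLinearMap.fst ℝ (E n) (E n))) z :=
  h.hasFDerivAt.comp z hasFDerivAt_fst

lemma hasFDerivAt_spray (c : Conn g) {z : E n × E n} (h : DifferentiableAt ℝ c.Γ z.1) :
    ∃ dA : (E n × E n) →L[ℝ] E n × E n, HasFDerivAt (spray c) dA z ∧ ∀ w, dA w =
      (w.2, -(fderiv ℝ c.Γ z.1 w.1 z.2 z.2 + c.Γ z.1 w.2 z.2 + c.Γ z.1 z.2 w.2)) := by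
  have h1 := (hasFDerivAt_gamma c h).clm_apply (hasFDerivAt_snd (𝕜 := ℝ) (p := z))
  have h2 := (h1.clm_apply (hasFDerivAt_snd (𝕜 := ℝ) (p := z))).neg
  refine ⟨_, (hasFDerivAt_snd (𝕜 := ℝ) (p := z)).prodMk h2, fun w => ?_⟩
  ext1
  · simp
  · simp; abel

lemma hasFDerivAt_horL_apply (c : Conn g) {z : E n × E n} (h : DifferentiableAt ℝ c.Γ z.1)
    {W : E n × E n → E n} {W' : E n × E n →L[ℝ] E n} (hW : HasFDerivAt W W' z) :
    ∃ dH : (E n × E n) →L[ℝ] E n × E n, HasFDerivAt (fun p => horL c p (W p)) dH z ∧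
      ∀ w, dH w = (W' w, -(fderiv ℝ c.Γ z.1 w.1 (W z) z.2 + c.Γ z.1 (W' w) z.2
        + c.Γ z.1 (W z) w.2)) := by
  have h1 := (hasFDerivAt_gamma c h).clm_apply hW
  have h2 := (h1.clm_apply (hasFDerivAt_snd (𝕜 := ℝ) (p := z))).neg
  refine ⟨_, hW.prodMk h2, fun w => ?_⟩
  ext1
  · simp
  · simp; abel

/-- Rademacher's theorem in the base; null sets pull back to null sets under the projection. The
identities below that differentiate the spray hold at these points. -/
lemma ae_differentiableAt_gamma (c : Conn g) :
    ∀ᵐ z : E n × E n, DifferentiableAt ℝ c.Γ z.1 := by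
  obtain ⟨K, hK⟩ := c.lip
  exact (Measure.quasiMeasurePreserving_fst (μ := (volume : Measure (E n)))
    (ν := (volume : Measure (E n)))).ae hK.ae_differentiableAt

lemma lipAt_gamma (c : Conn g) (z : E n × E n) : LipAt (fun p : E n × E n => c.Γ p.1) z := by
  obtain ⟨K, hK⟩ := c.lip
  exact (lipAt_of_lipschitzWith hK z.1).comp (lipAt_of_contDiffAt contDiffAt_fst)

lemma lipAt_spray (c : Conn g) (z : E n × E n) : LipAt (spray c) z := by
  have h2 : LipAt (fun p : E n × E n => p.2) z := lipAt_of_contDiffAt contDiffAt_snd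
  exact h2.prodMk (((lipAt_gamma c z).clm_apply h2).clm_apply h2).neg

lemma lipAt_horL_apply (c : Conn g) {z : E n × E n} {W : E n × E n → E n} (hW : LipAt W z) :
    LipAt (fun p => horL c p (W p)) z := by
  have h2 : LipAt (fun p : E n × E n => p.2) z := lipAt_of_contDiffAt contDiffAt_snd
  exact hW.prodMk (((lipAt_gamma c z).clm_apply hW).clm_apply h2).neg

/-- The interior of `TM ∖ 0`. -/
def slitI (n : ℕ) : Set (E n × E n) := inner n ×ˢ {0}ᶜ

lemma isOpen_slitI : IsOpen (slitI n) := isOpen_inner.prod isOpen_compl_singleton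

/-! ### The commutator identities -/

section pointwise
variable {U : E n × E n → ℝ}

/-- The vertical derivative of `U`, as a covector. -/
def vD (U : E n × E n → ℝ) (z : E n × E n) : E n →L[ℝ] ℝ := (fderiv ℝ U z).comp (vinc n)

lemma vD_apply (z : E n × E n) (ζ : E n) : vD U z ζ = fderiv ℝ U z (0, ζ) := rfl

/-- The vertical gradient of `U`. -/
def vGrad (g : E n → Matrix (Fin n) (Fin n) ℝ) (U : E n × E n → ℝ) (z : E n × E n) : E n :=
  sharp g z.1 (vD U z)

/-- The derivative of `U` along the geodesic vector field. -/
def XD (c : Conn g) (U : E n × E n → ℝ) (z : E n × E n) : ℝ := fderiv ℝ U z (spray c z)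

/-- The covariant derivative of `W` along the geodesic vector field. -/
def covX (c : Conn g) (W : E n × E n → E n) (z : E n × E n) : E n :=
  fderiv ℝ W z (spray c z) + c.Γ z.1 z.2 (W z)

/-- The curvature operator `R(w, v)v`. -/
def Rop (c : Conn g) (z : E n × E n) (w : E n) : E n :=
  fderiv ℝ c.Γ z.1 w z.2 z.2 - fderiv ℝ c.Γ z.1 z.2 w z.2
    + c.Γ z.1 w (c.Γ z.1 z.2 z.2) - c.Γ z.1 z.2 (c.Γ z.1 w z.2)

lemma contDiffAt_sharp_fst (hg : IsC11Metric g) {z : E n × E n} (hz : z.1 ∈ inner n) :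
    ContDiffAt ℝ 1 (fun p : E n × E n => sharp g p.1) z :=
  ((contDiffOn_sharp hg).contDiffAt (ball_mem_nhds hz)).comp z contDiffAt_fst

lemma contDiffAt_gF_fst (hg : IsC11Metric g) {z : E n × E n} (hz : z.1 ∈ inner n) :
    ContDiffAt ℝ 1 (fun p : E n × E n => gF g p.1) z :=
  ((contDiffOn_gF hg).contDiffAt (ball_mem_nhds hz)).comp z contDiffAt_fst

lemma contDiffAt_det_fst (hg : IsC11Metric g) {z : E n × E n} (hz : z.1 ∈ inner n) :
    ContDiffAt ℝ 1 (fun p : E n × E n => (g p.1).det) z :=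
  ((contDiffOn_det_g hg).contDiffAt (ball_mem_nhds hz)).comp z contDiffAt_fst

lemma contDiff_fderiv_one (hU : ContDiff ℝ 2 U) : ContDiff ℝ 1 (fderiv ℝ U) :=
  hU.fderiv_right (by norm_num)

lemma contDiff_vD (hU : ContDiff ℝ 2 U) : ContDiff ℝ 1 (vD U) :=
  (contDiff_fderiv_one hU).clm_comp contDiff_const

lemma contDiffAt_vGrad (hg : IsC11Metric g) (hU : ContDiff ℝ 2 U) {z : E n × E n}
    (hz : z.1 ∈ inner n) : ContDiffAt ℝ 1 (vGrad g U) z :=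
  (contDiffAt_sharp_fst hg hz).clm_apply (contDiff_vD hU).contDiffAt

lemma hasFDerivAt_gF_fst (hg : IsC11Metric g) {z : E n × E n} (hz : z.1 ∈ inner n) :
    HasFDerivAt (fun p : E n × E n => gF g p.1)
      ((fderivWithin ℝ (gF g) (ball n) z.1).comp (ContinuousLinearMap.fst ℝ (E n) (E n))) z :=
  (hasFDerivAt_gF hg hz).comp z hasFDerivAt_fst

/-- Product rule for the metric along the geodesic vector field. -/
lemma fderiv_gF_apply_spray (c : Conn g) (hg : IsC11Metric g) {z : E n × E n}
    (hz : z.1 ∈ inner n) {W T : E n × E n → E n} (hW : DifferentiableAt ℝ W z)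
    (hT : DifferentiableAt ℝ T z) :
    fderiv ℝ (fun p => gF g p.1 (W p) (T p)) z (spray c z) =
      gF g z.1 (covX c W z) (T z) + gF g z.1 (W z) (covX c T z) := by
  have h := ((hasFDerivAt_gF_fst hg hz).clm_apply hW.hasFDerivAt).clm_apply hT.hasFDerivAt
  rw [h.fderiv]
  have := c.compat hg (inner_subset_ball hz) z.2 (W z) (T z)
  simp [covX, spray] at this ⊢
  rw [this]; ring

/-- The commutator of the vertical gradient with the geodesic vector field. -/
lemma vD_XD (c : Conn g) (hg : IsC11Metric g) (hU : ContDiff ℝ 2 U) {z : E n × E n}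
    (hz : z.1 ∈ inner n) (hΓ : DifferentiableAt ℝ c.Γ z.1) (ζ : E n) :
    vD (XD c U) z ζ = fderiv ℝ U z (horL c z ζ) + gF g z.1 (covX c (vGrad g U) z) ζ := by
  have hD : HasFDerivAt (fderiv ℝ U) (fderiv ℝ (fderiv ℝ U) z) z :=
    ((contDiff_fderiv_one hU).differentiable one_ne_zero z).hasFDerivAt
  obtain ⟨dA, hA, hA'⟩ := hasFDerivAt_spray c hΓ
  have hsymm : IsSymmSndFDerivAt ℝ U z :=
    hU.contDiffAt.isSymmSndFDerivAt (by simp)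
  have hW := ((contDiffAt_vGrad hg hU hz).differentiableAt one_ne_zero)
  have h1 := fderiv_gF_apply_spray c hg hz hW (T := fun _ => ζ) (differentiableAt_const _)
  have h2 : (fun p => gF g p.1 (vGrad g U p) ζ) =ᶠ[𝓝 z] fun p => fderiv ℝ U p (0, ζ) := by
    have : ∀ᶠ p : E n × E n in 𝓝 z, p.1 ∈ inner n :=
      continuousAt_fst.eventually (isOpen_inner.mem_nhds hz)
    filter_upwards [this] with p hp
    exact gF_sharp hg (inner_subset_ball hp) _ _
  rw [h2.fderiv_eq, (hD.clm_apply (hasFDerivAt_const (0, ζ) z)).fderiv] at h1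
  have h3 : gF g z.1 (vGrad g U z) (c.Γ z.1 z.2 ζ) = fderiv ℝ U z (0, c.Γ z.1 z.2 ζ) :=
    gF_sharp hg (inner_subset_ball hz) _ _
  have h4 : covX c (fun _ => ζ) z = c.Γ z.1 z.2 ζ := by simp [covX]
  rw [h4, h3] at h1
  rw [vD_apply, show XD c U = fun p => fderiv ℝ U p (spray c p) from rfl, (hD.clm_apply hA).fderiv]
  simp only [_root_.add_apply, ContinuousLinearMap.comp_apply, ContinuousLinearMap.flip_apply,
    hA', map_zero, _root_.zero_apply, zero_add, horL_apply] at h1 ⊢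
  -- By symmetry of the second derivative, the mixed derivative of `U` is the derivative of the
  -- vertical covector along the spray; compatibility, in the form `h1`, turns it into the covariant
  -- derivative of the vertical gradient.
  rw [hsymm (0, ζ) (spray c z), h1]
  have h5 : ((ζ, -(c.Γ z.1 ζ z.2 + c.Γ z.1 z.2 ζ)) : E n × E n) =
      (ζ, -c.Γ z.1 ζ z.2) - (0, c.Γ z.1 z.2 ζ) := by
    ext1 <;> simp [sub_eq_add_neg, add_comm]
  rw [h5, map_sub]; ring

/-- The commutator of the horizontal gradient with the geodesic vector field. -/
lemma fderiv_hor_spray_sub (c : Conn g) (hg : IsC11Metric g) (hU : ContDiff ℝ 2 U)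
    {z : E n × E n} (hz : z.1 ∈ inner n) (hΓ : DifferentiableAt ℝ c.Γ z.1)
    {W : E n × E n → E n} (hW : DifferentiableAt ℝ W z) :
    fderiv ℝ (fun p => fderiv ℝ U p (horL c p (W p))) z (spray c z)
      - fderiv ℝ (XD c U) z (horL c z (W z)) =
    fderiv ℝ U z (horL c z (covX c W z)) + fderiv ℝ U z (0, Rop c z (W z)) := by
  have hD : HasFDerivAt (fderiv ℝ U) (fderiv ℝ (fderiv ℝ U) z) z :=
    ((contDiff_fderiv_one hU).differentiable one_ne_zero z).hasFDerivAt
  obtain ⟨dA, hA, hA'⟩ := hasFDerivAt_spray c hΓ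
  obtain ⟨dH, hH, hH'⟩ := hasFDerivAt_horL_apply c hΓ hW.hasFDerivAt
  have hsymm : IsSymmSndFDerivAt ℝ U z :=
    hU.contDiffAt.isSymmSndFDerivAt (by simp)
  rw [(hD.clm_apply hH).fderiv, show XD c U = fun p => fderiv ℝ U p (spray c p) from rfl,
    (hD.clm_apply hA).fderiv]
  simp only [_root_.add_apply, ContinuousLinearMap.comp_apply, ContinuousLinearMap.flip_apply]
  -- The second derivatives of `U` cancel by symmetry. What remains is `dU` applied to the bracket
  -- of the spray with the lift of `W`, whose two components are computed below; curvature appears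
  -- in the vertical one.
  rw [hsymm (spray c z) (horL c z (W z)), add_sub_add_right_eq_sub, ← map_sub, ← map_add]
  congr 1
  rw [hA', hH']
  have s := c.symm hg (inner_subset_ball hz)
  ext1
  · simp [horL_apply, covX, spray, s (W z) z.2]
  · simp only [horL_apply, covX, Rop, spray, map_add, map_neg, Prod.snd_sub, Prod.snd_add,
      _root_.neg_apply]
    rw [s (W z) z.2, s (c.Γ z.1 z.2 (W z)) z.2]
    abel

/-- The pointwise form of the Pestov identity. -/
lemma pestov_pointwise (c : Conn g) (hg : IsC11Metric g) (hU : ContDiff ℝ 2 U)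
    {z : E n × E n} (hz : z.1 ∈ inner n) (hΓ : DifferentiableAt ℝ c.Γ z.1) :
    vD (XD c U) z (sharp g z.1 (vD (XD c U) z))
      - gF g z.1 (covX c (vGrad g U) z) (covX c (vGrad g U) z)
      + gF g z.1 (Rop c z (vGrad g U z)) (vGrad g U z) =
    fderiv ℝ (fun p => fderiv ℝ U p (horL c p (vGrad g U p))) z (spray c z)
      + (fderiv ℝ (XD c U) z (0, sharp g z.1 ((fderiv ℝ U z).comp (horL c z)))
        - fderiv ℝ (XD c U) z (horL c z (vGrad g U z))) := by
  have hx := inner_subset_ball hz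
  have hW := ((contDiffAt_vGrad hg hU hz).differentiableAt one_ne_zero)
  have h1 := fderiv_hor_spray_sub c hg hU hz hΓ hW
  have h2 := vD_XD c hg hU hz hΓ
  set D := covX c (vGrad g U) z
  set b := (fderiv ℝ U z).comp (horL c z) with hb
  -- With the horizontal covector `b` and `D = XW`, the square expands as `|b|² + 2 b(D) + |D|²`,
  -- and `|D|²` is the term subtracted on the left. Of the two terms `b(D)` one comes from the spray
  -- derivative, the other from pairing `D♭` with `b♯`.
  have h2' : vD (XD c U) z = b + gF g z.1 D := by
    ext ζ; rw [h2]; rfl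
  have h3 : gF g z.1 (Rop c z (vGrad g U z)) (vGrad g U z) =
      fderiv ℝ U z (0, Rop c z (vGrad g U z)) := gF_sharp_right hg hx _ _
  have h4 : fderiv ℝ U z (horL c z D) = b D := rfl
  have h5 : fderiv ℝ (XD c U) z (0, sharp g z.1 b) = (b + gF g z.1 D) (sharp g z.1 b) := by
    rw [← h2']; rfl
  rw [h4] at h1
  rw [h5, h3, h2', map_add, sharp_gF hg hx]
  have h6 : gF g z.1 D (sharp g z.1 b) = b D := gF_sharp_right hg hx _ _
  simp only [map_add, _root_.add_apply, h6]
  linarith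

end pointwise
end RoughXRay
end

/-! ### Integration by parts on the tangent bundle with density `det g` -/

noncomputable section
namespace RoughXRay
variable {n : ℕ} {g : E n → Matrix (Fin n) (Fin n) ℝ}

/-- `φ` is Lipschitz with compact support in the interior of `TM`. -/
structure IsTestLip (φ : E n × E n → ℝ) : Prop where
  compact : HasCompactSupport φ
  subset : tsupport φ ⊆ inner n ×ˢ univ
  lip : ∀ z ∈ tsupport φ, LipAt φ z

namespace IsTestLip
variable {φ : E n × E n → ℝ}

lemma inner_of_mem (h : IsTestLip φ) {z : E n × E n} (hz : z ∈ tsupport φ) : z.1 ∈ inner n :=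
  (h.subset hz).1

lemma exists_lipschitz (h : IsTestLip φ) : ∃ K, LipschitzWith K φ :=
  exists_lipschitzWith_of_lipAt h.compact h.lip

lemma ae_differentiableAt (h : IsTestLip φ) : ∀ᵐ z, DifferentiableAt ℝ φ z := by
  obtain ⟨K, hK⟩ := h.exists_lipschitz
  exact hK.ae_differentiableAt

/-- The second factor needs regularity only near the support of `φ`, so metric coefficients, which
are controlled only over the ball, are admissible. -/
lemma mul_right (h : IsTestLip φ) {ψ : E n × E n → ℝ} (hψ : ∀ z ∈ tsupport φ, LipAt ψ z) :
    IsTestLip (fun z => φ z * ψ z) := by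
  have hs : tsupport (fun z => φ z * ψ z) ⊆ tsupport φ := tsupport_mul_subset_left
  exact ⟨h.compact.mul_right, hs.trans h.subset, fun z hz => (h.lip z (hs hz)).mul (hψ z (hs hz))⟩

end IsTestLip

lemma lipAt_coord {F : E n × E n → E n} {z : E n × E n} (h : LipAt F z) (l : Fin n) :
    LipAt (fun p => F p l) z :=
  h.contDiffAt_comp (Φ := fun u : E n => u l)
    (EuclideanSpace.proj l : E n →L[ℝ] ℝ).contDiff.contDiffAt

lemma hasFDerivAt_coord {F : E n × E n → E n} {F' : E n × E n →L[ℝ] E n} {z : E n × E n}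
    (h : HasFDerivAt F F' z) (l : Fin n) :
    HasFDerivAt (fun p => F p l) ((EuclideanSpace.proj l).comp F') z :=
  (EuclideanSpace.proj l : E n →L[ℝ] ℝ).hasFDerivAt.comp z h

lemma fderiv_of_notMem_tsupport {X F : Type*} [NormedAddCommGroup X] [NormedSpace ℝ X]
    [NormedAddCommGroup F] [NormedSpace ℝ F] {φ : X → F} {z : X} (hz : z ∉ tsupport φ) :
    fderiv ℝ φ z = 0 :=
  image_eq_zero_of_notMem_tsupport fun h' => hz (tsupport_fderiv_subset ℝ h')

lemma hasFDerivAt_det_fst (c : Conn g) (hg : IsC11Metric g) {z : E n × E n} (hz : z.1 ∈ inner n) :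
    ∃ G' : E n × E n →L[ℝ] ℝ, HasFDerivAt (fun p : E n × E n => (g p.1).det) G' z ∧
      ∀ w, G' w = 2 * (g z.1).det * ∑ l, c.Γ z.1 w.1 (bv l) l := by
  have h1 : HasFDerivAt (fun y => (g y).det) (fderivWithin ℝ (fun y => (g y).det) (ball n) z.1)
      z.1 := (((contDiffOn_det_g hg).differentiableOn one_ne_zero _
        (inner_subset_ball hz)).hasFDerivWithinAt).hasFDerivAt (ball_mem_nhds hz)
  refine ⟨_, h1.comp z hasFDerivAt_fst, fun w => ?_⟩
  rw [← c.fderivWithin_det hg (inner_subset_ball hz)]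
  rfl

/-- Integration by parts for the vector fields `F(x) · ∂_v`. -/
lemma integral_vert (hg : IsC11Metric g) {φ : E n × E n → ℝ} (hφ : IsTestLip φ)
    {F : E n × E n → E n}
    (hF : ∀ z ∈ tsupport φ, ContDiffAt ℝ 1 F z) (hF0 : ∀ z ∈ tsupport φ, ∀ ζ, fderiv ℝ F z (0, ζ) = 0) :
    Integrable (fun z => (g z.1).det * fderiv ℝ φ z (0, F z)) ∧
      ∫ z, (g z.1).det * fderiv ℝ φ z (0, F z) = 0 := by
  have hG : ∀ z ∈ tsupport φ, LipAt (fun p : E n × E n => (g p.1).det) z := fun z hz =>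
    lipAt_of_contDiffAt (contDiffAt_det_fst hg (hφ.inner_of_mem hz))
  have ht : ∀ l, IsTestLip (fun z => φ z * ((g z.1).det * F z l)) := fun l =>
    hφ.mul_right fun z hz => (hG z hz).mul (lipAt_coord (lipAt_of_contDiffAt (hF z hz)) l)
  refine integral_eq_zero_of_ae_eq_sum_fderiv _ Finset.univ
    (fun l z => φ z * ((g z.1).det * F z l)) (fun l => (0, bv l))
    (fun l _ => (ht l).exists_lipschitz) (fun l _ => (ht l).compact) ?_
  filter_upwards [hφ.ae_differentiableAt] with z hz
  by_cases hs : z ∈ tsupport φ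
  · have hG' : HasFDerivAt (fun p : E n × E n => (g p.1).det)
        (((fderiv ℝ (fun y => (g y).det) z.1)).comp (ContinuousLinearMap.fst ℝ (E n) (E n))) z :=
      (((contDiffOn_det_g hg).contDiffAt (ball_mem_nhds (hφ.inner_of_mem hs))).differentiableAt
        one_ne_zero).hasFDerivAt.comp z hasFDerivAt_fst
    have hF' := ((hF z hs).differentiableAt one_ne_zero).hasFDerivAt
    -- Neither `F` nor the density has a vertical derivative, so only `φ` is differentiated.
    have key : ∀ l, fderiv ℝ (fun z => φ z * ((g z.1).det * F z l)) z (0, bv l) =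
        (g z.1).det * (F z l * fderiv ℝ φ z (0, bv l)) := by
      intro l
      rw [(hz.hasFDerivAt.fun_mul (hG'.fun_mul (hasFDerivAt_coord hF' l))).fderiv]
      simp [hF0 z hs]
      ring
    simp only [key, ← Finset.mul_sum]
    congr 1
    rw [← vD_apply, clm_eq_sum_coord (vD φ z) (F z)]
    simp [vD_apply]
  · have h0 : ∀ l, fderiv ℝ (fun z => φ z * ((g z.1).det * F z l)) z = 0 := fun l =>
      fderiv_of_notMem_tsupport fun h => hs (tsupport_mul_subset_left h)
    simp [h0, fderiv_of_notMem_tsupport hs]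

/-- Integration by parts for horizontal derivatives. -/
lemma integral_hor (c : Conn g) (hg : IsC11Metric g) {φ : E n × E n → ℝ} (hφ : IsTestLip φ)
    (e : E n) :
    Integrable (fun z => (g z.1).det * (fderiv ℝ φ z (horL c z e)
        + φ z * ∑ l, c.Γ z.1 e (bv l) l)) ∧
      ∫ z, (g z.1).det * (fderiv ℝ φ z (horL c z e) + φ z * ∑ l, c.Γ z.1 e (bv l) l) = 0 := by
  have hG : ∀ z ∈ tsupport φ, LipAt (fun p : E n × E n => (g p.1).det) z := fun z hz =>
    lipAt_of_contDiffAt (contDiffAt_det_fst hg (hφ.inner_of_mem hz))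
  have hΓ : ∀ z : E n × E n, LipAt (fun p : E n × E n => c.Γ p.1 e p.2) z := fun z =>
    ((lipAt_gamma c z).clm_apply (lipAt_of_contDiffAt contDiffAt_const)).clm_apply
      (lipAt_of_contDiffAt contDiffAt_snd)
  have ht : ∀ l, IsTestLip (fun z => φ z * ((g z.1).det * (-c.Γ z.1 e z.2 l))) := fun l =>
    hφ.mul_right fun z hz => (hG z hz).mul (lipAt_coord (hΓ z) l).neg
  have ht0 : IsTestLip (fun z => φ z * (g z.1).det) := hφ.mul_right hG
  -- The component `none` is the derivative along `e` in the base, the others form the vertical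
  -- correction of the lift. The density contributes twice the trace of `Γ e`, and the divergence of
  -- the vertical part takes one of them back.
  refine integral_eq_zero_of_ae_eq_sum_fderiv _ Finset.univ
    (fun l => Option.elim l (fun z => φ z * (g z.1).det)
      (fun l z => φ z * ((g z.1).det * (-c.Γ z.1 e z.2 l))))
    (fun l => Option.elim l (e, 0) fun l => (0, bv l))
    (fun l _ => by cases l; exacts [ht0.exists_lipschitz, (ht _).exists_lipschitz])
    (fun l _ => by cases l; exacts [ht0.compact, (ht _).compact]) ?_
  filter_upwards [hφ.ae_differentiableAt, ae_differentiableAt_gamma c] with z hz hΓz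
  rw [Fintype.sum_option]
  simp only [Option.elim]
  by_cases hs : z ∈ tsupport φ
  · obtain ⟨G', hG', hGe⟩ := hasFDerivAt_det_fst c hg (hφ.inner_of_mem hs)
    have hΓ' := ((hasFDerivAt_gamma c hΓz).clm_apply (hasFDerivAt_const e z)).clm_apply
      (hasFDerivAt_snd (𝕜 := ℝ) (p := z))
    have key : ∀ l, fderiv ℝ (fun z => φ z * ((g z.1).det * (-c.Γ z.1 e z.2 l))) z (0, bv l) =
        (g z.1).det * ((-c.Γ z.1 e z.2 l) * fderiv ℝ φ z (0, bv l))
          - (g z.1).det * (φ z * c.Γ z.1 e (bv l) l) := by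
      intro l
      rw [(hz.hasFDerivAt.fun_mul (hG'.fun_mul (hasFDerivAt_coord hΓ' l).fun_neg)).fderiv]
      simp [hGe]
      ring
    rw [(hz.hasFDerivAt.fun_mul hG').fderiv]
    simp only [key, Finset.sum_sub_distrib, ← Finset.mul_sum]
    have h3 : fderiv ℝ φ z (horL c z e) = fderiv ℝ φ z (e, 0) +
        ∑ l, -(c.Γ z.1 e z.2 l) * fderiv ℝ φ z (0, bv l) := by
      have h4 : horL c z e = (e, 0) + vinc n (-c.Γ z.1 e z.2) := by
        rw [horL_apply, vinc_apply]; simp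
      have h5 : fderiv ℝ φ z (vinc n (-c.Γ z.1 e z.2)) = vD φ z (-c.Γ z.1 e z.2) := rfl
      rw [h4, map_add, h5, clm_eq_sum_coord (vD φ z) (-c.Γ z.1 e z.2)]
      simp [vD_apply]
    rw [h3]
    simp only [_root_.add_apply, _root_.smul_apply, smul_eq_mul, hGe]
    ring
  · have h0 : ∀ l, fderiv ℝ (fun z => φ z * ((g z.1).det * (-c.Γ z.1 e z.2 l))) z = 0 := fun l =>
      fderiv_of_notMem_tsupport fun h => hs (tsupport_mul_subset_left h)
    have h1 : fderiv ℝ (fun z => φ z * (g z.1).det) z = 0 :=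
      fderiv_of_notMem_tsupport fun h => hs (tsupport_mul_subset_left h)
    simp only [h0, h1, fderiv_of_notMem_tsupport hs, image_eq_zero_of_notMem_tsupport hs]
    simp

/-- Integration by parts for the Euler field in the fibres. -/
lemma integral_euler (hg : IsC11Metric g) {φ : E n × E n → ℝ} (hφ : IsTestLip φ) :
    Integrable (fun z => (g z.1).det * (fderiv ℝ φ z (0, z.2) + n * φ z)) ∧
      ∫ z, (g z.1).det * (fderiv ℝ φ z (0, z.2) + n * φ z) = 0 := by
  have hG : ∀ z ∈ tsupport φ, LipAt (fun p : E n × E n => (g p.1).det) z := fun z hz =>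
    lipAt_of_contDiffAt (contDiffAt_det_fst hg (hφ.inner_of_mem hz))
  have ht : ∀ l, IsTestLip (fun z => φ z * ((g z.1).det * z.2 l)) := fun l =>
    hφ.mul_right fun z hz => (hG z hz).mul (lipAt_coord (lipAt_of_contDiffAt contDiffAt_snd) l)
  refine integral_eq_zero_of_ae_eq_sum_fderiv _ Finset.univ
    (fun l z => φ z * ((g z.1).det * z.2 l)) (fun l => (0, bv l))
    (fun l _ => (ht l).exists_lipschitz) (fun l _ => (ht l).compact) ?_
  filter_upwards [hφ.ae_differentiableAt] with z hz
  by_cases hs : z ∈ tsupport φ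
  · have hG' : HasFDerivAt (fun p : E n × E n => (g p.1).det)
        (((fderiv ℝ (fun y => (g y).det) z.1)).comp (ContinuousLinearMap.fst ℝ (E n) (E n))) z :=
      (((contDiffOn_det_g hg).contDiffAt (ball_mem_nhds (hφ.inner_of_mem hs))).differentiableAt
        one_ne_zero).hasFDerivAt.comp z hasFDerivAt_fst
    have key : ∀ l, fderiv ℝ (fun z => φ z * ((g z.1).det * z.2 l)) z (0, bv l) =
        (g z.1).det * (z.2 l * fderiv ℝ φ z (0, bv l)) + (g z.1).det * φ z := by
      intro l
      rw [(hz.hasFDerivAt.fun_mul (hG'.fun_mul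
        (hasFDerivAt_coord (hasFDerivAt_snd (𝕜 := ℝ) (p := z)) l))).fderiv]
      simp
      ring
    simp only [key, Finset.sum_add_distrib, ← Finset.mul_sum]
    rw [← vD_apply, clm_eq_sum_coord (vD φ z) z.2]
    simp [vD_apply]
    ring
  · have h0 : ∀ l, fderiv ℝ (fun z => φ z * ((g z.1).det * z.2 l)) z = 0 := fun l =>
      fderiv_of_notMem_tsupport fun h => hs (tsupport_mul_subset_left h)
    simp [h0, fderiv_of_notMem_tsupport hs, image_eq_zero_of_notMem_tsupport hs]

/-- The geodesic vector field preserves the measure `det g dx dv`. -/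
lemma integral_spray (c : Conn g) (hg : IsC11Metric g) {φ : E n × E n → ℝ} (hφ : IsTestLip φ) :
    Integrable (fun z => (g z.1).det * fderiv ℝ φ z (spray c z)) ∧
      ∫ z, (g z.1).det * fderiv ℝ φ z (spray c z) = 0 := by
  have hv : ∀ j (z : E n × E n), LipAt (fun p : E n × E n => p.2 j) z := fun j z =>
    lipAt_coord (lipAt_of_contDiffAt contDiffAt_snd) j
  have h := fun j => integral_hor c hg (hφ.mul_right fun z _ => hv j z) (bv j)
  have he : ∀ᵐ z : E n × E n, (g z.1).det * fderiv ℝ φ z (spray c z) =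
      ∑ j, (g z.1).det * (fderiv ℝ (fun p => φ p * p.2 j) z (horL c z (bv j))
        + φ z * z.2 j * ∑ l, c.Γ z.1 (bv j) (bv l) l) := by
    filter_upwards [hφ.ae_differentiableAt] with z hz
    by_cases hs : z ∈ tsupport φ
    · rw [← Finset.mul_sum]
      congr 1
      have key : ∀ j, fderiv ℝ (fun p => φ p * p.2 j) z (horL c z (bv j)) =
          z.2 j * fderiv ℝ φ z (horL c z (bv j)) - φ z * c.Γ z.1 (bv j) z.2 j := by
        intro j
        rw [(hz.hasFDerivAt.fun_mul
          (hasFDerivAt_coord (hasFDerivAt_snd (𝕜 := ℝ) (p := z)) j)).fderiv]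
        simp [horL_apply]
        ring
      have h1 : fderiv ℝ φ z (spray c z) = ∑ j, z.2 j * fderiv ℝ φ z (horL c z (bv j)) := by
        rw [← horL_self]
        exact clm_eq_sum_coord ((fderiv ℝ φ z).comp (horL c z)) z.2
      -- By symmetry of the connection, the trace terms of the horizontal lifts cancel against the
      -- derivatives of the coefficients `v^j` along these lifts.
      have h2 : ∑ j, z.2 j * ∑ l, c.Γ z.1 (bv j) (bv l) l = ∑ j, c.Γ z.1 (bv j) z.2 j := by
        have : ∀ l, c.Γ z.1 (bv l) z.2 l = ∑ j, z.2 j * c.Γ z.1 (bv j) (bv l) l := by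
          intro l
          rw [c.symm hg (inner_subset_ball (hφ.inner_of_mem hs)),
            clm_eq_sum_coord (c.Γ z.1) z.2]
          simp
        simp only [this, Finset.mul_sum]
        exact Finset.sum_comm
      simp only [key, h1, Finset.sum_add_distrib, Finset.sum_sub_distrib, mul_assoc,
        ← Finset.mul_sum, h2]
      ring
    · have h0 : ∀ j, fderiv ℝ (fun p => φ p * p.2 j) z = 0 := fun j =>
        fderiv_of_notMem_tsupport fun h => hs (tsupport_mul_subset_left h)
      simp [h0, fderiv_of_notMem_tsupport hs, image_eq_zero_of_notMem_tsupport hs]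
  constructor
  · exact (integrable_finsetSum Finset.univ fun j _ => (h j).1).congr
      (he.mono fun z hz => hz.symm)
  · rw [integral_congr_ae he, integral_finsetSum _ fun j _ => (h j).1]
    exact Finset.sum_eq_zero fun j _ => (h j).2

end RoughXRay
end

/-! ### Divergence of Hamiltonian fields and symmetry of the curvature -/

noncomputable section
namespace RoughXRay
variable {n : ℕ} {g : E n → Matrix (Fin n) (Fin n) ℝ}

/-- The coordinate covector `dx^j`. -/
abbrev cproj (j : Fin n) : E n →L[ℝ] ℝ := EuclideanSpace.proj j

lemma sum_coord_smul_cproj (α : E n →L[ℝ] ℝ) : ∑ j, α (bv j) • (cproj j : E n →L[ℝ] ℝ) = α := by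
  ext u
  rw [clm_eq_sum_coord α u]
  simp [mul_comm]

lemma sharp_coord (hg : IsC11Metric g) {x : E n} (hx : x ∈ ball n) (α : E n →L[ℝ] ℝ) (j : Fin n) :
    sharp g x α j = α (sharp g x (cproj j)) := by
  have h1 : gF g x (sharp g x (cproj j)) (sharp g x α) = sharp g x α j := gF_sharp hg hx _ _
  rw [← h1, gF_sharp_right hg hx]

lemma hasFDerivAt_sharp_const (hg : IsC11Metric g) {x : E n} (hx : x ∈ inner n)
    (α : E n →L[ℝ] ℝ) :
    HasFDerivAt (fun y => sharp g y α) (fderiv ℝ (fun y => sharp g y α) x) x :=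
  ((((contDiffOn_sharp hg).contDiffAt (ball_mem_nhds hx)).clm_apply
    contDiffAt_const).differentiableAt one_ne_zero).hasFDerivAt

/-- The contracted derivative of the inverse metric. -/
lemma sum_fderiv_sharp (c : Conn g) (hg : IsC11Metric g) {x : E n} (hx : x ∈ inner n) :
    ∑ j, (c.Γ x (bv j) (sharp g x (cproj j))
      + (∑ l, c.Γ x (bv j) (bv l) l) • sharp g x (cproj j)
      + fderiv ℝ (fun y => sharp g y (cproj j)) x (bv j)) = 0 := by
  have hx' := inner_subset_ball hx
  refine gF_injective hg hx' fun ζ => ?_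
  -- The pairing of `(dx^j)♯` with the constant vector `ζ` is the constant `ζ j`. Differentiating it
  -- expresses the derivative of the inverse metric through the connection.
  have h1 : ∀ j ξ, gF g x (fderiv ℝ (fun y => sharp g y (cproj j)) x ξ) ζ =
      - gF g x (c.Γ x ξ (sharp g x (cproj j))) ζ - c.Γ x ξ ζ j := by
    intro j ξ
    have h2 := ((hasFDerivAt_gF hg hx).clm_apply (hasFDerivAt_sharp_const hg hx
      (cproj j))).clm_apply (hasFDerivAt_const ζ x)
    have h3 : (fun y => gF g y (sharp g y (cproj j)) ζ) =ᶠ[𝓝 x] fun _ => ζ j := by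
      filter_upwards [isOpen_inner.mem_nhds hx] with y hy
      exact gF_sharp hg (inner_subset_ball hy) _ _
    have h4 := h3.fderiv_eq (𝕜 := ℝ)
    rw [h2.fderiv, fderiv_const_apply] at h4
    have h5 := congrArg (fun L : E n →L[ℝ] ℝ => L ξ) h4
    have h6 : gF g x (sharp g x (cproj j)) (c.Γ x ξ ζ) = c.Γ x ξ ζ j := gF_sharp hg hx' _ _
    simp [c.compat hg hx', h6] at h5
    linarith
  simp only [map_sum, map_add, _root_.sum_apply, _root_.add_apply, h1, map_zero, _root_.zero_apply,
    map_smul, _root_.smul_apply, gF_sharp hg hx', smul_eq_mul]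
  have h7 : ∑ j, (∑ l, c.Γ x (bv j) (bv l) l) * (cproj j) ζ = ∑ l, c.Γ x (bv l) ζ l := by
    have : ∀ l, c.Γ x (bv l) ζ l = ∑ j, ζ j * c.Γ x (bv j) (bv l) l := by
      intro l
      rw [c.symm hg hx', clm_eq_sum_coord (c.Γ x) ζ]
      simp
    simp only [this, Finset.sum_mul]
    rw [Finset.sum_comm]
    exact Finset.sum_congr rfl fun l _ => Finset.sum_congr rfl fun j _ => by simp [mul_comm]
  simp only [Finset.sum_add_distrib, Finset.sum_sub_distrib, Finset.sum_neg_distrib, h7]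
  ring

/-- The Hamiltonian vector field of `U` preserves the measure `det g dx dv`. -/
lemma integral_hamilton (c : Conn g) (hg : IsC11Metric g) {U Y : E n × E n → ℝ}
    (hU : ContDiff ℝ 2 U) (hY : IsTestLip Y) :
    Integrable (fun z => (g z.1).det * (fderiv ℝ Y z (0, sharp g z.1 ((fderiv ℝ U z).comp
        (horL c z))) - fderiv ℝ Y z (horL c z (vGrad g U z)))) ∧
      ∫ z, (g z.1).det * (fderiv ℝ Y z (0, sharp g z.1 ((fderiv ℝ U z).comp
        (horL c z))) - fderiv ℝ Y z (horL c z (vGrad g U z))) = 0 := by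
  have hDU : ∀ z, LipAt (fderiv ℝ U) z := fun z =>
    lipAt_of_contDiffAt (contDiff_fderiv_one hU).contDiffAt
  have hEj : ∀ j, ∀ z ∈ tsupport Y,
      ContDiffAt ℝ 1 (fun p : E n × E n => sharp g p.1 (cproj j)) z := fun j z hz =>
    (contDiffAt_sharp_fst hg (hY.inner_of_mem hz)).clm_apply contDiffAt_const
  have h1 : ∀ j, IsTestLip fun z => Y z * fderiv ℝ U z (horL c z (bv j)) := fun j =>
    hY.mul_right fun z _ => (hDU z).clm_apply
      (lipAt_horL_apply c (lipAt_of_contDiffAt contDiffAt_const))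
  have h2 : ∀ j, IsTestLip fun z => Y z * fderiv ℝ U z (vinc n (sharp g z.1 (cproj j))) := fun j =>
    hY.mul_right fun z hz => (hDU z).clm_apply
      (lipAt_of_contDiffAt (contDiffAt_const.clm_apply (hEj j z hz)))
  have hEj' : ∀ j, ∀ z ∈ tsupport Y, HasFDerivAt (fun p : E n × E n => sharp g p.1 (cproj j))
      ((fderiv ℝ (fun y => sharp g y (cproj j)) z.1).comp
        (ContinuousLinearMap.fst ℝ (E n) (E n))) z := fun j z hz =>
    (hasFDerivAt_sharp_const hg (hY.inner_of_mem hz) _).comp z hasFDerivAt_fst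
  have hA := fun j => integral_vert hg (h1 j) (F := fun z => sharp g z.1 (cproj j))
    (fun z hz => hEj j z (tsupport_mul_subset_left hz))
    (fun z hz ζ => by rw [(hEj' j z (tsupport_mul_subset_left hz)).fderiv]; simp)
  have hB := fun j => integral_hor c hg (h2 j) (bv j)
  -- The Hamiltonian field is written as vertical minus horizontal divergences. The second
  -- derivatives of `U` cancel by symmetry, and the first-order remainder vanishes by
  -- `sum_fderiv_sharp`.
  have he : ∀ᵐ z : E n × E n, (g z.1).det * (fderiv ℝ Y z (0, sharp g z.1 ((fderiv ℝ U z).comp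
        (horL c z))) - fderiv ℝ Y z (horL c z (vGrad g U z))) =
      ∑ j, ((g z.1).det * fderiv ℝ (fun z => Y z * fderiv ℝ U z (horL c z (bv j))) z
          (0, sharp g z.1 (cproj j))
        - (g z.1).det * (fderiv ℝ (fun z => Y z * fderiv ℝ U z (vinc n (sharp g z.1 (cproj j)))) z
          (horL c z (bv j)) + Y z * fderiv ℝ U z (vinc n (sharp g z.1 (cproj j))) *
            ∑ l, c.Γ z.1 (bv j) (bv l) l)) := by
    filter_upwards [hY.ae_differentiableAt, ae_differentiableAt_gamma c] with z hz hΓ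
    by_cases hs : z ∈ tsupport Y
    · have hx := inner_subset_ball (hY.inner_of_mem hs)
      have hD : HasFDerivAt (fderiv ℝ U) (fderiv ℝ (fderiv ℝ U) z) z :=
        ((contDiff_fderiv_one hU).differentiable one_ne_zero z).hasFDerivAt
      have hsymm : IsSymmSndFDerivAt ℝ U z :=
        hU.contDiffAt.isSymmSndFDerivAt (by simp)
      have k1 : ∀ j, fderiv ℝ (fun z => Y z * fderiv ℝ U z (horL c z (bv j))) z
          (0, sharp g z.1 (cproj j)) =
          fderiv ℝ U z (horL c z (bv j)) * fderiv ℝ Y z (0, sharp g z.1 (cproj j))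
          + Y z * (fderiv ℝ (fderiv ℝ U) z (0, sharp g z.1 (cproj j)) (horL c z (bv j))
            - vD U z (c.Γ z.1 (bv j) (sharp g z.1 (cproj j)))) := by
        intro j
        obtain ⟨dH, hH, hH'⟩ := hasFDerivAt_horL_apply c hΓ (hasFDerivAt_const (bv j) z)
        rw [(hz.hasFDerivAt.fun_mul (hD.clm_apply hH)).fderiv]
        have : fderiv ℝ U z (0, -c.Γ z.1 (bv j) (sharp g z.1 (cproj j))) =
            -fderiv ℝ U z (0, c.Γ z.1 (bv j) (sharp g z.1 (cproj j))) := by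
          have h : ((0, -c.Γ z.1 (bv j) (sharp g z.1 (cproj j))) : E n × E n) =
              -(0, c.Γ z.1 (bv j) (sharp g z.1 (cproj j))) := by rw [Prod.neg_mk, neg_zero]
          rw [h, map_neg]
        simp [hH', this, vD_apply]
        ring
      have k2 : ∀ j, fderiv ℝ (fun z => Y z * fderiv ℝ U z (vinc n (sharp g z.1 (cproj j)))) z
          (horL c z (bv j)) =
          vD U z (sharp g z.1 (cproj j)) * fderiv ℝ Y z (horL c z (bv j))
          + Y z * (fderiv ℝ (fderiv ℝ U) z (0, sharp g z.1 (cproj j)) (horL c z (bv j))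
            + vD U z (fderiv ℝ (fun y => sharp g y (cproj j)) z.1 (bv j))) := by
        intro j
        have hv := (vinc n).hasFDerivAt.comp z (hEj' j z hs)
        have h3 := (hz.hasFDerivAt.fun_mul (hD.clm_apply hv)).fderiv
        rw [hsymm (0, sharp g z.1 (cproj j))]
        simp only [Function.comp_def] at h3
        rw [h3]
        simp [vD, horL_apply]
        ring
      have e1 : fderiv ℝ Y z (0, sharp g z.1 ((fderiv ℝ U z).comp (horL c z))) =
          ∑ j, fderiv ℝ U z (horL c z (bv j)) * fderiv ℝ Y z (0, sharp g z.1 (cproj j)) := by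
        rw [← sum_coord_smul_cproj ((fderiv ℝ U z).comp (horL c z)), ← vD_apply]
        simp [vD_apply]
      have e2 : fderiv ℝ Y z (horL c z (vGrad g U z)) =
          ∑ j, vD U z (sharp g z.1 (cproj j)) * fderiv ℝ Y z (horL c z (bv j)) := by
        rw [← ContinuousLinearMap.comp_apply, clm_eq_sum_coord]
        refine Finset.sum_congr rfl fun j _ => ?_
        rw [vGrad, sharp_coord hg hx]
        rfl
      have e3 := congrArg (fun w => vD U z w) (sum_fderiv_sharp c hg (hY.inner_of_mem hs))
      simp only [map_sum, map_add, map_smul, map_zero, smul_eq_mul] at e3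
      rw [e1, e2, ← Finset.sum_sub_distrib]
      simp only [k1, k2, ← mul_sub]
      rw [← Finset.mul_sum]
      congr 1
      rw [← sub_eq_zero, ← Finset.sum_sub_distrib, ← mul_zero (Y z), ← e3, Finset.mul_sum]
      refine Finset.sum_congr rfl fun j _ => ?_
      simp only [vD, ContinuousLinearMap.comp_apply]
      ring
    · have h0 : ∀ j, fderiv ℝ (fun z => Y z * fderiv ℝ U z (horL c z (bv j))) z = 0 := fun j =>
        fderiv_of_notMem_tsupport fun h => hs (tsupport_mul_subset_left h)
      have h0' : ∀ j, fderiv ℝ (fun z => Y z * fderiv ℝ U z (vinc n (sharp g z.1 (cproj j)))) z = 0 :=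
        fun j => fderiv_of_notMem_tsupport fun h => hs (tsupport_mul_subset_left h)
      simp only [h0, h0', fderiv_of_notMem_tsupport hs, image_eq_zero_of_notMem_tsupport hs]
      simp
  have hAB := fun j => (hA j).1.sub (hB j).1
  simp only [Pi.sub_def] at hAB
  constructor
  · exact (integrable_finsetSum Finset.univ fun j _ => hAB j).congr (he.mono fun z hz => hz.symm)
  · rw [integral_congr_ae he, integral_finsetSum _ fun j _ => hAB j]
    refine Finset.sum_eq_zero fun j _ => ?_
    rw [integral_sub (hA j).1 (hB j).1, (hA j).2, (hB j).2, sub_zero]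

/-! ### Symmetry of the curvature -/

/-- The curvature operator takes values orthogonal to the base vector. -/
lemma gF_Rop_self (c : Conn g) (hg : IsC11Metric g) {z : E n × E n} (hz : z.1 ∈ inner n)
    (hΓ : DifferentiableAt ℝ c.Γ z.1) (w : E n) : gF g z.1 (Rop c z w) z.2 = 0 := by
  obtain ⟨x, v⟩ := z
  simp only at hz hΓ
  have hx := inner_subset_ball hz
  -- The claim is the symmetry of the second derivative at `x` of `y ↦ |v|²` with `v` frozen. By
  -- compatibility the first derivative is `2 f'`, which is differentiable wherever `Γ` is, and this
  -- suffices although `g` is not `C²`.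
  let f' : E n → E n →L[ℝ] ℝ := fun y => ((gF g y).flip v).comp ((c.Γ y).flip v)
  have h1 : ∀ᶠ y in 𝓝 x, HasFDerivAt (fun y => gF g y v v) ((2 : ℝ) • f' y) y := by
    filter_upwards [isOpen_inner.mem_nhds hz] with y hy
    have := ((hasFDerivAt_gF hg hy).clm_apply (hasFDerivAt_const v y)).clm_apply
      (hasFDerivAt_const v y)
    refine this.congr_fderiv ?_
    ext ξ
    have s := gF_symm hg (inner_subset_ball hy) v (c.Γ y ξ v)
    simp [f', c.compat hg (inner_subset_ball hy), s]
    ring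
  have hG := (hasFDerivAt_gF hg hz).differentiableAt
  have h2 : DifferentiableAt ℝ f' x :=
    (((ContinuousLinearMap.flipₗᵢ ℝ (E n) (E n) ℝ).toContinuousLinearEquiv.differentiableAt.comp x
      hG).clm_apply (differentiableAt_const v)).clm_comp
    (((ContinuousLinearMap.flipₗᵢ ℝ (E n) (E n) (E n)).toContinuousLinearEquiv.differentiableAt.comp
      x hΓ).clm_apply (differentiableAt_const v))
  have h3 := second_derivative_symmetric_of_eventually_of_real h1
    (h2.hasFDerivAt.const_smul (2 : ℝ))
  have h4 : ∀ η ξ, fderiv ℝ f' x η ξ = gF g x (c.Γ x η (c.Γ x ξ v)) v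
      + gF g x (c.Γ x ξ v) (c.Γ x η v) + gF g x (fderiv ℝ c.Γ x η ξ v) v := by
    intro η ξ
    have e1 := (h2.hasFDerivAt.clm_apply (hasFDerivAt_const ξ x)).fderiv
    have e2 := (((hasFDerivAt_gF hg hz).clm_apply ((hΓ.hasFDerivAt.clm_apply
      (hasFDerivAt_const ξ x)).clm_apply (hasFDerivAt_const v x))).clm_apply
      (hasFDerivAt_const v x)).fderiv
    have e3 : (fun y => f' y ξ) = fun y => gF g y (c.Γ y ξ v) v := rfl
    rw [e3, e2] at e1
    have e4 := congrArg (fun L : E n →L[ℝ] ℝ => L η) e1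
    simp [c.compat hg hx] at e4
    rw [← e4]
    ring
  have h5 := h3 w v
  simp only [_root_.smul_apply, smul_eq_mul] at h5
  rw [h4, h4] at h5
  have s := gF_symm hg hx (c.Γ x w v) (c.Γ x v v)
  simp only [Rop, map_sub, map_add, _root_.sub_apply, _root_.add_apply]
  linarith

end RoughXRay
end

/-! ### The Pestov identity -/

noncomputable section
namespace RoughXRay
variable {n : ℕ} {g : E n → Matrix (Fin n) (Fin n) ℝ}

lemma slitI_mem_nhds {z : E n × E n} (hz : z ∈ slitI n) : slitI n ∈ 𝓝 z := isOpen_slitI.mem_nhds hz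

lemma isTestLip_of_subset {U φ : E n × E n → ℝ} (hc : HasCompactSupport U)
    (hs : tsupport U ⊆ slitI n) (hφ : tsupport φ ⊆ tsupport U)
    (hl : ∀ z ∈ tsupport U, LipAt φ z) : IsTestLip φ :=
  ⟨hc.of_isClosed_subset (isClosed_tsupport φ) hφ,
    fun _ hz => ⟨(hs (hφ hz)).1, trivial⟩, fun z hz => hl z (hφ hz)⟩

lemma tsupport_fderiv_apply_subset {U : E n × E n → ℝ} (w : E n × E n → E n × E n) :
    tsupport (fun z => fderiv ℝ U z (w z)) ⊆ tsupport U := by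
  refine (closure_mono fun z hz => ?_).trans (tsupport_fderiv_subset ℝ (f := U))
  intro h0
  exact hz (by simp only [h0, _root_.zero_apply])

lemma lipAt_fderiv_apply {U : E n × E n → ℝ} (hU : ContDiff ℝ 2 U) {w : E n × E n → E n × E n}
    {z : E n × E n} (hw : LipAt w z) : LipAt (fun z => fderiv ℝ U z (w z)) z :=
  (lipAt_of_contDiffAt (contDiff_fderiv_one hU).contDiffAt).clm_apply hw

/-- The square of the speed. -/
def speedSq (g : E n → Matrix (Fin n) (Fin n) ℝ) (z : E n × E n) : ℝ := gF g z.1 z.2 z.2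

lemma contDiffAt_speedSq (hg : IsC11Metric g) {z : E n × E n} (hz : z.1 ∈ inner n) :
    ContDiffAt ℝ 1 (speedSq g) z :=
  ((contDiffAt_gF_fst hg hz).clm_apply contDiffAt_snd).clm_apply contDiffAt_snd

lemma speedSq_pos (hg : IsC11Metric g) {z : E n × E n} (hz : z ∈ slitI n) : 0 < speedSq g z :=
  gF_pos hg (inner_subset_ball hz.1) hz.2

/-- The tautological field `v` is parallel along the spray: the acceleration `-Γ(v,v)` cancels the
connection term. -/
lemma covX_snd (c : Conn g) (z : E n × E n) : covX c (fun p => p.2) z = 0 := by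
  have : fderiv ℝ (fun p : E n × E n => p.2) z = ContinuousLinearMap.snd ℝ (E n) (E n) :=
    (hasFDerivAt_snd (𝕜 := ℝ) (p := z)).fderiv
  simp [covX, this, spray]

/-- The speed is constant along the geodesic vector field. -/
lemma fderiv_speedSq_spray (c : Conn g) (hg : IsC11Metric g) {z : E n × E n}
    (hz : z.1 ∈ inner n) : fderiv ℝ (speedSq g) z (spray c z) = 0 := by
  have h := fderiv_gF_apply_spray c hg hz (W := fun p => p.2) (T := fun p => p.2)
    differentiableAt_snd differentiableAt_snd
  rw [covX_snd] at h
  exact h.trans (by simp)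

/-- The tangential part of the vertical gradient of `U`. -/
def tanGrad (g : E n → Matrix (Fin n) (Fin n) ℝ) (U : E n × E n → ℝ) (z : E n × E n) : E n :=
  tanPart g z (vD U z)

lemma contDiffAt_tanGrad (hg : IsC11Metric g) {U : E n × E n → ℝ} (hU : ContDiff ℝ 2 U)
    {z : E n × E n} (hz : z ∈ slitI n) : ContDiffAt ℝ 1 (tanGrad g U) z := by
  have h1 := contDiffAt_vGrad hg hU hz.1
  refine h1.sub (ContDiffAt.fun_smul ?_ contDiffAt_snd)
  exact ((contDiff_vD hU).contDiffAt.clm_apply contDiffAt_snd).div (contDiffAt_speedSq hg hz.1)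
    (speedSq_pos hg hz).ne'

/-- Since `v` is parallel and `|v|²` is constant along the spray, the orthogonal projection off `v`
commutes with covariant differentiation. -/
lemma covX_tanGrad (c : Conn g) (hg : IsC11Metric g) {U : E n × E n → ℝ} (hU : ContDiff ℝ 2 U)
    {z : E n × E n} (hz : z ∈ slitI n) :
    covX c (tanGrad g U) z = covX c (vGrad g U) z
      - (gF g z.1 (covX c (vGrad g U) z) z.2 / speedSq g z) • z.2 := by
  have hW := (contDiffAt_vGrad hg hU hz.1).differentiableAt one_ne_zero
  have hq := (contDiffAt_speedSq hg hz.1).differentiableAt one_ne_zero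
  have hq0 := (speedSq_pos hg hz).ne'
  set f : E n × E n → ℝ := fun p => vD U p p.2 / speedSq g p with hf
  have hfd : DifferentiableAt ℝ f z :=
    (((contDiff_vD hU).contDiffAt.clm_apply contDiffAt_snd).div (contDiffAt_speedSq hg hz.1)
      hq0).differentiableAt one_ne_zero
  have h1 := fderiv_gF_apply_spray c hg hz.1 (W := vGrad g U) (T := fun p => p.2) hW
    differentiableAt_snd
  rw [covX_snd, map_zero, add_zero] at h1
  have h2 : (fun p => gF g p.1 (vGrad g U p) p.2) =ᶠ[𝓝 z] fun p => f p * speedSq g p := by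
    filter_upwards [slitI_mem_nhds hz] with p hp
    have : vD U p p.2 / speedSq g p * speedSq g p = vD U p p.2 :=
      div_mul_cancel₀ _ (speedSq_pos hg hp).ne'
    rw [hf, this]
    exact gF_sharp hg (inner_subset_ball hp.1) _ _
  rw [h2.fderiv_eq, (hfd.hasFDerivAt.fun_mul hq.hasFDerivAt).fderiv] at h1
  simp only [_root_.add_apply, _root_.smul_apply, smul_eq_mul, fderiv_speedSq_spray c hg hz.1,
    mul_zero, zero_add] at h1
  have h3 : fderiv ℝ f z (spray c z) = gF g z.1 (covX c (vGrad g U) z) z.2 / speedSq g z := by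
    rw [← h1]; field_simp
  have h4 : HasFDerivAt (tanGrad g U) _ z :=
    hW.hasFDerivAt.fun_sub (hfd.hasFDerivAt.fun_smul (hasFDerivAt_snd (𝕜 := ℝ) (p := z)))
  have h5 : tanGrad g U z = vGrad g U z - f z • z.2 := rfl
  rw [← h3]
  simp only [covX, h4.fderiv, h5]
  simp [spray]
  abel

lemma Rop_sub_smul (c : Conn g) (z : E n × E n) (w : E n) (t : ℝ) :
    Rop c z (w - t • z.2) = Rop c z w := by
  simp [Rop, map_sub]
  abel

/-- The integrand in the Pestov identity. -/
def pestovIntegrand (c : Conn g) (U : E n × E n → ℝ) (z : E n × E n) : ℝ :=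
  coN g z (vD (XD c U) z) - (n - 1) * XD c U z ^ 2 / speedSq g z
    - (gF g z.1 (covX c (tanGrad g U) z) (covX c (tanGrad g U) z)
      - gF g z.1 (Rop c z (tanGrad g U z)) (tanGrad g U z))

/-- Passage from full to tangential gradients. With `m = ⟨XW, v⟩`, where `W` is the full vertical
gradient, the radial component of the vertical derivative of `XU` is `XU + m` by the first
commutator, so removing radial parts costs `((XU + m)² - m²)/|v|²`. The curvature term is
unaffected, since `R(v,v)v = 0` and `R(·,v)v` is orthogonal to `v`. The remaining quotient is, up to
sign, the fibrewise divergence of `(XU)²/|v|²` times the Euler field. -/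
lemma pestovIntegrand_eq (c : Conn g) (hg : IsC11Metric g) {U : E n × E n → ℝ}
    (hU : ContDiff ℝ 2 U) {z : E n × E n} (hz : z ∈ slitI n) (hΓ : DifferentiableAt ℝ c.Γ z.1) :
    pestovIntegrand c U z =
      fderiv ℝ (fun p => fderiv ℝ U p (horL c p (vGrad g U p))) z (spray c z)
      + (fderiv ℝ (XD c U) z (0, sharp g z.1 ((fderiv ℝ U z).comp (horL c z)))
        - fderiv ℝ (XD c U) z (horL c z (vGrad g U z)))
      - (2 * XD c U z * vD (XD c U) z z.2 + (n - 2) * XD c U z ^ 2) / speedSq g z := by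
  have hx := inner_subset_ball hz.1
  have hq0 := (speedSq_pos hg hz).ne'
  have h1 := pestov_pointwise c hg hU hz.1 hΓ
  have h2 := vD_XD c hg hU hz.1 hΓ z.2
  rw [horL_self] at h2
  have h3 : gF g z.1 (Rop c z (tanGrad g U z)) (tanGrad g U z) =
      gF g z.1 (Rop c z (vGrad g U z)) (vGrad g U z) := by
    have : tanGrad g U z = vGrad g U z - (vD U z z.2 / gF g z.1 z.2 z.2) • z.2 := rfl
    rw [this, Rop_sub_smul, map_sub, map_smul, gF_Rop_self c hg hz.1 hΓ]
    simp
  rw [← h1, pestovIntegrand, h3, covX_tanGrad c hg hU hz, coN]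
  set D := covX c (vGrad g U) z
  set m := gF g z.1 D z.2 with hm
  have h4 : gF g z.1 z.2 D = m := gF_symm hg hx _ _
  have h5 : gF g z.1 z.2 z.2 = speedSq g z := rfl
  have h6 : vD (XD c U) z z.2 = XD c U z + m := h2
  simp only [map_sub, map_smul, _root_.sub_apply, _root_.smul_apply, smul_eq_mul, ← hm, h4, h5, h6]
  field_simp
  ring

lemma isTestLip_XD (c : Conn g) {U : E n × E n → ℝ} (hU : ContDiff ℝ 2 U)
    (hc : HasCompactSupport U) (hs : tsupport U ⊆ slitI n) : IsTestLip (XD c U) :=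
  isTestLip_of_subset hc hs (tsupport_fderiv_apply_subset _) fun z _ =>
    lipAt_fderiv_apply hU (lipAt_spray c z)

lemma tanGrad_of_notMem (g : E n → Matrix (Fin n) (Fin n) ℝ) {U : E n × E n → ℝ} {z : E n × E n}
    (hz : z ∉ tsupport U) : tanGrad g U z = 0 := by
  have h : vD U z = 0 := by
    rw [vD, fderiv_of_notMem_tsupport hz, ContinuousLinearMap.zero_comp]
  simp [tanGrad, tanPart, h]

lemma tsupport_tanGrad_subset (g : E n → Matrix (Fin n) (Fin n) ℝ) (U : E n × E n → ℝ) :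
    tsupport (tanGrad g U) ⊆ tsupport U :=
  closure_minimal (fun z hz => by
    by_contra h
    exact hz (tanGrad_of_notMem g h)) (isClosed_tsupport U)

lemma pestovIntegrand_of_notMem (c : Conn g) {U : E n × E n → ℝ} {z : E n × E n}
    (hz : z ∉ tsupport U) : pestovIntegrand c U z = 0 := by
  have h1 : XD c U z = 0 := by
    rw [XD, fderiv_of_notMem_tsupport hz, _root_.zero_apply]
  have h2 : vD (XD c U) z = 0 := by
    have h : fderiv ℝ (XD c U) z = 0 :=
      fderiv_of_notMem_tsupport fun h => hz (tsupport_fderiv_apply_subset _ h)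
    rw [vD, h, ContinuousLinearMap.zero_comp]
  have h3 : covX c (tanGrad g U) z = 0 := by
    rw [covX, fderiv_of_notMem_tsupport fun h => hz (tsupport_tanGrad_subset g U h),
      tanGrad_of_notMem g hz]
    simp
  simp [pestovIntegrand, h1, h2, h3, tanGrad_of_notMem g hz, coN]

/-- The Pestov identity. -/
theorem integral_pestov (c : Conn g) (hg : IsC11Metric g) {U : E n × E n → ℝ}
    (hU : ContDiff ℝ 2 U) (hc : HasCompactSupport U) (hs : tsupport U ⊆ slitI n) :
    Integrable (fun z => (g z.1).det * pestovIntegrand c U z) ∧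
      ∫ z, (g z.1).det * pestovIntegrand c U z = 0 := by
  have hY := isTestLip_XD c hU hc hs
  have hβ : IsTestLip fun p => fderiv ℝ U p (horL c p (vGrad g U p)) :=
    isTestLip_of_subset hc hs (tsupport_fderiv_apply_subset _) fun z hz =>
      lipAt_fderiv_apply hU (lipAt_horL_apply c
        (lipAt_of_contDiffAt (contDiffAt_vGrad hg hU (hs hz).1)))
  have hsY : tsupport (XD c U) ⊆ slitI n := (tsupport_fderiv_apply_subset _).trans hs
  have hqinv : ∀ z ∈ slitI n, ContDiffAt ℝ 1 (fun p => (speedSq g p)⁻¹) z := fun z hz =>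
    (contDiffAt_speedSq hg hz.1).inv (speedSq_pos hg hz).ne'
  -- The Euler field has divergence `n` and `|v|⁻²` has degree `-2`; this produces the coefficient
  -- `n - 2` of `pestovIntegrand_eq`.
  have hE : IsTestLip fun z => XD c U z * (XD c U z * (speedSq g z)⁻¹) :=
    hY.mul_right fun z hz => (hY.lip z hz).mul (lipAt_of_contDiffAt (hqinv z (hsY hz)))
  have i1 := integral_spray c hg hβ
  have i2 := integral_hamilton c hg hU hY
  have i3 := integral_euler hg hE
  have he : ∀ᵐ z : E n × E n, (g z.1).det * pestovIntegrand c U z =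
      (g z.1).det * fderiv ℝ (fun p => fderiv ℝ U p (horL c p (vGrad g U p))) z (spray c z)
      + (g z.1).det * (fderiv ℝ (XD c U) z (0, sharp g z.1 ((fderiv ℝ U z).comp (horL c z)))
        - fderiv ℝ (XD c U) z (horL c z (vGrad g U z)))
      - (g z.1).det * (fderiv ℝ (fun z => XD c U z * (XD c U z * (speedSq g z)⁻¹)) z (0, z.2)
        + n * (XD c U z * (XD c U z * (speedSq g z)⁻¹))) := by
    filter_upwards [hY.ae_differentiableAt, ae_differentiableAt_gamma c] with z hz hΓ
    by_cases hzs : z ∈ tsupport U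
    · have hzs' := hs hzs
      have hq0 := (speedSq_pos hg hzs').ne'
      have hq := ((contDiffAt_speedSq hg hzs'.1).differentiableAt one_ne_zero).hasFDerivAt
      have hqv : fderiv ℝ (speedSq g) z (0, z.2) = 2 * speedSq g z := by
        have h := ((hasFDerivAt_gF_fst hg hzs'.1).clm_apply
          (hasFDerivAt_snd (𝕜 := ℝ) (p := z))).clm_apply (hasFDerivAt_snd (𝕜 := ℝ) (p := z))
        have h' : fderiv ℝ (speedSq g) z = _ := h.fderiv
        rw [h']
        simp [speedSq]
        ring
      have h1 := (hz.hasFDerivAt.fun_mul (hz.hasFDerivAt.fun_mul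
        ((hasDerivAt_inv hq0).comp_hasFDerivAt z hq))).fderiv
      simp only [Function.comp_def] at h1
      rw [pestovIntegrand_eq c hg hU hzs' hΓ, h1, ← mul_add, ← mul_sub]
      congr 2
      simp only [_root_.add_apply, _root_.smul_apply, smul_eq_mul, hqv, vD_apply]
      field_simp
      ring
    · have hn : z ∉ tsupport (XD c U) := fun h => hzs (tsupport_fderiv_apply_subset _ h)
      have h1 : fderiv ℝ (fun z => XD c U z * (XD c U z * (speedSq g z)⁻¹)) z = 0 :=
        fderiv_of_notMem_tsupport fun h => hn (tsupport_mul_subset_left h)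
      have h2 : fderiv ℝ (fun p => fderiv ℝ U p (horL c p (vGrad g U p))) z = 0 :=
        fderiv_of_notMem_tsupport fun h => hzs (tsupport_fderiv_apply_subset _ h)
      simp [pestovIntegrand_of_notMem c hzs, h1, h2, fderiv_of_notMem_tsupport hn,
        image_eq_zero_of_notMem_tsupport hn]
  have i12 := i1.1.add i2.1
  have i123 := i12.sub i3.1
  simp only [Pi.sub_def, Pi.add_def] at i12 i123
  refine ⟨i123.congr (he.mono fun z hz => hz.symm), ?_⟩
  rw [integral_congr_ae he, integral_sub i12 i3.1, integral_add i1.1 i2.1, i1.2, i2.2, i3.2]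
  simp

end RoughXRay
end

/-! ### The measure on the sphere bundle and polar coordinates -/

noncomputable section
namespace RoughXRay
variable {n : ℕ} {g : E n → Matrix (Fin n) (Fin n) ℝ}

theorem lintegral_mul_left_Ioi {a : ℝ} (ha : 0 < a) (f : ℝ → ENNReal) :
    ∫⁻ s in Ioi 0, f s = ENNReal.ofReal a * ∫⁻ t in Ioi 0, f (a * t) := by
  have h := lintegral_image_eq_lintegral_abs_deriv_mul (s := Ioi (0:ℝ)) (f := fun t => a * t)
    (f' := fun _ => a) measurableSet_Ioi
    (fun x _ => by simpa using ((hasDerivAt_id x).const_mul a).hasDerivWithinAt)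
    (fun x _ y _ h => mul_left_cancel₀ ha.ne' h) f
  have himg : (fun t => a * t) '' Ioi (0:ℝ) = Ioi 0 := by
    ext y
    simp only [mem_image, mem_Ioi]
    constructor
    · rintro ⟨t, ht, rfl⟩
      positivity
    · intro hy
      exact ⟨y / a, by positivity, by field_simp⟩
  rw [himg] at h
  rw [h, abs_of_pos ha, lintegral_const_mul']
  exact ENNReal.ofReal_ne_top

/-- Evaluates the radial integral that is left over in `lintegral_polar` after the order of
integration has been exchanged. -/
theorem lintegral_Ioi_inv_pow {r : ℝ} (hr : 0 < r) (hn : 1 ≤ n) :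
    ∫⁻ t in Ioi r, ENNReal.ofReal (n * r ^ n * (t ^ (n + 1))⁻¹) = 1 := by
  have hlt : -((n:ℝ) + 1) < -1 := by
    have : (1:ℝ) ≤ n := by exact_mod_cast hn
    linarith
  have hcongr : ∀ t ∈ Ioi r, (n:ℝ) * r ^ n * (t ^ (n + 1))⁻¹
      = n * r ^ n * t ^ (-((n:ℝ) + 1)) := by
    intro t ht
    have ht0 : 0 < t := hr.trans ht
    rw [Real.rpow_neg ht0.le]
    congr 2
    exact_mod_cast (Real.rpow_natCast t (n+1)).symm
  rw [setLIntegral_congr_fun measurableSet_Ioi (fun t ht => by rw [hcongr t ht])]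
  rw [← ofReal_integral_eq_lintegral_ofReal]
  · rw [integral_const_mul, integral_Ioi_rpow_of_lt hlt hr]
    have h1 : r ^ (-((n:ℝ) + 1) + 1) = (r ^ n)⁻¹ := by
      rw [show -((n:ℝ) + 1) + 1 = -(n:ℝ) by ring, Real.rpow_neg hr.le, Real.rpow_natCast]
    rw [h1, ENNReal.ofReal_eq_one]
    have : (n:ℝ) ≠ 0 := by positivity
    field_simp
    rw [show -((n:ℝ) + 1) + 1 = -n by ring]
    field_simp
  · exact (integrableOn_Ioi_rpow_of_lt hlt hr).const_mul _
  · filter_upwards [ae_restrict_mem measurableSet_Ioi] with t ht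
    have : 0 < t := hr.trans ht
    positivity

/-- Integration in polar coordinates with respect to a positively homogeneous gauge. -/
theorem lintegral_polar (hn : 1 ≤ n) {ρ : E n → ℝ} (hm : Measurable ρ)
    (hpos : ∀ v, v ≠ 0 → 0 < ρ v) (hom : ∀ t v, 0 < t → ρ (t • v) = t * ρ v)
    {h : E n → ENNReal} (hh : Measurable h) :
    ∫⁻ s in Ioi (0:ℝ), ENNReal.ofReal (s ^ (n - 1)) *
        ∫⁻ v in {v | v ≠ 0 ∧ ρ v < 1}, ENNReal.ofReal n * h (s • (ρ v)⁻¹ • v)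
      = ∫⁻ v in {0}ᶜ, h v := by
  have hS : MeasurableSet {v : E n | v ≠ 0 ∧ ρ v < 1} :=
    (measurableSet_singleton (0 : E n)).compl.inter (measurableSet_lt hm measurable_const)
  have hmul : Measurable fun p : ℝ × E n => p.1 • p.2 := by fun_prop
  calc _ = ∫⁻ s in Ioi (0:ℝ), ∫⁻ v in {v | v ≠ 0 ∧ ρ v < 1},
        ENNReal.ofReal (s ^ (n - 1)) * (ENNReal.ofReal n * h (s • (ρ v)⁻¹ • v)) := by
        refine lintegral_congr fun s => ?_
        simp only [lintegral_const_mul' _ _ ENNReal.ofReal_ne_top]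
    _ = ∫⁻ v in {v | v ≠ 0 ∧ ρ v < 1}, ∫⁻ s in Ioi (0:ℝ),
        ENNReal.ofReal (s ^ (n - 1)) * (ENNReal.ofReal n * h (s • (ρ v)⁻¹ • v)) := by
        refine lintegral_lintegral_swap (Measurable.aemeasurable ?_)
        fun_prop
    -- Substitution `s = ρ(v) t`, which turns the normalized argument into `t • v`.
    _ = ∫⁻ v in {v | v ≠ 0 ∧ ρ v < 1}, ∫⁻ t in Ioi (0:ℝ),
        ENNReal.ofReal (n * ρ v ^ n * t ^ (n - 1)) * h (t • v) := by
        refine setLIntegral_congr_fun hS fun v hv => ?_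
        have hρ := hpos v hv.1
        beta_reduce
        rw [lintegral_mul_left_Ioi hρ, ← lintegral_const_mul' _ _ ENNReal.ofReal_ne_top]
        refine setLIntegral_congr_fun measurableSet_Ioi fun t (ht : 0 < t) => ?_
        rw [smul_smul, show ρ v * t * (ρ v)⁻¹ = t by field_simp, ← mul_assoc, ← mul_assoc,
          ← ENNReal.ofReal_mul hρ.le, ← ENNReal.ofReal_mul (by positivity)]
        congr 2
        obtain ⟨m, rfl⟩ : ∃ m, n = m + 1 := ⟨n - 1, by omega⟩
        rw [Nat.add_sub_cancel, mul_pow, pow_succ]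
        ring
    _ = ∫⁻ t in Ioi (0:ℝ), ∫⁻ v in {v | v ≠ 0 ∧ ρ v < 1},
        ENNReal.ofReal (n * ρ v ^ n * t ^ (n - 1)) * h (t • v) := by
        refine lintegral_lintegral_swap (Measurable.aemeasurable ?_)
        fun_prop
    -- Dilation `y = t • v`: the factor `t^(n-1) ρ(v)^n` becomes `ρ(y)^n / t`, the Jacobian
    -- contributes `t⁻ⁿ`, and the condition `ρ v < 1` becomes `ρ y < t`.
    _ = ∫⁻ t in Ioi (0:ℝ), ∫⁻ y in {0}ᶜ,
        (Ioi (ρ y)).indicator (fun t => ENNReal.ofReal (n * ρ y ^ n * (t ^ (n + 1))⁻¹)) t * h y := by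
        refine setLIntegral_congr_fun measurableSet_Ioi fun t (ht : 0 < t) => ?_
        beta_reduce
        rw [← lintegral_indicator hS, ← lintegral_indicator (measurableSet_singleton _).compl]
        set F : E n → ENNReal := fun y => ({0}ᶜ : Set (E n)).indicator (fun y =>
          (Ioi (ρ y)).indicator (fun t => ENNReal.ofReal (n * ρ y ^ n * (t ^ (n + 1))⁻¹)) t * h y) y
          with hF
        have h1 : (fun v => {v : E n | v ≠ 0 ∧ ρ v < 1}.indicator
            (fun v => ENNReal.ofReal (n * ρ v ^ n * t ^ (n - 1)) * h (t • v)) v)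
            = fun v => ENNReal.ofReal (t ^ n) * F (t • v) := by
          funext v
          by_cases hv : v = 0
          · simp [hF, hv]
          have htv : t • v ≠ 0 := smul_ne_zero ht.ne' hv
          have hmem : t • v ∈ ({0}ᶜ : Set (E n)) := htv
          simp only [hF, indicator_of_mem hmem, hom t v ht]
          by_cases h1 : ρ v < 1
          · have h2 : t ∈ Ioi (t * ρ v) := by
              simp only [mem_Ioi]
              nlinarith
            have h3 : v ∈ {v : E n | v ≠ 0 ∧ ρ v < 1} := ⟨hv, h1⟩
            rw [indicator_of_mem h3, indicator_of_mem h2, ← mul_assoc,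
              ← ENNReal.ofReal_mul (by positivity)]
            congr 2
            obtain ⟨m, rfl⟩ : ∃ m, n = m + 1 := ⟨n - 1, by omega⟩
            rw [Nat.add_sub_cancel, mul_pow]
            field_simp
            ring
          · have h2 : t ∉ Ioi (t * ρ v) := by
              simp only [mem_Ioi, not_lt] at h1 ⊢
              nlinarith
            have h3 : v ∉ {v : E n | v ≠ 0 ∧ ρ v < 1} := fun h => h1 h.2
            rw [indicator_of_notMem h3, indicator_of_notMem h2]
            simp
        have hFm : Measurable F := by
          refine Measurable.indicator ?_ (measurableSet_singleton _).compl
          refine Measurable.mul ?_ hh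
          have : (fun y => (Ioi (ρ y)).indicator
              (fun t => ENNReal.ofReal (n * ρ y ^ n * (t ^ (n + 1))⁻¹)) t)
              = {y | ρ y < t}.indicator
                fun y => ENNReal.ofReal (n * ρ y ^ n * (t ^ (n + 1))⁻¹) := by
            funext y
            simp [indicator_apply]
          rw [this]
          exact Measurable.indicator (by fun_prop) (measurableSet_lt hm measurable_const)
        rw [h1, lintegral_const_mul' _ _ ENNReal.ofReal_ne_top,
          ← lintegral_map hFm (measurable_const_smul t), Measure.map_addHaar_smul _ ht.ne',
          lintegral_smul_measure]
        simp only [finrank_euclideanSpace, Fintype.card_fin]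
        rw [smul_eq_mul, ← mul_assoc, ← ENNReal.ofReal_mul (by positivity), abs_of_pos (by positivity),
          mul_inv_cancel₀ (by positivity), ENNReal.ofReal_one, one_mul]
    _ = ∫⁻ y in {0}ᶜ, ∫⁻ t in Ioi (0:ℝ),
        (Ioi (ρ y)).indicator (fun t => ENNReal.ofReal (n * ρ y ^ n * (t ^ (n + 1))⁻¹)) t * h y := by
        refine lintegral_lintegral_swap (Measurable.aemeasurable ?_)
        refine Measurable.mul ?_ (by fun_prop)
        have : (Function.uncurry fun (t : ℝ) (y : E n) => (Ioi (ρ y)).indicator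
              (fun t => ENNReal.ofReal (n * ρ y ^ n * (t ^ (n + 1))⁻¹)) t)
              = {p : ℝ × E n | ρ p.2 < p.1}.indicator
                fun p => ENNReal.ofReal (n * ρ p.2 ^ n * (p.1 ^ (n + 1))⁻¹) := by
            funext y
            simp [indicator_apply, Function.uncurry]
        change Measurable (Function.uncurry fun (t : ℝ) (y : E n) => (Ioi (ρ y)).indicator
              (fun t => ENNReal.ofReal (n * ρ y ^ n * (t ^ (n + 1))⁻¹)) t)
        rw [this]
        exact Measurable.indicator (by fun_prop) (measurableSet_lt (by fun_prop) measurable_fst)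
    _ = _ := by
        refine setLIntegral_congr_fun (measurableSet_singleton _).compl fun y hy => ?_
        have hρ := hpos y hy
        rw [lintegral_mul_const _ (Measurable.indicator (by fun_prop) measurableSet_Ioi),
          lintegral_indicator measurableSet_Ioi, Measure.restrict_restrict measurableSet_Ioi,
          inter_eq_left.2 (Ioi_subset_Ioi hρ.le), lintegral_Ioi_inv_pow hρ hn, one_mul]

/-- The norm `|v|_{g(x)}` for `x ∈ M`, extended by the Euclidean norm for `x ∉ M`. -/
def gaugeF (g : E n → Matrix (Fin n) (Fin n) ℝ) (p : E n × E n) : ℝ :=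
  open Classical in if p.1 ∈ ball n then Real.sqrt (ip g p.1 p.2 p.2) else ‖p.2‖

theorem gaugeF_of_mem {p : E n × E n} (h : p.1 ∈ ball n) :
    gaugeF g p = Real.sqrt (ip g p.1 p.2 p.2) := if_pos h

theorem measurableSet_ball : MeasurableSet (ball n) := isClosed_ball.measurableSet

theorem ip_smul (x u : E n) (t : ℝ) : ip g x (t • u) (t • u) = t ^ 2 * ip g x u u := by
  rw [← gF_apply, ← gF_apply]
  simp
  ring

theorem continuousOn_ip (hg : IsC11Metric g) :
    ContinuousOn (fun p : E n × E n => ip g p.1 p.2 p.2) (ball n ×ˢ univ) := by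
  have h : ContinuousOn (fun p : E n × E n => gF g p.1 p.2 p.2) (ball n ×ˢ univ) := by
    have := (continuousOn_gF hg).comp (f := fun p : E n × E n => p.1) continuousOn_fst
      (s := ball n ×ˢ univ) (fun p hp => hp.1)
    exact (this.clm_apply continuousOn_snd).clm_apply continuousOn_snd
  simpa only [gF_apply] using h

theorem measurable_gaugeF (hg : IsC11Metric g) : Measurable (gaugeF g) := by
  classical
  have hB : MeasurableSet {p : E n × E n | p.1 ∈ ball n} := measurable_fst measurableSet_ball
  have h := ContinuousOn.measurable_piecewise (f := fun p : E n × E n => Real.sqrt (ip g p.1 p.2 p.2))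
    (g := fun p => ‖p.2‖) (((continuousOn_ip hg).mono fun p hp => ⟨hp, trivial⟩).sqrt)
    (by fun_prop) hB
  convert h using 1
  funext p
  simp only [gaugeF, piecewise]
  rfl

theorem gaugeF_pos (hg : IsC11Metric g) {p : E n × E n} (hp : p.2 ≠ 0) : 0 < gaugeF g p := by
  rw [gaugeF]
  split_ifs with h
  · exact Real.sqrt_pos.2 (by rw [← gF_apply]; exact gF_pos hg h hp)
  · exact norm_pos_iff.2 hp

theorem gaugeF_smul (x v : E n) {t : ℝ} (ht : 0 < t) :
    gaugeF g (x, t • v) = t * gaugeF g (x, v) := by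
  rw [gaugeF, gaugeF]
  split_ifs with h
  · simp only [ip_smul]
    rw [Real.sqrt_mul (by positivity), Real.sqrt_sq ht.le]
  · simp [norm_smul, abs_of_pos ht]

/-- `det g` on `M`, extended by zero. -/
def detF (g : E n → Matrix (Fin n) (Fin n) ℝ) : E n → ℝ := (ball n).indicator fun x => (g x).det

theorem detF_of_mem {x : E n} (h : x ∈ ball n) : detF g x = (g x).det := indicator_of_mem h _

theorem measurable_detF (hg : IsC11Metric g) : Measurable (detF g) := by
  classical
  have h := ContinuousOn.measurable_piecewise (f := fun x => (g x).det) (g := fun _ => (0:ℝ))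
    (contDiffOn_det_g hg).continuousOn continuousOn_const (measurableSet_ball (n := n))
  convert h using 1
  funext p
  simp only [detF, piecewise, indicator_apply]

/-- Outside the ball `g` is arbitrary and need not be measurable. The density and the projection are
replaced by globally measurable ones that agree with them on the domain of integration. -/
theorem sigma_eq (hg : IsC11Metric g) : sigma g =
    (((volume : Measure (E n × E n)).restrict {p | p.1 ∈ ball n ∧ p.2 ≠ 0 ∧ gaugeF g p < 1}).withDensity
      fun p => ENNReal.ofReal (n * detF g p.1)).map fun p => (p.1, (gaugeF g p)⁻¹ • p.2) := by
  have hD : {p : E n × E n | p.1 ∈ ball n ∧ p.2 ≠ 0 ∧ ip g p.1 p.2 p.2 < 1}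
      = {p | p.1 ∈ ball n ∧ p.2 ≠ 0 ∧ gaugeF g p < 1} := by
    ext p
    simp only [mem_ofPred_eq]
    refine and_congr_right fun h1 => and_congr_right fun _ => ?_
    rw [gaugeF_of_mem h1, Real.sqrt_lt' one_pos, one_pow]
  have hDm : MeasurableSet {p : E n × E n | p.1 ∈ ball n ∧ p.2 ≠ 0 ∧ gaugeF g p < 1} :=
    (measurable_fst measurableSet_ball).inter
      ((measurable_snd (measurableSet_singleton _).compl).inter
        (measurableSet_lt (measurable_gaugeF hg) measurable_const))
  rw [sigma, hD]
  have hw : (fun p : E n × E n => ENNReal.ofReal (n * (g p.1).det))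
      =ᵐ[(volume : Measure (E n × E n)).restrict {p | p.1 ∈ ball n ∧ p.2 ≠ 0 ∧ gaugeF g p < 1}]
      fun p => ENNReal.ofReal (n * detF g p.1) := by
    filter_upwards [ae_restrict_mem hDm] with p hp
    rw [detF_of_mem hp.1]
  rw [withDensity_congr_ae hw]
  refine Measure.map_congr ?_
  refine (withDensity_absolutelyContinuous _ _).ae_le ?_
  filter_upwards [ae_restrict_mem hDm] with p hp
  simp only [radial, gaugeF_of_mem hp.1]

theorem lintegral_sigma (hg : IsC11Metric g) {h : E n × E n → ENNReal} (hh : Measurable h) :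
    ∫⁻ p, h p ∂sigma g = ∫⁻ x in ball n, ENNReal.ofReal (detF g x) *
      ∫⁻ v in {v | v ≠ 0 ∧ gaugeF g (x, v) < 1},
        ENNReal.ofReal n * h (x, (gaugeF g (x, v))⁻¹ • v) := by
  have hm := measurable_gaugeF hg
  have hd := measurable_detF hg
  have hDm : MeasurableSet {p : E n × E n | p.1 ∈ ball n ∧ p.2 ≠ 0 ∧ gaugeF g p < 1} :=
    (measurable_fst measurableSet_ball).inter
      ((measurable_snd (measurableSet_singleton _).compl).inter
        (measurableSet_lt hm measurable_const))
  have hr : Measurable fun p : E n × E n => (p.1, (gaugeF g p)⁻¹ • p.2) := by fun_prop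
  have hhr : Measurable fun p : E n × E n => h (p.1, (gaugeF g p)⁻¹ • p.2) := hh.comp hr
  rw [sigma_eq hg, lintegral_map hh hr, lintegral_withDensity_eq_lintegral_mul _ (by fun_prop) hhr,
    ← lintegral_indicator hDm, Measure.volume_eq_prod, lintegral_prod,
    ← lintegral_indicator measurableSet_ball]
  · refine lintegral_congr fun x => ?_
    by_cases hx : x ∈ ball n
    · rw [indicator_of_mem hx, ← lintegral_const_mul' _ _ ENNReal.ofReal_ne_top,
        ← lintegral_indicator]
      · refine lintegral_congr fun v => ?_
        by_cases hv : v ∈ {v : E n | v ≠ 0 ∧ gaugeF g (x, v) < 1}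
        · have hp : (x, v) ∈ {p : E n × E n | p.1 ∈ ball n ∧ p.2 ≠ 0 ∧ gaugeF g p < 1} := ⟨hx, hv⟩
          rw [indicator_of_mem hv, indicator_of_mem hp]
          simp only [Pi.mul_apply]
          rw [mul_comm (n:ℝ), ENNReal.ofReal_mul, mul_assoc]
          rw [detF_of_mem hx]
          exact (det_g_pos hg hx).le
        · have hp : (x, v) ∉ {p : E n × E n | p.1 ∈ ball n ∧ p.2 ≠ 0 ∧ gaugeF g p < 1} :=
            fun h => hv h.2
          rw [indicator_of_notMem hv, indicator_of_notMem hp]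
      · exact (measurableSet_singleton _).compl.inter
          (measurableSet_lt (hm.comp measurable_prodMk_left) measurable_const)
    · rw [indicator_of_notMem hx]
      have : ∀ v, ({p : E n × E n | p.1 ∈ ball n ∧ p.2 ≠ 0 ∧ gaugeF g p < 1}.indicator
          ((fun p => ENNReal.ofReal (n * detF g p.1)) * fun p : E n × E n =>
            h (p.1, (gaugeF g p)⁻¹ • p.2)) (x, v)) = 0 := fun v =>
        indicator_of_notMem (fun hp => hx hp.1) _
      simp only [this, lintegral_zero]
  · exact (Measurable.indicator (by fun_prop) hDm).aemeasurable

/-- Integration in polar coordinates on `TM ∖ 0`. -/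
theorem lintegral_slit (hg : IsC11Metric g) (hn : 1 ≤ n) {h : E n × E n → ENNReal}
    (hh : Measurable h) :
    ∫⁻ s in Ioi (0:ℝ), ENNReal.ofReal (s ^ (n - 1)) * ∫⁻ p, h (p.1, s • p.2) ∂sigma g
      = ∫⁻ p in slit n, ENNReal.ofReal (detF g p.1) * h p := by
  have hm := measurable_gaugeF hg
  have hd := measurable_detF hg
  have hA : ∀ s : ℝ, ∫⁻ p, h (p.1, s • p.2) ∂sigma g = ∫⁻ x in ball n, ENNReal.ofReal (detF g x) *
      ∫⁻ v in {v | v ≠ 0 ∧ gaugeF g (x, v) < 1},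
        ENNReal.ofReal n * h (x, s • (gaugeF g (x, v))⁻¹ • v) := fun s =>
    lintegral_sigma hg (h := fun p => h (p.1, s • p.2)) (by fun_prop)
  have hmeas : Measurable fun p : ℝ × E n => ∫⁻ v in {v | v ≠ 0 ∧ gaugeF g (p.2, v) < 1},
        ENNReal.ofReal n * h (p.2, p.1 • (gaugeF g (p.2, v))⁻¹ • v) := by
    have h1 : ∀ p : ℝ × E n, ∫⁻ v in {v | v ≠ 0 ∧ gaugeF g (p.2, v) < 1},
        ENNReal.ofReal n * h (p.2, p.1 • (gaugeF g (p.2, v))⁻¹ • v)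
        = ∫⁻ v, {q : (ℝ × E n) × E n | q.2 ≠ 0 ∧ gaugeF g (q.1.2, q.2) < 1}.indicator (fun q =>
          ENNReal.ofReal n * h (q.1.2, q.1.1 • (gaugeF g (q.1.2, q.2))⁻¹ • q.2)) (p, v) := by
      intro p
      rw [← lintegral_indicator]
      · rfl
      · exact (measurableSet_singleton _).compl.inter
          (measurableSet_lt (hm.comp measurable_prodMk_left) measurable_const)
    simp only [h1]
    have hf : Measurable fun q : (ℝ × E n) × E n =>
      ENNReal.ofReal n * h (q.1.2, q.1.1 • (gaugeF g (q.1.2, q.2))⁻¹ • q.2) := by fun_prop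
    refine Measurable.lintegral_prod_right' (hf.indicator ?_)
    exact (measurable_snd (measurableSet_singleton _).compl).inter
      (measurableSet_lt (hm.comp (measurable_fst.snd.prodMk measurable_snd)) measurable_const)
  have hmeas' : Measurable fun p : ℝ × E n => ENNReal.ofReal (p.1 ^ (n - 1)) *
      (ENNReal.ofReal (detF g p.2) * ∫⁻ v in {v | v ≠ 0 ∧ gaugeF g (p.2, v) < 1},
        ENNReal.ofReal n * h (p.2, p.1 • (gaugeF g (p.2, v))⁻¹ • v)) := by fun_prop
  have hB : ∀ s : ℝ, ENNReal.ofReal (s ^ (n - 1)) * ∫⁻ p, h (p.1, s • p.2) ∂sigma g =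
      ∫⁻ x in ball n, ENNReal.ofReal (s ^ (n - 1)) *
        (ENNReal.ofReal (detF g x) * ∫⁻ v in {v | v ≠ 0 ∧ gaugeF g (x, v) < 1},
          ENNReal.ofReal n * h (x, s • (gaugeF g (x, v))⁻¹ • v)) := fun s => by
    rw [hA, lintegral_const_mul' _ _ ENNReal.ofReal_ne_top]
  simp only [hB]
  rw [lintegral_lintegral_swap hmeas'.aemeasurable]
  have hS : MeasurableSet (slit n) := measurableSet_ball.prod (measurableSet_singleton _).compl
  rw [slit, Measure.volume_eq_prod, ← Measure.prod_restrict, lintegral_prod]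
  · refine setLIntegral_congr_fun measurableSet_ball fun x hx => ?_
    beta_reduce
    rw [show (∫⁻ y in {0}ᶜ, ENNReal.ofReal (detF g (x, y).1) * h (x, y))
        = ENNReal.ofReal (detF g x) * ∫⁻ y in {0}ᶜ, h (x, y) from
        lintegral_const_mul' (ENNReal.ofReal (detF g x)) _ ENNReal.ofReal_ne_top,
      ← lintegral_polar hn (ρ := fun v => gaugeF g (x, v)) (h := fun v => h (x, v))
      (hm.comp measurable_prodMk_left)
      (fun v hv => gaugeF_pos hg (p := (x, v)) hv) (fun t v ht => gaugeF_smul x v ht)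
      (hh.comp measurable_prodMk_left), ← lintegral_const_mul' _ _ ENNReal.ofReal_ne_top]
    refine lintegral_congr fun s => ?_
    rw [← mul_assoc, mul_comm (ENNReal.ofReal (s ^ (n - 1))), mul_assoc]
  · exact Measurable.aemeasurable (by fun_prop)

/-- The measure is a push-forward under fibrewise normalization, so it is enough to test normalized
vectors over almost every base point. -/
theorem ae_sigma_of_measurableSet (hg : IsC11Metric g) {S : Set (E n × E n)} (hS : MeasurableSet S)
    (h : ∀ᵐ x ∂(volume : Measure (E n)).restrict (ball n), ∀ v, v ≠ 0 →
      (x, (gaugeF g (x, v))⁻¹ • v) ∈ S) :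
    ∀ᵐ p ∂sigma g, p ∈ S := by
  rw [ae_iff]
  change sigma g Sᶜ = 0
  rw [← lintegral_indicator_one hS.compl, lintegral_sigma hg (measurable_one.indicator hS.compl)]
  rw [← lintegral_zero (μ := (volume : Measure (E n)).restrict (ball n))]
  refine lintegral_congr_ae ?_
  filter_upwards [h] with x hx
  have : ∫⁻ v in {v | v ≠ 0 ∧ gaugeF g (x, v) < 1}, ENNReal.ofReal n *
      Sᶜ.indicator (1 : E n × E n → ENNReal) (x, (gaugeF g (x, v))⁻¹ • v) = 0 := by
    have hm : MeasurableSet {v | v ≠ 0 ∧ gaugeF g (x, v) < 1} :=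
      (measurableSet_singleton _).compl.inter
          (measurableSet_lt ((measurable_gaugeF hg).comp measurable_prodMk_left) measurable_const)
    rw [← lintegral_zero (μ := (volume : Measure (E n)).restrict {v | v ≠ 0 ∧ gaugeF g (x, v) < 1})]
    refine setLIntegral_congr_fun hm fun v hv => ?_
    have hmem : (x, (gaugeF g (x, v))⁻¹ • v) ∉ Sᶜ := notMem_compl_iff.2 (hx v hv.1)
    beta_reduce
    rw [indicator_of_notMem hmem, mul_zero]
  rw [this, mul_zero]

theorem gauge_normalize_mem (hg : IsC11Metric g) {x v : E n} (hx : x ∈ ball n) (hv : v ≠ 0) :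
    (x, (gaugeF g (x, v))⁻¹ • v) ∈ SM g := by
  refine ⟨hx, ?_⟩
  rw [ip_smul, gaugeF_of_mem (p := (x, v)) hx, inv_pow, Real.sq_sqrt]
  · exact inv_mul_cancel₀ (by rw [← gF_apply]; exact (gF_pos hg hx hv).ne')
  · rw [← gF_apply]; exact (gF_pos hg hx hv).le

theorem isCompact_SM (hg : IsC11Metric g) : IsCompact (SM g) := by
  obtain ⟨a, ha, hell⟩ := exists_ellipticity hg
  have hcl : IsClosed (SM g) := by
    have h := (continuousOn_ip hg).preimage_isClosed_of_isClosed
      (isClosed_ball.prod isClosed_univ) (isClosed_singleton (x := (1:ℝ)))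
    convert h using 1
    ext p
    simp [SM]
  refine Metric.isCompact_of_isClosed_isBounded hcl ?_
  refine (Metric.isBounded_closedBall (x := (0 : E n × E n)) (r := max 1 (Real.sqrt a⁻¹))).subset ?_
  rintro ⟨x, v⟩ ⟨hx, hv⟩
  rw [mem_closedBall_zero_iff, Prod.norm_def]
  refine max_le_max (by simpa [ball] using hx) ?_
  refine Real.le_sqrt_of_sq_le ?_
  have h1 := hell x hx v
  rw [gF_apply] at h1
  simp only at hv
  rw [hv] at h1
  rw [← one_div, le_div_iff₀ ha]
  simpa [mul_comm] using h1

theorem ae_sigma_mem_SM (hg : IsC11Metric g) : ∀ᵐ p ∂sigma g, p ∈ SM g := by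
  refine ae_sigma_of_measurableSet hg (isCompact_SM hg).isClosed.measurableSet ?_
  filter_upwards [ae_restrict_mem measurableSet_ball] with x hx v hv
  exact gauge_normalize_mem hg hx hv

/-- Null sets of the base lift to null sets of the sphere bundle. This makes the differentiability
of the connection, and the avoidance of the boundary sphere, available almost everywhere on `SM`. -/
theorem ae_sigma_fst (hg : IsC11Metric g) {P : E n → Prop} (h : ∀ᵐ x ∂(volume : Measure (E n)), P x) :
    ∀ᵐ p ∂sigma g, P p.1 := by
  have hm := measurableSet_toMeasurable (volume : Measure (E n)) {x | ¬ P x}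
  have h1 := ae_sigma_of_measurableSet hg (S := Prod.fst ⁻¹' (toMeasurable volume {x | ¬ P x})ᶜ)
    (measurable_fst hm.compl) (by
      refine ae_restrict_of_ae ?_
      have : volume (toMeasurable volume {x | ¬ P x}) = 0 := by
        rw [measure_toMeasurable]
        exact h
      filter_upwards [measure_eq_zero_iff_ae_notMem.1 this] with x hx v _
      exact hx)
  filter_upwards [h1] with p hp
  by_contra hP
  exact hp (subset_toMeasurable _ _ hP)

theorem isFiniteMeasure_sigma (hg : IsC11Metric g) : IsFiniteMeasure (sigma g) := by
  obtain ⟨a, ha, hell⟩ := exists_ellipticity hg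
  obtain ⟨C, hC⟩ := isCompact_ball.exists_bound_of_continuousOn (contDiffOn_det_g hg).continuousOn
  refine ⟨?_⟩
  set B : Set (E n) := Metric.closedBall 0 (Real.sqrt a⁻¹)
  have h0 := lintegral_sigma hg (h := fun _ => 1) measurable_const
  rw [lintegral_one] at h0
  rw [h0]
  calc _ ≤ ∫⁻ x in ball n, ENNReal.ofReal C * (ENNReal.ofReal n * volume B) := by
        refine setLIntegral_mono measurable_const fun x hx => ?_
        gcongr
        · rw [detF_of_mem hx]
          exact (le_abs_self _).trans (hC x hx)
        · rw [setLIntegral_const, mul_one]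
          gcongr
          rintro v ⟨hv, hlt⟩
          rw [mem_closedBall_zero_iff]
          refine Real.le_sqrt_of_sq_le ?_
          have h1 := hell x hx v
          rw [gF_apply] at h1
          rw [gaugeF_of_mem (p := (x, v)) hx, Real.sqrt_lt' one_pos, one_pow] at hlt
          rw [← one_div, le_div_iff₀ ha]
          rw [mul_comm]
          exact h1.trans hlt.le
    _ < ⊤ := by
        rw [setLIntegral_const]
        refine ENNReal.mul_lt_top (ENNReal.mul_lt_top ENNReal.ofReal_lt_top
          (ENNReal.mul_lt_top ENNReal.ofReal_lt_top ?_)) isCompact_ball.measure_lt_top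
        exact measure_closedBall_lt_top

end RoughXRay
end

/-! ### Continuous functions and `C¹` sections over the sphere bundle -/

noncomputable section
namespace RoughXRay
variable {n : ℕ} {g : E n → Matrix (Fin n) (Fin n) ℝ}

theorem SM_subset_slit : SM g ⊆ slit n := by
  rintro p ⟨h1, h2⟩
  refine ⟨h1, fun h => ?_⟩
  have h0 : p.2 = 0 := h
  rw [h0, ← gF_apply] at h2
  simp at h2

theorem sigma_restrict_SM (hg : IsC11Metric g) : (sigma g).restrict (SM g) = sigma g :=
  Measure.restrict_eq_self_of_ae_mem (ae_sigma_mem_SM hg)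

theorem aestronglyMeasurable_sigma (hg : IsC11Metric g) {F : Type*} [TopologicalSpace F]
    [TopologicalSpace.PseudoMetrizableSpace F] [SecondCountableTopologyEither (E n × E n) F]
    {f : E n × E n → F} (hf : ContinuousOn f (SM g)) : AEStronglyMeasurable f (sigma g) := by
  rw [← sigma_restrict_SM hg]
  exact hf.aestronglyMeasurable (isCompact_SM hg).isClosed.measurableSet

theorem lintegral_sigma_lt_top (hg : IsC11Metric g) {f : E n × E n → ℝ}
    (hf : ContinuousOn f (SM g)) : ∫⁻ p, ENNReal.ofReal (f p) ∂sigma g < ⊤ := by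
  obtain ⟨C, hC⟩ := (isCompact_SM hg).exists_bound_of_continuousOn hf
  have := isFiniteMeasure_sigma hg
  calc _ ≤ ∫⁻ _, ENNReal.ofReal C ∂sigma g := by
        refine lintegral_mono_ae ?_
        filter_upwards [ae_sigma_mem_SM hg] with p hp
        exact ENNReal.ofReal_le_ofReal ((le_abs_self _).trans (hC p hp))
    _ < ⊤ := by
        rw [lintegral_const]
        exact ENNReal.mul_lt_top ENNReal.ofReal_lt_top (measure_lt_top _ _)

theorem memL2_of_continuousOn (hg : IsC11Metric g) {f : E n × E n → ℝ}
    (hf : ContinuousOn f (SM g)) : MemL2 g f :=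
  ⟨aestronglyMeasurable_sigma hg hf, lintegral_sigma_lt_top hg (hf.pow 2)⟩

theorem continuousOn_ip_apply (hg : IsC11Metric g) {W : E n × E n → E n}
    (hf : ContinuousOn W (SM g)) : ContinuousOn (fun p => ip g p.1 (W p) (W p)) (SM g) := by
  simp only [← gF_apply]
  exact (((continuousOn_gF hg).comp continuousOn_fst fun p hp => hp.1).clm_apply hf).clm_apply hf

theorem memL2Sec_of_continuousOn (hg : IsC11Metric g) {W : E n × E n → E n}
    (hf : ContinuousOn W (SM g)) (h : ∀ᵐ p ∂sigma g, ip g p.1 (W p) p.2 = 0) : MemL2Sec g W :=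
  ⟨aestronglyMeasurable_sigma hg hf, h, lintegral_sigma_lt_top hg (continuousOn_ip_apply hg hf)⟩

theorem uniqueDiffOn_slit : UniqueDiffOn ℝ (slit n) :=
  uniqueDiffOn_ball.prod isOpen_compl_singleton.uniqueDiffOn

theorem contDiffOn_radial (hg : IsC11Metric g) : ContDiffOn ℝ 1 (radial g) (slit n) := by
  have h1 : ContDiffOn ℝ 1 (fun p : E n × E n => gF g p.1 p.2 p.2) (slit n) :=
    (((contDiffOn_gF hg).comp contDiffOn_fst fun p hp => hp.1).clm_apply contDiffOn_snd).clm_apply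
      contDiffOn_snd
  have hne : ∀ p ∈ slit n, gF g p.1 p.2 p.2 ≠ 0 := fun p hp => (gF_pos hg hp.1 hp.2).ne'
  unfold radial
  simp only [← gF_apply]
  refine contDiffOn_fst.prodMk (ContDiffOn.fun_smul ?_ contDiffOn_snd)
  exact (h1.sqrt hne).inv fun p hp => (Real.sqrt_pos.2 (gF_pos hg hp.1 hp.2)).ne'

section dRad
variable {u : E n × E n → ℝ}

theorem continuousOn_dRad (hu : ContDiffOn ℝ 1 (u ∘ radial g) (slit n))
    {w : E n × E n → E n × E n} (hw : ContinuousOn w (SM g)) :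
    ContinuousOn (fun p => dRad g u p (w p)) (SM g) :=
  ((hu.continuousOn_fderivWithin uniqueDiffOn_slit le_rfl).mono SM_subset_slit).clm_apply hw

theorem continuousOn_christoffel (hg : IsC11Metric g) (l j k : Fin n) :
    ContinuousOn (fun p : E n × E n => christoffel g l j k p.1) (SM g) := by
  obtain ⟨c⟩ := exists_conn hg
  obtain ⟨K, hK⟩ := c.lip
  have h : ContinuousOn (fun p : E n × E n => (c.Γ p.1 (bv j) (bv k) : E n) l) (SM g) := by
    have := hK.continuous
    have h1 : Continuous fun p : E n × E n => c.Γ p.1 (bv j) (bv k) := by fun_prop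
    exact ((EuclideanSpace.proj (𝕜 := ℝ) l : E n →L[ℝ] ℝ).continuous.comp h1).continuousOn
  exact h.congr fun p hp => (c.coeff p.1 hp.1 j k l).symm

/-- Matches the coordinate direction that defines `δ_j` with the invariant horizontal lift. -/
theorem hor_eq (c : Conn g) {p : E n × E n} (hp : p.1 ∈ ball n) (j : Fin n) :
    ((EuclideanSpace.single j 1, WithLp.toLp 2 fun l => -∑ k, christoffel g l j k p.1 * p.2 k) :
      E n × E n) = horL c p (bv j) := by
  rw [horL_apply]
  refine Prod.ext rfl ?_
  ext l
  simp [c.apply_eq hp, bv]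

theorem continuousOn_hDer (hg : IsC11Metric g) (hu : ContDiffOn ℝ 1 (u ∘ radial g) (slit n))
    (j : Fin n) : ContinuousOn (hDer g j u) (SM g) := by
  obtain ⟨c⟩ := exists_conn hg
  have h : ContinuousOn (fun p => dRad g u p (horL c p (bv j))) (SM g) := by
    refine continuousOn_dRad hu (Continuous.continuousOn ?_)
    obtain ⟨K, hK⟩ := c.lip
    have := hK.continuous
    simp only [horL_apply]
    fun_prop
  exact h.congr fun p hp => by rw [hDer, hor_eq c hp.1]

theorem geoX_eq (c : Conn g) {p : E n × E n} (hp : p.1 ∈ ball n) :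
    geoX g u p = dRad g u p (spray c p) := by
  rw [← horL_self, dRad]
  have h := clm_eq_sum_coord ((fderivWithin ℝ (u ∘ radial g) (slit n) p).comp (horL c p)) p.2
  simp only [ContinuousLinearMap.comp_apply, smul_eq_mul] at h
  rw [h, geoX]
  refine Finset.sum_congr rfl fun j _ => ?_
  rw [hDer, hor_eq c hp, dRad]

theorem continuousOn_coord {f : E n × E n → E n} {s : Set (E n × E n)} (hf : ContinuousOn f s)
    (j : Fin n) : ContinuousOn (fun p => f p j) s :=
  (EuclideanSpace.proj (𝕜 := ℝ) j : E n →L[ℝ] ℝ).continuous.comp_continuousOn hf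

theorem continuousOn_geoX (hg : IsC11Metric g) (hu : ContDiffOn ℝ 1 (u ∘ radial g) (slit n)) :
    ContinuousOn (geoX g u) (SM g) :=
  continuousOn_finsetSum _ fun j _ =>
    (continuousOn_coord continuousOn_snd j).mul (continuousOn_hDer hg hu j)

end dRad

section sections
variable {V : E n × E n → E n}

theorem contDiffOn_coord (hV : ContDiffOn ℝ 1 (V ∘ radial g) (slit n)) (j : Fin n) :
    ContDiffOn ℝ 1 ((fun q => V q j) ∘ radial g) (slit n) :=
  (EuclideanSpace.proj (𝕜 := ℝ) j : E n →L[ℝ] ℝ).contDiff.comp_contDiffOn hV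

theorem geoXSec_apply (c : Conn g) {p : E n × E n} (hp : p.1 ∈ ball n) (l : Fin n) :
    geoXSec g V p l = dRad g (fun q => V q l) p (spray c p) + c.Γ p.1 p.2 (V p) l := by
  simp only [geoXSec, geoX_eq c hp, c.apply_eq hp]

theorem continuousOn_vDiv (hV : ContDiffOn ℝ 1 (V ∘ radial g) (slit n)) :
    ContinuousOn (vDiv g V) (SM g) :=
  continuousOn_finsetSum _ fun j _ =>
    continuousOn_dRad (contDiffOn_coord hV j) continuousOn_const

theorem continuousOn_hDiv (hg : IsC11Metric g) (hV : ContDiffOn ℝ 1 (V ∘ radial g) (slit n))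
    (hc : ContinuousOn V (SM g)) : ContinuousOn (hDiv g V) (SM g) :=
  continuousOn_finsetSum _ fun j _ => (continuousOn_hDer hg (contDiffOn_coord hV j) j).add
    ((continuousOn_finsetSum _ fun i _ => continuousOn_christoffel hg i j i).mul
      (continuousOn_coord hc j))

theorem continuousOn_geoXSec (hg : IsC11Metric g) (hV : ContDiffOn ℝ 1 (V ∘ radial g) (slit n))
    (hc : ContinuousOn V (SM g)) : ContinuousOn (geoXSec g V) (SM g) := by
  refine (PiLp.continuous_toLp 2 _).comp_continuousOn (continuousOn_pi.2 fun l => ?_)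
  refine (continuousOn_geoX hg (contDiffOn_coord hV l)).add ?_
  refine continuousOn_finsetSum _ fun j _ => continuousOn_finsetSum _ fun k _ => ?_
  exact ((continuousOn_christoffel hg l j k).mul (continuousOn_coord continuousOn_snd j)).mul
    (continuousOn_coord hc k)

/-- A `C¹` section vanishing over the boundary, as an element of `H¹₀(N)`. -/
def IsC10Section.toH10 (hg : IsC11Metric g) (hV : IsC10Section g V) (hc : ContinuousOn V (SM g))
    (hX : ∀ᵐ p ∂sigma g, ip g p.1 (geoXSec g V p) p.2 = 0) : H10 g where
  sec := V
  Xsec := geoXSec g V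
  divV := vDiv g V
  divH := hDiv g V
  memL2_sec := memL2Sec_of_continuousOn hg hc ((ae_sigma_mem_SM hg).mono hV.1)
  memL2_Xsec := memL2Sec_of_continuousOn hg (continuousOn_geoXSec hg hV.2.1 hc) hX
  memL2_divV := memL2_of_continuousOn hg (continuousOn_vDiv hV.2.1)
  memL2_divH := memL2_of_continuousOn hg (continuousOn_hDiv hg hV.2.1 hc)
  exists_approx := ⟨fun _ => V, fun _ => hV, by simp [sqNormSec, ip], by simp [sqNormSec, ip],
    by simp [sqNorm], by simp [sqNorm]⟩

end sections

/-! ### The curvature operator -/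

theorem pd_christoffel (c : Conn g) {x : E n} (hx : x ∈ inner n) (hΓ : DifferentiableAt ℝ c.Γ x)
    (l i j k : Fin n) : pd (christoffel g l j k) i x = fderiv ℝ c.Γ x (bv i) (bv j) (bv k) l := by
  have h1 := (hΓ.hasFDerivAt.clm_apply (hasFDerivAt_const (bv j : E n) x)).clm_apply
    (hasFDerivAt_const (bv k : E n) x)
  have h2 := (EuclideanSpace.proj (𝕜 := ℝ) l : E n →L[ℝ] ℝ).hasFDerivAt.comp x h1
  have hb := inner_subset_ball hx
  have h3 := (h2.hasFDerivWithinAt (s := ball n)).congr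
    (f₁ := christoffel g l j k) (fun y hy => (c.coeff y hy j k l).symm) (c.coeff x hb j k l).symm
  rw [pd, h3.fderivWithin (uniqueDiffOn_ball x hb)]
  simp [bv]

theorem curvature_eq (c : Conn g) {x : E n} (hx : x ∈ inner n) (hΓ : DifferentiableAt ℝ c.Γ x)
    (l i j k : Fin n) : curvature g l i j k x =
      (fderiv ℝ c.Γ x (bv i) (bv j) (bv k) - fderiv ℝ c.Γ x (bv j) (bv i) (bv k)
        + c.Γ x (bv i) (c.Γ x (bv j) (bv k)) - c.Γ x (bv j) (c.Γ x (bv i) (bv k))) l := by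
  have hb := inner_subset_ball hx
  have h1 : ∀ a b d : Fin n, c.Γ x (bv a) (c.Γ x (bv b) (bv d)) l
      = ∑ m, christoffel g l a m x * christoffel g m b d x := by
    intro a b d
    rw [c.apply_eq hb, Finset.sum_comm]
    simp only [c.coeff x hb]
    refine Finset.sum_congr rfl fun m _ => ?_
    simp [bv]
  rw [curvature, pd_christoffel c hx hΓ, pd_christoffel c hx hΓ, Finset.sum_sub_distrib,
    ← h1, ← h1]
  simp only [PiLp.add_apply, PiLp.sub_apply]
  ring

/-- At interior points the one-sided partial derivatives of the symbols are derivatives of the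
extended connection, so the coordinate curvature is the operator `Rop` of the commutator formula.
The hypotheses hold almost everywhere on `SM`. -/
theorem curvOp_eq (c : Conn g) {V : E n × E n → E n} {p : E n × E n} (hx : p.1 ∈ inner n)
    (hΓ : DifferentiableAt ℝ c.Γ p.1) : curvOp g V p = Rop c p (V p) := by
  ext l
  have hR : ∀ w a b : E n, (∑ i, ∑ j, ∑ k, curvature g l i j k p.1 * w i * a j * b k) =
      (fderiv ℝ c.Γ p.1 w a b - fderiv ℝ c.Γ p.1 a w b
        + c.Γ p.1 w (c.Γ p.1 a b) - c.Γ p.1 a (c.Γ p.1 w b)) l := by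
    intro w a b
    symm
    have key : ∀ T : E n →L[ℝ] E n →L[ℝ] E n →L[ℝ] E n, T w a b l =
        ∑ i, ∑ j, ∑ k, T (bv i) (bv j) (bv k) l * w i * a j * b k := by
      intro T
      rw [clm_eq_sum_coord T w]
      simp only [_root_.sum_apply, _root_.smul_apply, WithLp.ofLp_sum, Finset.sum_apply,
        WithLp.ofLp_smul, Pi.smul_apply, smul_eq_mul]
      refine Finset.sum_congr rfl fun i _ => ?_
      rw [clm_eq_sum_coord (T (bv i)) a]
      simp only [_root_.sum_apply, _root_.smul_apply, WithLp.ofLp_sum, Finset.sum_apply,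
        WithLp.ofLp_smul, Pi.smul_apply, smul_eq_mul, Finset.mul_sum]
      refine Finset.sum_congr rfl fun j _ => ?_
      rw [clm_eq_sum_coord (T (bv i) (bv j)) b]
      simp only [WithLp.ofLp_sum, Finset.sum_apply,
        WithLp.ofLp_smul, Pi.smul_apply, smul_eq_mul, Finset.mul_sum]
      exact Finset.sum_congr rfl fun k _ => by ring
    let T1 := fderiv ℝ c.Γ p.1
    let T3 : E n →L[ℝ] E n →L[ℝ] E n →L[ℝ] E n :=
      (ContinuousLinearMap.compL ℝ (E n) (E n) (E n)).bilinearComp (c.Γ p.1) (c.Γ p.1)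
    -- The curvature as a trilinear map: `dΓ + ΓΓ` antisymmetrized in the first two arguments.
    have h := key (T1 - T1.flip + T3 - T3.flip)
    simp only [curvature_eq c hx hΓ]
    exact h
  simpa [curvOp, Rop] using hR (V p) p.2 p.2

end RoughXRay
end

/-! ### The tangential gradient on sphere bundles of arbitrary radius -/

noncomputable section
namespace RoughXRay
variable {n : ℕ} {g : E n → Matrix (Fin n) (Fin n) ℝ}

theorem continuous_of_continuousAt_tsupport {X F : Type*} [TopologicalSpace X] [TopologicalSpace F]
    [Zero F] {f : X → F} {K : Set X} (hK : IsClosed K) (h0 : ∀ z ∉ K, f z = 0)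
    (h : ∀ z ∈ K, ContinuousAt f z) : Continuous f := by
  refine continuous_iff_continuousAt.2 fun z => ?_
  by_cases hz : z ∈ K
  · exact h z hz
  · refine continuousAt_const.congr (f := fun _ => 0) ?_
    filter_upwards [hK.isOpen_compl.mem_nhds hz] with y hy
    exact (h0 y hy).symm

section tanGrad
variable (c : Conn g) (hg : IsC11Metric g) {U : E n × E n → ℝ} (hU : ContDiff ℝ 2 U)
  (hc : HasCompactSupport U) (hs : tsupport U ⊆ slitI n)
include hg hU hs

theorem contDiff_tanGrad : ContDiff ℝ 1 (tanGrad g U) := by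
  refine contDiff_iff_contDiffAt.2 fun z => ?_
  by_cases hz : z ∈ tsupport U
  · exact contDiffAt_tanGrad hg hU (hs hz)
  · refine contDiffAt_const.congr_of_eventuallyEq (f := fun _ => (0 : E n)) ?_
    filter_upwards [(isClosed_tsupport U).isOpen_compl.mem_nhds hz] with y hy
    exact tanGrad_of_notMem g hy

omit hg hU hs in
theorem covX_tanGrad_of_notMem {z : E n × E n} (hz : z ∉ tsupport U) :
    covX c (tanGrad g U) z = 0 := by
  have h : fderiv ℝ (tanGrad g U) z = 0 :=
    fderiv_of_notMem_tsupport fun h => hz (tsupport_tanGrad_subset g U h)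
  rw [covX, h, tanGrad_of_notMem g hz]
  simp

theorem continuous_covX_tanGrad : Continuous (covX c (tanGrad g U)) := by
  have h := contDiff_tanGrad hg hU hs
  obtain ⟨K, hK⟩ := c.lip
  have h1 := hK.continuous
  have h2 := h.continuous
  have h3 := h.continuous_fderiv one_ne_zero
  unfold covX spray
  fun_prop

/-- Differentiate `⟨W, v⟩ = 0` along the spray, where `v` is parallel. So the covariant derivative
is again a section of `N`, as an element of `H10` requires. -/
theorem gF_covX_tanGrad {z : E n × E n} :
    gF g z.1 (covX c (tanGrad g U) z) z.2 = 0 := by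
  by_cases hz : z ∈ tsupport U
  · have h := fderiv_gF_apply_spray c hg (hs hz).1 (W := tanGrad g U) (T := fun p => p.2)
      ((contDiff_tanGrad hg hU hs).differentiable one_ne_zero z) differentiableAt_snd
    rw [covX_snd, map_zero, add_zero] at h
    rw [← h]
    have h0 : (fun p : E n × E n => gF g p.1 (tanGrad g U p) p.2) =ᶠ[𝓝 z] fun _ => 0 := by
      filter_upwards [slitI_mem_nhds (hs hz)] with p hp
      exact gF_tanPart_self hg (inner_subset_ball hp.1) hp.2 _
    rw [h0.fderiv_eq]
    simp
  · rw [covX_tanGrad_of_notMem c hz]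
    simp

/-- The tangential gradient at speed `s`, as a section over the unit sphere bundle. -/
theorem isC10Section_tanGrad {s : ℝ} (hs0 : 0 < s) :
    IsC10Section g fun p => tanGrad g U (p.1, s • p.2) := by
  refine ⟨fun p hp => ?_, ?_, fun p _ hb => tanGrad_of_notMem g fun h => ?_⟩
  · have hp2 : p.2 ≠ 0 := (SM_subset_slit hp).2
    have h := gF_tanPart_self hg (z := (p.1, s • p.2)) hp.1 (smul_ne_zero hs0.ne' hp2)
      (vD U (p.1, s • p.2))
    simp only [map_smul, smul_eq_mul] at h
    rw [← gF_apply]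
    exact (mul_eq_zero.1 h).resolve_left hs0.ne'
  · have h1 : ContDiff ℝ 1 fun p : E n × E n => tanGrad g U (p.1, s • p.2) :=
      (contDiff_tanGrad hg hU hs).comp (contDiff_fst.prodMk (contDiff_snd.const_smul s))
    exact h1.comp_contDiffOn (contDiffOn_radial hg)
  · have h1 : ‖p.1‖ < 1 := mem_ball_zero_iff.1 (hs h).1
    have h2 : ‖p.1‖ = 1 := mem_sphere_zero_iff_norm.1 hb
    linarith

end tanGrad

/-- Derivative along the geodesic vector field of a function on `SM` given by the restriction
of a function on `TM` to the sphere bundle of radius `s`. -/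
theorem dRad_spray (c : Conn g) (hg : IsC11Metric g) {F : E n × E n → ℝ} (hF : Differentiable ℝ F)
    {s : ℝ} (hs0 : 0 < s) {p : E n × E n} (hp : p ∈ SM g) (hi : p.1 ∈ inner n) :
    dRad g (fun q => F (q.1, s • q.2)) p (spray c p)
      = s⁻¹ * fderiv ℝ F (p.1, s • p.2) (spray c (p.1, s • p.2)) := by
  have hps : p ∈ slitI n := ⟨hi, (SM_subset_slit hp).2⟩
  have hq1 : speedSq g p = 1 := by rw [speedSq, gF_apply]; exact hp.2
  have hnh : slit n ∈ 𝓝 p := mem_of_superset (slitI_mem_nhds hps) fun q hq =>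
    ⟨inner_subset_ball hq.1, hq.2⟩
  have hqd := ((contDiffAt_speedSq hg hi).differentiableAt one_ne_zero).hasFDerivAt
  have hr := (hqd.sqrt (by rw [hq1]; exact one_ne_zero))
  have hr2 := (hasDerivAt_inv (x := Real.sqrt (speedSq g p)) (by rw [hq1]; simp)).comp_hasFDerivAt p hr
  have h3 := (hasFDerivAt_fst (𝕜 := ℝ) (p := p)).prodMk
    ((hr2.fun_smul (hasFDerivAt_snd (𝕜 := ℝ) (p := p))).const_smul s)
  have h5 := HasFDerivAt.comp p (g := F) (f := fun q : E n × E n => (q.1, s • ((Real.sqrt (speedSq g q))⁻¹ • q.2))) (hF _).hasFDerivAt h3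
  have h6 : ((fun q => F (q.1, s • q.2)) ∘ radial g)
      = F ∘ fun q : E n × E n => (q.1, s • ((Real.sqrt (speedSq g q))⁻¹ • q.2)) := by
    funext q
    simp only [Function.comp, radial, speedSq, gF_apply]
  rw [dRad, fderivWithin_of_mem_nhds hnh, h6, h5.fderiv]
  -- The normalization in `radial` contributes nothing, because the speed is constant along the
  -- spray. The dilation by `s` sends the spray at `p` to `s⁻¹` times the spray at the dilated
  -- point, the acceleration being quadratic in `v`.
  have h0 := fderiv_speedSq_spray c hg hi
  rw [ContinuousLinearMap.comp_apply]
  have hsq : Real.sqrt (speedSq g p) = 1 := by rw [hq1, Real.sqrt_one]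
  have e : ∀ L : E n × E n →L[ℝ] ℝ, s⁻¹ * L (spray c (p.1, s • p.2))
      = L (s⁻¹ • spray c (p.1, s • p.2)) := fun L => by rw [map_smul, smul_eq_mul]
  rw [e]
  have hpt : (p.1, s • ((Real.sqrt (speedSq g p))⁻¹ • p.2)) = (p.1, s • p.2) := by
    rw [hsq, inv_one, one_smul]
  rw [hpt]
  congr 1
  simp only [ContinuousLinearMap.prod_apply, _root_.smul_apply, _root_.add_apply, hsq,
    ContinuousLinearMap.smulRight_apply, h0, ContinuousLinearMap.coe_fst', ContinuousLinearMap.coe_snd']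
  simp only [spray, map_smul, _root_.smul_apply, Prod.smul_mk, smul_smul, inv_mul_cancel₀ hs0.ne']
  refine Prod.ext (by simp) ?_
  simp [smul_smul, hs0.ne', hsq]

theorem geoXSec_scale (c : Conn g) (hg : IsC11Metric g) {W : E n × E n → E n}
    (hW : Differentiable ℝ W) {s : ℝ} (hs0 : 0 < s) {p : E n × E n} (hp : p ∈ SM g)
    (hi : p.1 ∈ inner n) :
    geoXSec g (fun q => W (q.1, s • q.2)) p = s⁻¹ • covX c W (p.1, s • p.2) := by
  ext l
  have hl := (EuclideanSpace.proj (𝕜 := ℝ) l : E n →L[ℝ] ℝ).differentiable.comp hW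
  rw [geoXSec_apply c hp.1]
  have h := dRad_spray c hg hl hs0 hp hi
  have h2 : fderiv ℝ ((EuclideanSpace.proj (𝕜 := ℝ) l : E n →L[ℝ] ℝ) ∘ W) (p.1, s • p.2)
      = (EuclideanSpace.proj (𝕜 := ℝ) l : E n →L[ℝ] ℝ).comp (fderiv ℝ W (p.1, s • p.2)) :=
    ((EuclideanSpace.proj (𝕜 := ℝ) l : E n →L[ℝ] ℝ).hasFDerivAt.comp _ (hW _).hasFDerivAt).fderiv
  rw [h2] at h
  refine (congrArg (· + c.Γ p.1 p.2 (W (p.1, s • p.2)) l) h).trans ?_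
  simp only [covX, map_smul, _root_.smul_apply, PiLp.smul_apply, PiLp.add_apply, smul_eq_mul,
    ContinuousLinearMap.comp_apply, mul_add]
  rw [← mul_assoc s⁻¹ s, inv_mul_cancel₀ hs0.ne', one_mul]
  rfl

theorem Rop_scale (c : Conn g) (x v w : E n) (s : ℝ) :
    Rop c (x, s • v) w = s ^ 2 • Rop c (x, v) w := by
  simp only [Rop, map_smul, _root_.smul_apply, smul_sub, smul_add, smul_smul, pow_two]

end RoughXRay
end

/-! ### Coercivity and the energy inequality for `C²` functions -/

noncomputable section
namespace RoughXRay
variable {n : ℕ} {g : E n → Matrix (Fin n) (Fin n) ℝ}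

theorem measurable_clm_apply {X F G : Type*} [MeasurableSpace X] [NormedAddCommGroup F]
    [NormedSpace ℝ F] [NormedAddCommGroup G] [NormedSpace ℝ G] [MeasurableSpace F] [BorelSpace F]
    [MeasurableSpace G] [BorelSpace G] [SecondCountableTopologyEither (F →L[ℝ] G) F]
    {L : X → F →L[ℝ] G} {u : X → F}
    (hL : Measurable L) (hu : Measurable u) : Measurable fun z => L z (u z) :=
  ((isBoundedBilinearMap_apply (𝕜 := ℝ) (E := F) (F := G)).continuous.measurable).comp
    (hL.prodMk hu)

theorem measurable_Rop (c : Conn g) {W : E n × E n → E n} (hW : Measurable W) :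
    Measurable fun z => Rop c z (W z) := by
  obtain ⟨K, hK⟩ := c.lip
  have h1 : Measurable fun z : E n × E n => fderiv ℝ c.Γ z.1 :=
    (measurable_fderiv ℝ c.Γ).comp measurable_fst
  have h2 : Measurable fun z : E n × E n => c.Γ z.1 := hK.continuous.measurable.comp measurable_fst
  have h3 : Measurable fun z : E n × E n => z.2 := measurable_snd
  have m3 : ∀ {L : E n × E n → E n →L[ℝ] E n →L[ℝ] E n →L[ℝ] E n} {a b d : E n × E n → E n},
      Measurable L → Measurable a → Measurable b → Measurable d →
      Measurable fun z => L z (a z) (b z) (d z) := fun hL ha hb hd =>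
    measurable_clm_apply (measurable_clm_apply (measurable_clm_apply hL ha) hb) hd
  have m2 : ∀ {L : E n × E n → E n →L[ℝ] E n →L[ℝ] E n} {a b : E n × E n → E n},
      Measurable L → Measurable a → Measurable b →
      Measurable fun z => L z (a z) (b z) := fun hL ha hb =>
    measurable_clm_apply (measurable_clm_apply hL ha) hb
  exact (((m3 h1 hW h3 h3).sub (m3 h1 h3 hW h3)).add (m2 h2 hW (m2 h2 h3 h3))).sub
    (m2 h2 h3 (m2 h2 hW h3))

/-- The derivative of `Γ` is bounded by its Lipschitz constant everywhere, since `fderiv` is zero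
where `Γ` is not differentiable. -/
theorem exists_bound_Rop (c : Conn g) : ∃ C : ℝ, 0 ≤ C ∧ ∀ z w, ‖Rop c z w‖ ≤ C * (‖z.2‖ ^ 2 * ‖w‖) := by
  obtain ⟨K, hK⟩ := c.lip
  obtain ⟨M, hM⟩ := c.bdd
  have hM0 : 0 ≤ M := (norm_nonneg _).trans (hM 0)
  refine ⟨2 * K + 2 * M ^ 2, by positivity, fun z w => ?_⟩
  have h1 : ∀ a b d : E n, ‖fderiv ℝ c.Γ z.1 a b d‖ ≤ K * ‖a‖ * ‖b‖ * ‖d‖ := fun a b d => by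
    refine (ContinuousLinearMap.le_opNorm₂ _ _ _).trans ?_
    gcongr
    refine (ContinuousLinearMap.le_opNorm _ _).trans ?_
    gcongr
    exact norm_fderiv_le_of_lipschitz ℝ hK
  have h2 : ∀ a b : E n, ‖c.Γ z.1 a b‖ ≤ M * ‖a‖ * ‖b‖ := fun a b => by
    refine (ContinuousLinearMap.le_opNorm₂ _ _ _).trans ?_
    gcongr
    exact hM _
  have e1 := h1 w z.2 z.2
  have e2 := h1 z.2 w z.2
  have e3 : ‖c.Γ z.1 w (c.Γ z.1 z.2 z.2)‖ ≤ M * ‖w‖ * (M * ‖z.2‖ * ‖z.2‖) :=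
    (h2 _ _).trans (by gcongr; exact h2 _ _)
  have e4 : ‖c.Γ z.1 z.2 (c.Γ z.1 w z.2)‖ ≤ M * ‖z.2‖ * (M * ‖w‖ * ‖z.2‖) :=
    (h2 _ _).trans (by gcongr; exact h2 _ _)
  rw [Rop]
  refine (norm_sub_le _ _).trans ((add_le_add (norm_add_le _ _) le_rfl).trans
    ((add_le_add (add_le_add (norm_sub_le _ _) le_rfl) le_rfl).trans ?_))
  nlinarith

theorem exists_bound_of_continuous {X : Type*} [TopologicalSpace X] {f : X → ℝ} {K : Set X}
    (hK : IsCompact K) (h0 : ∀ z ∉ K, f z = 0) (hf : Continuous f) : ∃ C, ∀ z, |f z| ≤ C := by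
  obtain ⟨C, hC⟩ := hK.exists_bound_of_continuousOn hf.continuousOn
  refine ⟨max C 0, fun z => ?_⟩
  by_cases hz : z ∈ K
  · exact (hC z hz).trans (le_max_left _ _)
  · rw [h0 z hz, abs_zero]
    exact le_max_right _ _

/-- `g`, as a bilinear form, extended by zero. -/
def gZ (g : E n → Matrix (Fin n) (Fin n) ℝ) : E n → E n →L[ℝ] E n →L[ℝ] ℝ :=
  (ball n).indicator (gF g)

theorem measurable_gZ (hg : IsC11Metric g) : Measurable (gZ g) := by
  classical
  have h := ContinuousOn.measurable_piecewise (f := gF g) (g := fun _ => 0)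
    (continuousOn_gF hg) continuousOn_const (measurableSet_ball (n := n))
  convert h using 1
  funext p
  simp only [gZ, piecewise, indicator_apply]

section coercivity
variable (c : Conn g) (hg : IsC11Metric g) {U : E n × E n → ℝ} (hU : ContDiff ℝ 2 U)
  (hc : HasCompactSupport U) (hs : tsupport U ⊆ slitI n)

/-- `|X𝒲|²` for the tangential gradient `𝒲` of `U`. -/
def kinTerm (c : Conn g) (U : E n × E n → ℝ) (z : E n × E n) : ℝ :=
  gF g z.1 (covX c (tanGrad g U) z) (covX c (tanGrad g U) z)

/-- `⟨R𝒲, 𝒲⟩` for the tangential gradient `𝒲` of `U`. -/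
def curvTerm (c : Conn g) (U : E n × E n → ℝ) (z : E n × E n) : ℝ :=
  gF g z.1 (Rop c z (tanGrad g U z)) (tanGrad g U z)

/-- `|v|²|𝒲|²` for the tangential gradient `𝒲` of `U`. -/
def massTerm (g : E n → Matrix (Fin n) (Fin n) ℝ) (U : E n × E n → ℝ) (z : E n × E n) : ℝ :=
  speedSq g z * gF g z.1 (tanGrad g U z) (tanGrad g U z)

theorem kinTerm_of_notMem {z : E n × E n} (hz : z ∉ tsupport U) : kinTerm c U z = 0 := by
  simp [kinTerm, covX_tanGrad_of_notMem c hz]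

theorem curvTerm_of_notMem {z : E n × E n} (hz : z ∉ tsupport U) : curvTerm c U z = 0 := by
  simp [curvTerm, tanGrad_of_notMem g hz]

theorem massTerm_of_notMem {z : E n × E n} (hz : z ∉ tsupport U) : massTerm g U z = 0 := by
  simp [massTerm, tanGrad_of_notMem g hz]

include hg hU hs

theorem continuous_kinTerm : Continuous (kinTerm c U) := by
  refine continuous_of_continuousAt_tsupport (isClosed_tsupport U)
    (fun z hz => kinTerm_of_notMem c hz) fun z hz => ?_
  have h1 := (contDiffAt_gF_fst hg (hs hz).1).continuousAt
  have h2 := (continuous_covX_tanGrad c hg hU hs).continuousAt (x := z)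
  exact (h1.clm_apply h2).clm_apply h2

theorem continuous_massTerm : Continuous (massTerm g U) := by
  refine continuous_of_continuousAt_tsupport (isClosed_tsupport U)
    (fun z hz => massTerm_of_notMem hz) fun z hz => ?_
  have h1 := (contDiffAt_gF_fst hg (hs hz).1).continuousAt
  have h2 := (contDiff_tanGrad hg hU hs).continuous.continuousAt (x := z)
  exact (contDiffAt_speedSq hg (hs hz).1).continuousAt.mul ((h1.clm_apply h2).clm_apply h2)

theorem measurable_curvTerm : Measurable (curvTerm c U) := by
  have hW := (contDiff_tanGrad hg hU hs).continuous.measurable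
  have h : curvTerm c U = fun z => gZ g z.1 (Rop c z (tanGrad g U z)) (tanGrad g U z) := by
    funext z
    by_cases hz : z ∈ tsupport U
    · rw [curvTerm, gZ, indicator_of_mem (inner_subset_ball (hs hz).1)]
    · rw [curvTerm_of_notMem c hz, tanGrad_of_notMem g hz, map_zero]
  rw [h]
  exact measurable_clm_apply (measurable_clm_apply ((measurable_gZ hg).comp measurable_fst)
    (measurable_Rop c hW)) hW

include hc

theorem exists_bound_curvTerm : ∃ C, ∀ z, |curvTerm c U z| ≤ C := by
  obtain ⟨C, hC0, hC⟩ := exists_bound_Rop c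
  obtain ⟨G, hG0, hG⟩ := exists_bound_gF hg
  have hW := (contDiff_tanGrad hg hU hs).continuous
  obtain ⟨B, hB⟩ := exists_bound_of_continuous (f := fun z => ‖z.2‖ ^ 2 * ‖tanGrad g U z‖ ^ 2)
    (K := tsupport U) hc (fun z hz => by simp [tanGrad_of_notMem g hz]) (by fun_prop)
  have hB0 : 0 ≤ B := (abs_nonneg _).trans (hB 0)
  refine ⟨G * (C * B), fun z => ?_⟩
  by_cases hz : z ∈ tsupport U
  · have h1 := (ContinuousLinearMap.le_opNorm₂ (gF g z.1) (Rop c z (tanGrad g U z)) (tanGrad g U z))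
    rw [Real.norm_eq_abs] at h1
    refine h1.trans ?_
    calc _ ≤ G * (C * (‖z.2‖ ^ 2 * ‖tanGrad g U z‖)) * ‖tanGrad g U z‖ := by
          gcongr
          · exact hG _ (inner_subset_ball (hs hz).1)
          · exact hC _ _
      _ = G * (C * (‖z.2‖ ^ 2 * ‖tanGrad g U z‖ ^ 2)) := by ring
      _ ≤ _ := by
          gcongr
          exact (le_abs_self _).trans (hB z)
  · rw [curvTerm_of_notMem c hz, abs_zero]
    positivity

/-- Condition (B1) for the tangential gradient on the sphere bundle of radius `s`, read as a section
over `SM`. Covariant differentiation scales by `s⁻¹` and curvature by `s²`; with the weight `|v|²`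
in `massTerm`, all three terms carry the same factor `s⁻²`. -/
theorem integral_sphere_nonneg {ε : ℝ}
    (hε : ∀ W : H10 g, ε * ipL2 g W.sec W.sec ≤ quadForm g W) {s : ℝ} (hs0 : 0 < s) :
    0 ≤ ∫ p, (kinTerm c U (p.1, s • p.2) - curvTerm c U (p.1, s • p.2)
      - ε * massTerm g U (p.1, s • p.2)) ∂sigma g := by
  have hfin := isFiniteMeasure_sigma hg
  have hW1 := contDiff_tanGrad hg hU hs
  have hsc : Continuous fun p : E n × E n => (p.1, s • p.2) := by fun_prop
  obtain ⟨C1, hC1⟩ := exists_bound_of_continuous hc (fun z hz => kinTerm_of_notMem c hz)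
    (continuous_kinTerm c hg hU hs)
  obtain ⟨C2, hC2⟩ := exists_bound_curvTerm c hg hU hc hs
  obtain ⟨C3, hC3⟩ := exists_bound_of_continuous hc (fun z hz => massTerm_of_notMem hz)
    (continuous_massTerm hg hU hs)
  have i1 : Integrable (fun p : E n × E n => kinTerm c U (p.1, s • p.2)) (sigma g) :=
    Integrable.of_bound ((continuous_kinTerm c hg hU hs).comp hsc).aestronglyMeasurable C1
      (Eventually.of_forall fun p => hC1 _)
  have i2 : Integrable (fun p : E n × E n => curvTerm c U (p.1, s • p.2)) (sigma g) :=
    Integrable.of_bound ((measurable_curvTerm c hg hU hs).comp hsc.measurable).aestronglyMeasurable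
      C2 (Eventually.of_forall fun p => hC2 _)
  have i3 : Integrable (fun p : E n × E n => massTerm g U (p.1, s • p.2)) (sigma g) :=
    Integrable.of_bound ((continuous_massTerm hg hU hs).comp hsc).aestronglyMeasurable C3
      (Eventually.of_forall fun p => hC3 _)
  have hae : ∀ᵐ p ∂sigma g, p ∈ SM g ∧ p.1 ∈ inner n ∧ DifferentiableAt ℝ c.Γ p.1 := by
    obtain ⟨K, hK⟩ := c.lip
    have hsph : ∀ᵐ x ∂(volume : Measure (E n)), x ∉ Metric.sphere (0 : E n) 1 := by
      exact measure_eq_zero_iff_ae_notMem.1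
        (Measure.addHaar_sphere_of_ne_zero (volume : Measure (E n)) 0 one_ne_zero)
    filter_upwards [ae_sigma_mem_SM hg, ae_sigma_fst hg hsph,
      ae_sigma_fst hg hK.ae_differentiableAt] with p h1 h2 h3
    refine ⟨h1, ?_, h3⟩
    have h4 : ‖p.1‖ ≤ 1 := mem_closedBall_zero_iff.1 h1.1
    rw [mem_sphere_zero_iff_norm] at h2
    exact mem_ball_zero_iff.2 (lt_of_le_of_ne h4 h2)
  have hX : ∀ᵐ p ∂sigma g, geoXSec g (fun q => tanGrad g U (q.1, s • q.2)) p
      = s⁻¹ • covX c (tanGrad g U) (p.1, s • p.2) := by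
    filter_upwards [hae] with p hp
    exact geoXSec_scale c hg (hW1.differentiable one_ne_zero) hs0 hp.1 hp.2.1
  have hX0 : ∀ᵐ p ∂sigma g, ip g p.1 (geoXSec g (fun q => tanGrad g U (q.1, s • q.2)) p) p.2 = 0 := by
    filter_upwards [hX] with p hp
    rw [hp, ← gF_apply]
    have h := gF_covX_tanGrad c hg hU hs (z := (p.1, s • p.2))
    simp only [map_smul, smul_eq_mul] at h
    rw [map_smul, _root_.smul_apply, (mul_eq_zero.1 h).resolve_left hs0.ne', smul_zero]
  have hsec := isC10Section_tanGrad hg hU hs hs0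
  have hQ := hε (hsec.toH10 hg (hW1.continuous.comp hsc).continuousOn hX0)
  have e1 : ipL2 g (geoXSec g fun q => tanGrad g U (q.1, s • q.2))
      (geoXSec g fun q => tanGrad g U (q.1, s • q.2)) =
      (s ^ 2)⁻¹ * ∫ p, kinTerm c U (p.1, s • p.2) ∂sigma g := by
    rw [ipL2, ← integral_const_mul]
    refine integral_congr_ae ?_
    filter_upwards [hX] with p hp
    rw [hp, ip_smul, inv_pow, kinTerm, gF_apply]
  have e2 : ipL2 g (curvOp g fun q => tanGrad g U (q.1, s • q.2))
      (fun q => tanGrad g U (q.1, s • q.2)) =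
      (s ^ 2)⁻¹ * ∫ p, curvTerm c U (p.1, s • p.2) ∂sigma g := by
    rw [ipL2, ← integral_const_mul]
    refine integral_congr_ae ?_
    filter_upwards [hae] with p hp
    rw [curvOp_eq c hp.2.1 hp.2.2, ← gF_apply, curvTerm, Rop_scale, map_smul, _root_.smul_apply,
      smul_eq_mul, ← mul_assoc, inv_mul_cancel₀ (by positivity), one_mul]
  have e3 : ipL2 g (fun q => tanGrad g U (q.1, s • q.2)) (fun q => tanGrad g U (q.1, s • q.2)) =
      (s ^ 2)⁻¹ * ∫ p, massTerm g U (p.1, s • p.2) ∂sigma g := by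
    rw [ipL2, ← integral_const_mul]
    refine integral_congr_ae ?_
    filter_upwards [hae] with p hp
    have hq : speedSq g (p.1, s • p.2) = s ^ 2 := by
      rw [speedSq, gF_apply, ip_smul, hp.1.2, mul_one]
    rw [massTerm, hq, ← mul_assoc, inv_mul_cancel₀ (by positivity), one_mul, gF_apply]
  have hQ' : ε * ipL2 g (fun q => tanGrad g U (q.1, s • q.2)) (fun q => tanGrad g U (q.1, s • q.2))
      ≤ ipL2 g (geoXSec g fun q => tanGrad g U (q.1, s • q.2))
        (geoXSec g fun q => tanGrad g U (q.1, s • q.2))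
        - ipL2 g (curvOp g fun q => tanGrad g U (q.1, s • q.2))
        (fun q => tanGrad g U (q.1, s • q.2)) := hQ
  rw [e1, e2, e3] at hQ'
  have i12 := i1.sub i2
  simp only [Pi.sub_def] at i12
  rw [integral_sub i12 (i3.const_mul ε), integral_sub i1 i2, integral_const_mul]
  have hpos : 0 < (s ^ 2)⁻¹ := by positivity
  by_contra! hlt
  nlinarith [mul_pos hpos (neg_pos.2 hlt)]

/-- Integrate `integral_sphere_nonneg` over all radii by means of the polar coordinate formula
`lintegral_slit`. -/
theorem integral_coercive (hn : 1 ≤ n) {ε : ℝ}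
    (hε : ∀ W : H10 g, ε * ipL2 g W.sec W.sec ≤ quadForm g W) :
    Integrable (fun z => (g z.1).det * (kinTerm c U z - curvTerm c U z - ε * massTerm g U z)) ∧
    0 ≤ ∫ z, (g z.1).det * (kinTerm c U z - curvTerm c U z - ε * massTerm g U z) := by
  have hfin := isFiniteMeasure_sigma hg
  obtain ⟨C1, hC1⟩ := exists_bound_of_continuous hc (fun z hz => kinTerm_of_notMem c hz)
    (continuous_kinTerm c hg hU hs)
  obtain ⟨C2, hC2⟩ := exists_bound_curvTerm c hg hU hc hs
  obtain ⟨C3, hC3⟩ := exists_bound_of_continuous hc (fun z hz => massTerm_of_notMem hz)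
    (continuous_massTerm hg hU hs)
  obtain ⟨C4, hC4⟩ := isCompact_ball.exists_bound_of_continuousOn (contDiffOn_det_g hg).continuousOn
  set k : E n × E n → ℝ := fun z => kinTerm c U z - curvTerm c U z - ε * massTerm g U z with hk
  have hkm : Measurable k := by
    have := (continuous_kinTerm c hg hU hs).measurable
    have := measurable_curvTerm c hg hU hs
    have := (continuous_massTerm hg hU hs).measurable
    fun_prop
  have hk0 : ∀ z ∉ tsupport U, k z = 0 := fun z hz => by
    simp only [hk, kinTerm_of_notMem c hz, curvTerm_of_notMem c hz, massTerm_of_notMem hz]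
    simp
  have hkb : ∀ z, |k z| ≤ C1 + C2 + |ε| * C3 := fun z => by
    refine (abs_sub _ _).trans (add_le_add ((abs_sub _ _).trans (add_le_add (hC1 z) (hC2 z))) ?_)
    rw [abs_mul]
    gcongr
    exact hC3 z
  have hdk : (fun z : E n × E n => (g z.1).det * k z) = fun z => detF g z.1 * k z := by
    funext z
    by_cases hz : z ∈ tsupport U
    · rw [detF_of_mem (inner_subset_ball (hs hz).1)]
    · rw [hk0 z hz, mul_zero, mul_zero]
  have hdm := measurable_detF hg
  have hdkm : Measurable fun z : E n × E n => detF g z.1 * k z := by fun_prop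
  have hint : Integrable (fun z : E n × E n => detF g z.1 * k z) := by
    rw [← integrableOn_iff_integrable_of_support_subset (s := tsupport U)]
    · have : IsFiniteMeasure ((volume : Measure (E n × E n)).restrict (tsupport U)) :=
        ⟨by rw [Measure.restrict_apply_univ]; exact hc.measure_lt_top⟩
      refine Integrable.of_bound hdkm.aestronglyMeasurable (C4 * (C1 + C2 + |ε| * C3)) ?_
      filter_upwards [ae_restrict_mem (isClosed_tsupport U).measurableSet] with z hz
      rw [norm_mul]
      have h4 := hC4 z.1 (inner_subset_ball (hs hz).1)
      rw [detF_of_mem (inner_subset_ball (hs hz).1)]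
      exact mul_le_mul h4 (hkb z) (norm_nonneg _) ((norm_nonneg _).trans h4)
    · intro z hz
      by_contra h
      exact hz (by simp only [hk0 z h, mul_zero])
  rw [hdk]
  refine ⟨hint, ?_⟩
  -- The polar formula is available for nonnegative functions, so positive and negative parts are
  -- compared radius by radius.
  have hsph : ∀ s ∈ Ioi (0:ℝ), ∫⁻ p, ENNReal.ofReal (-k (p.1, s • p.2)) ∂sigma g
      ≤ ∫⁻ p, ENNReal.ofReal (k (p.1, s • p.2)) ∂sigma g := by
    intro s hs0
    have h := integral_sphere_nonneg c hg hU hc hs hε hs0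
    have hi : Integrable (fun p : E n × E n => k (p.1, s • p.2)) (sigma g) :=
      Integrable.of_bound (hkm.comp (by fun_prop)).aestronglyMeasurable _
        (Eventually.of_forall fun p => hkb _)
    have h' : 0 ≤ ∫ p, k (p.1, s • p.2) ∂sigma g := h
    rw [integral_eq_lintegral_pos_part_sub_lintegral_neg_part hi, sub_nonneg] at h'
    refine (ENNReal.toReal_le_toReal ?_ ?_).1 h'
    · exact hi.neg.lintegral_lt_top.ne
    · exact hi.lintegral_lt_top.ne
  have hle : ∫⁻ p in slit n, ENNReal.ofReal (detF g p.1) * ENNReal.ofReal (-k p)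
      ≤ ∫⁻ p in slit n, ENNReal.ofReal (detF g p.1) * ENNReal.ofReal (k p) := by
    rw [← lintegral_slit hg hn (h := fun p => ENNReal.ofReal (-k p)) (by fun_prop),
      ← lintegral_slit hg hn (h := fun p => ENNReal.ofReal (k p)) (by fun_prop)]
    refine setLIntegral_mono' measurableSet_Ioi fun s hs0 => ?_
    exact mul_le_mul' le_rfl (hsph s hs0)
  have hd0 : ∀ x, 0 ≤ detF g x := fun x =>
    indicator_nonneg (fun x hx => (det_g_pos hg hx).le) x
  simp only [← ENNReal.ofReal_mul (hd0 _)] at hle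
  rw [← setIntegral_eq_integral_of_forall_compl_eq_zero (s := slit n)]
  · rw [integral_eq_lintegral_pos_part_sub_lintegral_neg_part hint.integrableOn, sub_nonneg]
    refine ENNReal.toReal_mono hint.integrableOn.lintegral_lt_top.ne ?_
    simpa only [mul_neg] using hle
  · intro z hz
    have : z ∉ tsupport U := fun h => hz ⟨inner_subset_ball (hs h).1, (hs h).2⟩
    rw [hk0 z this, mul_zero]

omit hg hU hs hc in
/-- The integrand of the energy inequality. -/
def energy (g : E n → Matrix (Fin n) (Fin n) ℝ) (ε : ℝ) (z : E n × E n) (y : ℝ) (η α : E n →L[ℝ] ℝ) : ℝ :=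
  coN g z η - (n - 1) * y ^ 2 / speedSq g z - ε * (speedSq g z * coN g z α)

/-- In the sum of the Pestov identity and the coercivity estimate the covariant derivative and the
curvature cancel. Only first derivatives of `U` and of `XU` remain, which is what allows the passage
to Lipschitz functions. -/
theorem integral_energy_nonneg (hn : 1 ≤ n) {ε : ℝ}
    (hε : ∀ W : H10 g, ε * ipL2 g W.sec W.sec ≤ quadForm g W) :
    Integrable (fun z => (g z.1).det * energy g ε z (XD c U z) (vD (XD c U) z) (vD U z)) ∧
    0 ≤ ∫ z, (g z.1).det * energy g ε z (XD c U z) (vD (XD c U) z) (vD U z) := by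
  obtain ⟨h1, h2⟩ := integral_pestov c hg hU hc hs
  obtain ⟨h3, h4⟩ := integral_coercive c hg hU hc hs hn hε
  have he : (fun z => (g z.1).det * energy g ε z (XD c U z) (vD (XD c U) z) (vD U z)) =
      fun z => (g z.1).det * pestovIntegrand c U z
        + (g z.1).det * (kinTerm c U z - curvTerm c U z - ε * massTerm g U z) := by
    funext z
    have hm : massTerm g U z = speedSq g z * coN g z (vD U z) := by
      by_cases hz : z ∈ tsupport U
      · rw [massTerm, tanGrad, gF_tanPart hg (inner_subset_ball (hs hz).1) (hs hz).2]
      · rw [massTerm_of_notMem hz, vD, fderiv_of_notMem_tsupport hz]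
        simp [coN]
    rw [energy, hm, pestovIntegrand, kinTerm, curvTerm]
    ring
  rw [he]
  exact ⟨h1.add h3, by rw [integral_add h1 h3, h2, zero_add]; exact h4⟩

end coercivity

end RoughXRay
end

/-! ### Mollification -/

noncomputable section
namespace RoughXRay

section mollify
variable {V : Type*} [NormedAddCommGroup V] [NormedSpace ℝ V] [FiniteDimensional ℝ V]
  [MeasurableSpace V] [BorelSpace V] {μ : Measure V} [μ.IsAddHaarMeasure]
  {F : Type*} [NormedAddCommGroup F] [NormedSpace ℝ F] {ρ : V → ℝ}

/-- The mollification of `f` at scale `h` with kernel `ρ`. -/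
def mollify (μ : Measure V) (ρ : V → ℝ) (h : ℝ) (f : V → F) (z : V) : F :=
  ∫ y, ρ y • f (z - h • y) ∂μ

/-- Kernels for mollification. -/
structure IsMollifier (μ : Measure V) (ρ : V → ℝ) : Prop where
  smooth : ContDiff ℝ (⊤ : ℕ∞) ρ
  supp : tsupport ρ ⊆ Metric.closedBall 0 1
  integral : ∫ y, ρ y ∂μ = 1

theorem exists_isMollifier (μ : Measure V) [μ.IsAddHaarMeasure] : ∃ ρ, IsMollifier μ ρ := by
  let φ : ContDiffBump (0 : V) := ⟨1 / 2, 1, by norm_num, by norm_num⟩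
  exact ⟨φ.normed μ, φ.contDiff_normed, (φ.tsupport_normed_eq (μ := μ)).subset, φ.integral_normed⟩

namespace IsMollifier

theorem hasCompactSupport (hρ : IsMollifier μ ρ) : HasCompactSupport ρ :=
  (isCompact_closedBall _ _).of_isClosed_subset (isClosed_tsupport _) hρ.supp

theorem eq_zero (hρ : IsMollifier μ ρ) {y : V} (hy : y ∉ Metric.closedBall (0 : V) 1) : ρ y = 0 :=
  image_eq_zero_of_notMem_tsupport fun h => hy (hρ.supp h)

theorem fderiv_eq_zero (hρ : IsMollifier μ ρ) {y : V} (hy : y ∉ Metric.closedBall (0 : V) 1) :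
    fderiv ℝ ρ y = 0 := by
  by_contra h
  exact hy (hρ.supp (support_fderiv_subset ℝ h))

theorem exists_bound (hρ : IsMollifier μ ρ) : ∃ C, ∀ y, |ρ y| ≤ C ∧ ‖fderiv ℝ ρ y‖ ≤ C := by
  obtain ⟨C1, h1⟩ := hρ.hasCompactSupport.exists_bound_of_continuous hρ.smooth.continuous
  obtain ⟨C2, h2⟩ := (hρ.hasCompactSupport.fderiv ℝ).exists_bound_of_continuous
    (hρ.smooth.continuous_fderiv (by simp))
  exact ⟨max C1 C2, fun y => ⟨(h1 y).trans (le_max_left _ _), (h2 y).trans (le_max_right _ _)⟩⟩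

end IsMollifier

theorem contDiff_scaled (hρ : IsMollifier μ ρ) (h : ℝ) (a : ℝ) :
    ContDiff ℝ (⊤ : ℕ∞) fun t : V => a * ρ (h⁻¹ • t) :=
  contDiff_const.mul (hρ.smooth.comp (contDiff_const_smul h⁻¹))

theorem hasCompactSupport_scaled (hρ : IsMollifier μ ρ) {h : ℝ} (hh : 0 < h) (a : ℝ) :
    HasCompactSupport fun t : V => a * ρ (h⁻¹ • t) :=
  (hρ.hasCompactSupport.comp_smul (inv_ne_zero hh.ne')).mul_left

theorem mollify_eq_convolution {h : ℝ} (hh : 0 < h) (f : V → ℝ) :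
    mollify μ ρ h f = convolution (fun t : V => (h ^ Module.finrank ℝ V)⁻¹ * ρ (h⁻¹ • t)) f
      (ContinuousLinearMap.lsmul ℝ ℝ) μ := by
  funext z
  have h1 := Measure.integral_comp_smul μ (fun t => ρ (h⁻¹ • t) * f (z - t)) h
  rw [mollify, convolution]
  simp only [ContinuousLinearMap.lsmul_apply, smul_eq_mul, mul_assoc]
  rw [integral_const_mul]
  rw [abs_of_pos (by positivity), smul_eq_mul] at h1
  rw [← h1]
  simp only [smul_smul, inv_mul_cancel₀ hh.ne', one_smul]

theorem contDiff_mollify (hρ : IsMollifier μ ρ) {h : ℝ} (hh : 0 < h) {f : V → ℝ}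
    (hf : LocallyIntegrable f μ) : ContDiff ℝ (⊤ : ℕ∞) (mollify μ ρ h f) := by
  rw [mollify_eq_convolution hh]
  exact (hasCompactSupport_scaled hρ hh _).contDiff_convolution_left _ (contDiff_scaled hρ h _) hf

/-- The derivative falls on the kernel at the cost of `h⁻¹`. Comparison with `hasFDerivAt_mollify`,
where it falls on the function, is an integration by parts. -/
theorem fderiv_mollify_apply (hρ : IsMollifier μ ρ) {h : ℝ} (hh : 0 < h) {f : V → ℝ}
    (hf : LocallyIntegrable f μ) (z m : V) :
    fderiv ℝ (mollify μ ρ h f) z m = h⁻¹ * ∫ y, fderiv ℝ ρ y m * f (z - h • y) ∂μ := by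
  set a := (h ^ Module.finrank ℝ V)⁻¹ with ha
  have hs := contDiff_scaled hρ h a
  have hcs := hasCompactSupport_scaled hρ hh a
  have h1 := hcs.hasFDerivAt_convolution_left (μ := μ) (ContinuousLinearMap.lsmul ℝ ℝ)
    (hs.of_le (by simp)) hf z
  rw [mollify_eq_convolution hh, h1.fderiv, convolution, ContinuousLinearMap.integral_apply]
  · have h2 := Measure.integral_comp_smul μ (fun t => fderiv ℝ ρ (h⁻¹ • t) m * f (z - t)) h
    rw [abs_of_pos (by positivity), smul_eq_mul, ← ha] at h2
    simp only [smul_smul, inv_mul_cancel₀ hh.ne', one_smul] at h2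
    rw [h2, ← integral_const_mul, ← integral_const_mul]
    refine integral_congr_ae (Eventually.of_forall fun t => ?_)
    have h3 : HasFDerivAt (fun t : V => a * ρ (h⁻¹ • t))
        (a • (fderiv ℝ ρ (h⁻¹ • t)).comp (h⁻¹ • ContinuousLinearMap.id ℝ V)) t := by
      have h4 : HasFDerivAt ρ (fderiv ℝ ρ (h⁻¹ • t)) (h⁻¹ • t) :=
        (hρ.smooth.differentiable (by simp) _).hasFDerivAt
      exact (HasFDerivAt.comp t h4 ((hasFDerivAt_id t).const_smul h⁻¹)).const_mul a
    beta_reduce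
    rw [h3.fderiv]
    simp [ContinuousLinearMap.precompL_apply]
    ring
  · exact (hcs.fderiv ℝ).convolutionExists_left _ (hs.continuous_fderiv (by simp)) hf z

theorem integrable_of_bound_closedBall {f : V → F} (hm : AEStronglyMeasurable f μ) {C : ℝ}
    (hb : ∀ y, ‖f y‖ ≤ C) (h0 : ∀ y ∉ Metric.closedBall (0 : V) 1, f y = 0) : Integrable f μ := by
  rw [← integrableOn_iff_integrable_of_support_subset (s := Metric.closedBall (0 : V) 1)]
  · have : IsFiniteMeasure (μ.restrict (Metric.closedBall (0 : V) 1)) :=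
      ⟨by rw [Measure.restrict_apply_univ]; exact measure_closedBall_lt_top⟩
    exact Integrable.of_bound hm.restrict C (Eventually.of_forall hb)
  · intro y hy
    by_contra h
    exact hy (h0 y h)

theorem quasiMeasurePreserving_sub_smul {h : ℝ} (hh : 0 < h) (z : V) :
    Measure.QuasiMeasurePreserving (fun y => z - h • y) μ μ := by
  have h1 : Measure.QuasiMeasurePreserving (fun y : V => h • y) μ μ :=
    ⟨measurable_const_smul h, by
      rw [Measure.map_addHaar_smul μ hh.ne']
      exact Measure.smul_absolutelyContinuous⟩
  exact (Measure.measurePreserving_sub_left μ z).quasiMeasurePreserving.comp h1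

theorem aestronglyMeasurable_comp_sub_smul {f : V → F} (hf : AEStronglyMeasurable f μ) {h : ℝ}
    (hh : 0 < h) (z : V) : AEStronglyMeasurable (fun y => f (z - h • y)) μ :=
  hf.comp_quasiMeasurePreserving (quasiMeasurePreserving_sub_smul hh z)

theorem aestronglyMeasurable_fderiv {f : V → ℝ} : AEStronglyMeasurable (fderiv ℝ f) μ :=
  (measurable_fderiv ℝ f).aestronglyMeasurable

/-- Derivative of the mollification of a Lipschitz function. -/
theorem hasFDerivAt_mollify (hρ : IsMollifier μ ρ) {h : ℝ} (hh : 0 < h) {f : V → ℝ} {K : NNReal}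
    (hf : LipschitzWith K f) (z : V) :
    Integrable (fun y => ρ y • fderiv ℝ f (z - h • y)) μ ∧
    HasFDerivAt (mollify μ ρ h f) (∫ y, ρ y • fderiv ℝ f (z - h • y) ∂μ) z := by
  obtain ⟨C, hC⟩ := hρ.exists_bound
  have hcont := hρ.smooth.continuous
  have hfc := hf.continuous
  refine hasFDerivAt_integral_of_dominated_loc_of_lip (bound := fun y => K * |ρ y|) (s := univ)
    univ_mem (Eventually.of_forall fun x => ?_) ?_ ?_ ?_ ?_ ?_
  · exact Continuous.aestronglyMeasurable (by fun_prop)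
  · refine Continuous.integrable_of_hasCompactSupport (by fun_prop) ?_
    exact hρ.hasCompactSupport.smul_right
  · exact hcont.aestronglyMeasurable.smul
      (aestronglyMeasurable_comp_sub_smul aestronglyMeasurable_fderiv hh z)
  · refine Eventually.of_forall fun y => LipschitzWith.lipschitzOnWith ?_
    refine LipschitzWith.of_dist_le_mul fun a b => ?_
    rw [Real.coe_nnabs, dist_eq_norm, ← smul_sub, norm_smul, abs_of_nonneg (by positivity),
      ← dist_eq_norm]
    have := hf.dist_le_mul (a - h • y) (b - h • y)
    rw [dist_sub_right] at this
    calc _ ≤ |ρ y| * (K * dist a b) := by gcongr; exact le_rfl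
      _ = _ := by ring
  · exact (Continuous.integrable_of_hasCompactSupport (by fun_prop)
      (hρ.hasCompactSupport.norm.mul_left))
  · filter_upwards [(quasiMeasurePreserving_sub_smul hh z).ae hf.ae_differentiableAt] with y hy
    have h1 : HasFDerivAt (fun x : V => x - h • y) (ContinuousLinearMap.id ℝ V) z :=
      (hasFDerivAt_id z).sub_const _
    exact (HasFDerivAt.comp z hy.hasFDerivAt h1).const_smul (ρ y)

/-- Lebesgue points, in the form needed for mollification. -/
theorem ae_tendsto_integral_norm_sub {G : V → F} (hG : LocallyIntegrable G μ) :
    ∀ᵐ z ∂μ, Tendsto (fun h : ℝ => ∫ y in Metric.closedBall (0 : V) 1, ‖G (z - h • y) - G z‖ ∂μ)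
      (𝓝[>] 0) (𝓝 0) := by
  filter_upwards [IsUnifLocDoublingMeasure.ae_tendsto_average_norm_sub μ hG 1] with z hz
  have h1 := hz (l := 𝓝[>] (0:ℝ)) (fun _ => z) (fun h => h) tendsto_id (by
    filter_upwards [self_mem_nhdsWithin] with h hh
    have : 0 < h := hh
    simp [this.le])
  have h2 := h1.const_mul (μ.real (Metric.closedBall (0 : V) 1))
  rw [mul_zero] at h2
  refine h2.congr' ?_
  filter_upwards [self_mem_nhdsWithin] with h hh
  have hh : 0 < h := hh
  set Φ : V → ℝ := (Metric.closedBall z h).indicator fun w => ‖G w - G z‖ with hΦ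
  have e1 : ∫ y, Φ (z - h • y) ∂μ = (h ^ Module.finrank ℝ V)⁻¹ * ∫ w, Φ w ∂μ := by
    rw [Measure.integral_comp_smul μ (fun y => Φ (z - y)) h, integral_sub_left_eq_self Φ μ z,
      abs_of_pos (by positivity), smul_eq_mul]
  have e2 : (fun y => Φ (z - h • y))
      = (Metric.closedBall (0 : V) 1).indicator fun y => ‖G (z - h • y) - G z‖ := by
    funext y
    have hiff : z - h • y ∈ Metric.closedBall z h ↔ y ∈ Metric.closedBall (0 : V) 1 := by
      rw [Metric.mem_closedBall, mem_closedBall_zero_iff, dist_eq_norm, sub_sub_cancel_left,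
        norm_neg, norm_smul, Real.norm_of_nonneg hh.le]
      constructor <;> intro h <;> nlinarith
    by_cases hy : y ∈ Metric.closedBall (0 : V) 1
    · rw [hΦ, indicator_of_mem hy, indicator_of_mem (hiff.2 hy)]
    · rw [hΦ, indicator_of_notMem hy, indicator_of_notMem fun h => hy (hiff.1 h)]
  rw [e2, integral_indicator Metric.isClosed_closedBall.measurableSet, hΦ,
    integral_indicator Metric.isClosed_closedBall.measurableSet] at e1
  rw [e1, setAverage_eq, smul_eq_mul]
  have e3 : μ.real (Metric.closedBall z h)
      = h ^ Module.finrank ℝ V * μ.real (Metric.closedBall (0 : V) 1) := by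
    rw [Measure.real, Measure.addHaar_closedBall' μ z hh.le, ENNReal.toReal_mul,
      ENNReal.toReal_ofReal (by positivity), Measure.real]
  have e4 : μ.real (Metric.closedBall (0 : V) 1) ≠ 0 := by
    have := Metric.measure_closedBall_pos μ (0 : V) one_pos
    exact (ENNReal.toReal_pos this.ne' measure_closedBall_lt_top.ne).ne'
  rw [e3]
  field_simp

end mollify

end RoughXRay
end

/-! ### Mollification along a Lipschitz vector field -/

noncomputable section
namespace RoughXRay

section mollify
variable {V : Type*} [NormedAddCommGroup V] [NormedSpace ℝ V] [FiniteDimensional ℝ V]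
  [MeasurableSpace V] [BorelSpace V] {μ : Measure V} [μ.IsAddHaarMeasure]
  {F : Type*} [NormedAddCommGroup F] [NormedSpace ℝ F] {ρ : V → ℝ}

/-- At a Lebesgue point of `G`, any quantity dominated by the oscillation of `G` at scale `h` tends
to zero. -/
theorem tendsto_integral_of_norm_le {G : V → F} {z : V} {Φ : ℝ → V → ℝ} {C : ℝ} {L : ℝ}
    (hb : ∀ w, ‖G w‖ ≤ L) (hGm : AEStronglyMeasurable G μ)
    (hG : Tendsto (fun h : ℝ => ∫ y in Metric.closedBall (0 : V) 1, ‖G (z - h • y) - G z‖ ∂μ)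
      (𝓝[>] (0:ℝ)) (𝓝 0))
    (h0 : ∀ h, ∀ y ∉ Metric.closedBall (0 : V) 1, Φ h y = 0)
    (hΦ : ∀ h > 0, ∀ y, |Φ h y| ≤ C * ‖G (z - h • y) - G z‖) :
    Tendsto (fun h => ∫ y, Φ h y ∂μ) (𝓝[>] (0:ℝ)) (𝓝 0) := by
  have h1 := hG.const_mul C
  rw [mul_zero] at h1
  refine squeeze_zero_norm' ?_ h1
  filter_upwards [self_mem_nhdsWithin] with h hh
  have hh : 0 < h := hh
  rw [← setIntegral_eq_integral_of_forall_compl_eq_zero (h0 h), ← integral_const_mul]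
  refine norm_integral_le_of_norm_le ?_ (Eventually.of_forall fun y => hΦ h hh y)
  have : IsFiniteMeasure (μ.restrict (Metric.closedBall (0 : V) 1)) :=
      ⟨by rw [Measure.restrict_apply_univ]; exact measure_closedBall_lt_top⟩
  refine (Integrable.of_bound (C := L + L) ?_ (Eventually.of_forall fun y => ?_)).const_mul C
  · exact ((aestronglyMeasurable_comp_sub_smul hGm hh z).sub
      aestronglyMeasurable_const).norm.restrict
  · rw [norm_norm]
    exact (norm_sub_le _ _).trans (add_le_add (hb _) (hb _))

/-- A compactly supported bounded kernel tested against a rescaled bounded covector field. -/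
theorem tendsto_integral_kernel {κ : V → ℝ} (hκ : Continuous κ)
    (hκ0 : ∀ y ∉ Metric.closedBall (0 : V) 1, κ y = 0) {G : V → V →L[ℝ] ℝ} {L : ℝ}
    (hb : ∀ w, ‖G w‖ ≤ L) (hGm : AEStronglyMeasurable G μ) {z : V}
    (hG : Tendsto (fun h : ℝ => ∫ y in Metric.closedBall (0 : V) 1, ‖G (z - h • y) - G z‖ ∂μ)
      (𝓝[>] (0:ℝ)) (𝓝 0)) {q : ℝ → V → V} {q0 : V → V} {M : ℝ}
    (hq : ∀ h, 0 < h → Continuous (q h)) (hqb : ∀ h, 0 < h → ∀ y ∈ Metric.closedBall (0 : V) 1, ‖q h y‖ ≤ M)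
    (hqt : ∀ y, Tendsto (fun h => q h y) (𝓝[>] (0:ℝ)) (𝓝 (q0 y))) :
    Tendsto (fun h => ∫ y, κ y * G (z - h • y) (q h y) ∂μ) (𝓝[>] (0:ℝ))
      (𝓝 (∫ y, κ y * G z (q0 y) ∂μ)) := by
  have hcs : HasCompactSupport κ := HasCompactSupport.intro (isCompact_closedBall 0 1) hκ0
  obtain ⟨C, hC⟩ := hcs.exists_bound_of_continuous hκ
  have hC0 : 0 ≤ C := (norm_nonneg _).trans (hC 0)
  have hL0 : 0 ≤ L := (norm_nonneg _).trans (hb 0)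
  have hM0 : 0 ≤ M := (norm_nonneg _).trans (hqb 1 one_pos 0 (by simp))
  have key : ∀ (A : V →L[ℝ] ℝ) (h : ℝ), 0 < h → ∀ y, |κ y * A (q h y)| ≤ C * M * ‖A‖ := by
    intro A h hh y
    by_cases hy : y ∈ Metric.closedBall (0 : V) 1
    · rw [abs_mul]
      have h1 : |A (q h y)| ≤ ‖A‖ * M := (A.le_opNorm _).trans
        (mul_le_mul_of_nonneg_left (hqb h hh y hy) (norm_nonneg _))
      have h2 : |κ y| ≤ C := hC y
      calc _ ≤ C * (‖A‖ * M) := mul_le_mul h2 h1 (abs_nonneg _) hC0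
        _ = _ := by ring
    · rw [hκ0 y hy, zero_mul, abs_zero]
      positivity
  -- The field is split into its value at `z` and an oscillation. The oscillation is handled by the
  -- Lebesgue point property, the frozen value by dominated convergence.
  have t1 : Tendsto (fun h => ∫ y, κ y * (G (z - h • y) - G z) (q h y) ∂μ) (𝓝[>] (0:ℝ)) (𝓝 0) := by
    have : Tendsto (fun h => ∫ y, (Ioi (0:ℝ)).indicator (fun h => κ y * (G (z - h • y) - G z) (q h y)) h ∂μ)
        (𝓝[>] (0:ℝ)) (𝓝 0) := by
      refine tendsto_integral_of_norm_le (C := C * M) hb hGm hG (fun h y hy => ?_) fun h hh y => ?_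
      · by_cases hh : h ∈ Ioi (0:ℝ)
        · rw [indicator_of_mem hh, hκ0 y hy, zero_mul]
        · rw [indicator_of_notMem hh]
      · rw [indicator_of_mem (show h ∈ Ioi (0:ℝ) from hh)]
        exact key _ h hh y
    refine this.congr' ?_
    filter_upwards [self_mem_nhdsWithin] with h hh
    simp only [indicator_of_mem hh]
  have t2 : Tendsto (fun h => ∫ y, κ y * G z (q h y) ∂μ) (𝓝[>] (0:ℝ)) (𝓝 (∫ y, κ y * G z (q0 y) ∂μ)) := by
    refine tendsto_integral_filter_of_dominated_convergence
      ((Metric.closedBall (0 : V) 1).indicator fun _ => C * M * ‖G z‖) ?_ ?_ ?_ ?_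
    · filter_upwards [self_mem_nhdsWithin] with h hh
      have := hq h hh
      exact Continuous.aestronglyMeasurable (by fun_prop)
    · filter_upwards [self_mem_nhdsWithin] with h hh
      refine Eventually.of_forall fun y => ?_
      by_cases hy : y ∈ Metric.closedBall (0 : V) 1
      · rw [indicator_of_mem hy]
        exact key _ h hh y
      · rw [indicator_of_notMem hy, hκ0 y hy, zero_mul, norm_zero]
    · rw [integrable_indicator_iff Metric.isClosed_closedBall.measurableSet]
      exact integrableOn_const measure_closedBall_lt_top.ne
    · exact Eventually.of_forall fun y =>
        (((G z).continuous.tendsto _).comp (hqt y)).const_mul _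
  have t3 := t1.add t2
  rw [zero_add] at t3
  refine t3.congr' ?_
  filter_upwards [self_mem_nhdsWithin] with h hh
  have hh : 0 < h := hh
  have hqc := hq h hh
  have im : ∀ {A : V → V →L[ℝ] ℝ} {L : ℝ}, AEStronglyMeasurable A μ → (∀ y, ‖A y‖ ≤ L) →
      Integrable (fun y => κ y * A y (q h y)) μ := by
    intro A L hA hAb
    refine integrable_of_bound_closedBall (C := C * M * L) ?_ (fun y => ?_) fun y hy => by
      rw [hκ0 y hy, zero_mul]
    · exact hκ.aestronglyMeasurable.mul
        ((isBoundedBilinearMap_apply (𝕜 := ℝ)).continuous.comp_aestronglyMeasurable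
          (hA.prodMk hqc.aestronglyMeasurable))
    · refine (key _ h hh y).trans ?_
      gcongr
      exact hAb y
  have hGs := aestronglyMeasurable_comp_sub_smul hGm hh z
  have i1 := im (A := fun y => G (z - h • y) - G z) (hGs.sub aestronglyMeasurable_const)
    (fun y => (norm_sub_le _ _).trans (add_le_add (hb _) (hb _)))
  rw [← integral_add i1 (im aestronglyMeasurable_const (fun y => hb z))]
  refine integral_congr_ae (Eventually.of_forall fun y => ?_)
  simp only [_root_.sub_apply]
  ring

/-- The derivative at the origin of the mollification of `ℓ` at scale 1 is computed with the
derivative on the kernel and on `ℓ`. -/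
theorem integral_fderiv_mollifier (hρ : IsMollifier μ ρ) (ℓ : V →L[ℝ] ℝ) (m : V) :
    ∫ y, fderiv ℝ ρ y m * ℓ y ∂μ = -ℓ m := by
  have h1 := fderiv_mollify_apply hρ one_pos ℓ.continuous.locallyIntegrable 0 m
  have h2 := (hasFDerivAt_mollify hρ one_pos ℓ.lipschitz 0).2.fderiv
  rw [h2] at h1
  have h3 : ∀ w, fderiv ℝ ℓ w = ℓ := fun w => ℓ.fderiv
  simp only [h3, integral_smul_const, hρ.integral, one_smul, inv_one, zero_sub, map_neg,
    mul_neg, integral_neg, one_mul] at h1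
  linarith

variable {u Y : V → ℝ} {A : V → V} {Ku KY KA : NNReal}

/-- The derivative along the vector field `A` of the mollification of `u`, where `Y = A u`. -/
theorem hasFDerivAt_mollify_along (hρ : IsMollifier μ ρ) (hu : LipschitzWith Ku u)
    (hY : LipschitzWith KY Y) (hA : LipschitzWith KA A)
    (hAu : ∀ᵐ z ∂μ, fderiv ℝ u z (A z) = Y z) {h : ℝ} (hh : 0 < h) {z : V}
    (hAz : DifferentiableAt ℝ A z) :
    ∃ D : V →L[ℝ] ℝ, HasFDerivAt (fun z => fderiv ℝ (mollify μ ρ h u) z (A z)) D z ∧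
      ∀ m, D m = (∫ y, ρ y * fderiv ℝ Y (z - h • y) m ∂μ)
        + (∫ y, fderiv ℝ ρ y m * fderiv ℝ u (z - h • y) (h⁻¹ • (A z - A (z - h • y))) ∂μ)
        + ∫ y, ρ y * fderiv ℝ u (z - h • y) (fderiv ℝ A z m) ∂μ := by
  have hul := hu.continuous.locallyIntegrable (μ := μ)
  have hsm := contDiff_mollify hρ hh hul
  have hD : HasFDerivAt (fderiv ℝ (mollify μ ρ h u)) (fderiv ℝ (fderiv ℝ (mollify μ ρ h u)) z) z :=
    ((hsm.fderiv_right (m := 1) (by norm_cast)).differentiable one_ne_zero z).hasFDerivAt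
  refine ⟨_, hD.clm_apply hAz.hasFDerivAt, fun m => ?_⟩
  have happ : ∀ w a, fderiv ℝ (mollify μ ρ h u) w a = ∫ y, ρ y * fderiv ℝ u (w - h • y) a ∂μ := by
    intro w a
    obtain ⟨hi, hd⟩ := hasFDerivAt_mollify hρ hh hu w
    rw [hd.fderiv, ContinuousLinearMap.integral_apply hi]
    rfl
  have hGm : ∀ a, AEStronglyMeasurable (fun w => fderiv ℝ u w a) μ := fun a =>
    (measurable_fderiv_apply_const ℝ u a).aestronglyMeasurable
  have hGb : ∀ w, ‖fderiv ℝ u w‖ ≤ Ku := fun w => norm_fderiv_le_of_lipschitz ℝ hu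
  have hGl : ∀ a, LocallyIntegrable (fun w => fderiv ℝ u w a) μ := fun a =>
    (memLp_top_of_bound (hGm a) (Ku * ‖a‖) (Eventually.of_forall fun w =>
      (ContinuousLinearMap.le_opNorm _ _).trans (by gcongr; exact hGb w))).locallyIntegrable le_top
  have h2 : fderiv ℝ (fderiv ℝ (mollify μ ρ h u)) z m (A z)
      = h⁻¹ * ∫ y, fderiv ℝ ρ y m * fderiv ℝ u (z - h • y) (A z) ∂μ := by
    have e1 : (fun w => fderiv ℝ (mollify μ ρ h u) w (A z))
        = mollify μ ρ h fun w => fderiv ℝ u w (A z) := by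
      funext w
      rw [happ]
      rfl
    have e2 := hD.clm_apply (hasFDerivAt_const (A z) z)
    rw [e1] at e2
    rw [← fderiv_mollify_apply hρ hh (hGl (A z)), e2.fderiv]
    simp
  have h3 : (∫ y, ρ y * fderiv ℝ Y (z - h • y) m ∂μ)
      = h⁻¹ * ∫ y, fderiv ℝ ρ y m * Y (z - h • y) ∂μ := by
    obtain ⟨hi, hd⟩ := hasFDerivAt_mollify hρ hh hY z
    rw [← fderiv_mollify_apply hρ hh hY.continuous.locallyIntegrable, hd.fderiv,
      ContinuousLinearMap.integral_apply hi]
    rfl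
  obtain ⟨C, hC⟩ := hρ.exists_bound
  have hC0 : 0 ≤ C := (abs_nonneg _).trans (hC 0).1
  have hdc : Continuous fun y => fderiv ℝ ρ y m :=
    (hρ.smooth.continuous_fderiv (by simp)).clm_apply continuous_const
  have hgs : AEStronglyMeasurable (fun y => fderiv ℝ u (z - h • y)) μ :=
    aestronglyMeasurable_comp_sub_smul aestronglyMeasurable_fderiv hh z
  have i1 : Integrable (fun y => fderiv ℝ ρ y m * Y (z - h • y)) μ := by
    have := hY.continuous
    refine Continuous.integrable_of_hasCompactSupport (by fun_prop) ?_
    refine HasCompactSupport.intro (isCompact_closedBall 0 1) fun y hy => ?_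
    rw [hρ.fderiv_eq_zero hy, _root_.zero_apply, zero_mul]
  have i2 : Integrable (fun y => fderiv ℝ ρ y m *
      fderiv ℝ u (z - h • y) (h⁻¹ • (A z - A (z - h • y)))) μ := by
    have hAc := hA.continuous
    refine integrable_of_bound_closedBall (C := C * ‖m‖ * (Ku * KA)) ?_ (fun y => ?_) fun y hy => ?_
    · exact hdc.aestronglyMeasurable.mul
        ((isBoundedBilinearMap_apply (𝕜 := ℝ)).continuous.comp_aestronglyMeasurable
          (hgs.prodMk (Continuous.aestronglyMeasurable (by fun_prop))))
    · by_cases hy : y ∈ Metric.closedBall (0 : V) 1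
      · rw [norm_mul]
        gcongr
        · exact (ContinuousLinearMap.le_opNorm _ _).trans (by gcongr; exact (hC y).2)
        · refine (ContinuousLinearMap.le_opNorm _ _).trans ?_
          gcongr
          · exact hGb _
          · rw [norm_smul, norm_inv, Real.norm_of_nonneg hh.le, inv_mul_le_iff₀ hh,
              ← dist_eq_norm, mul_comm]
            refine (hA.dist_le_mul _ _).trans ?_
            gcongr
            rw [dist_eq_norm, sub_sub_cancel, norm_smul, Real.norm_of_nonneg hh.le]
            have := mem_closedBall_zero_iff.1 hy
            nlinarith
      · rw [hρ.fderiv_eq_zero hy, _root_.zero_apply, zero_mul, norm_zero]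
        positivity
    · rw [hρ.fderiv_eq_zero hy, _root_.zero_apply, zero_mul]
  -- The vector `A z` is replaced by `A (z - h • y)`, for which `du(A)` is `Y`; the factor `h⁻¹`
  -- turns the error into a difference quotient of `A`, bounded by its Lipschitz constant.
  have h4 : h⁻¹ * ∫ y, fderiv ℝ ρ y m * fderiv ℝ u (z - h • y) (A z) ∂μ
      = (∫ y, ρ y * fderiv ℝ Y (z - h • y) m ∂μ)
        + ∫ y, fderiv ℝ ρ y m * fderiv ℝ u (z - h • y) (h⁻¹ • (A z - A (z - h • y))) ∂μ := by
    rw [h3, ← integral_const_mul, ← integral_const_mul, ← integral_add (i1.const_mul _) i2]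
    refine integral_congr_ae ?_
    filter_upwards [(quasiMeasurePreserving_sub_smul hh z).ae hAu] with y hy
    rw [map_smul, map_sub, hy, smul_eq_mul]
    ring
  simp only [_root_.add_apply, ContinuousLinearMap.comp_apply, ContinuousLinearMap.flip_apply]
  rw [h2, h4, happ]
  ring

omit [FiniteDimensional ℝ V] [MeasurableSpace V] [BorelSpace V] in
theorem norm_difference_quotient_le (hA : LipschitzWith KA A) (z : V) {h : ℝ} (hh : 0 < h) {y : V}
    (hy : y ∈ Metric.closedBall (0 : V) 1) : ‖h⁻¹ • (A z - A (z - h • y))‖ ≤ KA := by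
  rw [norm_smul, norm_inv, Real.norm_of_nonneg hh.le, inv_mul_le_iff₀ hh, ← dist_eq_norm, mul_comm]
  refine (hA.dist_le_mul _ _).trans ?_
  gcongr
  rw [dist_eq_norm, sub_sub_cancel, norm_smul, Real.norm_of_nonneg hh.le]
  have := mem_closedBall_zero_iff.1 hy
  nlinarith

theorem integrable_fderiv_loc (hu : LipschitzWith Ku u) : LocallyIntegrable (fderiv ℝ u) μ :=
  (memLp_top_of_bound aestronglyMeasurable_fderiv Ku (Eventually.of_forall fun _ =>
    norm_fderiv_le_of_lipschitz ℝ hu)).locallyIntegrable le_top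

theorem tendsto_integral_mollifier_fderiv (hρ : IsMollifier μ ρ) (hu : LipschitzWith Ku u) {z : V}
    (hG : Tendsto (fun h : ℝ => ∫ y in Metric.closedBall (0 : V) 1,
      ‖fderiv ℝ u (z - h • y) - fderiv ℝ u z‖ ∂μ) (𝓝[>] (0:ℝ)) (𝓝 0)) (a : V) :
    Tendsto (fun h => ∫ y, ρ y * fderiv ℝ u (z - h • y) a ∂μ) (𝓝[>] (0:ℝ)) (𝓝 (fderiv ℝ u z a)) := by
  have h := tendsto_integral_kernel hρ.smooth.continuous (fun y hy => hρ.eq_zero hy)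
    (fun w => norm_fderiv_le_of_lipschitz ℝ hu) aestronglyMeasurable_fderiv hG
    (q := fun _ _ => a) (q0 := fun _ => a) (M := ‖a‖) (fun _ _ => continuous_const)
    (fun _ _ _ _ => le_rfl) (fun _ => tendsto_const_nhds)
  rwa [integral_mul_const, hρ.integral, one_mul] at h

theorem fderiv_mollify_apply_eq (hρ : IsMollifier μ ρ) (hu : LipschitzWith Ku u) {h : ℝ}
    (hh : 0 < h) (z a : V) :
    fderiv ℝ (mollify μ ρ h u) z a = ∫ y, ρ y * fderiv ℝ u (z - h • y) a ∂μ := by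
  obtain ⟨hi, hd⟩ := hasFDerivAt_mollify hρ hh hu z
  rw [hd.fderiv, ContinuousLinearMap.integral_apply hi]
  rfl

theorem ae_tendsto_fderiv_mollify (hρ : IsMollifier μ ρ) (hu : LipschitzWith Ku u) :
    ∀ᵐ z ∂μ, ∀ a, Tendsto (fun h => fderiv ℝ (mollify μ ρ h u) z a) (𝓝[>] (0:ℝ))
      (𝓝 (fderiv ℝ u z a)) := by
  filter_upwards [ae_tendsto_integral_norm_sub (integrable_fderiv_loc (μ := μ) hu)] with z hz a
  refine (tendsto_integral_mollifier_fderiv hρ hu hz a).congr' ?_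
  filter_upwards [self_mem_nhdsWithin] with h hh
  rw [fderiv_mollify_apply_eq hρ hu hh]

/-- A commutator argument of Friedrichs type, one derivative higher. The difference quotient of `A`
tends to `dA(y)`, and integration against `∂_m ρ` yields `-du(dA(m))`, which cancels the term coming
from the derivative of the coefficient `A`. -/
theorem ae_tendsto_fderiv_mollify_along (hρ : IsMollifier μ ρ) (hu : LipschitzWith Ku u)
    (hY : LipschitzWith KY Y) (hA : LipschitzWith KA A)
    (hAu : ∀ᵐ z ∂μ, fderiv ℝ u z (A z) = Y z) :
    ∀ᵐ z ∂μ, ∀ m, Tendsto (fun h => fderiv ℝ (fun z => fderiv ℝ (mollify μ ρ h u) z (A z)) z m)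
      (𝓝[>] (0:ℝ)) (𝓝 (fderiv ℝ Y z m)) := by
  filter_upwards [ae_tendsto_integral_norm_sub (integrable_fderiv_loc (μ := μ) hu),
    ae_tendsto_integral_norm_sub (integrable_fderiv_loc (μ := μ) hY), hA.ae_differentiableAt (μ := μ)]
    with z hzu hzY hzA m
  have t1 := tendsto_integral_mollifier_fderiv hρ hY hzY m
  have t3 := tendsto_integral_mollifier_fderiv hρ hu hzu (fderiv ℝ A z m)
  have hdc : Continuous fun y => fderiv ℝ ρ y m :=
    (hρ.smooth.continuous_fderiv (by simp)).clm_apply continuous_const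
  have hAc := hA.continuous
  have t2 := tendsto_integral_kernel hdc (fun y hy => by
      rw [hρ.fderiv_eq_zero hy, _root_.zero_apply])
    (fun w => norm_fderiv_le_of_lipschitz ℝ hu) aestronglyMeasurable_fderiv hzu
    (q := fun h y => h⁻¹ • (A z - A (z - h • y))) (q0 := fun y => fderiv ℝ A z y) (M := KA)
    (fun _ _ => by fun_prop) (fun h hh y hy => norm_difference_quotient_le hA z hh hy) (fun y => by
      have h1 : HasDerivAt (fun t : ℝ => z - t • y) (-y) 0 := by
        simpa using ((hasDerivAt_id (0:ℝ)).smul_const y).const_sub z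
      have h2 : HasFDerivAt A (fderiv ℝ A z) (z - (0:ℝ) • y) := by simpa using hzA.hasFDerivAt
      have h3 := (h2.comp_hasDerivAt (0:ℝ) h1).tendsto_slope_zero_right.neg
      simp only [map_neg, neg_neg] at h3
      refine h3.congr fun t => ?_
      simp [← smul_neg])
  have e := integral_fderiv_mollifier hρ ((fderiv ℝ u z).comp (fderiv ℝ A z)) m
  simp only [ContinuousLinearMap.comp_apply] at e
  rw [e] at t2
  have t := (t1.add t2).add t3
  simp only [neg_add_cancel_right] at t
  refine t.congr' ?_
  filter_upwards [self_mem_nhdsWithin] with h hh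
  obtain ⟨D, hD, hD'⟩ := hasFDerivAt_mollify_along hρ hu hY hA hAu hh hzA
  rw [hD.fderiv, hD']

/-- Bounds uniform in the scale, for dominated convergence. No power of `h⁻¹` survives, since the
difference quotients of `A` are bounded. -/
theorem exists_bound_mollify (hρ : IsMollifier μ ρ) (hu : LipschitzWith Ku u)
    (hY : LipschitzWith KY Y) (hA : LipschitzWith KA A)
    (hAu : ∀ᵐ z ∂μ, fderiv ℝ u z (A z) = Y z) : ∃ C : ℝ, 0 ≤ C ∧ ∀ h > 0, ∀ z,
      ‖fderiv ℝ (mollify μ ρ h u) z‖ ≤ C ∧ (DifferentiableAt ℝ A z →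
      ‖fderiv ℝ (fun z => fderiv ℝ (mollify μ ρ h u) z (A z)) z‖ ≤ C) := by
  obtain ⟨C, hC⟩ := hρ.exists_bound
  have hC0 : 0 ≤ C := (abs_nonneg _).trans (hC 0).1
  set b := μ.real (Metric.closedBall (0 : V) 1)
  have key : ∀ {Φ : V → ℝ} {M : ℝ}, (∀ y ∉ Metric.closedBall (0 : V) 1, Φ y = 0) →
      (∀ y ∈ Metric.closedBall (0 : V) 1, ‖Φ y‖ ≤ M) → |∫ y, Φ y ∂μ| ≤ M * b := by
    intro Φ M h0 hM
    rw [← setIntegral_eq_integral_of_forall_compl_eq_zero h0]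
    exact norm_setIntegral_le_of_norm_le_const measure_closedBall_lt_top hM
  have hGu : ∀ w a, |fderiv ℝ u w a| ≤ Ku * ‖a‖ := fun w a =>
    (ContinuousLinearMap.le_opNorm _ _).trans
      (mul_le_mul_of_nonneg_right (norm_fderiv_le_of_lipschitz ℝ hu) (norm_nonneg _))
  have hGY : ∀ w a, |fderiv ℝ Y w a| ≤ KY * ‖a‖ := fun w a =>
    (ContinuousLinearMap.le_opNorm _ _).trans
      (mul_le_mul_of_nonneg_right (norm_fderiv_le_of_lipschitz ℝ hY) (norm_nonneg _))
  refine ⟨max (C * Ku * b) (C * KY * b + C * Ku * KA * b + C * Ku * KA * b), by positivity,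
    fun h hh z => ⟨(?_ : _ ≤ C * Ku * b).trans (le_max_left _ _),
      fun hz => (?_ : _ ≤ C * KY * b + C * Ku * KA * b + C * Ku * KA * b).trans (le_max_right _ _)⟩⟩
  · refine ContinuousLinearMap.opNorm_le_bound _ (by positivity) fun a => ?_
    rw [fderiv_mollify_apply_eq hρ hu hh]
    refine (key (M := C * (Ku * ‖a‖)) (fun y hy => by rw [hρ.eq_zero hy, zero_mul])
      fun y _ => ?_).trans (le_of_eq (by ring))
    rw [norm_mul]
    gcongr
    · exact (hC y).1
    · exact hGu _ _
  · refine ContinuousLinearMap.opNorm_le_bound _ (by positivity) fun m => ?_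
    obtain ⟨D, hD, hD'⟩ := hasFDerivAt_mollify_along hρ hu hY hA hAu hh hz
    rw [hD.fderiv, hD', add_mul, add_mul]
    refine (norm_add_le _ _).trans (add_le_add ((norm_add_le _ _).trans (add_le_add ?_ ?_)) ?_)
    · refine (key (M := C * (KY * ‖m‖)) (fun y hy => by rw [hρ.eq_zero hy, zero_mul])
        fun y _ => ?_).trans (le_of_eq (by ring))
      rw [norm_mul]
      gcongr
      · exact (hC y).1
      · exact hGY _ _
    · refine (key (M := C * ‖m‖ * (Ku * KA)) (fun y hy => by
        rw [hρ.fderiv_eq_zero hy, _root_.zero_apply, zero_mul]) fun y hy => ?_).trans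
          (le_of_eq (by ring))
      rw [norm_mul]
      gcongr
      · exact (ContinuousLinearMap.le_opNorm _ _).trans (by gcongr; exact (hC y).2)
      · refine (hGu _ _).trans ?_
        gcongr
        exact norm_difference_quotient_le hA z hh hy
    · refine (key (M := C * (Ku * (KA * ‖m‖))) (fun y hy => by rw [hρ.eq_zero hy, zero_mul])
        fun y _ => ?_).trans (le_of_eq (by ring))
      rw [norm_mul]
      gcongr
      · exact (hC y).1
      · refine (hGu _ _).trans ?_
        gcongr
        exact (ContinuousLinearMap.le_opNorm _ _).trans
          (by gcongr; exact norm_fderiv_le_of_lipschitz ℝ hA)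

theorem support_mollify_subset (hρ : IsMollifier μ ρ) {h : ℝ} (hh : 0 < h) {u : V → ℝ} :
    tsupport (mollify μ ρ h u) ⊆ Metric.cthickening h (tsupport u) := by
  refine closure_minimal (fun z hz => ?_) Metric.isClosed_cthickening
  by_contra hn
  refine hz ?_
  rw [mollify]
  refine integral_eq_zero_of_ae (Eventually.of_forall fun y => ?_)
  by_cases hy : y ∈ Metric.closedBall (0 : V) 1
  · have : z - h • y ∉ tsupport u := fun hm => hn (Metric.mem_cthickening_of_dist_le z _ h _ hm (by
      rw [dist_eq_norm, sub_sub_cancel, norm_smul, Real.norm_of_nonneg hh.le]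
      have := mem_closedBall_zero_iff.1 hy
      nlinarith))
    simp [image_eq_zero_of_notMem_tsupport this]
  · simp [hρ.eq_zero hy]

end mollify

end RoughXRay
end

/-! ### The energy inequality for Lipschitz functions -/

noncomputable section
namespace RoughXRay
variable {n : ℕ} {g : E n → Matrix (Fin n) (Fin n) ℝ}

theorem exists_truncation {R : ℝ} (hR : 0 < R) : ∃ φ : E n → ℝ, (∃ K, LipschitzWith K fun v => φ v • v) ∧
    (∃ B : ℝ, 0 ≤ B ∧ ∀ v, ‖φ v • v‖ ≤ B) ∧ (∀ v, ‖v‖ ≤ R → φ v = 1) ∧ (∀ v, 2 * R ≤ ‖v‖ → φ v = 0) ∧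
    ∀ v, φ (-v) = φ v := by
  let φ : ContDiffBump (0 : E n) := ⟨R, 2 * R, hR, by linarith⟩
  have hs : ContDiff ℝ 1 fun v : E n => φ v • v := φ.contDiff.smul contDiff_id
  have hc : HasCompactSupport fun v : E n => φ v • v := φ.hasCompactSupport.smul_right
  obtain ⟨B, hB⟩ := hc.exists_bound_of_continuous hs.continuous
  refine ⟨φ, ?_, ⟨B, (norm_nonneg _).trans (hB 0), hB⟩, fun v hv => ?_, fun v hv => ?_,
    fun v => φ.neg v⟩
  · exact hs.lipschitzWith_of_hasCompactSupport hc one_ne_zero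
  · exact φ.one_of_mem_closedBall (mem_closedBall_zero_iff.2 hv)
  · exact φ.zero_of_le_dist (by simpa using hv)

/-- A bounded Lipschitz vector field on phase space that is the geodesic vector field at
velocities at most `R`. -/
theorem exists_truncated_spray (c : Conn g) {R : ℝ} (hR : 0 < R) :
    ∃ (A : E n × E n → E n × E n) (φ : E n → ℝ), (∃ K, LipschitzWith K A) ∧
      (∃ B : ℝ, 0 ≤ B ∧ ∀ z, ‖A z‖ ≤ B) ∧ (∀ z, A z = φ z.2 • spray c z) ∧
      (∀ v, ‖v‖ ≤ R → φ v = 1) ∧ ∀ v, φ (-v) = φ v := by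
  obtain ⟨φ, ⟨K₁, hK₁⟩, ⟨B₁, hB₁0, hB₁⟩, hφ1, hφ0, hφn⟩ := exists_truncation (n := n) hR
  obtain ⟨ψ, ⟨K₂, hK₂⟩, ⟨B₂, hB₂0, hB₂⟩, hψ1, -, -⟩ :=
    exists_truncation (n := n) (R := 2 * R) (by positivity)
  set θ₁ : E n → E n := fun v => φ v • v
  set θ₂ : E n → E n := fun v => ψ v • v
  obtain ⟨L, hL⟩ := c.lip
  obtain ⟨M, hM⟩ := c.bdd
  have hM0 : 0 ≤ M := (norm_nonneg _).trans (hM 0)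
  have hΓ : ∀ x a b, ‖c.Γ x a b‖ ≤ M * ‖a‖ * ‖b‖ := fun x a b =>
    (ContinuousLinearMap.le_opNorm₂ _ _ _).trans (by gcongr; exact hM x)
  -- The second cutoff is 1 where the first is nonzero. So the field is exactly `φ(v)` times the
  -- spray, while each of its factors is bounded and Lipschitz.
  refine ⟨fun z => (θ₁ z.2, -c.Γ z.1 (θ₁ z.2) (θ₂ z.2)), φ, ?_, ⟨max B₁ (M * B₁ * B₂), by positivity,
    fun z => ?_⟩, fun z => ?_, hφ1, hφn⟩
  · refine ⟨max K₁ (L * ⟨B₁, hB₁0⟩ * ⟨B₂, hB₂0⟩ + (⟨M, hM0⟩ * K₁ * ⟨B₂, hB₂0⟩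
      + ⟨M, hM0⟩ * ⟨B₁, hB₁0⟩ * K₂)), LipschitzWith.of_dist_le_mul fun z w => ?_⟩
    have h1 : ‖θ₁ z.2 - θ₁ w.2‖ ≤ K₁ * dist z w := by
      rw [← dist_eq_norm]
      exact (hK₁.dist_le_mul _ _).trans (by gcongr; exact le_max_right _ _)
    have h3 : ‖θ₂ z.2 - θ₂ w.2‖ ≤ K₂ * dist z w := by
      rw [← dist_eq_norm]
      exact (hK₂.dist_le_mul _ _).trans (by gcongr; exact le_max_right _ _)
    have h2 : ‖c.Γ z.1 - c.Γ w.1‖ ≤ L * dist z w := by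
      rw [← dist_eq_norm]
      exact (hL.dist_le_mul _ _).trans (by gcongr; exact le_max_left _ _)
    rw [Prod.dist_eq]
    push_cast
    rw [max_mul_of_nonneg _ _ dist_nonneg]
    refine max_le_max (by rw [dist_eq_norm]; exact h1) ?_
    simp only [dist_neg_neg]
    rw [dist_eq_norm]
    have e : c.Γ z.1 (θ₁ z.2) (θ₂ z.2) - c.Γ w.1 (θ₁ w.2) (θ₂ w.2)
        = (c.Γ z.1 - c.Γ w.1) (θ₁ z.2) (θ₂ z.2)
          + (c.Γ w.1 (θ₁ z.2 - θ₁ w.2) (θ₂ z.2) + c.Γ w.1 (θ₁ w.2) (θ₂ z.2 - θ₂ w.2)) := by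
      simp [map_sub]
    rw [e, add_mul, add_mul]
    refine (norm_add_le _ _).trans (add_le_add ?_ ((norm_add_le _ _).trans (add_le_add ?_ ?_)))
    · refine (ContinuousLinearMap.le_opNorm₂ _ _ _).trans ?_
      calc _ ≤ (L * dist z w) * B₁ * B₂ := by
            gcongr
            · exact hB₁ _
            · exact hB₂ _
        _ = L * B₁ * B₂ * dist z w := by ring
    · refine (hΓ _ _ _).trans ?_
      calc _ ≤ M * (K₁ * dist z w) * B₂ := by
            gcongr
            exact hB₂ _
        _ = M * K₁ * B₂ * dist z w := by ring
    · refine (hΓ _ _ _).trans ?_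
      calc _ ≤ M * B₁ * (K₂ * dist z w) := by
            gcongr
            exact hB₁ _
        _ = M * B₁ * K₂ * dist z w := by ring
  · rw [Prod.norm_def]
    refine max_le_max (hB₁ _) ?_
    rw [norm_neg]
    refine (hΓ _ _ _).trans ?_
    gcongr
    · exact hB₁ _
    · exact hB₂ _
  · by_cases hz : ‖z.2‖ ≤ 2 * R
    · have h2 : θ₂ z.2 = z.2 := by simp only [θ₂, hψ1 _ hz, one_smul]
      simp only [h2, θ₁, spray, map_smul, _root_.smul_apply, Prod.smul_mk, smul_neg]
    · have h0 := hφ0 z.2 (not_le.1 hz).le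
      simp [θ₁, h0]

theorem norm_vD_le (f : E n × E n → ℝ) (z : E n × E n) : ‖vD f z‖ ≤ ‖fderiv ℝ f z‖ := by
  refine ContinuousLinearMap.opNorm_le_bound _ (norm_nonneg _) fun ζ => ?_
  rw [vD_apply]
  refine (ContinuousLinearMap.le_opNorm _ _).trans (le_of_eq ?_)
  simp [Prod.norm_def]

theorem tendsto_clm_of_apply {ι : Type*} {l : Filter ι} {α : ι → E n →L[ℝ] ℝ} {β : E n →L[ℝ] ℝ}
    (h : ∀ a, Tendsto (fun i => α i a) l (𝓝 (β a))) : Tendsto α l (𝓝 β) := by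
  have h1 : Tendsto (fun i => ∑ j, α i (bv j) • (cproj j : E n →L[ℝ] ℝ)) l
      (𝓝 (∑ j, β (bv j) • (cproj j : E n →L[ℝ] ℝ))) :=
    tendsto_finsetSum _ fun j _ => (h (bv j)).smul_const _
  simpa only [sum_coord_smul_cproj] using h1

theorem tendsto_coN {ι : Type*} {l : Filter ι} {α : ι → E n →L[ℝ] ℝ} {β : E n →L[ℝ] ℝ}
    (h : Tendsto α l (𝓝 β)) (z : E n × E n) :
    Tendsto (fun i => coN g z (α i)) l (𝓝 (coN g z β)) := by
  unfold coN
  have h1 : Tendsto (fun i => α i (sharp g z.1 (α i))) l (𝓝 (β (sharp g z.1 β))) :=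
    (isBoundedBilinearMap_apply.continuous.tendsto (β, sharp g z.1 β)).comp
      (h.prodMk_nhds (((sharp g z.1).continuous.tendsto β).comp h))
  have h2 : Tendsto (fun i => α i z.2) l (𝓝 (β z.2)) :=
    ((ContinuousLinearMap.apply ℝ ℝ z.2).continuous.tendsto β).comp h
  exact h1.sub ((h2.pow 2).div_const _)

theorem tendsto_energy {ι : Type*} {l : Filter ι} {α η : ι → E n →L[ℝ] ℝ} {β θ : E n →L[ℝ] ℝ}
    {y : ι → ℝ} {y0 : ℝ} (hy : Tendsto y l (𝓝 y0)) (hη : Tendsto η l (𝓝 θ))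
    (h : Tendsto α l (𝓝 β)) (ε : ℝ) (z : E n × E n) :
    Tendsto (fun i => energy g ε z (y i) (η i) (α i)) l (𝓝 (energy g ε z y0 θ β)) := by
  unfold energy
  exact ((tendsto_coN hη z).sub (((hy.pow 2).const_mul _).div_const _)).sub
    (((tendsto_coN h z).const_mul _).const_mul _)

/-- The energy density is bounded over compact sets. -/
theorem exists_bound_energy (hg : IsC11Metric g) (ε : ℝ) {K : Set (E n × E n)} (hK : IsCompact K)
    (hKs : K ⊆ slit n) : ∃ C : ℝ, 0 ≤ C ∧ ∀ z ∈ K, ∀ y η α,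
      |(g z.1).det * energy g ε z y η α| ≤ C * (y ^ 2 + ‖η‖ ^ 2 + ‖α‖ ^ 2) := by
  obtain ⟨CN, hCN0, hCN⟩ := exists_bound_coN hg
  have hqc : ContinuousOn (speedSq g) K := by
    have h := (continuousOn_ip hg).mono
      (show K ⊆ ball n ×ˢ univ from fun z hz => ⟨(hKs hz).1, trivial⟩)
    have e : speedSq g = fun p => ip g p.1 p.2 p.2 := funext fun z => gF_apply _ _ _
    exact e ▸ h
  have hq0 : ∀ z ∈ K, speedSq g z ≠ 0 := fun z hz => (gF_pos hg (hKs hz).1 (hKs hz).2).ne'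
  obtain ⟨Q, hQ⟩ := hK.exists_bound_of_continuousOn hqc
  obtain ⟨Q', hQ'⟩ := hK.exists_bound_of_continuousOn
    (hqc.inv₀ hq0)
  obtain ⟨D, hD⟩ := isCompact_ball.exists_bound_of_continuousOn (contDiffOn_det_g hg).continuousOn
  have hD0 : 0 ≤ D := (norm_nonneg _).trans (hD 0 (by simp [ball]))
  set C := |(n:ℝ) - 1| * |Q'| + CN + |ε| * (|Q| * CN) with hC
  refine ⟨D * C, by positivity, fun z hz y η α => ?_⟩
  have hN : ∀ α, |coN g z α| ≤ CN * ‖α‖ ^ 2 := fun α => by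
    rw [abs_of_nonneg (coN_nonneg hg (hKs hz).1 (hKs hz).2 α)]
    exact hCN z (hKs hz).1 (hKs hz).2 α
  rw [abs_mul, mul_assoc]
  refine mul_le_mul (hD _ (hKs hz).1) ?_ (abs_nonneg _) hD0
  rw [energy]
  have e1 : |((n:ℝ) - 1) * y ^ 2 / speedSq g z| ≤ |(n:ℝ) - 1| * |Q'| * y ^ 2 := by
    rw [div_eq_mul_inv, abs_mul, abs_mul, abs_of_nonneg (sq_nonneg y)]
    have : |(speedSq g z)⁻¹| ≤ |Q'| := (hQ' z hz).trans (le_abs_self _)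
    calc _ ≤ |(n:ℝ) - 1| * y ^ 2 * |Q'| := by gcongr
      _ = _ := by ring
  have e2 : |ε * (speedSq g z * coN g z α)| ≤ |ε| * (|Q| * CN) * ‖α‖ ^ 2 := by
    rw [abs_mul, abs_mul]
    have : |speedSq g z| ≤ |Q| := (hQ z hz).trans (le_abs_self _)
    calc _ ≤ |ε| * (|Q| * (CN * ‖α‖ ^ 2)) := by gcongr; exact hN α
      _ = _ := by ring
  refine (abs_sub _ _).trans ((add_le_add ((abs_sub _ _).trans (add_le_add (hN η) e1)) e2).trans ?_)
  have p1 : 0 ≤ |(n:ℝ) - 1| * |Q'| := by positivity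
  have p2 : 0 ≤ |ε| * (|Q| * CN) := by positivity
  have s1 := sq_nonneg y
  have s2 := sq_nonneg ‖η‖
  have s3 := sq_nonneg ‖α‖
  have m1 := mul_nonneg p1 s2
  have m2 := mul_nonneg p1 s3
  have m3 := mul_nonneg hCN0 s1
  have m4 := mul_nonneg hCN0 s3
  have m5 := mul_nonneg p2 s1
  have m6 := mul_nonneg p2 s2
  rw [hC]
  linarith

/-- The energy inequality for Lipschitz functions whose derivative along the geodesic vector field
is Lipschitz. -/
theorem integral_energy_nonneg_of_lipschitz (c : Conn g) (hg : IsC11Metric g) (hn : 1 ≤ n) {ε : ℝ}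
    (hε : ∀ W : H10 g, ε * ipL2 g W.sec W.sec ≤ quadForm g W) {u Y : E n × E n → ℝ} {Ku KY : NNReal}
    (hu : LipschitzWith Ku u) (hcu : HasCompactSupport u) (hsu : tsupport u ⊆ slitI n)
    (hY : LipschitzWith KY Y) (huY : ∀ᵐ z, fderiv ℝ u z (spray c z) = Y z) :
    Integrable (fun z => (g z.1).det * energy g ε z (Y z) (vD Y z) (vD u z)) ∧
      0 ≤ ∫ z, (g z.1).det * energy g ε z (Y z) (vD Y z) (vD u z) := by
  obtain ⟨δ, hδ, hδs⟩ := hcu.isCompact.exists_cthickening_subset_open isOpen_slitI hsu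
  set K' := Metric.cthickening δ (tsupport u) with hK'
  have hK'c : IsCompact K' := hcu.isCompact.cthickening
  obtain ⟨R, hR⟩ := hK'c.isBounded.exists_norm_le
  obtain ⟨A, φ, ⟨KA, hA⟩, ⟨B, hB0, hB⟩, hAs, hφ1, -⟩ :=
    exists_truncated_spray c (R := max R 1) (by positivity)
  have hAK : ∀ z ∈ K', A z = spray c z := fun z hz => by
    rw [hAs z, hφ1 _ ((norm_snd_le z).trans ((hR z hz).trans (le_max_left _ _))), one_smul]
  obtain ⟨ρ, hρ⟩ := exists_isMollifier (volume : Measure (E n × E n))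
  have hAu : ∀ᵐ z, fderiv ℝ u z (A z) = Y z := by
    filter_upwards [huY] with z hz
    by_cases hzs : z ∈ tsupport u
    · rw [hAK z (Metric.self_subset_cthickening _ hzs), hz]
    · rw [← hz, fderiv_of_notMem_tsupport hzs, _root_.zero_apply, _root_.zero_apply]
  obtain ⟨C, hC0, hC⟩ := exists_bound_mollify hρ hu hY hA hAu
  obtain ⟨D, hD0, hD⟩ := exists_bound_energy hg ε hK'c
    fun z hz => ⟨inner_subset_ball (hδs hz).1, (hδs hz).2⟩
  -- Scales at most `δ` keep the supports of the mollifications in the fixed compact set `K'` off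
  -- the boundary and off the zero section.
  set h : ℕ → ℝ := fun k => δ * (1 / ((k:ℝ) + 1)) with hh
  have hpos : ∀ k, 0 < h k := fun k => by positivity
  have hle : ∀ k, h k ≤ δ := fun k => by
    refine mul_le_of_le_one_right hδ.le ?_
    rw [div_le_one (by positivity)]
    linarith [(Nat.cast_nonneg k : (0:ℝ) ≤ k)]
  have hlim : Tendsto h atTop (𝓝[>] (0:ℝ)) := by
    refine tendsto_nhdsWithin_iff.2 ⟨?_, Eventually.of_forall hpos⟩
    simpa only [mul_zero] using (tendsto_one_div_add_atTop_nhds_zero_nat (𝕜 := ℝ)).const_mul δ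
  set U : ℕ → E n × E n → ℝ := fun k => mollify volume ρ (h k) u with hU
  have hUsm : ∀ k, ContDiff ℝ 2 (U k) := fun k =>
    (contDiff_mollify hρ (hpos k) hu.continuous.locallyIntegrable).of_le (by norm_cast)
  have hUs : ∀ k, tsupport (U k) ⊆ K' := fun k =>
    (support_mollify_subset hρ (hpos k)).trans (Metric.cthickening_mono (hle k) _)
  have hUc : ∀ k, HasCompactSupport (U k) := fun k =>
    hK'c.of_isClosed_subset (isClosed_tsupport _) (hUs k)
  -- The globally Lipschitz field `A` stands in for the spray: the two agree on `K'`, and off `K'`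
  -- the derivative of `U k` is zero.
  have hXD : ∀ k, XD c (U k) = fun z => fderiv ℝ (U k) z (A z) := by
    intro k
    funext z
    by_cases hz : z ∈ K'
    · rw [XD, hAK z hz]
    · rw [XD, fderiv_of_notMem_tsupport fun h => hz (hUs k h), _root_.zero_apply,
        _root_.zero_apply]
  have hint := fun k => integral_energy_nonneg c hg (hUsm k) (hUc k) ((hUs k).trans hδs) hn hε
  set bd : E n × E n → ℝ := K'.indicator fun _ => D * ((C * B) ^ 2 + C ^ 2 + C ^ 2) with hbd
  have hbi : Integrable bd := by
    rw [hbd, integrable_indicator_iff hK'c.isClosed.measurableSet]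
    exact integrableOn_const hK'c.measure_lt_top.ne
  have hbound : ∀ k, ∀ᵐ z : E n × E n, ‖(g z.1).det *
      energy g ε z (XD c (U k) z) (vD (XD c (U k)) z) (vD (U k) z)‖ ≤ bd z := by
    intro k
    filter_upwards [hA.ae_differentiableAt (μ := volume)] with z hzA
    obtain ⟨b1, b2⟩ := hC (h k) (hpos k) z
    have b2 := b2 hzA
    by_cases hz : z ∈ K'
    · rw [hbd, indicator_of_mem hz]
      refine (hD z hz _ _ _).trans ?_
      gcongr ?_ * (?_ + ?_ + ?_)
      · rw [hXD k, ← sq_abs]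
        have : |fderiv ℝ (U k) z (A z)| ≤ C * B :=
          (ContinuousLinearMap.le_opNorm _ _).trans (mul_le_mul b1 (hB z) (norm_nonneg _) hC0)
        gcongr
      · have : ‖vD (XD c (U k)) z‖ ≤ C := (norm_vD_le _ _).trans (by rw [hXD k]; exact b2)
        gcongr
      · have : ‖vD (U k) z‖ ≤ C := (norm_vD_le _ _).trans b1
        gcongr
    · have hz' : z ∉ tsupport (U k) := fun h => hz (hUs k h)
      have h1 : XD c (U k) z = 0 := by rw [XD, fderiv_of_notMem_tsupport hz', _root_.zero_apply]
      have h2 : vD (XD c (U k)) z = 0 := by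
        have h : fderiv ℝ (XD c (U k)) z = 0 :=
          fderiv_of_notMem_tsupport fun h => hz' (tsupport_fderiv_apply_subset _ h)
        rw [vD, h, ContinuousLinearMap.zero_comp]
      have h3 : vD (U k) z = 0 := by
        rw [vD, fderiv_of_notMem_tsupport hz', ContinuousLinearMap.zero_comp]
      rw [h1, h2, h3, hbd, indicator_of_notMem hz]
      simp [energy, coN]
  have htend : ∀ᵐ z : E n × E n, Tendsto (fun k => (g z.1).det *
      energy g ε z (XD c (U k) z) (vD (XD c (U k)) z) (vD (U k) z)) atTop
      (𝓝 ((g z.1).det * energy g ε z (Y z) (vD Y z) (vD u z))) := by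
    filter_upwards [ae_tendsto_fderiv_mollify hρ hu,
      ae_tendsto_fderiv_mollify_along hρ hu hY hA hAu, hAu] with z h1 h2 h3
    refine (tendsto_energy ?_ (tendsto_clm_of_apply fun a => ?_)
      (tendsto_clm_of_apply fun a => ?_) ε z).const_mul _
    · simp only [hXD, ← h3]
      exact (h1 (A z)).comp hlim
    · simp only [hXD, vD_apply]
      exact (h2 (0, a)).comp hlim
    · simp only [vD_apply]
      exact (h1 (0, a)).comp hlim
  have hlimI := tendsto_integral_of_dominated_convergence bd
    (fun k => (hint k).1.aestronglyMeasurable) hbi hbound htend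
  refine ⟨hbi.mono' (aestronglyMeasurable_of_tendsto_ae _
    (fun k => (hint k).1.aestronglyMeasurable) htend) ?_, ge_of_tendsto' hlimI fun k => (hint k).2⟩
  filter_upwards [htend, ae_all_iff.2 hbound] with z h1 h2
  exact le_of_tendsto' h1.norm h2

end RoughXRay
end

/-! ### The geodesic flow -/

noncomputable section
namespace RoughXRay
variable {n : ℕ} {g : E n → Matrix (Fin n) (Fin n) ℝ}

section ode
variable {V : Type*} [NormedAddCommGroup V] [NormedSpace ℝ V] {A : V → V} {K : NNReal}

/-- Solutions of an autonomous Lipschitz differential equation that agree at one time agree. -/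
theorem eqOn_of_hasDerivWithinAt (hA : LipschitzWith K A) {w w' : ℝ → V} {a b s : ℝ}
    (hs : s ∈ Icc a b) (hw : ∀ t ∈ Icc a b, HasDerivWithinAt w (A (w t)) (Icc a b) t)
    (hw' : ∀ t ∈ Icc a b, HasDerivWithinAt w' (A (w' t)) (Icc a b) t) (h : w s = w' s) :
    EqOn w w' (Icc a b) := by
  have hc : ∀ w : ℝ → V, (∀ t ∈ Icc a b, HasDerivWithinAt w (A (w t)) (Icc a b) t) →
      ContinuousOn w (Icc a b) := fun w hw t ht => (hw t ht).continuousWithinAt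
  have hr : ∀ w : ℝ → V, (∀ t ∈ Icc a b, HasDerivWithinAt w (A (w t)) (Icc a b) t) →
      ∀ t ∈ Ico s b, HasDerivWithinAt w (A (w t)) (Ici t) t := fun w hw t ht =>
    (hw t ⟨hs.1.trans ht.1, ht.2.le⟩).mono_of_mem_nhdsWithin
      (Icc_mem_nhdsGE_of_mem ⟨hs.1.trans ht.1, ht.2⟩)
  have hl : ∀ w : ℝ → V, (∀ t ∈ Icc a b, HasDerivWithinAt w (A (w t)) (Icc a b) t) →
      ∀ t ∈ Ioc a s, HasDerivWithinAt w (A (w t)) (Iic t) t := fun w hw t ht =>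
    (hw t ⟨ht.1.le, ht.2.trans hs.2⟩).mono_of_mem_nhdsWithin
      (Icc_mem_nhdsLE_of_mem ⟨ht.1, ht.2.trans hs.2⟩)
  rw [← Icc_union_Icc_eq_Icc hs.1 hs.2]
  refine EqOn.union ?_ ?_
  · exact ODE_solution_unique_of_mem_Icc_left (v := fun _ => A) (s := fun _ => univ)
      (fun t _ => hA.lipschitzOnWith) ((hc w hw).mono (Icc_subset_Icc_right hs.2)) (hl w hw)
      (fun _ _ => trivial) ((hc w' hw').mono (Icc_subset_Icc_right hs.2)) (hl w' hw')
      (fun _ _ => trivial) h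
  · exact ODE_solution_unique (v := fun _ => A)
      (fun t => hA) ((hc w hw).mono (Icc_subset_Icc_left hs.1)) (hr w hw)
      ((hc w' hw').mono (Icc_subset_Icc_left hs.1)) (hr w' hw') h

/-- A bounded Lipschitz vector field has a global flow. -/
theorem exists_flow [CompleteSpace V] (hA : LipschitzWith K A) {B : NNReal} (hB : ∀ z, ‖A z‖ ≤ B) :
    ∃ Φ : V → ℝ → V, ∀ z, Φ z 0 = z ∧ ∀ t, HasDerivAt (Φ z) (A (Φ z t)) t := by
  have key : ∀ (z : V) (T : NNReal), ∃ α : ℝ → V, α 0 = z ∧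
      ∀ t ∈ Icc (-(T:ℝ)) T, HasDerivWithinAt α (A (α t)) (Icc (-(T:ℝ)) T) t := by
    intro z T
    -- With radius `B * T` a solution of speed at most `B` cannot leave the ball within time `T`, so
    -- the solution interval is not shortened.
    have hp : IsPicardLindelof (fun _ => A) (⟨0, by simp⟩ : Icc (-(T:ℝ)) T) z (B * T) 0 B K :=
      { lipschitzOnWith := fun t _ => hA.lipschitzOnWith
        continuousOn := fun x _ => continuousOn_const
        norm_le := fun t _ x _ => hB x
        mul_max_le := by simp }
    exact hp.exists_eq_forall_mem_Icc_hasDerivWithinAt₀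
  choose α hα0 hα using key
  have hag : ∀ z (S T : NNReal), S ≤ T → EqOn (α z S) (α z T) (Icc (-(S:ℝ)) S) := by
    intro z S T hST
    have hsub : Icc (-(S:ℝ)) S ⊆ Icc (-(T:ℝ)) T :=
      Icc_subset_Icc (neg_le_neg (by exact_mod_cast hST)) (by exact_mod_cast hST)
    exact eqOn_of_hasDerivWithinAt hA (s := 0) (by simp) (hα z S)
      (fun t ht => (hα z T t (hsub ht)).mono hsub) (by rw [hα0, hα0])
  -- The solution used at time `t` lives on a window exceeding `|t|` by one; near `t` all these
  -- agree with the one on the window `|t| + 2`, which is differentiable there.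
  refine ⟨fun z t => α z (‖t‖₊ + 1) t, fun z => ⟨hα0 _ _, fun t => ?_⟩⟩
  set T : NNReal := ‖t‖₊ + 2
  have hT : (T:ℝ) = |t| + 2 := by simp [T]
  have hnear : ∀ s, |s - t| < 1 → α z (‖s‖₊ + 1) s = α z T s := by
    intro s hs
    refine hag z _ _ ?_ (abs_le.1 ?_)
    · rw [← NNReal.coe_le_coe, hT]
      push_cast
      have := abs_sub_abs_le_abs_sub s t
      rw [Real.norm_eq_abs]; linarith
    · push_cast; rw [Real.norm_eq_abs]; linarith
  have hmem : Icc (-(T:ℝ)) T ∈ 𝓝 t :=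
    Icc_mem_nhds (by rw [hT]; linarith [neg_abs_le t]) (by rw [hT]; linarith [le_abs_self t])
  have h := (hα z T t (mem_of_mem_nhds hmem)).hasDerivAt hmem
  rw [← hnear t (by simp)] at h
  refine h.congr_of_eventuallyEq ?_
  filter_upwards [Metric.ball_mem_nhds t one_pos] with s hs
  exact hnear s (by simpa [Real.dist_eq] using hs)

end ode

/-- The complete flow of a bounded Lipschitz vector field that is the geodesic vector field at unit
vectors. -/
structure GeoFlow (c : Conn g) where
  A : E n × E n → E n × E n
  φ : E n → ℝ
  Φ : E n × E n → ℝ → E n × E n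
  K : NNReal
  B : NNReal
  lip : LipschitzWith K A
  bdd : ∀ z, ‖A z‖ ≤ B
  A_eq : ∀ z, A z = φ z.2 • spray c z
  φ_SM : ∀ z ∈ SM g, φ z.2 = 1
  φ_neg : ∀ v, φ (-v) = φ v
  zero : ∀ z, Φ z 0 = z
  deriv : ∀ z t, HasDerivAt (Φ z) (A (Φ z t)) t

theorem exists_geoFlow (c : Conn g) (hg : IsC11Metric g) : Nonempty (GeoFlow c) := by
  obtain ⟨R, hR⟩ := (isCompact_SM hg).exists_bound_of_continuousOn
    (continuous_snd (X := E n) (Y := E n)).continuousOn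
  obtain ⟨A, φ, ⟨K, hK⟩, ⟨B, hB0, hB⟩, hA, hφ, hφn⟩ :=
    exists_truncated_spray c (R := max R 1) (by positivity)
  obtain ⟨Φ, hΦ⟩ := exists_flow hK (B := ⟨B, hB0⟩) hB
  exact ⟨⟨A, φ, Φ, K, ⟨B, hB0⟩, hK, hB, hA, fun z hz => hφ _ ((hR z hz).trans (le_max_left _ _)),
    hφn, fun z => (hΦ z).1, fun z => (hΦ z).2⟩⟩

/-- Reversal of the direction. -/
def flip (z : E n × E n) : E n × E n := (z.1, -z.2)

@[simp] lemma flip_fst (z : E n × E n) : (flip z).1 = z.1 := rfl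
@[simp] lemma flip_snd (z : E n × E n) : (flip z).2 = -z.2 := rfl
@[simp] lemma flip_flip (z : E n × E n) : flip (flip z) = z := by simp [flip]

lemma flip_mem_SM {z : E n × E n} (hz : z ∈ SM g) : flip z ∈ SM g :=
  ⟨hz.1, by have := hz.2; rw [← gF_apply] at this ⊢; simpa using this⟩

lemma dist_flip (z w : E n × E n) : dist (flip z) (flip w) = dist z w := by
  simp [flip, Prod.dist_eq]

lemma hasDerivWithinAt_fst {w : ℝ → E n × E n} {w' : E n × E n} {s : Set ℝ} {t : ℝ}
    (h : HasDerivWithinAt w w' s t) : HasDerivWithinAt (fun t => (w t).1) w'.1 s t := by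
  have := (ContinuousLinearMap.fst ℝ (E n) (E n)).hasFDerivAt.comp_hasDerivWithinAt t h
  exact this

lemma hasDerivWithinAt_snd {w : ℝ → E n × E n} {w' : E n × E n} {s : Set ℝ} {t : ℝ}
    (h : HasDerivWithinAt w w' s t) : HasDerivWithinAt (fun t => (w t).2) w'.2 s t := by
  have := (ContinuousLinearMap.snd ℝ (E n) (E n)).hasFDerivAt.comp_hasDerivWithinAt t h
  exact this

lemma hasDerivAt_flip {w : ℝ → E n × E n} {w' : E n × E n} {t : ℝ}
    (h : HasDerivAt w w' t) : HasDerivAt (fun t => flip (w t)) (flip w') t := by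
  rw [← hasDerivWithinAt_univ] at h ⊢
  exact (hasDerivWithinAt_fst h).prodMk (hasDerivWithinAt_snd h).neg

namespace GeoFlow
variable {c : Conn g} (F : GeoFlow c)

lemma continuous (z : E n × E n) : Continuous (F.Φ z) :=
  continuous_iff_continuousAt.2 fun t => (F.deriv z t).continuousAt

lemma eq_of_hasDerivAt {w : ℝ → E n × E n} (hw : ∀ t, HasDerivAt w (F.A (w t)) t) (t : ℝ) :
    w t = F.Φ (w 0) t :=
  eqOn_of_hasDerivWithinAt F.lip (s := 0) (a := min 0 t) (b := max 0 t) (by simp)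
    (fun t _ => (hw t).hasDerivWithinAt) (fun t _ => (F.deriv _ t).hasDerivWithinAt)
    (F.zero _).symm (by simp)

lemma add (z : E n × E n) (s t : ℝ) : F.Φ (F.Φ z s) t = F.Φ z (s + t) := by
  have h := F.eq_of_hasDerivAt (w := fun t => F.Φ z (s + t))
    (fun t => (F.deriv z (s + t)).comp_const_add s t) t
  simpa using h.symm

/-- Reversibility of geodesics. The truncated field inherits it because its cutoff is even. -/
lemma flip_eq (z : E n × E n) (t : ℝ) : F.Φ (flip z) t = flip (F.Φ z (-t)) := by
  have h := F.eq_of_hasDerivAt (w := fun t => flip (F.Φ z (-t))) (fun t => ?_) t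
  · simpa [F.zero] using h.symm
  have h1 : HasDerivAt (fun t => F.Φ z (-t)) (-F.A (F.Φ z (-t))) t := by
    have := (F.deriv z (-t)).scomp t (hasDerivAt_neg t)
    rw [neg_one_smul] at this
    exact this
  refine (hasDerivAt_flip h1).congr_deriv ?_
  simp [F.A_eq, flip, spray, F.φ_neg]

lemma spray_eq {z : E n × E n} (hz : z ∈ SM g) : F.A z = spray c z := by
  rw [F.A_eq, F.φ_SM z hz, one_smul]

lemma spray_snd {x : E n} (hx : x ∈ ball n) (v : E n) :
    (WithLp.toLp 2 fun l => -∑ j, ∑ k, christoffel g l j k x * v j * v k) = -c.Γ x v v := by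
  ext l
  simp [c.apply_eq hx]

/-- Unit speed geodesics stay in `SM`, where the truncation is inactive, so uniqueness for the
Lipschitz field applies. -/
lemma eqOn_of_isGeodesicOn {γ V : ℝ → E n} {a b s : ℝ} (h : IsGeodesicOn g γ V a b)
    (hs : s ∈ Icc a b) : ∀ t ∈ Icc a b, (γ t, V t) = F.Φ (γ s, V s) (t - s) := by
  have h0 : ∀ t ∈ Icc a b, HasDerivWithinAt (fun t => (γ t, V t)) (F.A (γ t, V t)) (Icc a b) t := by
    intro t ht
    obtain ⟨h1, h2, h3, h4⟩ := h t ht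
    rw [F.spray_eq (show (γ t, V t) ∈ SM g from ⟨h1, h2⟩)]
    rw [spray_snd (c := c) h1] at h4
    exact h3.prodMk h4
  exact eqOn_of_hasDerivWithinAt F.lip (w := fun t => (γ t, V t))
    (w' := fun t => F.Φ (γ s, V s) (t - s)) hs h0 (fun t _ =>
    ((F.deriv (γ s, V s) (t - s)).comp_sub_const t s).hasDerivWithinAt) (by simp [F.zero])

/-- Conservation of speed by metric compatibility, which is known only over the ball; hence the
assumption on the orbit. It holds for the truncated field because that is a multiple of the spray.
-/
lemma speedSq_flow (hg : IsC11Metric g) {z : E n × E n} {a b s : ℝ} (hs : s ∈ Icc a b)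
    (h : ∀ t ∈ Icc a b, (F.Φ z (t - s)).1 ∈ ball n) :
    ∀ t ∈ Icc a b, speedSq g (F.Φ z (t - s)) = speedSq g z := by
  have hd : ∀ t ∈ Icc a b,
      HasDerivWithinAt (fun t => speedSq g (F.Φ z (t - s))) 0 (Icc a b) t := by
    intro t ht
    set w := F.Φ z (t - s) with hw
    have h0 : HasDerivWithinAt (fun t => F.Φ z (t - s)) (F.A w) (Icc a b) t :=
      ((F.deriv z (t - s)).comp_sub_const t s).hasDerivWithinAt
    have h1 := hasDerivWithinAt_fst h0
    have h2 := hasDerivWithinAt_snd h0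
    have hb : w.1 ∈ ball n := h t ht
    have hl := hasFDerivWithinAt_gF hg hb
    have h3 : HasDerivWithinAt (gF g ∘ fun t => (F.Φ z (t - s)).1)
        (fderivWithin ℝ (gF g) (ball n) w.1 (F.A w).1) (Icc a b) t :=
      HasFDerivWithinAt.comp_hasDerivWithinAt_of_eq t hl h1 (fun t ht => h t ht) rfl
    have h4 : HasDerivWithinAt (fun t => speedSq g (F.Φ z (t - s))) _ (Icc a b) t :=
      (h3.clm_apply h2).clm_apply h2
    refine h4.congr_deriv ?_
    have hc := c.compat hg hb w.2 w.2 w.2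
    have hsym := gF_symm hg hb (c.Γ w.1 w.2 w.2) w.2
    simp only [F.A_eq, spray, Prod.smul_mk, map_smul, map_neg, _root_.smul_apply,
      _root_.add_apply, _root_.neg_apply, smul_eq_mul, smul_neg, Function.comp] at hc hsym ⊢
    rw [← hw, hc, hsym]; ring
  intro t ht
  have := (convex_Icc a b).norm_image_sub_le_of_norm_hasDerivWithin_le (C := 0) hd
    (fun _ _ => by simp) hs ht
  simpa [sub_eq_zero, F.zero] using this

lemma mem_SM_iff_speedSq {z : E n × E n} : z ∈ SM g ↔ z.1 ∈ ball n ∧ speedSq g z = 1 := by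
  rw [speedSq, gF_apply]; rfl

lemma mem_SM_of_mem_ball (hg : IsC11Metric g) {z : E n × E n} (hz : z ∈ SM g) {a b s : ℝ}
    (hs : s ∈ Icc a b) (h : ∀ t ∈ Icc a b, (F.Φ z (t - s)).1 ∈ ball n) :
    ∀ t ∈ Icc a b, F.Φ z (t - s) ∈ SM g := fun t ht =>
  mem_SM_iff_speedSq.2 ⟨h t ht, by rw [F.speedSq_flow hg hs h t ht, (mem_SM_iff_speedSq.1 hz).2]⟩

lemma isGeodesicOn (hg : IsC11Metric g) {z : E n × E n} (hz : z ∈ SM g) {a b s : ℝ}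
    (hs : s ∈ Icc a b) (h : ∀ t ∈ Icc a b, (F.Φ z (t - s)).1 ∈ ball n) :
    IsGeodesicOn g (fun t => (F.Φ z (t - s)).1) (fun t => (F.Φ z (t - s)).2) a b := by
  intro t ht
  have hm := F.mem_SM_of_mem_ball hg hz hs h t ht
  have h0 : HasDerivWithinAt (fun t => F.Φ z (t - s)) (F.A (F.Φ z (t - s))) (Icc a b) t :=
    ((F.deriv z (t - s)).comp_sub_const t s).hasDerivWithinAt
  rw [F.spray_eq hm] at h0
  refine ⟨hm.1, hm.2, hasDerivWithinAt_fst h0, ?_⟩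
  rw [spray_snd (c := c) hm.1]
  exact hasDerivWithinAt_snd h0

/-- Converts existence of a geodesic into a statement about the complete flow staying in the ball,
on which the travel time arguments rest. -/
lemma mem_existenceTimes_iff (hg : IsC11Metric g) {z : E n × E n} (hz : z ∈ SM g) {t : ℝ} :
    t ∈ existenceTimes g z ↔ 0 ≤ t ∧ ∀ s ∈ Icc 0 t, (F.Φ z s).1 ∈ ball n := by
  constructor
  · rintro ⟨h0, γ, V, hγ, h1, h2⟩
    refine ⟨h0, fun s hs => ?_⟩
    have := F.eqOn_of_isGeodesicOn hγ (left_mem_Icc.2 h0) s hs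
    rw [h1, h2, sub_zero] at this
    rw [← show _ = F.Φ z s from this]
    exact (hγ s hs).1
  · rintro ⟨h0, h⟩
    have := F.isGeodesicOn hg hz (left_mem_Icc.2 h0) (fun s hs => by simpa using h s hs)
    exact ⟨h0, _, _, this, by simp [F.zero], by simp [F.zero]⟩

end GeoFlow
end RoughXRay
end

/-! ### Travel time, exit points and maximal geodesics -/

noncomputable section
namespace RoughXRay
variable {n : ℕ} {g : E n → Matrix (Fin n) (Fin n) ℝ}

lemma travelTime_nonneg (z : E n × E n) : 0 ≤ travelTime g z := Real.sSup_nonneg fun _ h => h.1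

lemma zero_mem_travel (z : E n × E n) : (0:ℝ) ∈ Icc (-travelTime g (flip z)) (travelTime g z) :=
  ⟨by linarith [travelTime_nonneg (g := g) (flip z)], travelTime_nonneg z⟩

namespace GeoFlow
variable {c : Conn g} (F : GeoFlow c)

section travel
variable (hg : IsC11Metric g) (hB : ∀ p ∈ SM g, BddAbove (existenceTimes g p))
include hg hB

lemma le_travelTime {z : E n × E n} (hz : z ∈ SM g) {t : ℝ} (h0 : 0 ≤ t)
    (h : ∀ s ∈ Icc 0 t, (F.Φ z s).1 ∈ ball n) : t ≤ travelTime g z :=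
  le_csSup (hB z hz) ((F.mem_existenceTimes_iff hg hz).2 ⟨h0, h⟩)

/-- The supremum defining the travel time is attained, because the ball is closed. -/
lemma mem_ball_of_le_travelTime {z : E n × E n} (hz : z ∈ SM g) {t : ℝ}
    (ht : t ∈ Icc 0 (travelTime g z)) : (F.Φ z t).1 ∈ ball n := by
  have hlt : ∀ s ∈ Ico 0 (travelTime g z), (F.Φ z s).1 ∈ ball n := fun s hs => by
    obtain ⟨r, hr, hsr⟩ := exists_lt_of_lt_csSup
      ⟨0, (F.mem_existenceTimes_iff hg hz).2 ⟨le_rfl, fun s hs => by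
        rw [le_antisymm hs.2 hs.1, F.zero]; exact hz.1⟩⟩ hs.2
    exact ((F.mem_existenceTimes_iff hg hz).1 hr).2 s ⟨hs.1, hsr.le⟩
  rcases (travelTime_nonneg (g := g) z).eq_or_lt with h | h
  · rw [← h] at ht
    rw [le_antisymm ht.2 ht.1, F.zero]; exact hz.1
  · have hc : IsClosed {s | (F.Φ z s).1 ∈ ball n} :=
      isClosed_ball.preimage ((F.continuous z).fst)
    have := closure_minimal (s := Ico 0 (travelTime g z)) hlt hc
    rw [closure_Ico h.ne] at this
    exact this ht

lemma mem_ball {z : E n × E n} (hz : z ∈ SM g) {t : ℝ}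
    (ht : t ∈ Icc (-travelTime g (flip z)) (travelTime g z)) : (F.Φ z t).1 ∈ ball n := by
  rcases le_total 0 t with h | h
  · exact F.mem_ball_of_le_travelTime hg hB hz ⟨h, ht.2⟩
  · have := F.mem_ball_of_le_travelTime hg hB (flip_mem_SM hz) (t := -t)
      ⟨by linarith, by linarith [ht.1]⟩
    rwa [F.flip_eq, neg_neg] at this

lemma mem_SM {z : E n × E n} (hz : z ∈ SM g) {t : ℝ}
    (ht : t ∈ Icc (-travelTime g (flip z)) (travelTime g z)) : F.Φ z t ∈ SM g := by
  have := F.mem_SM_of_mem_ball hg hz (zero_mem_travel (g := g) z)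
    (fun t ht => by rw [sub_zero]; exact F.mem_ball hg hB hz ht) t ht
  rwa [sub_zero] at this

/-- If the exit point were interior, the orbit would stay in the ball a little longer. -/
lemma exit_mem_bdry {z : E n × E n} (hz : z ∈ SM g) :
    (F.Φ z (travelTime g z)).1 ∈ bdry n := by
  by_contra hne
  have hb := F.mem_ball hg hB hz (t := travelTime g z)
    ⟨(zero_mem_travel (g := g) z).1.trans (travelTime_nonneg z), le_rfl⟩
  rw [mem_bdry_iff] at hne
  have hi : (F.Φ z (travelTime g z)).1 ∈ inner n :=
    mem_inner_iff.2 (lt_of_le_of_ne (mem_ball_iff.1 hb) hne)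
  have hn := ((F.continuous z).fst).continuousAt.preimage_mem_nhds (isOpen_inner.mem_nhds hi)
  obtain ⟨ε, hε, h⟩ := Metric.mem_nhds_iff.1 hn
  have := F.le_travelTime hg hB hz (t := travelTime g z + ε / 2)
    (by linarith [travelTime_nonneg (g := g) z]) fun s hs => by
      rcases le_total s (travelTime g z) with h1 | h1
      · exact F.mem_ball_of_le_travelTime hg hB hz ⟨hs.1, h1⟩
      · refine inner_subset_ball (h (show s ∈ Metric.ball _ _ from ?_))
        rw [Metric.mem_ball, Real.dist_eq, abs_of_nonneg (by linarith)]
        linarith [hs.2]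
  linarith

lemma travelTime_flow {z : E n × E n} (hz : z ∈ SM g) {s : ℝ}
    (hs : s ∈ Icc (-travelTime g (flip z)) (travelTime g z)) :
    travelTime g (F.Φ z s) = travelTime g z - s := by
  have hm := F.mem_SM hg hB hz hs
  refine le_antisymm ?_ (F.le_travelTime hg hB hm (by linarith [hs.2]) fun t ht => ?_)
  · by_contra! hlt
    have := F.le_travelTime hg hB hz (t := travelTime g (F.Φ z s) + s)
      (by linarith [travelTime_nonneg (g := g) z]) fun t ht => by
        rcases le_total t s with h | h
        · exact F.mem_ball hg hB hz ⟨(zero_mem_travel (g := g) z).1.trans ht.1, h.trans hs.2⟩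
        · have := F.mem_ball_of_le_travelTime hg hB hm (t := t - s)
            ⟨by linarith, by linarith [ht.2]⟩
          rwa [F.add, add_sub_cancel] at this
    linarith
  · rw [F.add]
    exact F.mem_ball hg hB hz ⟨by linarith [ht.1, hs.1], by linarith [ht.2]⟩

/-- A geodesic on a larger interval would be an orbit of the flow staying in the ball beyond one of
the two travel times. -/
lemma isMaximalGeodesic {z : E n × E n} (hz : z ∈ SM g) :
    IsMaximalGeodesic g (fun t => (F.Φ z t).1) (fun t => (F.Φ z t).2)
      (-travelTime g (flip z)) (travelTime g z) := by
  have h0 := zero_mem_travel (g := g) z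
  refine ⟨h0.1.trans h0.2, ?_, ?_⟩
  · simpa using F.isGeodesicOn hg hz h0 (fun t ht => by simpa using F.mem_ball hg hB hz ht)
  · intro γ V a b ha hb hγ h1 h2
    have h0' : (0:ℝ) ∈ Icc a b := ⟨ha.trans h0.1, h0.2.trans hb⟩
    have he := F.eqOn_of_isGeodesicOn hγ h0'
    have e1 : γ 0 = z.1 := by rw [h1 h0]; simp [F.zero]
    have e2 : V 0 = z.2 := by rw [h2 h0]; simp [F.zero]
    simp only [e1, e2, sub_zero, Prod.mk.eta] at he
    have hball : ∀ t ∈ Icc a b, (F.Φ z t).1 ∈ ball n := fun t ht => by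
      rw [← he t ht]; exact (hγ t ht).1
    constructor
    · have := F.le_travelTime hg hB (flip_mem_SM hz) (t := -a) (by linarith [h0'.1]) fun s hs => by
        rw [F.flip_eq]; exact hball _ ⟨by linarith [hs.2], by linarith [hs.1, h0'.2]⟩
      linarith
    · have := F.le_travelTime hg hB hz h0'.2 fun s hs => hball s ⟨h0'.1.trans hs.1, hs.2⟩
      linarith

-- The geodesic is part of the orbit through its initial point, which stays in the ball for the full
-- forward and backward travel times. Maximality forces the two intervals to agree, and that orbit
-- ends on the boundary.
include F in
lemma bdry_of_isMaximalGeodesic {γ V : ℝ → E n} {a b : ℝ} (h : IsMaximalGeodesic g γ V a b) :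
    γ a ∈ bdry n ∧ γ b ∈ bdry n := by
  obtain ⟨hab, hγ, hmax⟩ := h
  have ha := left_mem_Icc.2 hab
  have he := F.eqOn_of_isGeodesicOn hγ ha
  set z : E n × E n := (γ a, V a) with hzdef
  have hz : z ∈ SM g := ⟨(hγ a ha).1, (hγ a ha).2.1⟩
  have h0 := zero_mem_travel (g := g) z
  have hle : b - a ≤ travelTime g z := F.le_travelTime hg hB hz (by linarith) fun s hs => by
    have := he (a + s) ⟨by linarith [hs.1], by linarith [hs.2]⟩
    rw [add_sub_cancel_left] at this
    rw [← this]
    exact (hγ _ ⟨by linarith [hs.1], by linarith [hs.2]⟩).1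
  obtain ⟨h1, h2⟩ := hmax (fun t => (F.Φ z (t - a)).1) (fun t => (F.Φ z (t - a)).2)
    (a - travelTime g (flip z)) (a + travelTime g z) (by linarith [h0.1]) (by linarith)
    (F.isGeodesicOn hg hz ⟨by linarith [h0.1], by linarith [h0.2]⟩ fun t ht =>
      F.mem_ball hg hB hz ⟨by linarith [ht.1], by linarith [ht.2]⟩)
    (fun t ht => by simp [← he t ht]) (fun t ht => by simp [← he t ht])
  constructor
  · have := F.exit_mem_bdry hg hB (flip_mem_SM hz)
    rw [F.flip_eq, show travelTime g (flip z) = 0 by linarith, neg_zero, F.zero] at this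
    exact this
  · have := F.exit_mem_bdry hg hB hz
    rw [show travelTime g z = b - a by linarith, ← he b (right_mem_Icc.2 hab)] at this
    exact this

end travel

lemma dist_flow_le (z z' : E n × E n) {t : ℝ} (ht : 0 ≤ t) :
    dist (F.Φ z t) (F.Φ z' t) ≤ dist z z' * Real.exp (F.K * t) := by
  have := dist_le_of_trajectories_ODE (v := fun _ => F.A) (K := F.K) (f := F.Φ z) (g := F.Φ z')
    (a := 0) (b := t) (δ := dist z z') (fun _ => F.lip) (F.continuous z).continuousOn
    (fun t _ => (F.deriv z t).hasDerivWithinAt) (F.continuous z').continuousOn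
    (fun t _ => (F.deriv z' t).hasDerivWithinAt) (by simp [F.zero]) t ⟨ht, le_rfl⟩
  simpa using this

lemma norm_flow_sub_le (z : E n × E n) (s t : ℝ) :
    ‖F.Φ z t - F.Φ z s‖ ≤ F.B * |t - s| := by
  have := convex_univ.norm_image_sub_le_of_norm_hasDerivWithin_le (f := F.Φ z) (C := F.B)
    (s := univ) (x := s) (y := t)
    (fun t _ => (F.deriv z t).hasDerivWithinAt) (fun t _ => F.bdd _) trivial trivial
  simpa using this

/-- A refinement of the Gronwall bound for the base component: a difference of initial velocities is
felt only after integration in time, hence the factor `t`. This is the source of the factor `τ²` in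
the vertical estimates. -/
lemma norm_fst_flow_sub_le (z z' : E n × E n) {t T : ℝ} (ht : 0 ≤ t) (hT : t ≤ T) :
    ‖(F.Φ z t).1 - (F.Φ z' t).1‖ ≤
      ‖z.1 - z'.1‖ + F.K * Real.exp (F.K * T) * t * dist z z' := by
  have hd : ∀ s ∈ Icc 0 t, HasDerivWithinAt (fun s => F.Φ z s - F.Φ z' s)
      (F.A (F.Φ z s) - F.A (F.Φ z' s)) (Icc 0 t) s := fun s _ =>
    ((F.deriv z s).sub (F.deriv z' s)).hasDerivWithinAt
  have hb : ∀ s ∈ Icc 0 t, ‖(F.A (F.Φ z s) - F.A (F.Φ z' s)).1‖ ≤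
      F.K * (dist z z' * Real.exp (F.K * T)) := fun s hs => by
    refine (norm_fst_le _).trans ?_
    rw [← dist_eq_norm]
    refine (F.lip.dist_le_mul _ _).trans ?_
    gcongr
    refine (F.dist_flow_le z z' hs.1).trans ?_
    gcongr
    exact hs.2.trans hT
  have := (convex_Icc 0 t).norm_image_sub_le_of_norm_hasDerivWithin_le
    (fun s hs => hasDerivWithinAt_fst (hd s hs)) hb (left_mem_Icc.2 ht) (right_mem_Icc.2 ht)
  simp only [F.zero, Prod.fst_sub, sub_zero, Real.norm_eq_abs, abs_of_nonneg ht] at this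
  have h2 := norm_le_norm_add_norm_sub' ((F.Φ z t).1 - (F.Φ z' t).1) (z.1 - z'.1)
  linarith

end GeoFlow
end RoughXRay
end

/-! ### The travel time near the boundary -/

noncomputable section
namespace RoughXRay
variable {n : ℕ} {g : E n → Matrix (Fin n) (Fin n) ℝ}

lemma radial_mem_SM (hg : IsC11Metric g) {z : E n × E n} (hz : z ∈ slit n) : radial g z ∈ SM g := by
  have := gauge_normalize_mem hg (x := z.1) (v := z.2) hz.1 hz.2
  rwa [gaugeF_of_mem (p := (z.1, z.2)) hz.1] at this

lemma radial_of_mem_SM {z : E n × E n} (hz : z ∈ SM g) : radial g z = z := by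
  simp [radial, hz.2]

lemma radial_smul {x v : E n} {t : ℝ} (ht : 0 < t) : radial g (x, t • v) = radial g (x, v) := by
  simp only [radial, ip_smul, Real.sqrt_mul (sq_nonneg t), Real.sqrt_sq ht.le, smul_smul]
  congr 2
  field_simp

lemma hasFDerivWithinAt_radial_fst (hg : IsC11Metric g) {y v : E n} (h : (y, v) ∈ slit n) :
    HasFDerivWithinAt (fun y => radial g (y, v))
      ((fderivWithin ℝ (radial g) (slit n) (y, v)).comp (ContinuousLinearMap.inl ℝ (E n) (E n)))
      (ball n) y := by
  have h1 : HasFDerivWithinAt (fun y => (y, v)) (ContinuousLinearMap.inl ℝ (E n) (E n))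
    (ball n) y := (hasFDerivWithinAt_id y _).prodMk (hasFDerivWithinAt_const v y _)
  have h2 := ((contDiffOn_radial hg).differentiableOn one_ne_zero _ h).hasFDerivWithinAt
  exact HasFDerivWithinAt.comp (t := slit n) y h2 h1 fun y hy => ⟨hy, h.2⟩

/-- Normalizing a unit vector of one metric in the metric at another point moves it by at most a
multiple of the distance of the points. -/
lemma exists_bound_radial_sub (hg : IsC11Metric g) : ∃ C : ℝ, 0 ≤ C ∧ ∀ z ∈ SM g, ∀ y ∈ ball n,
    ‖radial g (y, z.2) - z‖ ≤ C * ‖y - z.1‖ := by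
  set K : Set (E n × E n) := ball n ×ˢ (Prod.snd '' SM g) with hK
  have hKc : IsCompact K := isCompact_ball.prod ((isCompact_SM hg).image continuous_snd)
  have hKs : K ⊆ slit n := by
    rintro ⟨y, v⟩ ⟨hy, z, hz, rfl⟩
    exact ⟨hy, (SM_subset_slit hz).2⟩
  obtain ⟨C, hC⟩ := hKc.exists_bound_of_continuousOn
    (((contDiffOn_radial hg).continuousOn_fderivWithin uniqueDiffOn_slit le_rfl).mono hKs)
  have hb : ∀ z ∈ SM g, ∀ y ∈ ball n, ‖(fderivWithin ℝ (radial g) (slit n) (y, z.2)).comp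
      (ContinuousLinearMap.inl ℝ (E n) (E n))‖ ≤ max C 0 := fun z hz y hy =>
    ContinuousLinearMap.opNorm_le_bound _ (le_max_right _ _) fun ξ => by
      rw [ContinuousLinearMap.comp_apply]
      refine (ContinuousLinearMap.le_opNorm (fderivWithin ℝ (radial g) (slit n) (y, z.2)) _).trans ?_
      have h1 := (hC (y, z.2) ⟨hy, z, hz, rfl⟩).trans (le_max_left _ 0)
      have h2 : ‖ContinuousLinearMap.inl ℝ (E n) (E n) ξ‖ = ‖ξ‖ := by simp [Prod.norm_def]
      rw [h2]
      gcongr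
  refine ⟨max C 0, le_max_right _ _, fun z hz y hy => ?_⟩
  have hsl : ∀ y ∈ ball n, (y, z.2) ∈ slit n := fun y hy => hKs ⟨hy, z, hz, rfl⟩
  have := convex_ball.norm_image_sub_le_of_norm_hasFDerivWithin_le
    (fun y hy => hasFDerivWithinAt_radial_fst hg (hsl y hy)) (hb z hz) hz.1 hy
  rwa [show radial g (z.1, z.2) = z from radial_of_mem_SM hz] at this

namespace IsSimpleC11
variable (hs : IsSimpleC11 g)
include hs

lemma exists_geoFlow : ∃ c : Conn g, Nonempty (GeoFlow c) := by
  obtain ⟨c⟩ := exists_conn hs.metric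
  exact ⟨c, RoughXRay.exists_geoFlow c hs.metric⟩

lemma exists_bound_travelTime : ∃ T : ℝ, 1 ≤ T ∧ ∀ z ∈ SM g, travelTime g z ≤ T := by
  obtain ⟨K, hK⟩ := hs.lipschitz_sq
  obtain ⟨C, hC⟩ := (isCompact_SM hs.metric).exists_bound_of_continuousOn hK.continuousOn
  refine ⟨max C 1, le_max_right _ _, fun z hz => ?_⟩
  have h := hC z hz
  rw [Real.norm_eq_abs, abs_of_nonneg (sq_nonneg _)] at h
  by_contra! hlt
  have h1 := (le_max_right C 1).trans_lt hlt
  have h2 := (le_max_left C 1).trans_lt hlt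
  nlinarith

lemma exists_lipschitz_sq : ∃ L : ℝ, 0 ≤ L ∧ ∀ z ∈ SM g, ∀ z' ∈ SM g,
    |travelTime g z ^ 2 - travelTime g z' ^ 2| ≤ L * dist z z' := by
  obtain ⟨K, hK⟩ := hs.lipschitz_sq
  exact ⟨K, K.2, fun z hz z' hz' => by simpa [Real.dist_eq] using hK.dist_le_mul z hz z' hz'⟩

/-- The function `|x|²` increases strictly along an outgoing geodesic, which leaves the ball at
once. The Euclidean inner product decides this for every `g`, since the boundary is the Euclidean
sphere. -/
lemma travelTime_eq_zero_of_inner_pos {z : E n × E n} (hz : z ∈ SM g) (hb : z.1 ∈ bdry n)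
    (h : 0 < Inner.inner ℝ z.1 z.2) : travelTime g z = 0 := by
  obtain ⟨c, ⟨F⟩⟩ := hs.exists_geoFlow
  by_contra hne
  have hpos : 0 < travelTime g z := lt_of_le_of_ne (travelTime_nonneg z) (Ne.symm hne)
  have hd : HasDerivAt (fun t => ‖(F.Φ z t).1‖ ^ 2) (2 * Inner.inner ℝ z.1 z.2) 0 := by
    have h1 := F.deriv z 0
    rw [F.zero, F.spray_eq hz, ← hasDerivWithinAt_univ] at h1
    have h2 := ((hasDerivWithinAt_univ.1 (hasDerivWithinAt_fst h1))).norm_sq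
    rw [F.zero] at h2
    exact h2
  have hs' := (hasDerivWithinAt_iff_tendsto_slope' (by simp)).1 (hd.hasDerivWithinAt (s := Ioi 0))
  have hle := le_of_tendsto (b := 0) hs' (by
    filter_upwards [Ioo_mem_nhdsGT hpos] with t ht
    have hm := mem_ball_iff.1 (F.mem_ball_of_le_travelTime hs.metric hs.nontrapping hz
      (t := t) ⟨ht.1.le, ht.2.le⟩)
    rw [slope_def_field, F.zero, mem_bdry_iff.1 hb, sub_zero]
    exact div_nonpos_of_nonpos_of_nonneg (by nlinarith [norm_nonneg (F.Φ z t).1]) ht.1.le)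
  linarith

/-- A tangential direction is the limit, as `s → 0+`, of the normalized outgoing vectors `v + s x`,
whose travel time is zero; `τ²` is continuous by (B3). -/
lemma travelTime_eq_zero_of_inner_nonneg {z : E n × E n} (hz : z ∈ SM g) (hb : z.1 ∈ bdry n)
    (h : 0 ≤ Inner.inner ℝ z.1 z.2) : travelTime g z = 0 := by
  have hx1 := mem_bdry_iff.1 hb
  have hin : ∀ s : ℝ, Inner.inner ℝ z.1 (z.2 + s • z.1) = Inner.inner ℝ z.1 z.2 + s := fun s => by
    rw [inner_add_right, inner_smul_right, real_inner_self_eq_norm_sq, hx1]; ring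
  have hsl : ∀ s : ℝ, 0 < s → (z.1, z.2 + s • z.1) ∈ slit n := fun s hs0 => by
    refine ⟨hz.1, fun h0 => ?_⟩
    have := hin s
    rw [show z.2 + s • z.1 = 0 from h0, inner_zero_right] at this
    linarith
  have hz0 : ∀ s : ℝ, 0 < s → travelTime g (radial g (z.1, z.2 + s • z.1)) = 0 := fun s hs0 => by
    have hm := radial_mem_SM hs.metric (hsl s hs0)
    refine hs.travelTime_eq_zero_of_inner_pos hm hb ?_
    have hi : 0 < (Real.sqrt (ip g z.1 (z.2 + s • z.1) (z.2 + s • z.1)))⁻¹ := by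
      rw [inv_pos, Real.sqrt_pos, ← gF_apply]
      exact gF_pos hs.metric hz.1 (hsl s hs0).2
    simp only [radial, inner_smul_right, hin]
    exact mul_pos hi (by linarith)
  obtain ⟨K, hK⟩ := hs.lipschitz_sq
  have hcont := hK.continuousOn z hz
  have ht : Tendsto (fun s : ℝ => (z.1, z.2 + s • z.1)) (𝓝[>] (0:ℝ)) (𝓝[slit n] z) := by
    refine tendsto_nhdsWithin_iff.2 ⟨?_, ?_⟩
    · have hc : Continuous fun s : ℝ => (z.1, z.2 + s • z.1) := by fun_prop
      have := hc.tendsto 0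
      simp only [zero_smul, add_zero, Prod.mk.eta] at this
      exact this.mono_left nhdsWithin_le_nhds
    · filter_upwards [self_mem_nhdsWithin] with s hs0 using hsl s hs0
  have hr : Tendsto (fun s : ℝ => radial g (z.1, z.2 + s • z.1)) (𝓝[>] (0:ℝ)) (𝓝[SM g] z) := by
    refine tendsto_nhdsWithin_iff.2 ⟨?_, ?_⟩
    · have := ((contDiffOn_radial hs.metric).continuousOn z (SM_subset_slit hz)).tendsto.comp ht
      rwa [radial_of_mem_SM hz] at this
    · filter_upwards [self_mem_nhdsWithin] with s hs0
      exact radial_mem_SM hs.metric (hsl s hs0)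
  have hlim := hcont.tendsto.comp hr
  have : Tendsto (fun _ : ℝ => (0:ℝ)) (𝓝[>] (0:ℝ)) (𝓝 (travelTime g z ^ 2)) := by
    refine hlim.congr' ?_
    filter_upwards [self_mem_nhdsWithin] with s hs0
    simp [hz0 s hs0]
  have h0 := tendsto_nhds_unique this tendsto_const_nhds
  exact pow_eq_zero_iff two_ne_zero |>.1 h0

lemma travelTime_eq_zero_or_flip {z : E n × E n} (hz : z ∈ SM g) (hb : z.1 ∈ bdry n) :
    travelTime g z = 0 ∨ travelTime g (flip z) = 0 := by
  rcases le_total 0 (Inner.inner ℝ z.1 z.2) with h | h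
  · exact Or.inl (hs.travelTime_eq_zero_of_inner_nonneg hz hb h)
  · exact Or.inr (hs.travelTime_eq_zero_of_inner_nonneg (flip_mem_SM hz) hb (by simpa using h))

lemma exists_nearest_bdry (hn : 1 ≤ n) {x : E n} (hx : x ∈ ball n) :
    ∃ y ∈ bdry n, ‖y - x‖ = 1 - ‖x‖ := by
  have hx1 := mem_ball_iff.1 hx
  by_cases h0 : x = 0
  · refine ⟨bv ⟨0, hn⟩, by simp [mem_bdry_iff], by simp [h0]⟩
  · have hp := norm_pos_iff.2 h0
    refine ⟨‖x‖⁻¹ • x, by simp [mem_bdry_iff, norm_smul, hp.ne'], ?_⟩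
    have : ‖x‖⁻¹ • x - x = (‖x‖⁻¹ - 1) • x := by rw [sub_smul, one_smul]
    rw [this, norm_smul, Real.norm_eq_abs, abs_of_nonneg (sub_nonneg.2 ((one_le_inv₀ hp).2 hx1))]
    field_simp

/-- The shorter of the two travel times is at most of the order of the square root of the distance
to the boundary. -/
lemma exists_bound_min_travelTime (hn : 1 ≤ n) : ∃ C : ℝ, 0 ≤ C ∧ ∀ z ∈ SM g,
    min (travelTime g z) (travelTime g (flip z)) ^ 2 ≤ C * (1 - ‖z.1‖) := by
  obtain ⟨C, hC0, hC⟩ := exists_bound_radial_sub hs.metric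
  obtain ⟨L, hL0, hL⟩ := hs.exists_lipschitz_sq
  refine ⟨L * C, by positivity, fun z hz => ?_⟩
  obtain ⟨y, hy, hyx⟩ := hs.exists_nearest_bdry hn hz.1
  have hsl : (y, z.2) ∈ slit n := ⟨bdry_subset_ball hy, (SM_subset_slit hz).2⟩
  -- The same direction at the nearest boundary point. There one of the two travel times is zero,
  -- and the Lipschitz bound for `τ²` carries this back to `z`.
  set w := radial g (y, z.2)
  have hw : w ∈ SM g := radial_mem_SM hs.metric hsl
  have hd : dist z w ≤ C * (1 - ‖z.1‖) := by
    rw [dist_comm, dist_eq_norm, ← hyx]; exact hC z hz y (bdry_subset_ball hy)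
  have h1 := le_of_abs_le ((hL z hz w hw).trans (mul_le_mul_of_nonneg_left hd hL0))
  have h2 := le_of_abs_le ((hL _ (flip_mem_SM hz) _ (flip_mem_SM hw)).trans
    (mul_le_mul_of_nonneg_left ((dist_flip z w).trans_le hd) hL0))
  have hm0 : 0 ≤ min (travelTime g z) (travelTime g (flip z)) :=
    le_min (travelTime_nonneg z) (travelTime_nonneg _)
  rw [mul_assoc]
  rcases hs.travelTime_eq_zero_or_flip hw hy with h | h
  · rw [h] at h1
    have := pow_le_pow_left₀ hm0 (min_le_left _ _) 2
    linarith
  · rw [h] at h2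
    have := pow_le_pow_left₀ hm0 (min_le_right _ _) 2
    linarith

lemma travelTime_pos {z : E n × E n} (hz : z ∈ SM g) (hi : z.1 ∈ inner n) :
    0 < travelTime g z := by
  obtain ⟨c, ⟨F⟩⟩ := hs.exists_geoFlow
  refine lt_of_le_of_ne (travelTime_nonneg z) fun h => ?_
  have := F.exit_mem_bdry hs.metric hs.nontrapping hz
  rw [← h, F.zero, mem_bdry_iff] at this
  rw [mem_inner_iff] at hi
  linarith

end IsSimpleC11
end RoughXRay
end

/-! ### Integrals along geodesics up to the boundary -/

noncomputable section
namespace RoughXRay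
variable {n : ℕ} {g : E n → Matrix (Fin n) (Fin n) ℝ}

/-- A Lipschitz function on the sphere bundle that vanishes over the boundary, with a vertical
Lipschitz constant of the order of the distance to the boundary. -/
structure IsRayWeight (g : E n → Matrix (Fin n) (Fin n) ℝ) (f : E n × E n → ℝ) (L : ℝ) : Prop where
  nonneg : 0 ≤ L
  lip : ∀ z ∈ SM g, ∀ z' ∈ SM g,
    |f z - f z'| ≤ L * (‖z.1 - z'.1‖ + (1 - ‖z.1‖) * ‖z.2 - z'.2‖)
  bound : ∀ z ∈ SM g, |f z| ≤ L * (1 - ‖z.1‖)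

namespace IsRayWeight
variable {f : E n × E n → ℝ} {L : ℝ} (hf : IsRayWeight g f L)
include hf

lemma comp_flip : IsRayWeight g (f ∘ flip) L where
  nonneg := hf.nonneg
  lip z hz z' hz' := by
    have := hf.lip _ (flip_mem_SM hz) _ (flip_mem_SM hz')
    simp only [flip_fst, flip_snd, neg_sub_neg] at this
    rwa [norm_sub_rev z'.2] at this
  bound z hz := hf.bound _ (flip_mem_SM hz)

lemma exists_lipschitzOnWith : ∃ K, LipschitzOnWith K f (SM g) := by
  refine ⟨⟨L * 2, by linarith [hf.nonneg]⟩, LipschitzOnWith.of_dist_le_mul fun z hz z' hz' => ?_⟩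
  rw [Real.dist_eq]
  refine (hf.lip z hz z' hz').trans ?_
  have h1 : ‖z.1 - z'.1‖ ≤ dist z z' := by rw [dist_eq_norm]; exact norm_fst_le (z - z')
  have h2 : ‖z.2 - z'.2‖ ≤ dist z z' := by rw [dist_eq_norm]; exact norm_snd_le (z - z')
  have h3 : (1 - ‖z.1‖) * ‖z.2 - z'.2‖ ≤ 1 * dist z z' :=
    mul_le_mul (by linarith [norm_nonneg z.1]) h2 (norm_nonneg _) zero_le_one
  have := hf.nonneg
  change _ ≤ L * 2 * dist z z'
  nlinarith

lemma continuousOn : ContinuousOn f (SM g) := hf.exists_lipschitzOnWith.choose_spec.continuousOn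

end IsRayWeight

lemma travelTime_mem_travel (z : E n × E n) :
    travelTime g z ∈ Icc (-travelTime g (flip z)) (travelTime g z) :=
  ⟨(zero_mem_travel (g := g) z).1.trans (zero_mem_travel (g := g) z).2, le_rfl⟩

namespace GeoFlow
variable {c : Conn g} (F : GeoFlow c) {f : E n × E n → ℝ} {L : ℝ}

/-- The integral of a function along the geodesic with given initial data up to the boundary. -/
def rayInt (f : E n × E n → ℝ) (z : E n × E n) : ℝ := ∫ t in (0:ℝ)..travelTime g z, f (F.Φ z t)

section
variable (hs : IsSimpleC11 g) (hf : IsRayWeight g f L)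
include hs hf

lemma continuousOn_ray {z : E n × E n} (hz : z ∈ SM g) :
    ContinuousOn (fun t => f (F.Φ z t)) (Icc (-travelTime g (flip z)) (travelTime g z)) :=
  hf.continuousOn.comp (F.continuous z).continuousOn fun _ ht =>
    F.mem_SM hs.metric hs.nontrapping hz ht

lemma intervalIntegrable_ray {z : E n × E n} (hz : z ∈ SM g) {a b : ℝ}
    (ha : a ∈ Icc (-travelTime g (flip z)) (travelTime g z))
    (hb : b ∈ Icc (-travelTime g (flip z)) (travelTime g z)) :
    IntervalIntegrable (fun t => f (F.Φ z t)) volume a b :=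
  ((F.continuousOn_ray hs hf hz).mono (uIcc_subset_Icc ha hb)).intervalIntegrable

-- The exit point lies on the boundary, and the flow moves at speed at most `B`.
omit hf in
lemma one_sub_norm_flow_le {z : E n × E n} (hz : z ∈ SM g) {t : ℝ} (ht : t ≤ travelTime g z) :
    1 - ‖(F.Φ z t).1‖ ≤ F.B * (travelTime g z - t) := by
  have h1 := mem_bdry_iff.1 (F.exit_mem_bdry hs.metric hs.nontrapping hz)
  have h2 := (norm_fst_le _).trans (F.norm_flow_sub_le z t (travelTime g z))
  rw [abs_of_nonneg (by linarith)] at h2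
  have h3 := norm_sub_norm_le (F.Φ z (travelTime g z)).1 (F.Φ z t).1
  rw [Prod.fst_sub] at h2
  linarith

/-- The weight is of the order of the distance to the boundary, hence of the remaining time;
integrating over the remaining time makes the bound quadratic. -/
lemma abs_integral_ray_le {z : E n × E n} (hz : z ∈ SM g) {a : ℝ}
    (ha : a ∈ Icc (-travelTime g (flip z)) (travelTime g z)) :
    |∫ t in a..travelTime g z, f (F.Φ z t)| ≤ L * F.B * (travelTime g z - a) ^ 2 := by
  have h := intervalIntegral.norm_integral_le_of_norm_le_const (a := a) (b := travelTime g z)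
    (f := fun t => f (F.Φ z t)) (C := L * (F.B * (travelTime g z - a))) fun t ht => by
      rw [uIoc_of_le ha.2] at ht
      refine (hf.bound _ (F.mem_SM hs.metric hs.nontrapping hz ⟨ha.1.trans ht.1.le, ht.2⟩)).trans ?_
      refine mul_le_mul_of_nonneg_left ((F.one_sub_norm_flow_le hs hz ht.2).trans ?_) hf.nonneg
      exact mul_le_mul_of_nonneg_left (by linarith [ht.1]) F.B.2
  rw [abs_of_nonneg (by linarith [ha.2] : 0 ≤ travelTime g z - a)] at h
  rw [← Real.norm_eq_abs]
  linarith

lemma abs_rayInt_le {z : E n × E n} (hz : z ∈ SM g) :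
    |F.rayInt f z| ≤ L * F.B * travelTime g z ^ 2 := by
  simpa [rayInt] using F.abs_integral_ray_le hs hf hz (zero_mem_travel (g := g) z)

/-- The geodesics are compared up to the shorter travel time `τ`; the rest of the longer one costs
the square of the time difference. On the common interval the base points differ by `‖z.1 - z'.1‖`
plus a term of order `t`, and velocity differences are weighted by the distance to the boundary, of
order `τ`. So the full distance of `z` and `z'` enters only with `τ²`. -/
lemma rayInt_sub_le_of_le {T : ℝ} (hT : ∀ z ∈ SM g, travelTime g z ≤ T) {z z' : E n × E n}
    (hz : z ∈ SM g) (hz' : z' ∈ SM g) (hle : travelTime g z ≤ travelTime g z') :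
    |F.rayInt f z - F.rayInt f z'| ≤ L * (travelTime g z * ‖z.1 - z'.1‖
      + (F.K + F.B) * Real.exp (F.K * T) * travelTime g z ^ 2 * dist z z'
      + F.B * (travelTime g z - travelTime g z') ^ 2) := by
  set τ := travelTime g z with hτ
  have hτ0 : 0 ≤ τ := travelTime_nonneg z
  have h0 := zero_mem_travel (g := g) z
  have h0' := zero_mem_travel (g := g) z'
  have hm' : τ ∈ Icc (-travelTime g (flip z')) (travelTime g z') := ⟨h0'.1.trans hτ0, hle⟩
  have i1 := F.intervalIntegrable_ray hs hf hz h0 (travelTime_mem_travel (g := g) z)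
  have i2 := F.intervalIntegrable_ray hs hf hz' h0' hm'
  have i3 := F.intervalIntegrable_ray hs hf hz' hm' (travelTime_mem_travel (g := g) z')
  have e : F.rayInt f z - F.rayInt f z' = (∫ t in (0:ℝ)..τ, f (F.Φ z t) - f (F.Φ z' t))
      - ∫ t in τ..travelTime g z', f (F.Φ z' t) := by
    rw [intervalIntegral.integral_sub i1 i2, rayInt, rayInt,
      ← intervalIntegral.integral_add_adjacent_intervals i2 i3]
    ring
  have hb := intervalIntegral.norm_integral_le_of_norm_le_const (a := 0) (b := τ)
    (f := fun t => f (F.Φ z t) - f (F.Φ z' t))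
    (C := L * (‖z.1 - z'.1‖ + (F.K + F.B) * Real.exp (F.K * T) * τ * dist z z')) fun t ht => by
      rw [uIoc_of_le hτ0] at ht
      have htT : t ≤ T := ht.2.trans (hT z hz)
      refine (hf.lip _ (F.mem_SM hs.metric hs.nontrapping hz ⟨h0.1.trans ht.1.le, ht.2⟩) _
        (F.mem_SM hs.metric hs.nontrapping hz' ⟨h0'.1.trans ht.1.le, ht.2.trans hle⟩)).trans ?_
      refine mul_le_mul_of_nonneg_left ?_ hf.nonneg
      have a1 := F.norm_fst_flow_sub_le z z' ht.1.le htT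
      have a2 : F.K * Real.exp (F.K * T) * t * dist z z' ≤
          F.K * Real.exp (F.K * T) * τ * dist z z' := by gcongr; exact ht.2
      have a3 : 1 - ‖(F.Φ z t).1‖ ≤ F.B * τ :=
        (F.one_sub_norm_flow_le hs hz ht.2).trans (by gcongr; linarith [ht.1])
      have a4 : ‖(F.Φ z t).2 - (F.Φ z' t).2‖ ≤ dist z z' * Real.exp (F.K * T) := by
        refine (norm_snd_le (F.Φ z t - F.Φ z' t)).trans ?_
        rw [← dist_eq_norm]
        refine (F.dist_flow_le z z' ht.1.le).trans ?_
        gcongr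
      have a5 := mul_le_mul a3 a4 (norm_nonneg _) (by positivity)
      linarith
  rw [Real.norm_eq_abs, sub_zero, abs_of_nonneg hτ0] at hb
  have ht := F.abs_integral_ray_le hs hf hz' hm'
  rw [e]
  refine (abs_sub _ _).trans ?_
  have e2 : (travelTime g z' - τ) ^ 2 = (τ - travelTime g z') ^ 2 := by ring
  rw [e2] at ht
  linarith

lemma exists_bound_rayInt_sub : ∃ C : ℝ, 0 ≤ C ∧ ∀ z ∈ SM g, ∀ z' ∈ SM g,
    |F.rayInt f z - F.rayInt f z'| ≤ C * (travelTime g z * ‖z.1 - z'.1‖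
      + travelTime g z ^ 2 * dist z z' + (travelTime g z - travelTime g z') ^ 2) := by
  obtain ⟨T, hT1, hT⟩ := hs.exists_bound_travelTime
  set D := (F.K + F.B) * Real.exp (F.K * T) with hD
  have hD0 : 0 ≤ D := by positivity
  have hB := F.B.2
  change 0 ≤ (F.B : ℝ) at hB
  have hL := hf.nonneg
  refine ⟨L * (1 + D + F.B), by positivity, fun z hz z' hz' => ?_⟩
  have hτ0 := travelTime_nonneg (g := g) z
  have key : ∀ s : ℝ, 0 ≤ s → s ≤ travelTime g z → L * (s * ‖z.1 - z'.1‖ + D * s ^ 2 * dist z z'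
      + F.B * (travelTime g z - travelTime g z') ^ 2) ≤
      L * (1 + D + F.B) * (travelTime g z * ‖z.1 - z'.1‖
      + travelTime g z ^ 2 * dist z z' + (travelTime g z - travelTime g z') ^ 2) := by
    intro s hs0 hst
    rw [mul_assoc L (1 + D + F.B)]
    refine mul_le_mul_of_nonneg_left ?_ hL
    have b1 : s * ‖z.1 - z'.1‖ ≤ travelTime g z * ‖z.1 - z'.1‖ := by gcongr
    have b2 : D * s ^ 2 * dist z z' ≤ D * (travelTime g z ^ 2 * dist z z') := by
      rw [mul_assoc]; gcongr
    have p1 : 0 ≤ travelTime g z * ‖z.1 - z'.1‖ := by positivity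
    have p2 : 0 ≤ travelTime g z ^ 2 * dist z z' := by positivity
    have p3 : 0 ≤ (travelTime g z - travelTime g z') ^ 2 := sq_nonneg _
    have q1 := mul_nonneg hD0 p1
    have q2 := mul_nonneg hD0 p3
    have q3 := mul_nonneg hB p1
    have q4 := mul_nonneg hB p2
    linarith
  rcases le_total (travelTime g z) (travelTime g z') with h | h
  · exact (F.rayInt_sub_le_of_le hs hf hT hz hz' h).trans (key _ hτ0 le_rfl)
  · have := F.rayInt_sub_le_of_le hs hf hT hz' hz h
    rw [abs_sub_comm, norm_sub_rev, dist_comm] at this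
    refine this.trans ((le_of_eq ?_).trans (key _ (travelTime_nonneg z') h))
    ring

/-- The travel time itself need not be Lipschitz at tangential directions, but it enters the
estimate only through the square of its increments. -/
lemma exists_lipschitzOnWith_rayInt : ∃ K, LipschitzOnWith K (F.rayInt f) (SM g) := by
  obtain ⟨C, hC0, hC⟩ := F.exists_bound_rayInt_sub hs hf
  obtain ⟨T, hT1, hT⟩ := hs.exists_bound_travelTime
  obtain ⟨M, hM0, hM⟩ := hs.exists_lipschitz_sq
  refine ⟨⟨C * (T + T ^ 2 + M), by positivity⟩, LipschitzOnWith.of_dist_le_mul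
    fun z hz z' hz' => ?_⟩
  rw [Real.dist_eq]
  refine (hC z hz z' hz').trans ?_
  change _ ≤ C * (T + T ^ 2 + M) * dist z z'
  rw [mul_assoc]
  refine mul_le_mul_of_nonneg_left ?_ hC0
  have h0 := travelTime_nonneg (g := g) z
  have h0' := travelTime_nonneg (g := g) z'
  have h1 : ‖z.1 - z'.1‖ ≤ dist z z' := by rw [dist_eq_norm]; exact norm_fst_le (z - z')
  -- For nonnegative numbers `(a - b)² ≤ |a² - b²|`, so the Lipschitz bound for `τ²` is enough.
  have h2 : (travelTime g z - travelTime g z') ^ 2 ≤ M * dist z z' := by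
    refine le_trans ?_ (hM z hz z' hz')
    rw [sq_sub_sq, abs_mul, ← sq_abs, sq, abs_of_nonneg (add_nonneg h0 h0')]
    refine mul_le_mul_of_nonneg_right ?_ (abs_nonneg _)
    rw [abs_le]; constructor <;> linarith
  have h3 := mul_le_mul (hT z hz) h1 (norm_nonneg _) (by linarith)
  have h4 : travelTime g z ^ 2 * dist z z' ≤ T ^ 2 * dist z z' := by
    gcongr; exact hT z hz
  linarith

/-- The forward and the backward integral add up to zero, so every estimate for `rayInt` also holds
with the travel time of the reversed direction. -/
lemma rayInt_eq_neg_flip (h0 : ∀ z ∈ SM g,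
      ∫ t in (-travelTime g (flip z))..travelTime g z, f (F.Φ z t) = 0)
    {z : E n × E n} (hz : z ∈ SM g) : F.rayInt f z = -F.rayInt (f ∘ flip) (flip z) := by
  have e : F.rayInt (f ∘ flip) (flip z) = ∫ t in (-travelTime g (flip z))..0, f (F.Φ z t) := by
    have := intervalIntegral.integral_comp_neg (a := 0) (b := travelTime g (flip z))
      (fun t => f (F.Φ z t))
    rw [neg_zero] at this
    rw [← this, rayInt]
    simp [F.flip_eq]
  have hm := zero_mem_travel (g := g) z
  have h1 := intervalIntegral.integral_add_adjacent_intervals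
    (F.intervalIntegrable_ray hs hf hz (left_mem_Icc.2 (hm.1.trans hm.2)) hm)
    (F.intervalIntegrable_ray hs hf hz hm (travelTime_mem_travel (g := g) z))
  rw [h0 z hz] at h1
  rw [e, rayInt]
  linarith

/-- Along an orbit the integral is that of a fixed function from a moving lower limit to a fixed
upper one; the fundamental theorem of calculus applies, both travel times being positive at interior
points. -/
lemma hasDerivAt_rayInt_flow {z : E n × E n} (hz : z ∈ SM g) (hi : z.1 ∈ inner n) :
    HasDerivAt (fun s => F.rayInt f (F.Φ z s)) (-f z) 0 := by
  have hp := hs.travelTime_pos hz hi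
  have hp' := hs.travelTime_pos (flip_mem_SM hz) hi
  have hn : Icc (-travelTime g (flip z)) (travelTime g z) ∈ 𝓝 (0:ℝ) :=
    Icc_mem_nhds (by linarith) hp
  have hm := zero_mem_travel (g := g) z
  have hc := F.continuousOn_ray hs hf hz
  have h1 : HasDerivAt (fun s => ∫ t in s..travelTime g z, f (F.Φ z t)) (-f (F.Φ z 0)) 0 :=
    intervalIntegral.integral_hasDerivAt_left
      (F.intervalIntegrable_ray hs hf hz hm (travelTime_mem_travel (g := g) z))
      (hc.stronglyMeasurableAtFilter_nhdsWithin measurableSet_Icc 0 |>.filter_mono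
        (by rw [nhdsWithin_eq_nhds.2 hn]))
      (hc.continuousAt hn)
  rw [F.zero] at h1
  refine h1.congr_of_eventuallyEq ?_
  filter_upwards [hn] with s hs'
  rw [rayInt, F.travelTime_flow hs.metric hs.nontrapping hz hs']
  simp only [F.add]
  rw [intervalIntegral.integral_comp_add_left (fun t => f (F.Φ z t)) s]
  simp

end
end GeoFlow
end RoughXRay
end

/-! ### Vertical estimates and the homogeneous potential -/

noncomputable section
namespace RoughXRay
variable {n : ℕ} {g : E n → Matrix (Fin n) (Fin n) ℝ}

lemma slitI_subset_slit : slitI n ⊆ slit n := fun _ hz => ⟨inner_subset_ball hz.1, hz.2⟩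

lemma contDiffAt_radial (hg : IsC11Metric g) {z : E n × E n} (hz : z ∈ slitI n) :
    ContDiffAt ℝ 1 (radial g) z :=
  (contDiffOn_radial hg).contDiffAt (mem_of_superset (slitI_mem_nhds hz) slitI_subset_slit)

lemma exists_bound_fderiv_radial (hg : IsC11Metric g) {K : Set (E n × E n)} (hK : IsCompact K)
    (hKs : K ⊆ slit n) : ∃ C : ℝ, 0 ≤ C ∧ ∀ z ∈ K, z ∈ slitI n → ‖fderiv ℝ (radial g) z‖ ≤ C := by
  obtain ⟨C, hC⟩ := hK.exists_bound_of_continuousOn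
    (((contDiffOn_radial hg).continuousOn_fderivWithin uniqueDiffOn_slit le_rfl).mono hKs)
  refine ⟨max C 0, le_max_right _ _, fun z hz hzI => (le_trans ?_ (hC z hz)).trans (le_max_left _ _)⟩
  rw [fderivWithin_of_mem_nhds (mem_of_superset (slitI_mem_nhds hzI) slitI_subset_slit)]

/-- A function whose increments are dominated to first order by those of `w` has derivative bounded
by that of `w`. -/
lemma abs_deriv_le_of_abs_sub_le {φ : ℝ → ℝ} {V : Type*} [NormedAddCommGroup V] [NormedSpace ℝ V]
    {w : ℝ → V} {a : ℝ} {b : V} {M C : ℝ} (hφ : HasDerivAt φ a 0) (hw : HasDerivAt w b 0)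
    (h : ∀ᶠ s in 𝓝 (0:ℝ), |φ s - φ 0| ≤ M * ‖w s - w 0‖ + C * ‖w s - w 0‖ ^ 2) :
    |a| ≤ M * ‖b‖ := by
  have h1 := (hasDerivAt_iff_tendsto_slope.1 hφ).abs
  have h2 := (hasDerivAt_iff_tendsto_slope.1 hw).norm
  have h3 : Tendsto (fun s => ‖w s - w 0‖) (𝓝[≠] (0:ℝ)) (𝓝 0) := by
    have := (hw.continuousAt.tendsto.sub_const (w 0)).norm
    simp only [sub_self, norm_zero] at this
    exact this.mono_left nhdsWithin_le_nhds
  have h4 := (h2.const_mul M).add ((h2.mul h3).const_mul C)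
  rw [mul_zero, mul_zero, add_zero] at h4
  refine le_of_tendsto_of_tendsto h1 h4 ?_
  filter_upwards [self_mem_nhdsWithin, h.filter_mono nhdsWithin_le_nhds] with s hs hs'
  have hs0 : 0 < |s| := abs_pos.2 hs
  simp only [slope_def_module, norm_smul, sub_zero, norm_inv, Real.norm_eq_abs, smul_eq_mul, abs_mul,
    abs_inv]
  calc |s|⁻¹ * |φ s - φ 0| ≤ |s|⁻¹ * (M * ‖w s - w 0‖ + C * ‖w s - w 0‖ ^ 2) := by gcongr
    _ = _ := by ring

namespace GeoFlow
variable {c : Conn g} (F : GeoFlow c) {f : E n × E n → ℝ} {L : ℝ}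

section
variable (hs : IsSimpleC11 g) (hf : IsRayWeight g f L)
include hs hf

/-- For equal base points the only first-order term is `τ² ‖v - v'‖`. Since `|τ - τ'| ≤ (M/τ) ‖v -
v'‖`, the squared time difference is of second order. Its constant depends on `z`, but it does not
matter for derivatives. -/
lemma exists_vertical_bound_of_le : ∃ C : ℝ, 0 ≤ C ∧ ∀ z ∈ SM g, z.1 ∈ inner n →
    ∃ C' : ℝ, ∀ v, (z.1, v) ∈ SM g → |F.rayInt f z - F.rayInt f (z.1, v)| ≤
      C * travelTime g z ^ 2 * ‖z.2 - v‖ + C' * ‖z.2 - v‖ ^ 2 := by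
  obtain ⟨C, hC0, hC⟩ := F.exists_bound_rayInt_sub hs hf
  obtain ⟨M, hM0, hM⟩ := hs.exists_lipschitz_sq
  refine ⟨C, hC0, fun z hz hi => ⟨C * (M / travelTime g z) ^ 2, fun v hv => ?_⟩⟩
  have hτ := hs.travelTime_pos hz hi
  have h0' := travelTime_nonneg (g := g) (z.1, v)
  have hd : dist z (z.1, v) = ‖z.2 - v‖ := by
    rw [← dist_eq_norm, Prod.dist_eq]; simp
  have h1 := hC z hz _ hv
  have h2 := hM z hz _ hv
  rw [hd] at h1 h2
  have h3 : |travelTime g z - travelTime g (z.1, v)| ≤ M / travelTime g z * ‖z.2 - v‖ := by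
    rw [div_mul_eq_mul_div, le_div_iff₀ hτ]
    refine le_trans ?_ h2
    rw [sq_sub_sq, abs_mul, mul_comm, abs_of_nonneg (add_nonneg hτ.le h0')]
    gcongr
    linarith
  have h4 : (travelTime g z - travelTime g (z.1, v)) ^ 2 ≤ (M / travelTime g z * ‖z.2 - v‖) ^ 2 := by
    rw [← sq_abs]; gcongr
  have h5 := mul_le_mul_of_nonneg_left h4 hC0
  simp only [sub_self, norm_zero, mul_zero, zero_add] at h1
  rw [mul_add] at h1
  rw [mul_pow] at h5
  linarith

variable (h0 : ∀ z ∈ SM g, ∫ t in (-travelTime g (flip z))..travelTime g z, f (F.Φ z t) = 0)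
include h0

/-- Whichever direction has the shorter travel time is used, by `rayInt_eq_neg_flip`; the square of
the shorter time is of the order of the distance to the boundary. -/
lemma exists_vertical_bound (hn : 1 ≤ n) : ∃ C : ℝ, 0 ≤ C ∧ ∀ z ∈ SM g, z.1 ∈ inner n →
    ∃ C' : ℝ, ∀ v, (z.1, v) ∈ SM g → |F.rayInt f z - F.rayInt f (z.1, v)| ≤
      C * (1 - ‖z.1‖) * ‖z.2 - v‖ + C' * ‖z.2 - v‖ ^ 2 := by
  obtain ⟨C₁, hC₁0, hC₁⟩ := F.exists_vertical_bound_of_le hs hf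
  obtain ⟨C₂, hC₂0, hC₂⟩ := F.exists_vertical_bound_of_le hs hf.comp_flip
  obtain ⟨M, hM0, hM⟩ := hs.exists_bound_min_travelTime hn
  refine ⟨(C₁ + C₂) * M, by positivity, fun z hz hi => ?_⟩
  have hm := hM z hz
  have hd : 0 ≤ M * (1 - ‖z.1‖) := mul_nonneg hM0 (by linarith [mem_ball_iff.1 hz.1])
  rcases le_total (travelTime g z) (travelTime g (flip z)) with h | h
  · rw [min_eq_left h] at hm
    obtain ⟨C', hC'⟩ := hC₁ z hz hi
    refine ⟨C', fun v hv => (hC' v hv).trans ?_⟩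
    have : C₁ * travelTime g z ^ 2 ≤ (C₁ + C₂) * M * (1 - ‖z.1‖) := by
      rw [mul_assoc (C₁ + C₂)]; nlinarith
    gcongr
  · rw [min_eq_right h] at hm
    obtain ⟨C', hC'⟩ := hC₂ (flip z) (flip_mem_SM hz) hi
    refine ⟨C', fun v hv => ?_⟩
    have := hC' (-v) (flip_mem_SM hv)
    rw [F.rayInt_eq_neg_flip hs hf h0 hz, F.rayInt_eq_neg_flip hs hf h0 hv, neg_sub_neg,
      abs_sub_comm]
    refine this.trans ?_
    have h3 : C₂ * travelTime g (flip z) ^ 2 ≤ (C₁ + C₂) * M * (1 - ‖z.1‖) := by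
      rw [mul_assoc (C₁ + C₂)]; nlinarith
    have h4 : ‖(flip z).2 - -v‖ = ‖z.2 - v‖ := by
      rw [flip_snd, neg_sub_neg, norm_sub_rev]
    rw [h4]
    gcongr

lemma exists_bound_rayInt (hn : 1 ≤ n) : ∃ C : ℝ, 0 ≤ C ∧ ∀ z ∈ SM g,
    |F.rayInt f z| ≤ C * (1 - ‖z.1‖) := by
  obtain ⟨M, hM0, hM⟩ := hs.exists_bound_min_travelTime hn
  have hL := hf.nonneg
  refine ⟨L * F.B * M, by positivity, fun z hz => ?_⟩
  have hm := mul_le_mul_of_nonneg_left (hM z hz) (by positivity : 0 ≤ L * F.B)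
  rw [mul_assoc _ M]
  refine le_trans ?_ hm
  rcases le_total (travelTime g z) (travelTime g (flip z)) with h | h
  · rw [min_eq_left h]
    exact F.abs_rayInt_le hs hf hz
  · rw [min_eq_right h, F.rayInt_eq_neg_flip hs hf h0 hz, abs_neg]
    exact F.abs_rayInt_le hs hf.comp_flip (flip_mem_SM hz)

end
end GeoFlow

/-- The homogeneous extension `U` of the integrals of `f` along geodesics up to the boundary. -/
structure IsRayPotential (c : Conn g) (f U : E n × E n → ℝ) : Prop where
  eq_radial : ∃ û : E n × E n → ℝ, (∃ K, LipschitzWith K û) ∧ ∀ z, U z = û (radial g z)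
  bound : ∃ C : ℝ, 0 ≤ C ∧ ∀ z ∈ slit n, |U z| ≤ C * (1 - ‖z.1‖)
  curve : ∀ z ∈ slitI n, ∃ σ : ℝ → E n × E n, σ 0 = z ∧ HasDerivAt σ (spray c z) 0 ∧
    HasDerivAt (fun t => U (σ t)) (-(Real.sqrt (speedSq g z) * f (radial g z))) 0
  vert_bound : ∀ K : Set (E n × E n), IsCompact K → K ⊆ slit n → ∃ C : ℝ, 0 ≤ C ∧
    ∀ z ∈ K, z ∈ slitI n → DifferentiableAt ℝ U z → ‖vD U z‖ ≤ C * (1 - ‖z.1‖)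

theorem IsRayPotential.fderiv_spray {c : Conn g} {f U : E n × E n → ℝ} (hU : IsRayPotential c f U)
    {z : E n × E n} (hz : z ∈ slitI n) (hd : DifferentiableAt ℝ U z) :
    fderiv ℝ U z (spray c z) = -(Real.sqrt (speedSq g z) * f (radial g z)) := by
  obtain ⟨σ, hσ0, hσ, hU⟩ := hU.curve z hz
  exact (HasFDerivAt.comp_hasDerivAt_of_eq (l := U) 0 hd.hasFDerivAt hσ hσ0.symm).unique hU

namespace GeoFlow
variable {c : Conn g} (F : GeoFlow c) {f : E n × E n → ℝ} {L : ℝ}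

/-- The curve in phase space that follows the geodesic in the direction of an arbitrary vector. -/
lemma exists_curve_spray (hs : IsSimpleC11 g) {z : E n × E n} (hz : z ∈ slitI n) :
    ∃ σ : ℝ → E n × E n, σ 0 = z ∧ HasDerivAt σ (spray c z) 0 ∧
      ∀ᶠ t in 𝓝 0, radial g (σ t) = F.Φ (radial g z) (Real.sqrt (speedSq g z) * t) := by
  set q := Real.sqrt (speedSq g z) with hq
  have hq0 : 0 < q := Real.sqrt_pos.2 (speedSq_pos hs.metric hz)
  set w := radial g z with hw
  have hwS : w ∈ SM g := radial_mem_SM hs.metric (slitI_subset_slit hz)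
  have hw2 : w.2 = q⁻¹ • z.2 := by rw [hq, speedSq, gF_apply]; rfl
  have hw1 : w.1 = z.1 := rfl
  refine ⟨fun t => ((F.Φ w (q * t)).1, q • (F.Φ w (q * t)).2), ?_, ?_, ?_⟩
  · simp [F.zero, hw2, hw1, smul_smul, hq0.ne']
  · have h1 : HasDerivAt (fun t => F.Φ w (q * t)) (q • spray c w) 0 := by
      have h := F.deriv w (q * 0)
      rw [mul_zero, F.zero, F.spray_eq hwS] at h
      have h2 := (hasDerivAt_id (0:ℝ)).const_mul q
      rw [mul_one] at h2
      have h3 : HasDerivAt (F.Φ w) (spray c w) (q * id (0:ℝ)) := by simpa using h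
      exact h3.scomp (0:ℝ) h2
    rw [← hasDerivWithinAt_univ] at h1 ⊢
    refine ((hasDerivWithinAt_fst h1).prodMk ((hasDerivWithinAt_snd h1).const_smul q)).congr_deriv ?_
    simp only [spray, Prod.smul_mk, hw2, hw1, smul_smul, map_smul, _root_.smul_apply, smul_neg]
    congr 1
    · rw [mul_inv_cancel₀ hq0.ne', one_smul]
    · congr 1
      rw [show q * (q * (q⁻¹ * q⁻¹)) = 1 by field_simp, one_smul]
  · have hp := hs.travelTime_pos hwS hz.1
    have hp' := hs.travelTime_pos (flip_mem_SM hwS) hz.1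
    have hcont : Continuous fun t : ℝ => q * t := by fun_prop
    have hn : Icc (-travelTime g (flip w)) (travelTime g w) ∈ 𝓝 (q * 0) := by
      rw [mul_zero]; exact Icc_mem_nhds (by linarith) hp
    filter_upwards [hcont.continuousAt.preimage_mem_nhds hn] with t ht
    rw [radial_smul hq0]
    exact radial_of_mem_SM (F.mem_SM hs.metric hs.nontrapping hwS ht)

/-- The integral is extended from `SM` to a Lipschitz function on all pairs and composed with the
radial projection. For the vertical bound, a vertical line through `z` projects to a curve in one
fibre of `SM`, so only the first-order constant of `exists_vertical_bound` survives differentiation.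
-/
theorem exists_isRayPotential (hs : IsSimpleC11 g) (hn : 1 ≤ n) (hf : IsRayWeight g f L)
    (h0 : ∀ z ∈ SM g, ∫ t in (-travelTime g (flip z))..travelTime g z, f (F.Φ z t) = 0) :
    ∃ U, IsRayPotential c f U := by
  obtain ⟨K, hK⟩ := F.exists_lipschitzOnWith_rayInt hs hf
  obtain ⟨û, hûL, hû⟩ := hK.extend_real
  have hS : ∀ z ∈ slit n, radial g z ∈ SM g := fun z hz => radial_mem_SM hs.metric hz
  have hU : ∀ z ∈ slit n, û (radial g z) = F.rayInt f (radial g z) := fun z hz => (hû (hS z hz)).symm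
  obtain ⟨C, hC0, hC⟩ := F.exists_vertical_bound hs hf h0 hn
  refine ⟨fun z => û (radial g z), ⟨û, ⟨K, hûL⟩, fun _ => rfl⟩, ?_, fun z hz => ?_,
    fun D hD hDs => ?_⟩
  · obtain ⟨C, hC0, hC⟩ := F.exists_bound_rayInt hs hf h0 hn
    exact ⟨C, hC0, fun z hz => by rw [hU z hz]; exact hC _ (hS z hz)⟩
  · obtain ⟨σ, hσ0, hσ, hσr⟩ := F.exists_curve_spray hs hz
    have hwS := hS z (slitI_subset_slit hz)
    set q := Real.sqrt (speedSq g z)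
    have h2 := F.hasDerivAt_rayInt_flow hs hf hwS hz.1
    have h3 : HasDerivAt (fun t => F.rayInt f (F.Φ (radial g z) (q * t)))
        (q * -f (radial g z)) 0 := by
      have h4 := (hasDerivAt_id (0:ℝ)).const_mul q
      rw [mul_one] at h4
      have h5 : HasDerivAt (fun s => F.rayInt f (F.Φ (radial g z) s)) (-f (radial g z))
        (q * id (0:ℝ)) := by simpa using h2
      have := h5.scomp (0:ℝ) h4
      exact this
    have h6 := h3.congr_of_eventuallyEq (f₁ := fun t => û (radial g (σ t))) (by
      have hmem : ∀ᶠ t in 𝓝 (0:ℝ), σ t ∈ slitI n :=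
        hσ.continuousAt.preimage_mem_nhds (by rw [hσ0]; exact slitI_mem_nhds hz)
      filter_upwards [hσr, hmem] with t ht ht'
      rw [hU _ (slitI_subset_slit ht'), ht])
    exact ⟨σ, hσ0, hσ, h6.congr_deriv (by ring)⟩
  · obtain ⟨R, hR0, hR⟩ := exists_bound_fderiv_radial hs.metric hD hDs
    refine ⟨C * R, by positivity, fun z hz hzI hd => ?_⟩
    have hdz : 0 ≤ 1 - ‖z.1‖ := by linarith [mem_inner_iff.1 hzI.1]
    refine ContinuousLinearMap.opNorm_le_bound _ (by positivity) fun ζ => ?_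
    have hwS := hS z (slitI_subset_slit hzI)
    obtain ⟨C', hC'⟩ := hC _ hwS hzI.1
    have hl : HasDerivAt (fun s : ℝ => z + s • ((0:E n), ζ)) ((0:E n), ζ) 0 := by
      simpa using ((hasDerivAt_id (0:ℝ)).smul_const ((0:E n), ζ)).const_add z
    have h1 : HasDerivAt (fun s : ℝ => û (radial g (z + s • ((0:E n), ζ))))
        (fderiv ℝ (fun z => û (radial g z)) z (0, ζ)) 0 :=
      HasFDerivAt.comp_hasDerivAt_of_eq (l := fun z => û (radial g z)) 0 hd.hasFDerivAt hl (by simp)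
    have hr := ((contDiffAt_radial hs.metric hzI).differentiableAt one_ne_zero).hasFDerivAt
    have h2 : HasDerivAt (fun s : ℝ => (radial g (z + s • ((0:E n), ζ))))
        (fderiv ℝ (radial g) z (0, ζ)) 0 := HasFDerivAt.comp_hasDerivAt_of_eq 0 hr hl (by simp)
    rw [← hasDerivWithinAt_univ] at h2
    have h3 := hasDerivWithinAt_univ.1 (hasDerivWithinAt_snd h2)
    have h4 := abs_deriv_le_of_abs_sub_le h1 h3 (M := C * (1 - ‖z.1‖)) (C := C') (by
      have hmem : ∀ᶠ s in 𝓝 (0:ℝ), z + s • ((0:E n), ζ) ∈ slitI n :=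
        hl.continuousAt.preimage_mem_nhds (by simpa using slitI_mem_nhds hzI)
      filter_upwards [hmem] with s hs'
      have hs2 := hS _ (slitI_subset_slit hs')
      have e : (radial g (z + s • ((0:E n), ζ))) =
          ((radial g z).1, (radial g (z + s • ((0:E n), ζ))).2) := by
        simp [radial]
      have h5 := hC' (radial g (z + s • ((0:E n), ζ))).2 (e ▸ hs2)
      rw [← e] at h5
      rw [hU _ (slitI_subset_slit hs')]
      simp only [zero_smul, add_zero]
      rw [hU _ (slitI_subset_slit hzI), abs_sub_comm, norm_sub_rev]
      exact h5)
    have h6 : ‖(fderiv ℝ (radial g) z (0, ζ)).2‖ ≤ R * ‖ζ‖ := by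
      refine (norm_snd_le _).trans ((ContinuousLinearMap.le_opNorm _ _).trans ?_)
      have : ‖((0:E n), ζ)‖ = ‖ζ‖ := by simp [Prod.norm_def]
      rw [this]
      gcongr
      exact hR z hz hzI
    rw [vD_apply, Real.norm_eq_abs]
    refine h4.trans ?_
    have h7 := mul_le_mul_of_nonneg_left h6 (mul_nonneg hC0 hdz)
    linarith

end GeoFlow
end RoughXRay
end

/-! ### Cutoffs in the base and localization of the speed -/

noncomputable section
namespace RoughXRay
variable {n : ℕ} {g : E n → Matrix (Fin n) (Fin n) ℝ}

/-- A function that is Lipschitz near every point of a set is differentiable at almost every point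
of it. -/
theorem ae_differentiableAt_of_lipAt {X F : Type*} [NormedAddCommGroup X] [NormedSpace ℝ X]
    [FiniteDimensional ℝ X] [MeasurableSpace X] [BorelSpace X] [NormedAddCommGroup F]
    [NormedSpace ℝ F] [FiniteDimensional ℝ F] (μ : Measure X) [μ.IsAddHaarMeasure]
    {f : X → F} {s : Set X} (h : ∀ x ∈ s, LipAt f x) : ∀ᵐ x ∂μ, x ∈ s → DifferentiableAt ℝ f x := by
  have : ProperSpace X := FiniteDimensional.proper_real X
  rw [ae_iff]
  refine measure_null_of_locally_null _ fun x hx => ?_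
  simp only [Classical.not_imp, Set.mem_ofPred_eq] at hx
  obtain ⟨K, t, ht, hK⟩ := h x hx.1
  refine ⟨_, inter_mem_nhdsWithin _ (interior_mem_nhds.2 ht), measure_mono_null ?_
    (ae_iff.1 (hK.ae_differentiableWithinAt_of_mem (μ := μ)))⟩
  rintro y ⟨hy, hyt⟩
  simp only [Classical.not_imp, Set.mem_ofPred_eq] at hy ⊢
  exact ⟨interior_subset hyt, fun hd => hy.2 (hd.differentiableAt (mem_interior_iff_mem_nhds.1 hyt))⟩

/-- Smooth cutoff functions exhausting the interior of the ball, with gradients of the order of the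
inverse distance to the boundary. -/
theorem exists_cutoff (n : ℕ) : ∃ (χ : ℕ → E n → ℝ) (C : ℝ), 0 ≤ C ∧ ∀ k, ContDiff ℝ 2 (χ k) ∧
    tsupport (χ k) ⊆ inner n ∧ (∀ x, |χ k x| ≤ 1) ∧
    (∀ x ∈ ball n, ‖fderiv ℝ (χ k) x‖ * (1 - ‖x‖) ≤ C) ∧
    ∀ x ∈ inner n, ∀ᶠ k in atTop, χ k x = 1 ∧ fderiv ℝ (χ k) x = 0 := by
  set θ : ℝ → ℝ := fun s => Real.smoothTransition (s - 1) with hθ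
  have hθs : ContDiff ℝ 2 θ := (Real.smoothTransition.contDiff (n := 2)).comp (contDiff_id.sub contDiff_const)
  have hd0 : ∀ s, s ∉ Icc (1:ℝ) 2 → deriv θ s = 0 := by
    intro s hs
    rw [mem_Icc, not_and_or, not_le, not_le] at hs
    rcases hs with h | h
    · have : θ =ᶠ[𝓝 s] fun _ => 0 := by
        filter_upwards [Iio_mem_nhds h] with r hr
        exact Real.smoothTransition.zero_of_nonpos (by linarith [show r < 1 from hr])
      rw [this.deriv_eq]; simp
    · have : θ =ᶠ[𝓝 s] fun _ => 1 := by
        filter_upwards [Ioi_mem_nhds h] with r hr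
        exact Real.smoothTransition.one_of_one_le (by linarith [show 2 < r from hr])
      rw [this.deriv_eq]; simp
  obtain ⟨M, hM⟩ := (isCompact_Icc (a := (1:ℝ)) (b := 2)).exists_bound_of_continuousOn
    (hθs.continuous_deriv (by norm_num)).continuousOn
  have hM0 : 0 ≤ M := (norm_nonneg _).trans (hM 1 (by norm_num))
  -- The gradient is of order `k` and lives where `1 ≤ k (1 - |x|²) ≤ 2`, hence where `k (1 - |x|) ≤
  -- 2`.
  set χ : ℕ → E n → ℝ := fun k x => θ (k * (1 - ‖x‖ ^ 2)) with hχ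
  have hfd : ∀ k x, HasFDerivAt (χ k)
      ((deriv θ (k * (1 - ‖x‖ ^ 2)) * (k * (-2))) • (innerSL ℝ x : E n →L[ℝ] ℝ)) x := by
    intro k x
    have h1 := ((hasStrictFDerivAt_norm_sq x).hasFDerivAt.const_sub 1).const_mul (k:ℝ)
    refine (((hθs.differentiable two_ne_zero _).hasDerivAt).comp_hasFDerivAt x h1).congr_fderiv ?_
    ext ζ
    simp
    ring
  have hz : ∀ (k : ℕ) (x : E n), (k:ℝ) * (1 - ‖x‖ ^ 2) ≤ 1 → χ k x = 0 := fun k x h =>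
    Real.smoothTransition.zero_of_nonpos (by linarith)
  have hsupp : ∀ k, tsupport (χ k) ⊆ {x | 1 ≤ (k:ℝ) * (1 - ‖x‖ ^ 2)} := by
    intro k
    refine closure_minimal (fun x hx => ?_) (isClosed_le continuous_const (by fun_prop))
    by_contra hlt
    exact hx (hz k x (le_of_not_ge hlt))
  have hsub : ∀ k, tsupport (χ k) ⊆ inner n := fun k x hx => by
    have h1 : 1 ≤ (k:ℝ) * (1 - ‖x‖ ^ 2) := hsupp k hx
    rw [mem_inner_iff]
    by_contra! hge
    have : (k:ℝ) * (1 - ‖x‖ ^ 2) ≤ 0 :=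
      mul_nonpos_of_nonneg_of_nonpos (Nat.cast_nonneg k) (by nlinarith)
    linarith
  refine ⟨χ, 4 * M, by positivity, fun k => ⟨hθs.comp (contDiff_const.mul (contDiff_const.sub (contDiff_norm_sq ℝ))), hsub k, fun x => ?_,
    fun x hx => ?_, fun x hx => ?_⟩⟩
  · rw [abs_of_nonneg (Real.smoothTransition.nonneg _)]
    exact Real.smoothTransition.le_one _
  · have hx1 := mem_ball_iff.1 hx
    have hx0 := norm_nonneg x
    rw [(hfd k x).fderiv]
    by_cases hm : (k:ℝ) * (1 - ‖x‖ ^ 2) ∈ Icc (1:ℝ) 2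
    · have h1 := hM _ hm
      have hk0 : (0:ℝ) ≤ k := Nat.cast_nonneg k
      have h2 : (k:ℝ) * (1 - ‖x‖) ≤ 2 := by
        refine le_trans ?_ hm.2
        gcongr
        nlinarith
      rw [norm_smul, innerSL_apply_norm, norm_mul, norm_mul, Real.norm_of_nonneg hk0, norm_neg,
        Real.norm_ofNat]
      have h3 : 0 ≤ (k:ℝ) * (1 - ‖x‖) := mul_nonneg hk0 (by linarith)
      calc _ = ‖deriv θ (k * (1 - ‖x‖ ^ 2))‖ * 2 * ‖x‖ * (k * (1 - ‖x‖)) := by ring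
        _ ≤ M * 2 * 1 * 2 := by gcongr
        _ = _ := by ring
    · rw [hd0 _ hm]; simp; positivity
  · have hlim : Tendsto (fun k : ℕ => (k:ℝ) * (1 - ‖x‖ ^ 2)) atTop atTop :=
      tendsto_natCast_atTop_atTop.atTop_mul_const (by nlinarith [mem_inner_iff.1 hx, norm_nonneg x])
    filter_upwards [hlim.eventually_gt_atTop 2] with k hk
    refine ⟨Real.smoothTransition.one_of_one_le (by linarith), ?_⟩
    rw [(hfd k x).fderiv, hd0 _ (fun h => by linarith [h.2]), zero_mul, zero_smul]

theorem isCompact_shell (hg : IsC11Metric g) {A : Set (E n)} (hA : IsClosed A) (hAb : A ⊆ ball n)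
    {I : Set ℝ} (hI : IsCompact I) (hI0 : I ⊆ Ioi 0) :
    IsCompact {z : E n × E n | z.1 ∈ A ∧ speedSq g z ∈ I} ∧
      {z : E n × E n | z.1 ∈ A ∧ speedSq g z ∈ I} ⊆ slit n := by
  obtain ⟨a, ha, hell⟩ := exists_ellipticity hg
  obtain ⟨b, hb⟩ := hI.isBounded.exists_norm_le
  have hqc : ContinuousOn (speedSq g) (A ×ˢ univ) := by
    have e : speedSq g = fun p => ip g p.1 p.2 p.2 := funext fun z => gF_apply _ _ _
    rw [e]
    exact (continuousOn_ip hg).mono (prod_mono_left hAb)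
  have e : {z : E n × E n | z.1 ∈ A ∧ speedSq g z ∈ I} = (A ×ˢ univ) ∩ speedSq g ⁻¹' I := by
    ext z; simp
  refine ⟨?_, fun z hz => ⟨hAb hz.1, fun h0 => ?_⟩⟩
  · have hcl : IsClosed {z : E n × E n | z.1 ∈ A ∧ speedSq g z ∈ I} := by
      rw [e]; exact hqc.preimage_isClosed_of_isClosed (hA.prod isClosed_univ) hI.isClosed
    refine (isCompact_ball.prod (isCompact_closedBall (0 : E n) (Real.sqrt (b / a)))).of_isClosed_subset
      hcl fun z hz => ⟨hAb hz.1, ?_⟩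
    rw [mem_closedBall_zero_iff]
    refine Real.le_sqrt_of_sq_le ?_
    rw [le_div_iff₀ ha, mul_comm]
    exact (hell _ (hAb hz.1) _).trans ((le_abs_self _).trans (hb _ hz.2))
  · have h1 := hI0 hz.2
    rw [speedSq, show z.2 = 0 from h0] at h1
    simp at h1

theorem vD_speedSq (hg : IsC11Metric g) {z : E n × E n} (hz : z.1 ∈ inner n) :
    vD (speedSq g) z = (2:ℝ) • gF g z.1 z.2 := by
  have h := ((hasFDerivAt_gF_fst hg hz).clm_apply hasFDerivAt_snd).clm_apply hasFDerivAt_snd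
  ext1 ζ
  rw [vD_apply, show speedSq g = fun p => gF g p.1 p.2 p.2 from rfl, h.fderiv]
  simp [gF_symm hg (inner_subset_ball hz) ζ z.2]
  ring

/-- `U` is locally Lipschitz, vanishes over the boundary to first order together with its vertical
derivative, and its derivative along the geodesic vector field is the locally Lipschitz `Y`. -/
structure IsRoughPair (c : Conn g) (U Y : E n × E n → ℝ) : Prop where
  lipU : ∀ z ∈ slitI n, LipAt U z
  lipY : ∀ z ∈ slitI n, LipAt Y z
  boundU : ∃ C : ℝ, 0 ≤ C ∧ ∀ z ∈ slit n, |U z| ≤ C * (1 - ‖z.1‖)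
  fderiv_spray : ∀ z ∈ slitI n, DifferentiableAt ℝ U z → fderiv ℝ U z (spray c z) = Y z
  vert_boundU : ∀ K : Set (E n × E n), IsCompact K → K ⊆ slit n → ∃ C : ℝ, 0 ≤ C ∧
    ∀ z ∈ K, z ∈ slitI n → DifferentiableAt ℝ U z → ‖vD U z‖ ≤ C * (1 - ‖z.1‖)
  boundY : ∀ K : Set (E n × E n), IsCompact K → K ⊆ slit n → ∃ C : ℝ, 0 ≤ C ∧
    ∀ z ∈ K, z ∈ slitI n → |Y z| ≤ C ∧ (DifferentiableAt ℝ Y z → ‖vD Y z‖ ≤ C)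

end RoughXRay
end

/-! ### The energy inequality up to the boundary -/

noncomputable section
namespace RoughXRay
variable {n : ℕ} {g : E n → Matrix (Fin n) (Fin n) ℝ}

/-- The energy density of `U` and `Y` with weight `κ(|v|²)² det g`, cut off in the base. -/
def cutEnergy (g : E n → Matrix (Fin n) (Fin n) ℝ) (ε : ℝ) (κ : ℝ → ℝ) (U Y : E n × E n → ℝ)
    (χ : E n → ℝ) (z : E n × E n) : ℝ :=
  κ (speedSq g z) ^ 2 * ((g z.1).det * energy g ε z
    (χ z.1 * Y z + fderiv ℝ χ z.1 z.2 * U z)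
    (χ z.1 • vD Y z + (fderiv ℝ χ z.1 z.2 • vD U z + U z • fderiv ℝ χ z.1)) (χ z.1 • vD U z))

/-- Makes a profile in the speed pass out of the energy density as a square, without terms
containing its derivative. -/
theorem energy_add_flat (hg : IsC11Metric g) (ε : ℝ) {z : E n × E n} (hz : z ∈ slitI n) (y s t r : ℝ)
    (η α : E n →L[ℝ] ℝ) :
    energy g ε z (r * y) (r • η + s • gF g z.1 z.2) (r • α + t • gF g z.1 z.2) =
      r ^ 2 * energy g ε z y η α := by
  simp only [energy, coN_add_flat hg (inner_subset_ball hz.1) hz.2, coN_smul]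
  ring

/-- The Lipschitz energy inequality for `κ(|v|²) χ(x) U`. As the speed is constant along the spray,
only `χ` produces a commutator there, and the vertical derivative of `κ(|v|²)` is a multiple of
`v♭`. -/
theorem integral_cutEnergy_nonneg (c : Conn g) (hg : IsC11Metric g) (hn : 1 ≤ n) {ε : ℝ}
    (hε : ∀ W : H10 g, ε * ipL2 g W.sec W.sec ≤ quadForm g W) {U Y : E n × E n → ℝ}
    (hUY : IsRoughPair c U Y) {κ : ℝ → ℝ} (hκ : ContDiff ℝ 1 κ) (hκc : HasCompactSupport κ)
    (hκ0 : tsupport κ ⊆ Ioi 0) {χ : E n → ℝ} (hχ : ContDiff ℝ 2 χ)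
    (hχi : tsupport χ ⊆ inner n) :
    Integrable ((slitI n).indicator (cutEnergy g ε κ U Y χ)) ∧
      0 ≤ ∫ z, (slitI n).indicator (cutEnergy g ε κ U Y χ) z := by
  set S : Set (E n × E n) := {z | z.1 ∈ tsupport χ ∧ speedSq g z ∈ tsupport κ} with hS
  obtain ⟨hSc, hSs⟩ := isCompact_shell hg (isClosed_tsupport χ) (hχi.trans inner_subset_ball)
    hκc.isCompact hκ0
  have hSI : S ⊆ slitI n := fun z hz => ⟨hχi hz.1, (hSs hz).2⟩
  have hχ' : ContDiff ℝ 1 (fderiv ℝ χ) := hχ.fderiv_right (by norm_num)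
  set u : E n × E n → ℝ := fun z => κ (speedSq g z) * (χ z.1 * U z) with hu
  set y : E n × E n → ℝ := fun z => κ (speedSq g z) * (χ z.1 * Y z + fderiv ℝ χ z.1 z.2 * U z) with hy
  have hus : tsupport u ⊆ S := by
    refine closure_minimal (fun z hz => ?_) hSc.isClosed
    by_contra hne
    refine hz ?_
    rw [hS, Set.mem_ofPred_eq, not_and_or] at hne
    rcases hne with h | h
    · simp [hu, image_eq_zero_of_notMem_tsupport h]
    · simp [hu, image_eq_zero_of_notMem_tsupport h]
  have hys : tsupport y ⊆ S := by
    refine closure_minimal (fun z hz => ?_) hSc.isClosed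
    by_contra hne
    refine hz ?_
    rw [hS, Set.mem_ofPred_eq, not_and_or] at hne
    rcases hne with h | h
    · simp [hy, image_eq_zero_of_notMem_tsupport h, fderiv_of_notMem_tsupport h]
    · simp [hy, image_eq_zero_of_notMem_tsupport h]
  have hκq : ∀ z ∈ slitI n, ContDiffAt ℝ 1 (fun z => κ (speedSq g z)) z := fun z hz =>
    hκ.contDiffAt.comp z (contDiffAt_speedSq hg hz.1)
  have hχz : ∀ z : E n × E n, ContDiffAt ℝ 1 (fun z : E n × E n => χ z.1) z := fun z =>
    ((hχ.of_le (by norm_num)).comp contDiff_fst).contDiffAt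
  have hdz : ∀ z : E n × E n, ContDiffAt ℝ 1 (fun z : E n × E n => fderiv ℝ χ z.1 z.2) z := fun z =>
    ((hχ'.comp contDiff_fst).clm_apply contDiff_snd).contDiffAt
  have hcu : HasCompactSupport u := hSc.of_isClosed_subset (isClosed_tsupport _) hus
  have hcy : HasCompactSupport y := hSc.of_isClosed_subset (isClosed_tsupport _) hys
  obtain ⟨Ku, hKu⟩ := exists_lipschitzWith_of_lipAt hcu fun z hz =>
    (lipAt_of_contDiffAt (hκq z (hSI (hus hz)))).mul
      ((lipAt_of_contDiffAt (hχz z)).mul (hUY.lipU z (hSI (hus hz))))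
  obtain ⟨Ky, hKy⟩ := exists_lipschitzWith_of_lipAt hcy fun z hz =>
    (lipAt_of_contDiffAt (hκq z (hSI (hys hz)))).mul
      (((lipAt_of_contDiffAt (hχz z)).mul (hUY.lipY z (hSI (hys hz)))).add
        ((lipAt_of_contDiffAt (hdz z)).mul (hUY.lipU z (hSI (hys hz)))))
  have dκ : ∀ z ∈ slitI n, HasFDerivAt (fun z => κ (speedSq g z))
      (deriv κ (speedSq g z) • fderiv ℝ (speedSq g) z) z := fun z hz =>
    (hκ.differentiable one_ne_zero _).hasDerivAt.comp_hasFDerivAt z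
      ((contDiffAt_speedSq hg hz.1).differentiableAt one_ne_zero).hasFDerivAt
  have dχ : ∀ z : E n × E n, HasFDerivAt (fun z : E n × E n => χ z.1)
      ((fderiv ℝ χ z.1).comp (ContinuousLinearMap.fst ℝ (E n) (E n))) z := fun z =>
    ((hχ.differentiable two_ne_zero z.1).hasFDerivAt).comp z hasFDerivAt_fst
  have du : ∀ z ∈ slitI n, DifferentiableAt ℝ U z → HasFDerivAt u _ z := fun z hz hd =>
    (dκ z hz).fun_mul ((dχ z).fun_mul hd.hasFDerivAt)
  have ddχ : ∀ z : E n × E n, HasFDerivAt (fun z : E n × E n => fderiv ℝ χ z.1 z.2) _ z := fun z =>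
    (((hχ'.differentiable one_ne_zero z.1).hasFDerivAt).comp z hasFDerivAt_fst).clm_apply
      hasFDerivAt_snd
  have dy : ∀ z ∈ slitI n, DifferentiableAt ℝ U z → DifferentiableAt ℝ Y z →
      HasFDerivAt y _ z := fun z hz hd hd' =>
    (dκ z hz).fun_mul (((dχ z).fun_mul hd'.hasFDerivAt).fun_add ((ddχ z).fun_mul hd.hasFDerivAt))
  have hq1 := fun z (hz : z ∈ slitI n) => fderiv_speedSq_spray c hg hz.1
  have hq2 : ∀ z ∈ slitI n, ∀ ζ, fderiv ℝ (speedSq g) z (0, ζ) = 2 * gF g z.1 z.2 ζ :=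
    fun z hz ζ => by rw [← vD_apply, vD_speedSq hg hz.1]; rfl
  have hX : ∀ᵐ z, fderiv ℝ u z (spray c z) = y z := by
    filter_upwards [ae_differentiableAt_of_lipAt volume hUY.lipU] with z hz
    by_cases hzS : z ∈ S
    · have hzI := hSI hzS
      have hd := hz hzI
      rw [(du z hzI hd).fderiv]
      simp only [_root_.add_apply, _root_.smul_apply, hq1 z hzI, smul_eq_mul, mul_zero, add_zero,
        hUY.fderiv_spray z hzI hd, ContinuousLinearMap.comp_apply, ContinuousLinearMap.coe_fst', hy]
      simp only [spray]
      ring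
    · have h1 : y z = 0 := image_eq_zero_of_notMem_tsupport fun h => hzS (hys h)
      rw [h1, fderiv_of_notMem_tsupport fun h => hzS (hus h), _root_.zero_apply]
  have hmain := integral_energy_nonneg_of_lipschitz c hg hn hε hKu hcu (hus.trans hSI) hKy hX
  have hae : (fun z => (g z.1).det * energy g ε z (y z) (vD y z) (vD u z)) =ᵐ[volume]
      (slitI n).indicator (cutEnergy g ε κ U Y χ) := by
    filter_upwards [ae_differentiableAt_of_lipAt volume hUY.lipU,
      ae_differentiableAt_of_lipAt volume hUY.lipY] with z hz hz'
    by_cases hzI : z ∈ slitI n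
    · have hd := hz hzI
      have hd' := hz' hzI
      rw [indicator_of_mem hzI]
      have eu : vD u z = κ (speedSq g z) • (χ z.1 • vD U z) +
          (2 * deriv κ (speedSq g z) * (χ z.1 * U z)) • gF g z.1 z.2 := by
        ext1 ζ
        rw [vD_apply, (du z hzI hd).fderiv]
        simp only [_root_.add_apply, _root_.smul_apply, hq2 z hzI, smul_eq_mul, vD_apply,
          ContinuousLinearMap.comp_apply, ContinuousLinearMap.coe_fst', map_zero, mul_zero, add_zero]
        ring
      have ey : vD y z = κ (speedSq g z) • (χ z.1 • vD Y z + (fderiv ℝ χ z.1 z.2 • vD U z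
            + U z • fderiv ℝ χ z.1)) +
          (2 * deriv κ (speedSq g z) * (χ z.1 * Y z + fderiv ℝ χ z.1 z.2 * U z)) •
            gF g z.1 z.2 := by
        ext1 ζ
        rw [vD_apply, (dy z hzI hd hd').fderiv]
        simp only [_root_.add_apply, _root_.smul_apply, hq2 z hzI, smul_eq_mul, vD_apply,
          ContinuousLinearMap.comp_apply, ContinuousLinearMap.coe_fst', ContinuousLinearMap.coe_snd',
          map_zero, mul_zero, add_zero, ContinuousLinearMap.flip_apply,
          _root_.zero_apply, Function.comp]
        ring
      rw [eu, ey, hy]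
      simp only [energy_add_flat hg ε hzI, cutEnergy]
      ring
    · rw [indicator_of_notMem hzI]
      have h1 : y z = 0 := image_eq_zero_of_notMem_tsupport fun h => hzI (hSI (hys h))
      have h2 : vD y z = 0 := by
        rw [vD, fderiv_of_notMem_tsupport fun h => hzI (hSI (hys h)), ContinuousLinearMap.zero_comp]
      have h3 : vD u z = 0 := by
        rw [vD, fderiv_of_notMem_tsupport fun h => hzI (hSI (hus h)), ContinuousLinearMap.zero_comp]
      rw [h1, h2, h3]
      simp [energy, coN]
  exact ⟨hmain.1.congr hae, by rw [← integral_congr_ae hae]; exact hmain.2⟩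

/-- The energy inequality for a rough potential. -/
theorem IsRoughPair.integral_energy_nonneg {c : Conn g} (hg : IsC11Metric g) (hn : 1 ≤ n) {ε : ℝ}
    (hε : ∀ W : H10 g, ε * ipL2 g W.sec W.sec ≤ quadForm g W) {U Y : E n × E n → ℝ}
    (hUY : IsRoughPair c U Y) {κ : ℝ → ℝ} (hκ : ContDiff ℝ 1 κ) (hκc : HasCompactSupport κ)
    (hκ0 : tsupport κ ⊆ Ioi 0) :
    IntegrableOn (fun z => κ (speedSq g z) ^ 2 *
      ((g z.1).det * energy g ε z (Y z) (vD Y z) (vD U z))) (slitI n) ∧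
    0 ≤ ∫ z in slitI n, κ (speedSq g z) ^ 2 *
      ((g z.1).det * energy g ε z (Y z) (vD Y z) (vD U z)) := by
  obtain ⟨χ, M, hM0, hχ⟩ := exists_cutoff n
  set I : E n × E n → ℝ := fun z => κ (speedSq g z) ^ 2 *
      ((g z.1).det * energy g ε z (Y z) (vD Y z) (vD U z)) with hI
  have hint := fun k => integral_cutEnergy_nonneg c hg hn hε hUY hκ hκc hκ0 (hχ k).1
    (hχ k).2.1
  obtain ⟨hSc, hSs⟩ := isCompact_shell hg isClosed_ball subset_rfl hκc.isCompact hκ0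
  set S : Set (E n × E n) := {z | z.1 ∈ ball n ∧ speedSq g z ∈ tsupport κ} with hS
  obtain ⟨R, hR⟩ := hSc.isBounded.exists_norm_le
  obtain ⟨A, hA⟩ := hκc.exists_bound_of_continuous hκ.continuous
  obtain ⟨CU, hCU0, hCU⟩ := hUY.boundU
  obtain ⟨CV, hCV0, hCV⟩ := hUY.vert_boundU S hSc hSs
  obtain ⟨CY, hCY0, hCY⟩ := hUY.boundY S hSc hSs
  obtain ⟨D, hD0, hD⟩ := exists_bound_energy hg ε hSc hSs
  set bd : E n × E n → ℝ := S.indicator fun _ => A ^ 2 * (D * ((CY + M * R * CU) ^ 2 +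
    (CY + (M * R * CV + CU * M)) ^ 2 + CV ^ 2)) with hbd
  have hbi : Integrable bd := by
    rw [hbd, integrable_indicator_iff hSc.isClosed.measurableSet]
    exact integrableOn_const hSc.measure_lt_top.ne
  have hbound : ∀ k, ∀ᵐ z, ‖(slitI n).indicator (cutEnergy g ε κ U Y (χ k)) z‖ ≤ bd z := by
    intro k
    obtain ⟨-, -, hχ1, hχd, -⟩ := hχ k
    filter_upwards [ae_differentiableAt_of_lipAt volume hUY.lipU,
      ae_differentiableAt_of_lipAt volume hUY.lipY] with z hz hz'
    have hbd0 : 0 ≤ bd z := indicator_nonneg (fun _ _ => by positivity) z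
    by_cases hzI : z ∈ slitI n
    · rw [indicator_of_mem hzI]
      by_cases hzS : z ∈ S
      · rw [hbd, indicator_of_mem hzS, cutEnergy, norm_mul, norm_pow]
        have hx1 := mem_ball_iff.1 hzS.1
        have hx0 : 0 ≤ 1 - ‖z.1‖ := by linarith
        have hv : ‖z.2‖ ≤ R := (norm_snd_le z).trans (hR z hzS)
        have hR0 : 0 ≤ R := (norm_nonneg _).trans hv
        have b1 := hCY z hzS hzI
        have b2 := hCU z (hSs hzS)
        have b3 := hCV z hzS hzI (hz hzI)
        have b4 := b1.2 (hz' hzI)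
        have b5 := hχd z.1 hzS.1
        have b6 := hχ1 z.1
        have b7 : |fderiv ℝ (χ k) z.1 z.2| ≤ ‖fderiv ℝ (χ k) z.1‖ * R :=
          (ContinuousLinearMap.le_opNorm (fderiv ℝ (χ k) z.1) z.2).trans (by gcongr)
        have b8 : ‖vD U z‖ ≤ CV := b3.trans (mul_le_of_le_one_right hCV0 (by linarith [norm_nonneg z.1]))
        have c1 : ∀ {a b C : ℝ}, |a| ≤ 1 → |b| ≤ C → |a * b| ≤ C := fun {a b C} h h' => by
          rw [abs_mul]; nlinarith [abs_nonneg a, abs_nonneg b]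
        -- The gradients of the cutoffs, of order `1 / (1 - ‖x‖)`, are absorbed by the first-order
        -- vanishing of `U` and of its vertical derivative; the bound is uniform in `k`.
        have c2 : ∀ {p r C : ℝ}, 0 ≤ C → 0 ≤ p → p ≤ ‖fderiv ℝ (χ k) z.1‖ * R →
            r ≤ C * (1 - ‖z.1‖) → p * r ≤ M * R * C := fun {p r C} hC hp h h' => by
          calc p * r ≤ p * (C * (1 - ‖z.1‖)) := by gcongr
            _ ≤ (‖fderiv ℝ (χ k) z.1‖ * R) * (C * (1 - ‖z.1‖)) := by gcongr
            _ = (‖fderiv ℝ (χ k) z.1‖ * (1 - ‖z.1‖)) * R * C := by ring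
            _ ≤ M * R * C := by gcongr
        refine mul_le_mul (by gcongr; exact hA _) ((hD z hzS _ _ _).trans ?_) (norm_nonneg _)
          (by positivity)
        gcongr ?_ * (?_ + ?_ + ?_)
        · rw [← sq_abs]
          refine pow_le_pow_left₀ (abs_nonneg _) ((abs_add_le _ _).trans ?_) 2
          refine add_le_add (c1 b6 b1.1) ?_
          rw [abs_mul]
          exact c2 hCU0 (abs_nonneg _) b7 b2
        · refine pow_le_pow_left₀ (norm_nonneg _) ((norm_add_le _ _).trans
            (add_le_add ?_ ((norm_add_le _ _).trans (add_le_add ?_ ?_)))) 2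
          · rw [norm_smul, Real.norm_eq_abs]
            exact (mul_le_of_le_one_left (norm_nonneg _) b6).trans b4
          · rw [norm_smul, Real.norm_eq_abs]
            exact c2 hCV0 (abs_nonneg _) b7 b3
          · rw [norm_smul, Real.norm_eq_abs]
            calc |U z| * ‖fderiv ℝ (χ k) z.1‖ ≤ (CU * (1 - ‖z.1‖)) * ‖fderiv ℝ (χ k) z.1‖ := by gcongr
              _ = CU * (‖fderiv ℝ (χ k) z.1‖ * (1 - ‖z.1‖)) := by ring
              _ ≤ CU * M := by gcongr
        · refine pow_le_pow_left₀ (norm_nonneg _) ?_ 2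
          rw [norm_smul, Real.norm_eq_abs]
          exact (mul_le_of_le_one_left (norm_nonneg _) b6).trans b8
      · have : κ (speedSq g z) = 0 := image_eq_zero_of_notMem_tsupport fun h =>
          hzS ⟨inner_subset_ball hzI.1, h⟩
        rw [cutEnergy, this]
        simpa using hbd0
    · rw [indicator_of_notMem hzI]
      simpa using hbd0
  have htend : ∀ᵐ z, Tendsto (fun k => (slitI n).indicator (cutEnergy g ε κ U Y (χ k)) z) atTop
      (𝓝 ((slitI n).indicator I z)) := by
    refine Eventually.of_forall fun z => ?_
    by_cases hzI : z ∈ slitI n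
    · simp only [indicator_of_mem hzI]
      refine tendsto_const_nhds.congr' ?_
      have hev : ∀ᶠ k in atTop, χ k z.1 = 1 ∧ fderiv ℝ (χ k) z.1 = 0 := (hχ 0).2.2.2.2 z.1 hzI.1
      filter_upwards [hev] with k hk
      simp [cutEnergy, hI, hk.1, hk.2]
    · simp only [indicator_of_notMem hzI]
      exact tendsto_const_nhds
  have hlimI := tendsto_integral_of_dominated_convergence bd
    (fun k => (hint k).1.aestronglyMeasurable) hbi hbound htend
  have hfin : Integrable ((slitI n).indicator I) := by
    refine hbi.mono' (aestronglyMeasurable_of_tendsto_ae _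
      (fun k => (hint k).1.aestronglyMeasurable) htend) ?_
    filter_upwards [htend, ae_all_iff.2 hbound] with z h1 h2
    exact le_of_tendsto' h1.norm h2
  have hm := (isOpen_slitI (n := n)).measurableSet
  refine ⟨(integrable_indicator_iff hm).1 hfin, ?_⟩
  rw [← integral_indicator hm]
  exact ge_of_tendsto' hlimI fun k => (hint k).2

end RoughXRay
end

/-! ### The trace identity in the fibres and rough pairs from potentials -/

noncomputable section
namespace RoughXRay
variable {n : ℕ} {g : E n → Matrix (Fin n) (Fin n) ℝ}

/-- The trace identity `∫ |ℓ|² = n ∫ ℓ(v)² / |v|²` over the shells of a Euclidean norm. -/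
theorem integral_fiber_trace {A : E n →L[ℝ] E n →L[ℝ] ℝ} (hA : ∀ v w, A v w = A w v) {a : ℝ}
    (ha : 0 < a) (hpos : ∀ v, a * ‖v‖ ^ 2 ≤ A v v) (w : E n) {κ : ℝ → ℝ} (hκ : ContDiff ℝ 1 κ)
    (hκc : HasCompactSupport κ) (hκ0 : tsupport κ ⊆ Ioi 0) :
    ∫ v, κ (A v v) ^ 2 * (A w w - n * A w v ^ 2 / A v v) = 0 := by
  set k : ℝ → ℝ := fun s => κ s ^ 2 / s with hk
  have hkt : tsupport k ⊆ tsupport κ := closure_mono fun s hs h => hs (by simp [hk, h])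
  have hks : ContDiff ℝ 1 k := contDiff_iff_contDiffAt.2 fun s => by
    by_cases hs : s ∈ tsupport k
    · exact (hκ.contDiffAt.pow 2).div contDiffAt_id (hκ0 (hkt hs)).ne'
    · exact contDiffAt_const.congr_of_eventuallyEq (notMem_tsupport_iff_eventuallyEq.1 hs)
  obtain ⟨b, hb⟩ := hκc.isCompact.isBounded.exists_norm_le
  have hqs : ContDiff ℝ 1 fun v => A v v := A.contDiff.clm_apply contDiff_id
  have hkq : ContDiff ℝ 1 fun v => k (A v v) := hks.comp hqs
  have hkc : HasCompactSupport fun v => k (A v v) := by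
    refine HasCompactSupport.intro (isCompact_closedBall (0 : E n) (Real.sqrt (b / a))) fun v hv => ?_
    refine image_eq_zero_of_notMem_tsupport fun h => hv ?_
    rw [mem_closedBall_zero_iff]
    refine Real.le_sqrt_of_sq_le ?_
    rw [le_div_iff₀ ha, mul_comm]
    exact (hpos v).trans ((le_abs_self _).trans (hb _ (hkt h)))
  -- With `q = A v v` and `ℓ = A w v`, the integrand is the divergence of `k(q) (q ℓ w - ℓ² v)`. The
  -- terms containing the derivative of `k` cancel, and so do the derivatives of the powers of `ℓ`.
  set φ : Option (Fin n) → E n → ℝ := fun o v =>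
    k (A v v) * o.elim (A v v * A w v) (fun j => -(A w v * A w v * v j)) with hφ
  have hcoord : ∀ j, ContDiff ℝ 1 fun v : E n => v j := fun j =>
    (EuclideanSpace.proj j : E n →L[ℝ] ℝ).contDiff
  have hφs : ∀ o, ContDiff ℝ 1 (φ o) := by
    rintro (_ | j)
    · exact hkq.mul (hqs.mul (A w).contDiff)
    · exact hkq.mul (((A w).contDiff.mul (A w).contDiff).mul (hcoord j)).neg
  have hφc : ∀ o, HasCompactSupport (φ o) := fun o => hkc.mul_right
  refine (integral_eq_zero_of_ae_eq_sum_fderiv (volume : Measure (E n)) Finset.univ φ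
    (fun o => o.elim w bv) (fun o _ => (hφs o).lipschitzWith_of_hasCompactSupport (hφc o) one_ne_zero)
    (fun o _ => hφc o) (Eventually.of_forall fun v => ?_)).2
  have dq : HasFDerivAt (fun v => A v v) ((2:ℝ) • A v) v := by
    refine (A.hasFDerivAt.clm_apply (hasFDerivAt_id v)).congr_fderiv ?_
    ext ξ
    simp [hA ξ v]
    ring
  have dk : HasFDerivAt (fun v => k (A v v)) (deriv k (A v v) • ((2:ℝ) • A v)) v :=
    ((hks.differentiable one_ne_zero _).hasDerivAt).comp_hasFDerivAt v dq
  have dl : HasFDerivAt (fun v => A w v) (A w) v := (A w).hasFDerivAt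
  have d1 : HasFDerivAt (φ none) _ v := dk.fun_mul (dq.fun_mul dl)
  have d2 : ∀ j, HasFDerivAt (φ (some j)) _ v := fun j =>
    dk.fun_mul (((dl.fun_mul dl).fun_mul (EuclideanSpace.proj j : E n →L[ℝ] ℝ).hasFDerivAt).fun_neg)
  rw [Fintype.sum_option, d1.fderiv]
  simp only [(d2 _).fderiv, Option.elim]
  have e1 : ∀ B : E n →L[ℝ] ℝ, ∑ j, v j * B (bv j) = B v := fun B => by
    conv_rhs => rw [clm_eq_sum_coord B v]
    simp
  simp only [_root_.add_apply, _root_.smul_apply, _root_.neg_apply, smul_eq_mul]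
  have e2 : ∀ j, (EuclideanSpace.proj j : E n →L[ℝ] ℝ) (bv j) = 1 := fun j => by simp
  have e3 : ∀ j, (EuclideanSpace.proj j : E n →L[ℝ] ℝ) v = v j := fun j => rfl
  simp only [e2, e3]
  have e4 : ∀ j, k (A v v) * -(A w v * A w v * 1 + v j * (A w v * A w (bv j) + A w v * A w (bv j)))
      + -(A w v * A w v * v j) * (deriv k (A v v) * (2 * A v (bv j))) =
      -(k (A v v) * A w v ^ 2) - 2 * k (A v v) * A w v * (v j * A w (bv j))
        - 2 * A w v ^ 2 * deriv k (A v v) * (v j * A v (bv j)) := fun j => by ring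
  simp only [e4, Finset.sum_sub_distrib, ← Finset.mul_sum, e1, Finset.sum_const, Finset.card_univ,
    Fintype.card_fin, nsmul_eq_mul]
  have e5 : κ (A v v) ^ 2 = A v v * k (A v v) := by
    by_cases h0 : A v v = 0
    · have : κ 0 = 0 := image_eq_zero_of_notMem_tsupport fun h => lt_irrefl (0:ℝ) (hκ0 h)
      rw [h0, this]; simp
    · rw [hk]; field_simp
  have e6 : κ (A v v) ^ 2 / A v v = k (A v v) := rfl
  rw [mul_sub, mul_div_assoc', mul_comm (κ (A v v) ^ 2) (n * A w v ^ 2), mul_div_assoc, e6, e5, hA v w]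
  ring

/-- A potential whose derivative along geodesics is explicit enough gives a rough pair. -/
theorem IsRayPotential.isRoughPair {c : Conn g} (hg : IsC11Metric g) {f U Y : E n × E n → ℝ}
    (hU : IsRayPotential c f U) (hY : ∀ z ∈ slitI n, Y z = -(Real.sqrt (speedSq g z) * f (radial g z)))
    (hYl : ∀ z ∈ slitI n, LipAt Y z)
    (hYb : ∀ K : Set (E n × E n), IsCompact K → K ⊆ slit n → ∃ C : ℝ, 0 ≤ C ∧
      ∀ z ∈ K, z ∈ slitI n → |Y z| ≤ C ∧ (DifferentiableAt ℝ Y z → ‖vD Y z‖ ≤ C)) :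
    IsRoughPair c U Y where
  lipU z hz := by
    obtain ⟨û, ⟨K, hK⟩, hû⟩ := hU.eq_radial
    exact ((lipAt_of_lipschitzWith hK _).comp
      (lipAt_of_contDiffAt (contDiffAt_radial hg hz))).congr (Eventually.of_forall hû)
  lipY := hYl
  boundU := hU.bound
  fderiv_spray z hz hd := by rw [hU.fderiv_spray hz hd, hY z hz]
  vert_boundU := hU.vert_bound
  boundY := hYb

theorem vD_eq_of_hasFDerivAt {U : E n × E n → ℝ} {z : E n × E n} (hd : DifferentiableAt ℝ U z)
    {L : E n →L[ℝ] ℝ} (h : HasFDerivAt (fun v => U (z.1, v)) L z.2) : vD U z = L := by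
  have h1 : HasFDerivAt (fun v : E n => (z.1, v)) (ContinuousLinearMap.inr ℝ (E n) (E n)) z.2 :=
    (hasFDerivAt_const z.1 z.2).prodMk (hasFDerivAt_id z.2)
  have h2 := HasFDerivAt.comp (g := U) z.2 hd.hasFDerivAt h1
  exact h2.unique h

/-- The smooth profile `κ` used to localize the speed. -/
theorem exists_profile {s : ℝ} (hs : 0 < s) : ∃ κ : ℝ → ℝ, ContDiff ℝ 1 κ ∧ HasCompactSupport κ ∧
    tsupport κ ⊆ Ioi 0 ∧ ∀ᶠ r in 𝓝 s, κ r ≠ 0 := by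
  let φ : ContDiffBump s := ⟨s / 4, s / 2, by linarith, by linarith⟩
  refine ⟨φ, φ.contDiff, φ.hasCompactSupport, fun r hr => ?_, ?_⟩
  · rw [φ.tsupport_eq, Metric.mem_closedBall, Real.dist_eq, abs_le] at hr
    have : φ.rOut = s / 2 := rfl
    rw [mem_Ioi]
    linarith [hr.1]
  · filter_upwards [φ.eventuallyEq_one] with r hr
    rw [hr]; simp

end RoughXRay
end

/-! ### Functions: vanishing in the interior -/

noncomputable section
namespace RoughXRay
variable {n : ℕ} {g : E n → Matrix (Fin n) (Fin n) ℝ}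

theorem lipAt_of_lipschitzOnWith_ball {F : Type*} [NormedAddCommGroup F] [NormedSpace ℝ F]
    {f : E n → F} {K : NNReal} (hf : LipschitzOnWith K f (ball n)) {x : E n} (hx : x ∈ inner n) :
    LipAt f x := ⟨K, ball n, ball_mem_nhds hx, hf⟩

theorem exists_bound_of_lipschitzOnWith_ball {F : Type*} [NormedAddCommGroup F]
    {f : E n → F} {K : NNReal} (hf : LipschitzOnWith K f (ball n)) :
    ∃ C : ℝ, 0 ≤ C ∧ ∀ x ∈ ball n, ‖f x‖ ≤ C := by
  obtain ⟨C, hC⟩ := isCompact_ball.exists_bound_of_continuousOn hf.continuousOn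
  exact ⟨max C 0, le_max_right _ _, fun x hx => (hC x hx).trans (le_max_left _ _)⟩

theorem exists_bound_speedSq (hg : IsC11Metric g) {K : Set (E n × E n)} (hK : IsCompact K)
    (hKs : K ⊆ slit n) : ∃ q Q V : ℝ, 0 < q ∧ 0 ≤ Q ∧ 0 ≤ V ∧ ∀ z ∈ K,
      q ≤ speedSq g z ∧ speedSq g z ≤ Q ∧ ‖z.2‖ ≤ V := by
  have hqc : ContinuousOn (speedSq g) K := by
    have h := (continuousOn_ip hg).mono
      (show K ⊆ ball n ×ˢ univ from fun z hz => ⟨(hKs hz).1, trivial⟩)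
    have e : speedSq g = fun p => ip g p.1 p.2 p.2 := funext fun z => gF_apply _ _ _
    exact e ▸ h
  have hq0 : ∀ z ∈ K, 0 < speedSq g z := fun z hz => gF_pos hg (hKs hz).1 (hKs hz).2
  obtain ⟨Q, hQ⟩ := hK.exists_bound_of_continuousOn hqc
  obtain ⟨V, hV⟩ := hK.exists_bound_of_continuousOn
    (continuous_snd (X := E n) (Y := E n)).continuousOn
  rcases K.eq_empty_or_nonempty with rfl | hne
  · exact ⟨1, 0, 0, one_pos, le_rfl, le_rfl, by simp⟩
  obtain ⟨z₀, hz₀, hmin⟩ := hK.exists_isMinOn hne hqc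
  exact ⟨speedSq g z₀, Q, V, hq0 z₀ hz₀, (norm_nonneg _).trans (hQ z₀ hz₀),
    (norm_nonneg _).trans (hV z₀ hz₀), fun z hz =>
    ⟨hmin hz, (le_abs_self _).trans (hQ z hz), hV z hz⟩⟩

/-- The weight of a function on the base. -/
theorem isRayWeight_function {f : E n → ℝ} {K : NNReal} (hf : LipschitzOnWith K f (ball n))
    (h0 : ∀ x ∈ bdry n, f x = 0) (hn : 1 ≤ n) (hs : IsSimpleC11 g) :
    IsRayWeight g (fun z => f z.1) K where
  nonneg := K.2
  lip z hz z' hz' := by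
    have h := hf.dist_le_mul z.1 hz.1 z'.1 hz'.1
    rw [Real.dist_eq, dist_eq_norm] at h
    refine h.trans (mul_le_mul_of_nonneg_left ?_ K.2)
    have := mul_nonneg (sub_nonneg.2 (mem_ball_iff.1 hz.1)) (norm_nonneg (z.2 - z'.2))
    linarith
  bound z hz := by
    obtain ⟨y, hy, hyx⟩ := hs.exists_nearest_bdry hn hz.1
    have h := hf.dist_le_mul z.1 hz.1 y (bdry_subset_ball hy)
    rwa [h0 y hy, dist_zero_right, dist_comm, dist_eq_norm, hyx] at h

/-- The weight of a one-form. -/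
theorem exists_isRayWeight_form {h : E n → E n →L[ℝ] ℝ} {K : NNReal}
    (hh : LipschitzOnWith K h (ball n)) (h0 : ∀ x ∈ bdry n, h x = 0) (hn : 1 ≤ n)
    (hs : IsSimpleC11 g) : ∃ L, IsRayWeight g (fun z => h z.1 z.2) L := by
  obtain ⟨R, hR⟩ := (isCompact_SM hs.metric).exists_bound_of_continuousOn
    (continuous_snd (X := E n) (Y := E n)).continuousOn
  have hd : ∀ x ∈ ball n, ‖h x‖ ≤ K * (1 - ‖x‖) := fun x hx => by
    obtain ⟨y, hy, hyx⟩ := hs.exists_nearest_bdry hn hx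
    have h := hh.dist_le_mul x hx y (bdry_subset_ball hy)
    rwa [h0 y hy, dist_zero_right, dist_comm, dist_eq_norm, hyx] at h
  refine ⟨K * (|R| + 1), by positivity, fun z hz z' hz' => ?_, fun z hz => ?_⟩
  · have e : h z.1 z.2 - h z'.1 z'.2 = h z.1 (z.2 - z'.2) + (h z.1 - h z'.1) z'.2 := by
      simp
    have h1 := hh.dist_le_mul z.1 hz.1 z'.1 hz'.1
    rw [dist_eq_norm, dist_eq_norm] at h1
    have hd0 : 0 ≤ 1 - ‖z.1‖ := sub_nonneg.2 (mem_ball_iff.1 hz.1)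
    have h2 : |h z.1 (z.2 - z'.2)| ≤ K * (1 - ‖z.1‖) * ‖z.2 - z'.2‖ :=
      ((h z.1).le_opNorm _).trans (by gcongr; exact hd _ hz.1)
    have h3 : |(h z.1 - h z'.1) z'.2| ≤ K * ‖z.1 - z'.1‖ * |R| :=
      ((h z.1 - h z'.1).le_opNorm _).trans (by gcongr; exact (hR _ hz').trans (le_abs_self R))
    rw [e]
    refine (abs_add_le _ _).trans ?_
    have p1 : 0 ≤ K * (1 - ‖z.1‖) * ‖z.2 - z'.2‖ * |R| := by positivity
    have p2 : 0 ≤ K * ‖z.1 - z'.1‖ := by positivity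
    linarith
  · have h2 : |h z.1 z.2| ≤ K * (1 - ‖z.1‖) * |R| :=
      ((h z.1).le_opNorm _).trans (by
        gcongr
        · exact mul_nonneg K.2 (sub_nonneg.2 (mem_ball_iff.1 hz.1))
        · exact hd _ hz.1
        · exact (hR _ hz).trans (le_abs_self R))
    have p1 : 0 ≤ K * (1 - ‖z.1‖) := mul_nonneg K.2 (sub_nonneg.2 (mem_ball_iff.1 hz.1))
    linarith

theorem hasFDerivAt_sqrt_speedSq (hg : IsC11Metric g) {z : E n × E n} (hz : z ∈ slitI n) :
    HasFDerivAt (fun v => Real.sqrt (speedSq g (z.1, v)))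
      ((Real.sqrt (speedSq g z))⁻¹ • gF g z.1 z.2) z.2 := by
  have dq : HasFDerivAt (fun v => speedSq g (z.1, v)) ((2:ℝ) • gF g z.1 z.2) z.2 := by
    refine ((gF g z.1).hasFDerivAt.clm_apply (hasFDerivAt_id z.2)).congr_fderiv ?_
    ext ξ
    simp [gF_symm hg (inner_subset_ball hz.1) ξ z.2]
    ring
  have h := dq.sqrt (speedSq_pos hg hz).ne'
  refine h.congr_fderiv ?_
  rw [smul_smul]
  congr 1
  simp

theorem lipAt_fst {F : Type*} [NormedAddCommGroup F] [NormedSpace ℝ F] {f : E n → F}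
    {z : E n × E n} (h : LipAt f z.1) : LipAt (fun z : E n × E n => f z.1) z :=
  LipAt.comp (f := f) (h := fun z : E n × E n => z.1) h (lipAt_of_contDiffAt contDiffAt_fst)

theorem isRoughPair_function {c : Conn g} (hg : IsC11Metric g) {f : E n → ℝ} {K : NNReal}
    (hf : LipschitzOnWith K f (ball n)) {U : E n × E n → ℝ}
    (hU : IsRayPotential c (fun z => f z.1) U) :
    IsRoughPair c U (fun z => -(Real.sqrt (speedSq g z) * f z.1)) := by
  refine hU.isRoughPair hg (fun z _ => rfl) (fun z hz => ?_) fun D hD hDs => ?_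
  · exact ((lipAt_of_contDiffAt ((contDiffAt_speedSq hg hz.1).sqrt (speedSq_pos hg hz).ne')).mul
      (lipAt_fst (lipAt_of_lipschitzOnWith_ball hf hz.1))).neg
  · obtain ⟨q, Q, V, hq, hQ, hV, hqQ⟩ := exists_bound_speedSq hg hD hDs
    obtain ⟨C, hC0, hC⟩ := exists_bound_of_lipschitzOnWith_ball hf
    obtain ⟨G, hG0, hG⟩ := exists_bound_gF hg
    refine ⟨max (Real.sqrt Q * C) (C * ((Real.sqrt q)⁻¹ * (G * V))), by positivity, fun z hz hzI =>
      ⟨le_max_of_le_left ?_, fun hd => le_max_of_le_right ?_⟩⟩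
    · rw [abs_neg, abs_mul, abs_of_nonneg (Real.sqrt_nonneg _)]
      exact mul_le_mul (Real.sqrt_le_sqrt (hqQ z hz).2.1) (hC _ (hDs hz).1) (abs_nonneg _)
        (Real.sqrt_nonneg _)
    · have h1 := ((hasFDerivAt_sqrt_speedSq hg hzI).mul_const (f z.1)).fun_neg
      rw [vD_eq_of_hasFDerivAt hd h1, norm_neg, norm_smul, norm_smul, norm_inv,
        Real.norm_of_nonneg (Real.sqrt_nonneg _)]
      have h2 : ‖gF g z.1 z.2‖ ≤ G * V :=
        ((gF g z.1).le_opNorm _).trans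
          (mul_le_mul (hG _ (hDs hz).1) (hqQ z hz).2.2 (norm_nonneg _) hG0)
      have h3 : (Real.sqrt (speedSq g z))⁻¹ ≤ (Real.sqrt q)⁻¹ :=
        inv_anti₀ (Real.sqrt_pos.2 hq) (Real.sqrt_le_sqrt (hqQ z hz).1)
      gcongr
      exact hC _ (hDs hz).1

theorem isRoughPair_form {c : Conn g} (hg : IsC11Metric g) {h : E n → E n →L[ℝ] ℝ} {K : NNReal}
    (hh : LipschitzOnWith K h (ball n)) {U : E n × E n → ℝ}
    (hU : IsRayPotential c (fun z => h z.1 z.2) U) :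
    IsRoughPair c U (fun z => -h z.1 z.2) := by
  refine hU.isRoughPair hg (fun z hz => ?_) (fun z hz => ?_) fun D hD hDs => ?_
  · have hq := Real.sqrt_pos.2 (speedSq_pos hg hz)
    have e : (radial g z).2 = (Real.sqrt (speedSq g z))⁻¹ • z.2 := by
      rw [speedSq, gF_apply]; rfl
    change _ = -(Real.sqrt (speedSq g z) * h z.1 (radial g z).2)
    rw [e, map_smul, smul_eq_mul]
    field_simp
  · exact ((lipAt_fst (lipAt_of_lipschitzOnWith_ball hh hz.1)).clm_apply
      (lipAt_of_contDiffAt contDiffAt_snd)).neg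
  · obtain ⟨q, Q, V, hq, hQ, hV, hqQ⟩ := exists_bound_speedSq hg hD hDs
    obtain ⟨C, hC0, hC⟩ := exists_bound_of_lipschitzOnWith_ball hh
    refine ⟨max (C * V) C, by positivity, fun z hz hzI =>
      ⟨le_max_of_le_left ?_, fun hd => le_max_of_le_right ?_⟩⟩
    · rw [abs_neg]
      exact ((h z.1).le_opNorm _).trans (mul_le_mul (hC _ (hDs hz).1) (hqQ z hz).2.2 (norm_nonneg _) hC0)
    · have h1 : HasFDerivAt (fun v => -h z.1 v) (-h z.1) z.2 := (h z.1).hasFDerivAt.fun_neg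
      rw [vD_eq_of_hasFDerivAt hd h1, norm_neg]
      exact hC _ (hDs hz).1

theorem exists_unit_vector (hg : IsC11Metric g) (hn : 1 ≤ n) {x : E n} (hx : x ∈ ball n) :
    ∃ v : E n, v ≠ 0 ∧ speedSq g (x, v) = 1 := by
  have hsl : (x, bv ⟨0, hn⟩) ∈ slit n := ⟨hx, by simp⟩
  have h := radial_mem_SM hg hsl
  exact ⟨(radial g (x, bv ⟨0, hn⟩)).2, (SM_subset_slit h).2, (GeoFlow.mem_SM_iff_speedSq.1 h).2⟩

theorem false_of_ae_not_of_eventually {X : Type*} [TopologicalSpace X] [MeasurableSpace X]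
    {μ : Measure X} [μ.IsOpenPosMeasure] {p : X → Prop} {x : X} (h : ∀ᵐ z ∂μ, ¬ p z)
    (h' : ∀ᶠ z in 𝓝 x, p z) : False := by
  have h1 : μ {z | p z} = 0 := by
    have := ae_iff.1 h
    simpa only [not_not] using this
  exact (Measure.measure_pos_of_mem_nhds μ h').ne' h1

/-- On the support of the profile, the energy inequality forces the function to vanish. -/
theorem ae_eq_zero_of_isRayPotential (hs : IsSimpleC11 g) (hn : 2 ≤ n) {f : E n → ℝ} {K : NNReal}
    (hf : LipschitzOnWith K f (ball n)) {c : Conn g} {U : E n × E n → ℝ}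
    (hU : IsRayPotential c (fun z => f z.1) U) {κ : ℝ → ℝ} (hκ : ContDiff ℝ 1 κ)
    (hκc : HasCompactSupport κ) (hκ0 : tsupport κ ⊆ Ioi 0) :
    ∀ᵐ z : E n × E n, z ∈ slitI n → κ (speedSq g z) ≠ 0 → f z.1 = 0 := by
  have hg := hs.metric
  obtain ⟨ε, hε0, hε⟩ := hs.coercive
  have hUY := isRoughPair_function hg hf hU
  obtain ⟨hint, hpos⟩ := hUY.integral_energy_nonneg hg (by omega) hε hκ hκc hκ0
  set Y : E n × E n → ℝ := fun z => -(Real.sqrt (speedSq g z) * f z.1) with hYdef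
  have hn1 : (1:ℝ) ≤ n - 1 := by
    have : (2:ℝ) ≤ n := by exact_mod_cast hn
    linarith
  have hm := (isOpen_slitI (n := n)).measurableSet
  -- No positive term is left in the energy, and `n - 1 ≥ 1` keeps a full multiple of `-f²`.
  have hle : ∀ᵐ z ∂(volume.restrict (slitI n)), κ (speedSq g z) ^ 2 *
      ((g z.1).det * energy g ε z (Y z) (vD Y z) (vD U z)) ≤
        -(κ (speedSq g z) ^ 2 * (g z.1).det * f z.1 ^ 2) := by
    rw [ae_restrict_iff' hm]
    filter_upwards [ae_differentiableAt_of_lipAt volume hUY.lipY] with z hd hz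
    have hq := speedSq_pos hg hz
    have h1 := ((hasFDerivAt_sqrt_speedSq hg hz).mul_const (f z.1)).fun_neg
    -- The vertical derivative of `-|v| f(x)` is a multiple of `v♭`.
    have e1 : coN g z (vD Y z) = 0 := by
      rw [vD_eq_of_hasFDerivAt (hd hz) h1]
      have := coN_add_flat hg (inner_subset_ball hz.1) hz.2 0 (-(f z.1 * (Real.sqrt (speedSq g z))⁻¹))
      rw [zero_add] at this
      rw [smul_smul, ← neg_smul, this]
      simp [coN]
    have e2 : Y z ^ 2 / speedSq g z = f z.1 ^ 2 := by
      simp only [hYdef]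
      rw [neg_sq, mul_pow, Real.sq_sqrt hq.le]
      field_simp
    have e3 := coN_nonneg hg (inner_subset_ball hz.1) hz.2 (vD U z)
    have hdet := det_g_pos hg (inner_subset_ball hz.1)
    rw [mul_assoc, ← mul_neg, ← mul_neg]
    refine mul_le_mul_of_nonneg_left (mul_le_mul_of_nonneg_left ?_ hdet.le) (sq_nonneg _)
    rw [energy, e1, mul_div_assoc, e2]
    have p1 := mul_nonneg hε0.le (mul_nonneg hq.le e3)
    have p2 := mul_le_mul_of_nonneg_right hn1 (sq_nonneg (f z.1))
    linarith
  have hz0 : ∀ᵐ z ∂(volume.restrict (slitI n)), κ (speedSq g z) ^ 2 *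
      ((g z.1).det * energy g ε z (Y z) (vD Y z) (vD U z)) = 0 := by
    have hneg : ∀ᵐ z ∂(volume.restrict (slitI n)), 0 ≤ -(κ (speedSq g z) ^ 2 *
      ((g z.1).det * energy g ε z (Y z) (vD Y z) (vD U z))) := by
      filter_upwards [hle, ae_restrict_mem hm] with z h1 hz
      have hdet := det_g_pos hg (inner_subset_ball hz.1)
      have : 0 ≤ κ (speedSq g z) ^ 2 * (g z.1).det * f z.1 ^ 2 := by positivity
      linarith
    have h0 := (integral_eq_zero_iff_of_nonneg_ae hneg hint.neg).1 (by
      refine le_antisymm ?_ (integral_nonneg_of_ae hneg)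
      rw [integral_neg]; linarith)
    filter_upwards [h0] with z hz
    simpa using hz
  have hz1 : ∀ᵐ z ∂(volume.restrict (slitI n)), κ (speedSq g z) ≠ 0 → f z.1 = 0 := by
    filter_upwards [hle, hz0, ae_restrict_mem hm] with z h1 h2 hz hκz
    have hdet := det_g_pos hg (inner_subset_ball hz.1)
    rw [h2] at h1
    by_contra hne
    have : 0 < κ (speedSq g z) ^ 2 * (g z.1).det * f z.1 ^ 2 := by positivity
    linarith
  rwa [ae_restrict_iff' hm] at hz1

/-- A function vanishing at the boundary with vanishing integrals along all geodesics is zero. -/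
theorem IsRayPotential.eq_zero (hs : IsSimpleC11 g) (hn : 2 ≤ n) {f : E n → ℝ} {K : NNReal}
    (hf : LipschitzOnWith K f (ball n)) {c : Conn g} {U : E n × E n → ℝ}
    (hU : IsRayPotential c (fun z => f z.1) U) {x : E n} (hx : x ∈ inner n) : f x = 0 := by
  have hg := hs.metric
  obtain ⟨κ, hκ, hκc, hκ0, hκ1⟩ := exists_profile one_pos
  have hz1 := ae_eq_zero_of_isRayPotential hs hn hf hU hκ hκc hκ0
  by_contra hne
  obtain ⟨v, hv, hv1⟩ := exists_unit_vector hg (by omega) (inner_subset_ball hx)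
  have hzI : (x, v) ∈ slitI n := ⟨hx, hv⟩
  have a1 : ∀ᶠ z in 𝓝 (x, v), z ∈ slitI n := by
    filter_upwards [slitI_mem_nhds hzI] with z hz using hz
  have a2 : ∀ᶠ z in 𝓝 (x, v), κ (speedSq g z) ≠ 0 :=
    (contDiffAt_speedSq hg (z := (x, v)) hx).continuousAt.tendsto.eventually (by rw [hv1]; exact hκ1)
  have a3 : ∀ᶠ z in 𝓝 (x, v), f z.1 ≠ 0 := by
    have hc : Tendsto f (𝓝 x) (𝓝 (f x)) :=
      (hf.continuousOn.continuousAt (ball_mem_nhds hx)).tendsto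
    exact ((continuous_fst (X := E n) (Y := E n)).tendsto (x, v)).eventually (hc.eventually_ne hne)
  refine false_of_ae_not_of_eventually (μ := volume) ?_ (a1.and (a2.and a3))
  filter_upwards [hz1] with z hz h using h.2.2 (hz h.1 h.2.1)

end RoughXRay
end

/-! ### One-forms: the vertical derivative of the potential vanishes -/

noncomputable section
namespace RoughXRay
variable {n : ℕ} {g : E n → Matrix (Fin n) (Fin n) ℝ}

/-- The density of the trace identity for a one-form. -/
def traceDensity (g : E n → Matrix (Fin n) (Fin n) ℝ) (κ : ℝ → ℝ) (h : E n → E n →L[ℝ] ℝ)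
    (z : E n × E n) : ℝ :=
  κ (speedSq g z) ^ 2 * ((g z.1).det *
    (h z.1 (sharp g z.1 (h z.1)) - n * h z.1 z.2 ^ 2 / speedSq g z))

theorem integrableOn_traceDensity (hg : IsC11Metric g) {κ : ℝ → ℝ} (hκ : ContDiff ℝ 1 κ)
    (hκc : HasCompactSupport κ) (hκ0 : tsupport κ ⊆ Ioi 0) {h : E n → E n →L[ℝ] ℝ}
    (hh : ContinuousOn h (ball n)) : IntegrableOn (traceDensity g κ h) (slitI n) := by
  obtain ⟨hSc, hSs⟩ := isCompact_shell hg isClosed_ball subset_rfl hκc.isCompact hκ0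
  set S : Set (E n × E n) := {z | z.1 ∈ ball n ∧ speedSq g z ∈ tsupport κ} with hS
  have hfst : MapsTo (fun z : E n × E n => z.1) S (ball n) := fun z hz => hz.1
  have c1 : ContinuousOn (fun z : E n × E n => z.1) S := continuousOn_fst
  have c2 : ContinuousOn (fun z : E n × E n => z.2) S := continuousOn_snd
  have ch : ContinuousOn (fun z : E n × E n => h z.1) S := hh.comp c1 hfst
  have cs : ContinuousOn (fun z : E n × E n => sharp g z.1) S :=
    (contDiffOn_sharp hg).continuousOn.comp c1 hfst
  have cg : ContinuousOn (fun z : E n × E n => gF g z.1) S := (continuousOn_gF hg).comp c1 hfst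
  have cd : ContinuousOn (fun z : E n × E n => (g z.1).det) S :=
    (contDiffOn_det_g hg).continuousOn.comp c1 hfst
  have cq : ContinuousOn (speedSq g) S := (cg.clm_apply c2).clm_apply c2
  have hq : ∀ z ∈ S, speedSq g z ≠ 0 := fun z hz => (hκ0 hz.2).ne'
  have hc : ContinuousOn (traceDensity g κ h) S :=
    ((hκ.continuous.comp_continuousOn cq).pow 2).mul (cd.mul ((ch.clm_apply (cs.clm_apply ch)).sub
      ((continuousOn_const.mul ((ch.clm_apply c2).pow 2)).div cq hq)))
  have hi := (integrable_indicator_iff (μ := (volume : Measure (E n × E n)))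
    hSc.isClosed.measurableSet).2 (hc.integrableOn_compact hSc)
  refine hi.integrableOn.congr_fun (fun z hz => ?_) isOpen_slitI.measurableSet
  by_cases hzS : z ∈ S
  · rw [indicator_of_mem hzS]
  · have : κ (speedSq g z) = 0 := image_eq_zero_of_notMem_tsupport fun h =>
      hzS ⟨inner_subset_ball hz.1, h⟩
    rw [indicator_of_notMem hzS, traceDensity, this]
    simp

/-- Fubini, and in each fibre the trace identity with `w = h♯`. -/
theorem integral_traceDensity (hg : IsC11Metric g) {κ : ℝ → ℝ} (hκ : ContDiff ℝ 1 κ)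
    (hκc : HasCompactSupport κ) (hκ0 : tsupport κ ⊆ Ioi 0) {h : E n → E n →L[ℝ] ℝ}
    (hh : ContinuousOn h (ball n)) : ∫ z in slitI n, traceDensity g κ h z = 0 := by
  have hi := integrableOn_traceDensity hg hκ hκc hκ0 hh
  obtain ⟨a, ha, hell⟩ := exists_ellipticity hg
  rw [slitI, Measure.volume_eq_prod] at hi ⊢
  rw [setIntegral_prod _ hi]
  refine setIntegral_eq_zero_of_forall_eq_zero fun x hx => ?_
  have hxb := inner_subset_ball hx
  have hκz : κ 0 = 0 := image_eq_zero_of_notMem_tsupport fun h => lt_irrefl (0:ℝ) (hκ0 h)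
  rw [setIntegral_eq_integral_of_forall_compl_eq_zero fun v hv => ?_]
  · have h1 := integral_fiber_trace (gF_symm hg hxb) ha (hell x hxb) (sharp g x (h x)) hκ hκc hκ0
    simp only [gF_sharp hg hxb] at h1
    have h2 : ∀ v, traceDensity g κ h (x, v) = (g x).det * (κ (gF g x v v) ^ 2 *
        (h x (sharp g x (h x)) - n * h x v ^ 2 / gF g x v v)) := fun v => by
      simp only [traceDensity, speedSq]; ring
    simp only [h2]
    rw [integral_const_mul, h1, mul_zero]
  · have : v = 0 := by simpa using hv
    rw [traceDensity, speedSq, this]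
    simp [hκz]

theorem eq_zero_of_coN_eq_zero (hg : IsC11Metric g) {z : E n × E n} (hx : z.1 ∈ ball n)
    {α : E n →L[ℝ] ℝ} (h : coN g z α = 0) (h2 : α z.2 = 0) : α = 0 := by
  have h1 : α (sharp g z.1 α) = 0 := by
    rw [coN, h2] at h
    simpa using h
  have h3 : sharp g z.1 α = 0 := by
    by_contra hne
    have := gF_pos hg hx hne
    rw [gF_sharp hg hx, h1] at this
    exact lt_irrefl _ this
  ext w
  rw [← gF_sharp hg hx, h3]
  simp

namespace IsRayPotential
variable {c : Conn g}

/-- Euler's relation: the potential is constant on rays. -/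
theorem vD_self {f U : E n × E n → ℝ} (hU : IsRayPotential c f U) {z : E n × E n}
    (hd : DifferentiableAt ℝ U z) : vD U z z.2 = 0 := by
  obtain ⟨û, -, hû⟩ := hU.eq_radial
  have hl : HasDerivAt (fun s : ℝ => z + s • ((0:E n), z.2)) ((0:E n), z.2) 0 := by
    simpa using ((hasDerivAt_id (0:ℝ)).smul_const ((0:E n), z.2)).const_add z
  have h1 := HasFDerivAt.comp_hasDerivAt_of_eq (l := U) 0 hd.hasFDerivAt hl (by simp)
  have h2 : HasDerivAt (U ∘ fun s : ℝ => z + s • ((0:E n), z.2)) 0 0 := by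
    refine (hasDerivAt_const (0:ℝ) (U z)).congr_of_eventuallyEq ?_
    filter_upwards [Ioi_mem_nhds (show (-1:ℝ) < 0 by norm_num)] with s hs
    have hs1 : 0 < 1 + s := by linarith [show -1 < s from hs]
    have e : z + s • ((0:E n), z.2) = (z.1, (1 + s) • z.2) := by
      ext1 <;> simp [add_smul]
    rw [Function.comp, e, hû, radial_smul hs1, ← hû]
  exact h1.unique h2

variable {h : E n → E n →L[ℝ] ℝ} {K : NNReal} {U : E n × E n → ℝ}

/-- For `XU = -h(v)` the first two terms of the energy are the trace density, with integral zero. So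
the integral of `ε |v|² coN (vD U)`, against a nonnegative weight, is at most zero. -/
theorem ae_coN_vD_eq_zero (hs : IsSimpleC11 g) (hn : 1 ≤ n) (hh : LipschitzOnWith K h (ball n))
    (hU : IsRayPotential c (fun z => h z.1 z.2) U) {κ : ℝ → ℝ} (hκ : ContDiff ℝ 1 κ)
    (hκc : HasCompactSupport κ) (hκ0 : tsupport κ ⊆ Ioi 0) :
    ∀ᵐ z : E n × E n, z ∈ slitI n → κ (speedSq g z) ≠ 0 → coN g z (vD U z) = 0 := by
  have hg := hs.metric
  obtain ⟨ε, hε0, hε⟩ := hs.coercive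
  have hUY := isRoughPair_form hg hh hU
  obtain ⟨hint, hpos⟩ := hUY.integral_energy_nonneg hg hn hε hκ hκc hκ0
  have hti := integrableOn_traceDensity hg hκ hκc hκ0 hh.continuousOn
  have ht0 := integral_traceDensity hg hκ hκc hκ0 hh.continuousOn
  set Y : E n × E n → ℝ := fun z => -h z.1 z.2 with hYdef
  have hm := (isOpen_slitI (n := n)).measurableSet
  set D : E n × E n → ℝ := fun z => traceDensity g κ h z - κ (speedSq g z) ^ 2 *
      ((g z.1).det * energy g ε z (Y z) (vD Y z) (vD U z)) with hD
  have hDi : IntegrableOn D (slitI n) := hti.sub hint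
  have hDe : ∀ᵐ z ∂(volume.restrict (slitI n)), D z = κ (speedSq g z) ^ 2 * ((g z.1).det *
      (ε * (speedSq g z * coN g z (vD U z)))) := by
    rw [ae_restrict_iff' hm]
    filter_upwards [ae_differentiableAt_of_lipAt volume hUY.lipY] with z hd hz
    have hq := speedSq_pos hg hz
    have h1 : HasFDerivAt (fun v => -h z.1 v) (-h z.1) z.2 := (h z.1).hasFDerivAt.fun_neg
    have e1 : coN g z (vD Y z) = coN g z (h z.1) := by
      rw [vD_eq_of_hasFDerivAt (hd hz) h1]
      have := coN_smul (g := g) z (h z.1) (-1)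
      rw [neg_one_smul] at this
      rw [this]; ring
    simp only [hD, traceDensity, energy, e1]
    rw [show coN g z (h z.1) = h z.1 (sharp g z.1 (h z.1)) - h z.1 z.2 ^ 2 / speedSq g z from rfl]
    simp only [hYdef]
    field_simp
    ring
  have hD0 : ∀ᵐ z ∂(volume.restrict (slitI n)), 0 ≤ D z := by
    filter_upwards [hDe, ae_restrict_mem hm] with z h1 hz
    rw [h1]
    have hdet := det_g_pos hg (inner_subset_ball hz.1)
    have hq := speedSq_pos hg hz
    have hN := coN_nonneg hg (inner_subset_ball hz.1) hz.2 (vD U z)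
    positivity
  have hDz : ∀ᵐ z ∂(volume.restrict (slitI n)), D z = 0 := by
    refine (integral_eq_zero_iff_of_nonneg_ae hD0 hDi).1 (le_antisymm ?_ (integral_nonneg_of_ae hD0))
    rw [hD, integral_sub hti hint, ht0]
    linarith
  rw [← ae_restrict_iff' hm]
  filter_upwards [hDe, hDz, ae_restrict_mem hm] with z h1 h2 hz hκz
  have hdet := det_g_pos hg (inner_subset_ball hz.1)
  have hq := speedSq_pos hg hz
  rw [h2] at h1
  have := h1.symm
  simpa [hκz, hdet.ne', hq.ne', hε0.ne'] using this

/-- The tangential part vanishes by the energy argument, the radial part by homogeneity. Each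
profile sees only a range of speeds, so the null set is obtained locally, with a profile adapted to
the point. -/
theorem ae_vD_eq_zero (hs : IsSimpleC11 g) (hn : 1 ≤ n) (hh : LipschitzOnWith K h (ball n))
    (hU : IsRayPotential c (fun z => h z.1 z.2) U) :
    ∀ᵐ z : E n × E n, z ∈ slitI n → vD U z = 0 := by
  have hg := hs.metric
  have hlip := (isRoughPair_form hg hh hU).lipU
  rw [ae_iff]
  refine measure_null_of_locally_null _ fun z hz => ?_
  simp only [Classical.not_imp, Set.mem_ofPred_eq] at hz
  obtain ⟨κ, hκ, hκc, hκ0, hκ1⟩ := exists_profile (speedSq_pos hg hz.1)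
  have hnear : ∀ᶠ w in 𝓝 z, κ (speedSq g w) ≠ 0 :=
    (contDiffAt_speedSq hg hz.1.1).continuousAt.tendsto.eventually hκ1
  have hae := hU.ae_coN_vD_eq_zero hs hn hh hκ hκc hκ0
  have hall : ∀ᵐ w : E n × E n, ¬ ((w ∈ slitI n ∧ vD U w ≠ 0) ∧ κ (speedSq g w) ≠ 0) := by
    filter_upwards [hae, ae_differentiableAt_of_lipAt volume hlip] with w h1 h2 h3
    exact h3.1.2 (eq_zero_of_coN_eq_zero hg (inner_subset_ball h3.1.1.1) (h1 h3.1.1 h3.2)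
      (hU.vD_self (h2 h3.1.1)))
  refine ⟨_, inter_mem_nhdsWithin _ hnear, ?_⟩
  have h4 := ae_iff.1 hall
  refine measure_mono_null (fun w hw => ?_) h4
  simp only [Classical.not_imp, not_not, Set.mem_ofPred_eq, mem_inter_iff, ne_eq] at hw ⊢
  exact hw

end IsRayPotential
end RoughXRay
end

/-! ### One-forms: the potential does not depend on the direction -/

noncomputable section
namespace RoughXRay
variable {n : ℕ} {g : E n → Matrix (Fin n) (Fin n) ℝ}

section mollify
variable {V : Type*} [NormedAddCommGroup V] [NormedSpace ℝ V] [FiniteDimensional ℝ V]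
  [MeasurableSpace V] [BorelSpace V] {μ : Measure V} [μ.IsAddHaarMeasure] {ρ : V → ℝ}

theorem tendsto_mollify (hρ : IsMollifier μ ρ) {u : V → ℝ} {K : NNReal} (hu : LipschitzWith K u)
    (z : V) : Tendsto (fun h => mollify μ ρ h u z) (𝓝[>] (0:ℝ)) (𝓝 (u z)) := by
  have hi : ∀ h : ℝ, Integrable (fun y => ρ y * u (z - h • y)) μ := fun h =>
    (hρ.smooth.continuous.mul (hu.continuous.comp (by fun_prop))).integrable_of_hasCompactSupport
      hρ.hasCompactSupport.mul_right
  have hi1 : Integrable ρ μ :=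
    hρ.smooth.continuous.integrable_of_hasCompactSupport hρ.hasCompactSupport
  have hI : Integrable (fun y => K * |ρ y|) μ := hi1.abs.const_mul _
  have key : ∀ h > 0, |mollify μ ρ h u z - u z| ≤ h * ∫ y, K * |ρ y| ∂μ := fun h hh => by
    have e : mollify μ ρ h u z - u z = ∫ y, ρ y * (u (z - h • y) - u z) ∂μ := by
      simp only [mul_sub]
      rw [integral_sub (hi h) (hi1.mul_const _), integral_mul_const, hρ.integral, one_mul, mollify]
      simp only [smul_eq_mul]
    rw [e, ← integral_const_mul]
    rw [← Real.norm_eq_abs]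
    refine norm_integral_le_of_norm_le (hI.const_mul h) (Eventually.of_forall fun y => ?_)
    by_cases hy : y ∈ Metric.closedBall (0 : V) 1
    · have h1 := hu.dist_le_mul (z - h • y) z
      rw [Real.dist_eq, dist_eq_norm, sub_sub_cancel_left, norm_neg, norm_smul, Real.norm_eq_abs,
        abs_of_pos hh] at h1
      rw [mem_closedBall_zero_iff] at hy
      rw [norm_mul, Real.norm_eq_abs, Real.norm_eq_abs]
      calc |ρ y| * |u (z - h • y) - u z| ≤ |ρ y| * (K * (h * 1)) := by
            gcongr
            exact h1.trans (by gcongr)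
        _ = _ := by ring
    · rw [hρ.eq_zero hy]
      simp
  rw [tendsto_iff_norm_sub_tendsto_zero]
  refine squeeze_zero' (Eventually.of_forall fun _ => norm_nonneg _)
    (by filter_upwards [self_mem_nhdsWithin] with h hh using key h hh) ?_
  have : Tendsto (fun h : ℝ => h * ∫ y, K * |ρ y| ∂μ) (𝓝 0) (𝓝 (0 * ∫ y, K * |ρ y| ∂μ)) :=
    tendsto_id.mul_const _
  rw [zero_mul] at this
  exact this.mono_left nhdsWithin_le_nhds

/-- A locally Lipschitz function whose derivative in the direction of a segment vanishes almost
everywhere near the segment takes the same value at its end points. -/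
theorem eq_of_ae_fderiv_apply_eq_zero (μ : Measure V) [μ.IsAddHaarMeasure] {u : V → ℝ} {Ω : Set V}
    (hΩ : IsOpen Ω) (hu : ∀ z ∈ Ω, LipAt u z) {z w : V} (hS : segment ℝ z w ⊆ Ω)
    (hae : ∀ᵐ y ∂μ, y ∈ Ω → fderiv ℝ u y (w - z) = 0) : u z = u w := by
  have hSc : IsCompact (segment ℝ z w) := by
    rw [segment_eq_image_lineMap]
    exact isCompact_Icc.image AffineMap.lineMap_continuous
  have : ProperSpace V := FiniteDimensional.proper_real V
  obtain ⟨δ, hδ, hδs⟩ := hSc.exists_cthickening_subset_open hΩ hS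
  set C := Metric.cthickening δ (segment ℝ z w) with hC
  have hCc : IsCompact C := hSc.cthickening
  have hloc : LocallyLipschitzOn C u := fun y hy => by
    obtain ⟨K, t, ht, hK⟩ := hu y (hδs hy)
    exact ⟨K, t, mem_nhdsWithin_of_mem_nhds ht, hK⟩
  obtain ⟨K, hK⟩ := hloc.exists_lipschitzOnWith_of_compact hCc
  obtain ⟨û, hû, heq⟩ := hK.extend_real
  obtain ⟨ρ, hρ⟩ := exists_isMollifier μ
  have hCδ : Metric.thickening δ (segment ℝ z w) ⊆ C := Metric.thickening_subset_cthickening _ _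
  have hfd : ∀ y ∈ Metric.thickening δ (segment ℝ z w), fderiv ℝ û y = fderiv ℝ u y := fun y hy => by
    refine Filter.EventuallyEq.fderiv_eq ?_
    filter_upwards [Metric.isOpen_thickening.mem_nhds hy] with y' hy' using (heq (hCδ hy')).symm
  -- The segment is a null set and may lie in the exceptional set. Mollification averages over
  -- nearby translates, so the derivative of the smoothed function vanishes at every point of the
  -- segment.
  have hzero : ∀ h, 0 < h → h < δ → ∀ p ∈ segment ℝ z w,
      fderiv ℝ (mollify μ ρ h û) p (w - z) = 0 := fun h hh hhδ p hp => by
    rw [fderiv_mollify_apply_eq hρ hû hh]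
    refine integral_eq_zero_of_ae ?_
    filter_upwards [(quasiMeasurePreserving_sub_smul hh p).ae hae] with y hy
    by_cases hy1 : y ∈ Metric.closedBall (0 : V) 1
    · rw [mem_closedBall_zero_iff] at hy1
      have hm : p - h • y ∈ Metric.thickening δ (segment ℝ z w) := by
        refine Metric.mem_thickening_iff.2 ⟨p, hp, ?_⟩
        rw [dist_eq_norm, sub_sub_cancel_left, norm_neg, norm_smul, Real.norm_eq_abs, abs_of_pos hh]
        nlinarith
      rw [hfd _ hm, hy (hδs (hCδ hm)), mul_zero]
      rfl
    · rw [hρ.eq_zero hy1, zero_mul]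
      rfl
  have hconst : ∀ h, 0 < h → h < δ → mollify μ ρ h û z = mollify μ ρ h û w := fun h hh hhδ => by
    have hd : ∀ t ∈ Icc (0:ℝ) 1, HasDerivAt (fun t : ℝ => mollify μ ρ h û (z + t • (w - z))) 0 t :=
      fun t ht => by
      have hl : HasDerivAt (fun t : ℝ => z + t • (w - z)) (w - z) t := by
        simpa using ((hasDerivAt_id t).smul_const (w - z)).const_add z
      have hp : z + t • (w - z) ∈ segment ℝ z w := by
        rw [segment_eq_image']
        exact ⟨t, ht, rfl⟩
      have h1 := (hasFDerivAt_mollify hρ hh hû (z + t • (w - z))).2.differentiableAt.hasFDerivAt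
      have h2 := h1.comp_hasDerivAt t hl
      rwa [hzero h hh hhδ _ hp] at h2
    have h3 := constant_of_has_deriv_right_zero
      (fun t ht => (hd t ht).continuousAt.continuousWithinAt)
      (fun t ht => (hd t (Ico_subset_Icc_self ht)).hasDerivWithinAt) 1 (right_mem_Icc.2 zero_le_one)
    simpa using h3.symm
  have hends : û z = û w := by
    refine tendsto_nhds_unique (tendsto_mollify hρ hû z) ((tendsto_mollify hρ hû w).congr' ?_)
    filter_upwards [Ioo_mem_nhdsGT hδ] with h hh using (hconst h hh.1 hh.2).symm
  have hzC : z ∈ C := Metric.self_subset_cthickening _ (left_mem_segment ℝ z w)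
  have hwC : w ∈ C := Metric.self_subset_cthickening _ (right_mem_segment ℝ z w)
  rw [heq hzC, heq hwC, hends]

end mollify

theorem exists_notMem_span_singleton (hn : 2 ≤ n) {x : E n} (hx : x ≠ 0) :
    ∃ e : E n, e ∉ Submodule.span ℝ {x} := by
  by_contra hall
  push Not at hall
  have htop : Submodule.span ℝ {x} = (⊤ : Submodule ℝ (E n)) := Submodule.eq_top_iff'.2 hall
  have h1 := finrank_span_singleton (K := ℝ) hx
  rw [htop, finrank_top, finrank_euclideanSpace_fin] at h1
  omega

/-- If the origin separates `v` from `w`, the path makes a detour through a vector off their common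
line; this needs dimension at least 2. Otherwise `e = v` serves. -/
theorem exists_zero_notMem_segments (hn : 2 ≤ n) {v w : E n} (hv : v ≠ 0) (hw : w ≠ 0) :
    ∃ e : E n, (0 : E n) ∉ segment ℝ v e ∧ (0 : E n) ∉ segment ℝ e w := by
  have hneg : ∀ a b : E n, a ≠ 0 → (0 : E n) ∈ segment ℝ a b → b ∈ Submodule.span ℝ {a} := by
    rintro a b ha ⟨s, t, hs, ht, hst, h⟩
    rcases ht.eq_or_lt with rfl | ht
    · simp only [add_zero] at hst
      rw [hst] at h
      exact absurd (by simpa using h) ha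
    · rw [Submodule.mem_span_singleton]
      refine ⟨-(t⁻¹ * s), ?_⟩
      have : t • b = -(s • a) := by rw [eq_neg_iff_add_eq_zero, add_comm, h]
      rw [neg_smul, mul_smul, ← smul_neg, ← this, smul_smul, inv_mul_cancel₀ ht.ne', one_smul]
  by_cases hvw : (0 : E n) ∈ segment ℝ v w
  · have hwv := hneg v w hv hvw
    obtain ⟨e, he⟩ := exists_notMem_span_singleton hn hv
    refine ⟨e, fun h => he (hneg v e hv h), fun h => he ?_⟩
    rw [segment_symm] at h
    have h1 := hneg w e hw h
    exact (Submodule.span_singleton_le_iff_mem w _).2 hwv h1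
  · exact ⟨v, by simpa using hv.symm, hvw⟩

namespace IsRayPotential
variable {c : Conn g} {h : E n → E n →L[ℝ] ℝ} {K : NNReal} {U : E n × E n → ℝ}

theorem eq_of_notMem_segment (hs : IsSimpleC11 g) (hn : 1 ≤ n) (hh : LipschitzOnWith K h (ball n))
    (hU : IsRayPotential c (fun z => h z.1 z.2) U) {x v w : E n} (hx : x ∈ inner n)
    (h0 : (0 : E n) ∉ segment ℝ v w) : U (x, v) = U (x, w) := by
  refine eq_of_ae_fderiv_apply_eq_zero (volume : Measure (E n × E n)) isOpen_slitI
    (isRoughPair_form hs.metric hh hU).lipU ?_ ?_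
  · rintro - ⟨s, t, ha, hb, hab, rfl⟩
    refine ⟨?_, fun he => h0 ⟨s, t, ha, hb, hab, ?_⟩⟩
    · simpa [← add_smul, hab] using hx
    · simpa using he
  · filter_upwards [hU.ae_vD_eq_zero hs hn hh] with y hy hyI
    have : ((x, w) - (x, v) : E n × E n) = (0, w - v) := by simp
    rw [this, ← vD_apply, hy hyI]
    rfl

/-- The potential of a one-form does not depend on the direction. -/
theorem eq_of_ne_zero (hs : IsSimpleC11 g) (hn : 2 ≤ n) (hh : LipschitzOnWith K h (ball n))
    (hU : IsRayPotential c (fun z => h z.1 z.2) U) {x v w : E n} (hx : x ∈ inner n)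
    (hv : v ≠ 0) (hw : w ≠ 0) : U (x, v) = U (x, w) := by
  obtain ⟨e, h1, h2⟩ := exists_zero_notMem_segments hn hv hw
  rw [hU.eq_of_notMem_segment hs (by omega) hh hx h1, hU.eq_of_notMem_segment hs (by omega) hh hx h2]

end IsRayPotential
end RoughXRay
end

/-! ### One-forms: the primitive -/

noncomputable section
namespace RoughXRay
variable {n : ℕ} {g : E n → Matrix (Fin n) (Fin n) ℝ}

/-- Derivatives along curves of a locally Lipschitz function depend only on the velocity. -/
theorem LipAt.hasDerivAt_congr {X : Type*} [NormedAddCommGroup X] [NormedSpace ℝ X] {p : X → ℝ}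
    {α β : ℝ → X} {w : X} {a : ℝ} (hp : LipAt p (α 0)) (h0 : β 0 = α 0) (hα : HasDerivAt α w 0)
    (hβ : HasDerivAt β w 0) (h : HasDerivAt (fun t => p (α t)) a 0) :
    HasDerivAt (fun t => p (β t)) a 0 := by
  obtain ⟨K, t, ht, hK⟩ := hp
  have h1 : HasDerivAt (fun t => β t - α t) 0 0 := by simpa using hβ.fun_sub hα
  have h2 : HasDerivAt (fun t => p (β t) - p (α t)) 0 0 := by
    rw [hasDerivAt_iff_isLittleO] at h1 ⊢
    simp only [h0, sub_self, sub_zero, smul_zero] at h1 ⊢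
    refine Asymptotics.IsBigO.trans_isLittleO (Asymptotics.IsBigO.of_bound K ?_) h1
    filter_upwards [hα.continuousAt.preimage_mem_nhds ht,
      hβ.continuousAt.preimage_mem_nhds (by rwa [h0])] with s hs1 hs2
    rw [← dist_eq_norm, ← dist_eq_norm]
    exact hK.dist_le_mul _ hs2 _ hs1
  simpa using h2.fun_add h

theorem isC11_of_hasFDerivWithinAt {p : E n → ℝ} {h : E n → E n →L[ℝ] ℝ} {K : NNReal}
    (hh : LipschitzOnWith K h (ball n)) (hd : ∀ x ∈ ball n, HasFDerivWithinAt p (h x) (ball n) x) :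
    IsC11 p := by
  refine ⟨?_, K, fun x hx y hy => ?_⟩
  · rw [show (1 : WithTop ℕ∞) = 0 + 1 from rfl,
      contDiffOn_succ_iff_hasFDerivWithinAt_of_uniqueDiffOn uniqueDiffOn_ball]
    exact ⟨fun h => absurd h (by simp), h, contDiffOn_zero.2 hh.continuousOn, hd⟩
  · rw [(hd x hx).fderivWithin (uniqueDiffOn_ball x hx), (hd y hy).fderivWithin (uniqueDiffOn_ball y hy)]
    exact hh hx hy

/-- A continuous function on the ball whose directional derivatives in the interior are given by a
Lipschitz one-form is differentiable up to the boundary. -/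
theorem hasFDerivWithinAt_of_hasDerivAt_line {p : E n → ℝ} {h : E n → E n →L[ℝ] ℝ} {K : NNReal}
    (hh : LipschitzOnWith K h (ball n)) (hp : ContinuousOn p (ball n))
    (hd : ∀ x ∈ inner n, ∀ v, HasDerivAt (fun t : ℝ => p (x + t • v)) (h x v) 0) {x : E n}
    (hx : x ∈ ball n) : HasFDerivWithinAt p (h x) (ball n) x := by
  -- A first-order Taylor estimate with a constant uniform in the interior. It extends by continuity
  -- to the closed ball and gives differentiability up to the boundary.
  have hint : ∀ z ∈ inner n ×ˢ inner n,
      ‖p z.2 - p z.1 - h z.1 (z.2 - z.1)‖ ≤ K * ‖z.2 - z.1‖ ^ 2 := by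
    rintro ⟨x, y⟩ ⟨hx, hy⟩
    dsimp only at hx hy ⊢
    have hseg : ∀ t ∈ Icc (0:ℝ) 1, x + t • (y - x) ∈ inner n := fun t ht => by
      refine (_root_.convex_ball (0 : E n) 1).segment_subset hx hy ?_
      rw [segment_eq_image']
      exact ⟨t, ht, rfl⟩
    have hder : ∀ t ∈ Icc (0:ℝ) 1, HasDerivWithinAt
        (fun t : ℝ => p (x + t • (y - x)) - t * h x (y - x))
        ((h (x + t • (y - x)) - h x) (y - x)) (Icc 0 1) t := fun t ht => by
      have h1 := hd _ (hseg t ht) (y - x)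
      rw [← sub_self t] at h1
      have h2 := h1.comp_sub_const t t
      have e : (fun s : ℝ => p (x + t • (y - x) + (s - t) • (y - x))) =
          fun s : ℝ => p (x + s • (y - x)) := by
        funext s
        congr 1
        rw [sub_smul]; abel
      rw [e] at h2
      have h3 := h2.fun_sub ((hasDerivAt_id t).mul_const (h x (y - x)))
      simp only [one_mul] at h3
      exact h3.hasDerivWithinAt
    have h4 := norm_image_sub_le_of_norm_deriv_le_segment_01' (C := K * ‖y - x‖ ^ 2) hder
      fun t ht => by
      refine ((h (x + t • (y - x)) - h x).le_opNorm _).trans ?_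
      have h5 := hh.dist_le_mul _ (inner_subset_ball (hseg t (Ico_subset_Icc_self ht))) x
        (inner_subset_ball hx)
      rw [dist_eq_norm, dist_eq_norm, add_sub_cancel_left, norm_smul, Real.norm_eq_abs,
        abs_of_nonneg ht.1] at h5
      have h6 : t * ‖y - x‖ ≤ 1 * ‖y - x‖ := by gcongr; exact ht.2.le
      calc _ ≤ K * (1 * ‖y - x‖) * ‖y - x‖ := by
            gcongr
            exact h5.trans (by gcongr)
        _ = _ := by ring
    simp only [one_smul, zero_smul, add_zero, add_sub_cancel, one_mul, zero_mul, sub_zero] at h4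
    rwa [sub_right_comm]
  have hcl : closure (inner n ×ˢ inner n) = ball n ×ˢ ball n := by
    rw [closure_prod_eq, inner, closure_ball (0 : E n) one_ne_zero]
    rfl
  have hall : ∀ y ∈ ball n, ‖p y - p x - h x (y - x)‖ ≤ K * ‖y - x‖ ^ 2 := fun y hy => by
    have m1 : MapsTo (fun z : E n × E n => z.1) (ball n ×ˢ ball n) (ball n) := fun z hz => hz.1
    have m2 : MapsTo (fun z : E n × E n => z.2) (ball n ×ˢ ball n) (ball n) := fun z hz => hz.2
    have c1 := hp.comp continuousOn_fst m1
    have c2 := hp.comp continuousOn_snd m2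
    have c3 := hh.continuousOn.comp continuousOn_fst m1
    have c4 : ContinuousOn (fun z : E n × E n => z.2 - z.1) (ball n ×ˢ ball n) :=
      (continuous_snd.sub continuous_fst).continuousOn
    exact le_on_closure (s := inner n ×ˢ inner n) hint
      (by rw [hcl]; exact ((c2.sub c1).sub (c3.clm_apply c4)).norm)
      (by rw [hcl]; exact continuousOn_const.mul (c4.norm.pow 2))
      (show (x, y) ∈ closure (inner n ×ˢ inner n) by rw [hcl]; exact ⟨hx, hy⟩)
  refine HasFDerivWithinAt.of_isLittleO ?_
  have h1 : Tendsto (fun y => y - x) (𝓝[ball n] x) (𝓝 0) := by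
    have : Tendsto (fun y => y - x) (𝓝 x) (𝓝 (x - x)) := tendsto_id.sub_const x
    rw [sub_self] at this
    exact this.mono_left nhdsWithin_le_nhds
  refine Asymptotics.IsBigO.trans_isLittleO (Asymptotics.IsBigO.of_bound K ?_)
    ((Asymptotics.isLittleO_norm_pow_id one_lt_two).comp_tendsto h1)
  filter_upwards [self_mem_nhdsWithin] with y hy
  simpa using hall y hy

namespace IsRayPotential
variable {c : Conn g} {h : E n → E n →L[ℝ] ℝ} {K : NNReal} {U : E n × E n → ℝ}

theorem continuousOn (hg : IsC11Metric g) {f : E n × E n → ℝ} (hU : IsRayPotential c f U) :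
    ContinuousOn U (slit n) := by
  obtain ⟨û, ⟨L, hL⟩, hû⟩ := hU.eq_radial
  rw [funext hû]
  exact hL.continuous.comp_continuousOn (contDiffOn_radial hg).continuousOn

/-- By independence of the direction, `e` may be replaced by the velocity of the curve provided by
`IsRayPotential.curve`, along which the derivative is known even if `U` is not differentiable there.
The base curve is then exchanged for the straight line with the same velocity. -/
theorem hasDerivAt_line (hs : IsSimpleC11 g) (hn : 2 ≤ n) (hh : LipschitzOnWith K h (ball n))
    (hU : IsRayPotential c (fun z => h z.1 z.2) U) {e : E n} (he : e ≠ 0) {x : E n}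
    (hx : x ∈ inner n) (v : E n) :
    HasDerivAt (fun t : ℝ => -U (x + t • v, e)) (h x v) 0 := by
  by_cases hv : v = 0
  · simpa [hv] using hasDerivAt_const (0:ℝ) (-U (x, e))
  have hz : (x, v) ∈ slitI n := ⟨hx, hv⟩
  obtain ⟨σ, hσ0, hσ, hσU⟩ := hU.curve _ hz
  have hq := Real.sqrt_pos.2 (speedSq_pos hs.metric hz)
  have hr : (radial g (x, v)).2 = (Real.sqrt (speedSq g (x, v)))⁻¹ • v := by
    rw [radial, speedSq, gF_apply]
  have hval : -(Real.sqrt (speedSq g (x, v)) * h (radial g (x, v)).1 (radial g (x, v)).2) =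
      -h x v := by
    rw [hr, map_smul, smul_eq_mul, mul_inv_cancel_left₀ hq.ne']
    rfl
  rw [hval] at hσU
  have hmem : ∀ᶠ t in 𝓝 (0:ℝ), σ t ∈ slitI n :=
    hσ.continuousAt.preimage_mem_nhds (by rw [hσ0]; exact slitI_mem_nhds hz)
  have h1 : HasDerivAt (fun t => -U ((σ t).1, e)) (h x v) 0 := by
    have := hσU.fun_neg
    rw [neg_neg] at this
    refine this.congr_of_eventuallyEq ?_
    filter_upwards [hmem] with t ht
    rw [hU.eq_of_ne_zero hs hn hh ht.1 he ht.2]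
  have h2 : HasDerivAt (fun t => (σ t).1) v 0 :=
    (hasFDerivAt_fst (𝕜 := ℝ) (E := E n) (F := E n) (p := σ 0)).comp_hasDerivAt 0 hσ
  have h3 : HasDerivAt (fun t : ℝ => x + t • v) v 0 := by
    simpa using ((hasDerivAt_id (0:ℝ)).smul_const v).const_add x
  have hx0 : (σ 0).1 = x := by rw [hσ0]
  refine LipAt.hasDerivAt_congr (p := fun y => -U (y, e)) (α := fun t => (σ t).1)
    (β := fun t => x + t • v) ?_ (by simp [hx0]) h2 h3 h1
  rw [hx0]
  exact (LipAt.comp (f := U) (h := fun y : E n => (y, e))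
    ((isRoughPair_form hs.metric hh hU).lipU _ ⟨hx, he⟩)
    (lipAt_of_contDiffAt (contDiffAt_id.prodMk contDiffAt_const))).neg

/-- The potential of a one-form is a primitive of the form. -/
theorem exists_primitive (hs : IsSimpleC11 g) (hn : 2 ≤ n) (hh : LipschitzOnWith K h (ball n))
    (hU : IsRayPotential c (fun z => h z.1 z.2) U) : ∃ p : E n → ℝ, IsC11 p ∧
      (∀ x ∈ bdry n, p x = 0) ∧ ∀ x ∈ ball n, HasFDerivWithinAt p (h x) (ball n) x := by
  obtain ⟨e, he⟩ : ∃ e : E n, e ≠ 0 := ⟨bv ⟨0, by omega⟩, by simp⟩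
  have hsl : MapsTo (fun x : E n => (x, e)) (ball n) (slit n) := fun x hx => ⟨hx, he⟩
  have hd : ∀ x ∈ ball n, HasFDerivWithinAt (fun x => -U (x, e)) (h x) (ball n) x := fun x hx =>
    hasFDerivWithinAt_of_hasDerivAt_line hh
      (((hU.continuousOn hs.metric).comp (by fun_prop) hsl).neg)
      (fun x hx v => hU.hasDerivAt_line hs hn hh he hx v) hx
  refine ⟨_, isC11_of_hasFDerivWithinAt hh hd, fun x hx => ?_, hd⟩
  obtain ⟨C, -, hC⟩ := hU.bound
  have h1 := hC (x, e) (hsl (bdry_subset_ball hx))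
  have h2 : ‖x‖ = 1 := by simpa [bdry] using hx
  rw [h2, sub_self, mul_zero, abs_nonpos_iff] at h1
  rw [h1, neg_zero]

end IsRayPotential
end RoughXRay
end

/-! ### Boundary determination and exact forms -/

noncomputable section
namespace RoughXRay
variable {n : ℕ} {g : E n → Matrix (Fin n) (Fin n) ℝ}

theorem exists_ne_zero_inner_eq_zero (hn : 2 ≤ n) {x : E n} (hx : x ∈ bdry n) :
    ∃ v : E n, v ≠ 0 ∧ Inner.inner ℝ x v = 0 := by
  have hx1 := mem_bdry_iff.1 hx
  obtain ⟨e, he⟩ := exists_notMem_span_singleton hn (x := x) (by rintro rfl; simp at hx1)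
  refine ⟨e - (Inner.inner ℝ x e) • x, fun h => he ?_, ?_⟩
  · rw [sub_eq_zero.1 h]
    exact Submodule.smul_mem _ _ (Submodule.mem_span_singleton_self x)
  · rw [inner_sub_right, inner_smul_right, real_inner_self_eq_norm_sq, hx1]
    ring

/-- Since `f` has mean zero along the geodesic, `f z.1` is the mean of its differences from the
values along it, each at most the Lipschitz constant times the Euclidean distance travelled. -/
theorem GeoFlow.abs_le_of_integral_eq_zero {c : Conn g} (F : GeoFlow c) (hs : IsSimpleC11 g)
    {f : E n → ℝ} {K : NNReal} (hf : LipschitzOnWith K f (ball n)) {z : E n × E n} (hz : z ∈ SM g)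
    (hi : z.1 ∈ inner n)
    (h0 : ∫ t in (-travelTime g (flip z))..travelTime g z, f (F.Φ z t).1 = 0) :
    |f z.1| ≤ K * F.B * (travelTime g z + travelTime g (flip z)) := by
  set a := -travelTime g (flip z) with ha
  set b := travelTime g z with hb
  have hb0 : 0 < b := hs.travelTime_pos hz hi
  have ha0 : a < 0 := neg_lt_zero.2 (hs.travelTime_pos (flip_mem_SM hz) hi)
  have hball : ∀ t ∈ Icc a b, (F.Φ z t).1 ∈ ball n := fun t ht =>
    F.mem_ball hs.metric hs.nontrapping hz ht
  have hc : ContinuousOn (fun t => f (F.Φ z t).1) (Icc a b) :=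
    hf.continuousOn.comp (F.continuous z).fst.continuousOn hball
  have hi : IntervalIntegrable (fun t => f (F.Φ z t).1) volume a b :=
    ContinuousOn.intervalIntegrable (by rwa [uIcc_of_le (ha0.trans hb0).le])
  have e : ∫ t in a..b, (f z.1 - f (F.Φ z t).1) = (b - a) * f z.1 := by
    rw [intervalIntegral.integral_sub intervalIntegrable_const hi, h0,
      intervalIntegral.integral_const, sub_zero, smul_eq_mul]
  have hle : ‖∫ t in a..b, (f z.1 - f (F.Φ z t).1)‖ ≤ K * F.B * (b - a) * |b - a| := by
    refine intervalIntegral.norm_integral_le_of_norm_le_const fun t ht => ?_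
    rw [uIoc_of_le (ha0.trans hb0).le] at ht
    have h1 := hf.dist_le_mul z.1 hz.1 _ (hball t (Ioc_subset_Icc_self ht))
    have h2 := (norm_fst_le _).trans (F.norm_flow_sub_le z t 0)
    rw [F.zero, Prod.fst_sub, zero_sub, abs_neg] at h2
    have h3 : |t| ≤ b - a := abs_le.2 ⟨by linarith [ht.1], by linarith [ht.2]⟩
    rw [dist_eq_norm, dist_eq_norm] at h1
    calc _ ≤ K * (F.B * |t|) := h1.trans (by gcongr)
      _ ≤ K * (F.B * (b - a)) := by gcongr
      _ = _ := by ring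
  have hba : 0 < b - a := by linarith
  rw [e, norm_mul, Real.norm_eq_abs, Real.norm_eq_abs, abs_of_pos hba, mul_comm] at hle
  have := le_of_mul_le_mul_right hle hba
  rwa [ha, sub_neg_eq_add] at this

/-- Boundary determination along short geodesics with almost tangential directions. -/
theorem GeoFlow.eq_zero_of_mem_bdry {c : Conn g} (F : GeoFlow c) (hs : IsSimpleC11 g) (hn : 2 ≤ n)
    {f : E n → ℝ} {K : NNReal} (hf : LipschitzOnWith K f (ball n))
    (h0 : ∀ z ∈ SM g, ∫ t in (-travelTime g (flip z))..travelTime g z, f (F.Φ z t).1 = 0)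
    {x : E n} (hx : x ∈ bdry n) : f x = 0 := by
  obtain ⟨v, hv, hxv⟩ := exists_ne_zero_inner_eq_zero hn hx
  have hx1 := mem_bdry_iff.1 hx
  have hxb := bdry_subset_ball hx
  set z := radial g (x, v) with hzdef
  have hz : z ∈ SM g := radial_mem_SM hs.metric ⟨hxb, hv⟩
  have hz1 : z.1 = x := rfl
  have hzi : Inner.inner ℝ z.1 z.2 = 0 := by
    change Inner.inner ℝ x ((Real.sqrt (ip g x v v))⁻¹ • v) = 0
    rw [inner_smul_right, hxv, mul_zero]
  have t1 : travelTime g z = 0 := hs.travelTime_eq_zero_of_inner_nonneg hz hx hzi.ge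
  have t2 : travelTime g (flip z) = 0 :=
    hs.travelTime_eq_zero_of_inner_nonneg (flip_mem_SM hz) hx
      (by rw [flip_fst, flip_snd, inner_neg_right, hzi, neg_zero])
  obtain ⟨C, hC0, hC⟩ := exists_bound_radial_sub hs.metric
  obtain ⟨L, hL0, hL⟩ := hs.exists_lipschitz_sq
  have key : ∀ s ∈ Ioo (0:ℝ) 1, f (s • x) ^ 2 ≤ (K * F.B) ^ 2 * (4 * (L * C)) * (1 - s) := by
    intro s hs1
    have hsx : ‖s • x‖ = s := by rw [norm_smul, hx1, mul_one, Real.norm_eq_abs, abs_of_pos hs1.1]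
    have hin : s • x ∈ inner n := by
      rw [inner, mem_ball_zero_iff, hsx]
      exact hs1.2
    have hdist : ‖s • x - x‖ = 1 - s := by
      rw [show s • x - x = (s - 1) • x by rw [sub_smul, one_smul], norm_smul, hx1, mul_one,
        Real.norm_eq_abs, abs_sub_comm, abs_of_pos (by linarith [hs1.2])]
    -- The tangential direction of `z` moved to the interior point `s • x`. Both travel times vanish
    -- at `z`, so those at `w` are of order `√(1 - s)`.
    set w := radial g (s • x, z.2) with hw
    have hwS : w ∈ SM g :=
      radial_mem_SM hs.metric ⟨inner_subset_ball hin, (SM_subset_slit hz).2⟩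
    have hwz : dist w z ≤ C * (1 - s) := by
      rw [dist_eq_norm, ← hdist]
      exact hC z hz _ (inner_subset_ball hin)
    have a1 := hL w hwS z hz
    have a2 := hL _ (flip_mem_SM hwS) _ (flip_mem_SM hz)
    rw [dist_flip, t2, zero_pow two_ne_zero, sub_zero, abs_of_nonneg (sq_nonneg _)] at a2
    rw [t1, zero_pow two_ne_zero, sub_zero, abs_of_nonneg (sq_nonneg _)] at a1
    have a3 : L * dist w z ≤ L * (C * (1 - s)) := by gcongr
    have h1 := F.abs_le_of_integral_eq_zero hs hf hwS hin (h0 w hwS)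
    rw [← sq_abs]
    calc |f (s • x)| ^ 2 ≤ (K * F.B * (travelTime g w + travelTime g (flip w))) ^ 2 := by
          gcongr
          exact h1
      _ = (K * F.B) ^ 2 * (travelTime g w + travelTime g (flip w)) ^ 2 := by ring
      _ ≤ (K * F.B) ^ 2 * (4 * (L * (C * (1 - s)))) := by
          gcongr
          linarith [add_sq_le (a := travelTime g w) (b := travelTime g (flip w))]
      _ = _ := by ring
  have hmem : ∀ᶠ s in 𝓝[<] (1:ℝ), s ∈ Ioo (0:ℝ) 1 := Ioo_mem_nhdsLT one_pos
  have l0 : Tendsto (fun s : ℝ => s • x) (𝓝[<] 1) (𝓝 x) := by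
    have : Tendsto (fun s : ℝ => s • x) (𝓝 1) (𝓝 ((1:ℝ) • x)) := tendsto_id.smul_const x
    rw [one_smul] at this
    exact this.mono_left nhdsWithin_le_nhds
  have l1 : Tendsto (fun s : ℝ => f (s • x) ^ 2) (𝓝[<] 1) (𝓝 (f x ^ 2)) := by
    refine Tendsto.pow ((hf.continuousOn x hxb).tendsto.comp (tendsto_nhdsWithin_iff.2 ⟨l0, ?_⟩)) 2
    filter_upwards [hmem] with s hs1
    rw [mem_ball_iff, norm_smul, hx1, mul_one, Real.norm_eq_abs, abs_of_pos hs1.1]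
    exact hs1.2.le
  have l2 : Tendsto (fun s : ℝ => (K * F.B) ^ 2 * (4 * (L * C)) * (1 - s)) (𝓝[<] 1) (𝓝 0) := by
    have : Tendsto (fun s : ℝ => (K * F.B) ^ 2 * (4 * (L * C)) * (1 - s)) (𝓝 1)
        (𝓝 ((K * F.B) ^ 2 * (4 * (L * C)) * (1 - 1))) := (tendsto_const_nhds.sub tendsto_id).const_mul _
    rw [sub_self, mul_zero] at this
    exact this.mono_left nhdsWithin_le_nhds
  have h2 : f x ^ 2 ≤ 0 := le_of_tendsto_of_tendsto l1 l2 (hmem.mono key)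
  exact pow_eq_zero_iff two_ne_zero |>.1 (le_antisymm h2 (sq_nonneg _))

/-- The integral of an exact form along a geodesic is the difference of the values of its primitive
at the end points. -/
theorem IsGeodesicOn.integral_eq_sub {γ V : ℝ → E n} {a b : ℝ} (hγ : IsGeodesicOn g γ V a b)
    (hab : a ≤ b) {p : E n → ℝ} {h : E n → E n →L[ℝ] ℝ} (hh : ContinuousOn h (ball n))
    (hp : ∀ x ∈ ball n, HasFDerivWithinAt p (h x) (ball n) x) :
    ∫ t in a..b, h (γ t) (V t) = p (γ b) - p (γ a) := by
  have hmaps : MapsTo γ (Icc a b) (ball n) := fun t ht => (hγ t ht).1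
  have hcγ : ContinuousOn γ (Icc a b) := fun t ht => (hγ t ht).2.2.1.continuousWithinAt
  have hcV : ContinuousOn V (Icc a b) := fun t ht => (hγ t ht).2.2.2.continuousWithinAt
  have hd : ∀ t ∈ Icc a b, HasDerivWithinAt (fun t => p (γ t)) (h (γ t) (V t)) (Icc a b) t :=
    fun t ht => (hp _ (hmaps ht)).comp_hasDerivWithinAt t (hγ t ht).2.2.1 hmaps
  refine intervalIntegral.integral_eq_sub_of_hasDerivAt_of_le hab
    (fun t ht => (hd t ht).continuousWithinAt)
    (fun t ht => (hd t (Ioo_subset_Icc_self ht)).hasDerivAt (Icc_mem_nhds ht.1 ht.2)) ?_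
  refine ContinuousOn.intervalIntegrable ?_
  rw [uIcc_of_le hab]
  exact (hh.comp hcγ hmaps).clm_apply hcV

end RoughXRay
end

/-! ### Proof of the theorem -/

theorem theorem1 (n : ℕ) (hn : 2 ≤ n)
    (g : RoughXRay.E n → Matrix (Fin n) (Fin n) ℝ) (hg : RoughXRay.IsSimpleC11 g) :
    (∀ f : RoughXRay.E n → ℝ, (∃ K, LipschitzOnWith K f (RoughXRay.ball n)) →
      (∀ (γ V : ℝ → RoughXRay.E n) (a b : ℝ), RoughXRay.IsMaximalGeodesic g γ V a b →
        ∫ t in a..b, f (γ t) = 0) →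
      ∀ x ∈ RoughXRay.ball n, f x = 0) ∧
    (∀ h : RoughXRay.E n → RoughXRay.E n →L[ℝ] ℝ,
      (∃ K, LipschitzOnWith K h (RoughXRay.ball n)) →
      (∀ x ∈ RoughXRay.bdry n, h x = 0) →
      ((∀ (γ V : ℝ → RoughXRay.E n) (a b : ℝ), RoughXRay.IsMaximalGeodesic g γ V a b →
          ∫ t in a..b, h (γ t) (V t) = 0) ↔
        ∃ p : RoughXRay.E n → ℝ, RoughXRay.IsC11 p ∧ (∀ x ∈ RoughXRay.bdry n, p x = 0) ∧
          ∀ x ∈ RoughXRay.ball n, HasFDerivWithinAt p (h x) (RoughXRay.ball n) x)) := by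
  obtain ⟨c, ⟨F⟩⟩ := hg.exists_geoFlow
  refine ⟨fun f hf h0 x hx => ?_, fun h hh hb => ⟨fun h0 => ?_, fun hp γ V a b hγ => ?_⟩⟩
  · obtain ⟨K, hK⟩ := hf
    have hz : ∀ z ∈ RoughXRay.SM g, ∫ t in (-RoughXRay.travelTime g (RoughXRay.flip z))..
        RoughXRay.travelTime g z, f (F.Φ z t).1 = 0 := fun z hz =>
      h0 _ _ _ _ (F.isMaximalGeodesic hg.metric hg.nontrapping hz)
    -- Boundary determination comes first, because only a function vanishing on the boundary is a
    -- ray weight; for one-forms this is assumed.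
    have hbd : ∀ y ∈ RoughXRay.bdry n, f y = 0 := fun y hy => F.eq_zero_of_mem_bdry hg hn hK hz hy
    obtain ⟨U, hU⟩ := F.exists_isRayPotential hg (by omega)
      (RoughXRay.isRayWeight_function hK hbd (by omega) hg) hz
    rcases (RoughXRay.mem_ball_iff.1 hx).eq_or_lt with h1 | h1
    · exact hbd x (RoughXRay.mem_bdry_iff.2 h1)
    · exact hU.eq_zero hg hn hK (mem_ball_zero_iff.2 h1)
  · obtain ⟨K, hK⟩ := hh
    obtain ⟨L, hL⟩ := RoughXRay.exists_isRayWeight_form hK hb (by omega) hg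
    obtain ⟨U, hU⟩ := F.exists_isRayPotential hg (by omega) hL fun z hz =>
      h0 _ _ _ _ (F.isMaximalGeodesic hg.metric hg.nontrapping hz)
    exact hU.exists_primitive hg hn hK
  · obtain ⟨K, hK⟩ := hh
    obtain ⟨p, -, hp0, hp⟩ := hp
    obtain ⟨ha, hb'⟩ := F.bdry_of_isMaximalGeodesic hg.metric hg.nontrapping hγ
    rw [hγ.2.1.integral_eq_sub hγ.1 hK.continuousOn hp, hp0 _ ha, hp0 _ hb', sub_zero]
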